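/- **Theorem (invariance of $\psi_X$ under Reidemeister moves).** Let $(X,*)$ be a quandle: $(a*b)*c=(a*c)*(b*c)$, each $x\mapsto x*b$ is bijective, and $a*a=a$. *Spaces.* The extended rack space $B_XX$ is the geometric realization $\coprod_n (X^{n+1}\times[0,1]^n)/\!\sim$ of the pre-cubic set with $n$-cells $X^{n+1}$ and faces $$d_i^0(x_1,\dots,x_{n+1})=(x_1,\dots,x_i,x_{i+2},\dots,x_{n+1}),$$ $$d_i^1(x_1,\dots,x_{n+1})=(x_1*x_{i+1},\dots,x_i*x_{i+1},x_{i+2},\dots,x_{n+1})\qquad(1\le i\le n).$$ A label is degenerate if $x_i=x_{i+1}$ for some $i\geq 1$ (extended case), respectively for some $i\ge 2$ (action case). The extended quandle space $B_X^QX$, respectively the action quandle space $BX_Q^X$, is obtained from $B_XX$ by adjoining, for every degenerate label, the mapping cone of the inclusion of the corresponding closed cell. The theorem holds for these spaces, and also for the spaces given by the low-dimensional cell description: to $B_XX$ one attaches a $3$-cell along the sphere $(a,b,b)$ for all $a,b\in X$ and, in the extended case, also a disc $D_{(a,a)}$ along each loop $(a,a)$ and a $3$-cell along each capped cylinder $(a,a,b)\cup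 D_{(a,a)}\cup D_{(a*b,a*b)}$. Let $Z$ be any one of these four spaces; the vertex labeled $r\in X$ is denoted by $r$. *Diagrams and colorings.* Let $D$ be an oriented link diagram in the interior of $I^2=[0,1]^2$, and let the normal direction of a strand point to its left. A shadow coloring $\widetilde{\mathcal C}$ of $D$ by $X$ assigns elements of $X$ to the arcs and regions of $D$ such that (i) at a crossing with over-arc $b$, the under-arcs on the right and left side of the over-arc are colored $a$ and $a*b$ for some $a$; (ii) the regions on the right and left side of an arc colored $a$ are colored $r$ and $r*a$ for some $r$. *The map.* Let $r_0$ be the color of the region adjacent to $\partial I^2$. A map $\psi_X(D;\widetilde{\mathcal C}):(I^2,\partial I^2)\to(B_XX,r_0)\to (Z,r_0)$ is one that assigns to the labeled cells dual to $D$ the cells with the same label: a region colored $r$ corresponds to the vertex $r$; a strand colored $a$ with color $r$ on its right corresponds to the edge $(r,a)$ and is mapped to the midpoint of this edge, with its right (left) side mapped to the initial (terminal) half; a crossing corresponds to the square $(r,a,b)$, where $r$ is the color of the source region (the region to the right of both strands), $a$ the color of the under-arc adjoining it and $b$ the color of the over-arc, the under- and over-strand being mapped to the two midlines and the regions to the quarters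 of the square. (Near the midpoint of an edge or cell, $\psi_X$ may also take values in adjacent cells of higher dimension, with the remaining cell coordinates different from $1/2$.) Then the following hold. 1. For every $D$ and $\widetilde{\mathcal C}$ such a map exists, and any two such maps represent the same class $[\psi_X(D;\widetilde{\mathcal C})]\in\pi_2(Z,r_0)$. 2. Let $D'$ be obtained from $D$ by a Reidemeister move of type I, II or III (with any choice of over/under information and orientations allowed by the move) inside a disc $B\subset I^2\setminus\partial I^2$. Every shadow coloring of $D$ agrees outside $B$ with exactly one shadow coloring of $D'$, and conversely. If $\widetilde{\mathcal C}$ and $\widetilde{\mathcal C}'$ agree outside $B$, then the color of the region adjacent to $\partial I^2$ is the same element $r_0$ for both, and $[\psi_X(D';\widetilde{\mathcal C}')]=[\psi_X(D;\widetilde{\mathcal C})]$ in $\pi_2(Z,r_0)$. 3. Consequently, if $D$ and $D'$ are related by a finite sequence of Reidemeister moves, their inverses, and homeomorphisms of $I^2$ fixing $\partial I^2$ pointwise, then there is a bijection between the shadow colorings of $D$ and those of $D'$ which preserves the color of the region adjacent to $\partial I^2$ and the class in $\pi_2$. In particular, the state sum $\sum_{\widetilde{\mathcal C}}[\psi_X(D;\widetilde{\mathcal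 C})]$, a finite sum when $X$ is finite, formed after comparing the groups $\pi_2(Z,r)$, $r\in X$, with a fixed set $G$ by arbitrary maps $T_r:\pi_2(Z,r)\to G$ and taken in the free abelian group on $G$, is the same for $D$ and $D'$. (For connected $X$ one takes for $G$ one of the groups $\pi_2(Z,r)$; this gives the shadow homotopy invariant.) -/

import Mathlib

open scoped unitInterval Topology Topology.Homotopy Quandles

universe u v

/-! ## Pre-cubic sets and their geometric realization -/

/-- A pre-cubic set.  `face i false` is the face map `d_{i+1}^0` and `face i true` is `d_{i+1}^1`
(face indices start at `0` here). -/
structure PreCubicSet where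
  cells : ℕ → Type u
  face : {n : ℕ} → Fin (n + 1) → Bool → cells (n + 1) → cells n
  face_face : ∀ {n : ℕ} (i j : Fin (n + 1)) (ε δ : Bool) (x : cells (n + 2)), i ≤ j →
    face i ε (face j.succ δ x) = face j δ (face i.castSucc ε x)

/-- The endpoint `0` or `1` of the unit interval. -/
def cubeEnd (ε : Bool) : I := if ε then 1 else 0

namespace PreCubicSet

/-- The disjoint union of the cubes `{x} × Iⁿ`, over all `n` and all `x ∈ Xₙ` (each `Xₙ` is
discrete). -/
abbrev Cubes (K : PreCubicSet.{u}) : Type u := Σ n : ℕ, Σ _ : K.cells n, (Fin n → I)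

/-- The gluing `(x, d^i_ε t) ∼ (d_i^ε x, t)`. -/
inductive Glue (K : PreCubicSet.{u}) : K.Cubes → K.Cubes → Prop
  | face {n : ℕ} (x : K.cells (n + 1)) (i : Fin (n + 1)) (ε : Bool) (t : Fin n → I) :
      Glue K ⟨n + 1, x, i.insertNth (cubeEnd ε) t⟩ ⟨n, K.face i ε x, t⟩

/-- The geometric realization of a pre-cubic set, with the quotient topology. -/
def Realization (K : PreCubicSet.{u}) : Type u := Quot (Glue K)

instance (K : PreCubicSet.{u}) : TopologicalSpace K.Realization :=
  inferInstanceAs (TopologicalSpace (Quot (Glue K)))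

/-- The point with coordinates `t` of the closed cell labeled by `x`. -/
def point (K : PreCubicSet.{u}) {n : ℕ} (x : K.cells n) (t : Fin n → I) : K.Realization :=
  Quot.mk _ ⟨n, x, t⟩

/-- `RoundsTo w z`: the point `z` of a cube of `K` is obtained from the point `w` by successively
choosing a coordinate different from `1/2` and replacing it by the nearer one of `0` and `1`, i.e.
by passing to the corresponding face.  For `z` of dimension `0` this says that `w` lies in
the dual cell (with respect to the midpoint subdivision) of the vertex `z`; in general that
`w` lies in the union of the half cubes around a face, over the point `z` of that face. -/
inductive RoundsTo (K : PreCubicSet.{u}) : K.Cubes → K.Cubes → Prop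
  | refl (z : K.Cubes) : RoundsTo K z z
  | down {n : ℕ} (x : K.cells (n + 1)) (t : Fin (n + 1) → I) (i : Fin (n + 1)) (z : K.Cubes) :
      (t i : ℝ) < 1 / 2 → RoundsTo K ⟨n, K.face i false x, i.removeNth t⟩ z →
      RoundsTo K ⟨n + 1, x, t⟩ z
  | up {n : ℕ} (x : K.cells (n + 1)) (t : Fin (n + 1) → I) (i : Fin (n + 1)) (z : K.Cubes) :
      1 / 2 < (t i : ℝ) → RoundsTo K ⟨n, K.face i true x, i.removeNth t⟩ z →
      RoundsTo K ⟨n + 1, x, t⟩ z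

/-- The point `b` of the realization rounds to the point with coordinates `t` of the cell `y`. -/
def Rounds (K : PreCubicSet.{u}) (b : K.Realization) {n : ℕ} (y : K.cells n) (t : Fin n → I) :
    Prop :=
  ∃ w : K.Cubes, (Quot.mk _ w : K.Realization) = b ∧ K.RoundsTo w ⟨n, y, t⟩

end PreCubicSet

/-! ## Extended rack space, action quandle space, extended quandle space

Mathlib's quandles are written with a left action: `b ◃ a` is `a * b`. -/

section Spaces

variable (X : Type u) [Quandle X]

/-- The faces of the labels `(x₁, …, x_{n+1})`: deleting `x_{i}` (`i ≥ 2`), after having acted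
with it on the preceding entries in the case of `d^1`. -/
def rackFace {X : Type u} [Quandle X] {n : ℕ} (i : Fin (n + 1)) (ε : Bool) (x : Fin (n + 2) → X) :
    Fin (n + 1) → X :=
  fun k => if ε = true ∧ i.succ.succAbove k < i.succ
    then x i.succ ◃ x (i.succ.succAbove k) else x (i.succ.succAbove k)

theorem rackFace_rackFace {X : Type u} [Quandle X] {n : ℕ} (i j : Fin (n + 1)) (ε δ : Bool)
    (x : Fin (n + 3) → X) (hij : i ≤ j) :
    rackFace i ε (rackFace j.succ δ x) = rackFace j δ (rackFace i.castSucc ε x) := by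
  have v : ∀ {m : ℕ} (p : Fin (m + 1)) (k : Fin m),
      (p.succAbove k).val = if k.val < p.val then k.val else k.val + 1 := by
    intro m p k
    by_cases h : k.val < p.val
    · rw [if_pos h, Fin.succAbove_of_castSucc_lt p k h, Fin.val_castSucc]
    · rw [if_neg h, Fin.succAbove_of_le_castSucc p k (not_lt.mp h), Fin.val_succ]
  have hij' : i.val ≤ j.val := hij
  have key : ∀ k : Fin (n + 1), j.succ.succ.succAbove (i.succ.succAbove k) =
      i.castSucc.succ.succAbove (j.succ.succAbove k) := by
    intro k
    apply Fin.ext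
    simp only [v, Fin.val_succ, Fin.val_castSucc]
    split_ifs <;> omega
  have h1 : j.succ.succ.succAbove i.succ = i.castSucc.succ := by
    apply Fin.ext
    simp only [v, Fin.val_succ, Fin.val_castSucc]
    split_ifs <;> omega
  have h2 : i.castSucc.succ.succAbove j.succ = j.succ.succ := by
    apply Fin.ext
    simp only [v, Fin.val_succ, Fin.val_castSucc]
    split_ifs <;> omega
  have l1 : i.castSucc.succ < j.succ.succ := by
    simp only [Fin.lt_def, Fin.val_succ, Fin.val_castSucc]
    omega
  have l2 : ¬ j.succ.succ < i.castSucc.succ := l1.le.not_gt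
  have l3 : ∀ k : Fin (n + 1), j.succ.succ.succAbove (i.succ.succAbove k) < j.succ.succ ↔
      j.succ.succAbove k < j.succ := by
    intro k
    simp only [Fin.lt_def, v, Fin.val_succ]
    split_ifs <;> omega
  have l4 : ∀ k : Fin (n + 1), i.succ.succAbove k < i.succ ↔
      j.succ.succ.succAbove (i.succ.succAbove k) < i.castSucc.succ := by
    intro k
    simp only [Fin.lt_def, v, Fin.val_succ, Fin.val_castSucc]
    split_ifs <;> omega
  have l5 : ∀ k : Fin (n + 1), i.succ.succAbove k < i.succ → j.succ.succAbove k < j.succ := by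
    intro k
    simp only [Fin.lt_def, v, Fin.val_succ]
    split_ifs <;> omega
  funext k
  have h5 := l5 k
  simp only [rackFace, h1, h2, l1, l2, l3, ← key, ← l4, and_true, and_false, if_false]
  generalize j.succ.succ.succAbove (i.succ.succAbove k) = c
  by_cases a : i.succ.succAbove k < i.succ <;> by_cases b : j.succ.succAbove k < j.succ <;>
    cases ε <;> cases δ <;> simp only [a, b, and_true, and_false, if_true, if_false,
      Bool.false_eq_true] <;> first | rfl | exact Shelf.self_distrib.symm | exact absurd (h5 a) b

/-- The pre-cubic set whose `n`-cells are labeled by `X^{n+1}`. -/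
def extendedRackCubes : PreCubicSet.{u} where
  cells n := Fin (n + 1) → X
  face := rackFace
  face_face := rackFace_rackFace

/-- The extended rack space `B_X X`. -/
abbrev ExtendedRackSpace : Type u := (extendedRackCubes X).Realization

variable {X}

/-- The vertex labeled by `r`. -/
def rackVertex (r : X) : ExtendedRackSpace X :=
  (extendedRackCubes X).point (n := 0) ![r] ![]

/-- The point with coordinate `t` on the edge labeled by `(r, a)`. -/
def rackEdge (r a : X) (t : I) : ExtendedRackSpace X :=
  (extendedRackCubes X).point (n := 1) ![r, a] ![t]

/-- The point with coordinates `(t, u)` in the square labeled by `(r, a, b)`. -/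
def rackSquare (r a b : X) (t u : I) : ExtendedRackSpace X :=
  (extendedRackCubes X).point (n := 2) ![r, a, b] ![t, u]

variable (X)

/-- The two kinds of quandle spaces: the action quandle space `BX_Q^X` and the extended quandle
space `B_X^Q X`. -/
inductive SpaceKind
  | action
  | extended

/-- The cell labeled by `(x₁, …, x_{n+1})` is degenerate: `x_i = x_{i+1}` for some `i`, where
`i ≥ 2` in the case of the action quandle space. -/
def IsDegenerate {X : Type u} (k : SpaceKind) {n : ℕ} (x : Fin (n + 1) → X) : Prop :=
  ∃ i : Fin n, x i.castSucc = x i.succ ∧ (k = SpaceKind.action → 1 ≤ i.val)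

/-- The labels of the degenerate cells. -/
abbrev DegenerateCell (k : SpaceKind) : Type u :=
  Σ n : ℕ, {x : Fin (n + 1) → X // IsDegenerate k x}

/-- The closed cell `({x} × Iⁿ)/∼` as a subspace of the extended rack space. -/
def closedCell {X : Type u} [Quandle X] {n : ℕ} (x : Fin (n + 1) → X) :
    Set (ExtendedRackSpace X) :=
  Set.range fun t : Fin n → I => (extendedRackCubes X).point (n := n) x t

/-- The disjoint union of the extended rack space and the cylinders over the degenerate closed
cells. -/
abbrev ConePieces (k : SpaceKind) : Type u :=
  ExtendedRackSpace X ⊕ (Σ x : DegenerateCell X k, closedCell x.2.1 × I)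

/-- The gluing of the mapping cones of the inclusions of the degenerate closed cells. -/
inductive ConeGlue (k : SpaceKind) : ConePieces X k → ConePieces X k → Prop
  | base (x : DegenerateCell X k) (p : closedCell x.2.1) :
      ConeGlue k (Sum.inr ⟨x, p, 0⟩) (Sum.inl p.1)
  | apex (x : DegenerateCell X k) (p q : closedCell x.2.1) :
      ConeGlue k (Sum.inr ⟨x, p, 1⟩) (Sum.inr ⟨x, q, 1⟩)

/-- The quandle space as the union, over all degenerate `x`, of the mapping cones of the
inclusions `f_x : ({x} × Iⁿ)/∼ ↪ B_X X`. -/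
def ConeQuandleSpace (k : SpaceKind) : Type u := Quot (ConeGlue X k)

instance (k : SpaceKind) : TopologicalSpace (ConeQuandleSpace X k) :=
  inferInstanceAs (TopologicalSpace (Quot (ConeGlue X k)))

/-- The building blocks of the low-dimensional cell description of the quandle spaces: the extended
rack space, extra discs `D_{(a,a)}` (only in the extended case; coordinates `(t, s)`),
extra balls for the spheres `e_{(a,b,b)}` (coordinates `(t, u, s)`), and extra solid cylinders for
the cylinders `e_{(a,a,b)}` (only in the extended case; coordinates `(t, u, s)`).  The
coordinate `s` is the cone parameter: `s = 0` is the part glued to the extended rack space. -/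
abbrev CellPieces (k : SpaceKind) : Type u :=
  (ExtendedRackSpace X ⊕ (Σ _ : {_a : X // k = SpaceKind.extended}, I × I)) ⊕
    ((Σ _ : X × X, I × I × I) ⊕ (Σ _ : {_p : X × X // k = SpaceKind.extended}, I × I × I))

section Pieces

variable {X} {k : SpaceKind}

/-- A point of the extended rack space, as a point of the disjoint union. -/
def rackPiece (b : ExtendedRackSpace X) : CellPieces X k := Sum.inl (Sum.inl b)

/-- A point of the disc `D_{(a,a)}`. -/
def discPiece (hk : k = SpaceKind.extended) (a : X) (t s : I) : CellPieces X k :=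
  Sum.inl (Sum.inr ⟨⟨a, hk⟩, t, s⟩)

/-- A point of the ball attached to `e_{(a,b,b)}`. -/
def ballPiece (a b : X) (t u s : I) : CellPieces X k :=
  Sum.inr (Sum.inl ⟨(a, b), t, u, s⟩)

/-- A point of the solid cylinder attached to `e_{(a,a,b)} ∪ D_{(a,a)} ∪ D_{(a*b,a*b)}`. -/
def cylPiece (hk : k = SpaceKind.extended) (a b : X) (t u s : I) : CellPieces X k :=
  Sum.inr (Sum.inr ⟨⟨(a, b), hk⟩, t, u, s⟩)

end Pieces

/-- The gluing of the extra cells.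
* The disc `D_{(a,a)}` is the cone over a circle (`t = 0` and `t = 1` identified), glued along its
  boundary to the loop `(a,a)`.
* The ball of `(a,b,b)` is the cone over the sphere obtained from the square by folding, i.e. by
  identifying the sides `t = ε` and `u = ε`; its boundary is glued to the square `(a,b,b)`.
* The solid cylinder of `(a,a,b)` is the product of a disc (with coordinates `(t, s)`) and an
  interval (with coordinate `u`); its side is glued to the square `(a,a,b)`, and its bottom and
  top to the discs `D_{(a,a)}` and `D_{(a*b,a*b)}`. -/
inductive CellGlue (k : SpaceKind) : CellPieces X k → CellPieces X k → Prop
  | disc_base (hk : k = SpaceKind.extended) (a : X) (t : I) :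
      CellGlue k (discPiece hk a t 0) (rackPiece (rackEdge a a t))
  | disc_seam (hk : k = SpaceKind.extended) (a : X) (s : I) :
      CellGlue k (discPiece hk a 0 s) (discPiece hk a 1 s)
  | disc_apex (hk : k = SpaceKind.extended) (a : X) (t t' : I) :
      CellGlue k (discPiece hk a t 1) (discPiece hk a t' 1)
  | ball_base (a b : X) (t u : I) :
      CellGlue k (ballPiece a b t u 0) (rackPiece (rackSquare a b b t u))
  | ball_fold (a b : X) (ε : Bool) (t s : I) :
      CellGlue k (ballPiece a b (cubeEnd ε) t s) (ballPiece a b t (cubeEnd ε) s)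
  | ball_apex (a b : X) (t u t' u' : I) :
      CellGlue k (ballPiece a b t u 1) (ballPiece a b t' u' 1)
  | cyl_side (hk : k = SpaceKind.extended) (a b : X) (t u : I) :
      CellGlue k (cylPiece hk a b t u 0) (rackPiece (rackSquare a a b t u))
  | cyl_bottom (hk : k = SpaceKind.extended) (a b : X) (t s : I) :
      CellGlue k (cylPiece hk a b t 0 s) (discPiece hk a t s)
  | cyl_top (hk : k = SpaceKind.extended) (a b : X) (t s : I) :
      CellGlue k (cylPiece hk a b t 1 s) (discPiece hk (b ◃ a) t s)
  | cyl_seam (hk : k = SpaceKind.extended) (a b : X) (u s : I) :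
      CellGlue k (cylPiece hk a b 0 u s) (cylPiece hk a b 1 u s)
  | cyl_axis (hk : k = SpaceKind.extended) (a b : X) (t t' u : I) :
      CellGlue k (cylPiece hk a b t u 1) (cylPiece hk a b t' u 1)

/-- The extended rack space with the extra `2`- and `3`-cells attached; its `3`-skeleton is the
`3`-skeleton of the quandle space. -/
def CellQuandleSpace (k : SpaceKind) : Type u := Quot (CellGlue X k)

instance (k : SpaceKind) : TopologicalSpace (CellQuandleSpace X k) :=
  inferInstanceAs (TopologicalSpace (Quot (CellGlue X k)))

/-- The two descriptions of the quandle spaces: by mapping cones on the degenerate closed cells, and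
by extra `2`- and `3`-cells. -/
inductive SpaceModel
  | mappingCones
  | extraCells

/-- The action quandle space (`k = action`) or the extended quandle space (`k = extended`). -/
def QuandleSpace (k : SpaceKind) : SpaceModel → Type u
  | .mappingCones => ConeQuandleSpace X k
  | .extraCells => CellQuandleSpace X k

instance (k : SpaceKind) : (m : SpaceModel) → TopologicalSpace (QuandleSpace X k m)
  | .mappingCones => inferInstanceAs (TopologicalSpace (ConeQuandleSpace X k))
  | .extraCells => inferInstanceAs (TopologicalSpace (CellQuandleSpace X k))

/-- The canonical map from the extended rack space to the quandle space. -/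
def toQuandleSpace (k : SpaceKind) : (m : SpaceModel) → C(ExtendedRackSpace X, QuandleSpace X k m)
  | .mappingCones => ⟨fun b => (Quot.mk _ (Sum.inl b) : ConeQuandleSpace X k),
      continuous_quot_mk.comp continuous_inl⟩
  | .extraCells => ⟨fun b => (Quot.mk _ (rackPiece b) : CellQuandleSpace X k),
      continuous_quot_mk.comp (continuous_inl.comp continuous_inl)⟩

end Spaces

/-! ## Oriented link diagrams in the square -/

/-- The square `I² = [0,1] × [0,1]`. -/
abbrev Square : Type := Fin 2 → I

/-- The data of an oriented link diagram in the square: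
* the underlying set of the immersed curves, and the finite set of crossings;
* at each crossing `p`, a set `overStrand p` which near `p` is the over-strand;
* the index (winding number, Alexander numbering) `index q` of the points `q` off the curves.

The index encodes the orientation of the curves, by its normal direction: the index grows by one
when an oriented strand is crossed from its right to its left.  So the strand is oriented such that
the side with the larger index is on its left, and "left side" below is the side to which the normal
points. -/
structure DiagramData where
  curve : Set Square
  crossings : Finset Square
  overStrand : Square → Set Square
  index : Square → ℤ

namespace DiagramData

/-- A chart `e` around a non-crossing point `p` of the diagram, in which the diagram is the
line `x = 0`, with left side `x > 0`. -/
structure IsRegularChart (D : DiagramData) (p : Square)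
    (e : OpenPartialHomeomorph Square (ℝ × ℝ)) : Prop where
  mem_source : p ∈ e.source
  map_center : e p = 0
  mem_curve_iff : ∀ q ∈ e.source, q ∈ D.curve ↔ (e q).1 = 0
  index_eq : ∃ n : ℤ, ∀ q ∈ e.source,
    ((e q).1 < 0 → D.index q = n) ∧ (0 < (e q).1 → D.index q = n + 1)

/-- A chart `e` around a crossing `p`, in which the under-strand is the line `x = 0`
with left side `x > 0`, and the over-strand is the line `y = 0` with left side `y > 0`. -/
structure IsCrossingChart (D : DiagramData) (p : Square)
    (e : OpenPartialHomeomorph Square (ℝ × ℝ)) : Prop where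
  mem_source : p ∈ e.source
  map_center : e p = 0
  mem_curve_iff : ∀ q ∈ e.source, q ∈ D.curve ↔ (e q).1 = 0 ∨ (e q).2 = 0
  mem_over_iff : ∀ q ∈ e.source, q ∈ D.overStrand p ↔ (e q).2 = 0
  index_eq : ∃ n : ℤ, ∀ q ∈ e.source, (e q).1 ≠ 0 → (e q).2 ≠ 0 →
    D.index q = n + (if 0 < (e q).1 then 1 else 0) + (if 0 < (e q).2 then 1 else 0)

end DiagramData

/-- An oriented link diagram in the interior of the square: a compact set which is near each of
its points a (locally flat) strand or a transverse crossing of two strands, with over/under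
information and an orientation.  (Such a set is a finite union of immersed
closed curves in general position; it may be empty or disconnected.) -/
structure LinkDiagram extends DiagramData where
  isClosed_curve : IsClosed curve
  disjoint_boundary : Disjoint curve (Cube.boundary (Fin 2))
  crossings_subset : ↑crossings ⊆ curve
  index_boundary : ∀ p ∈ Cube.boundary (Fin 2), index p = 0
  index_locally_constant : ∀ p, p ∉ curve → ∀ᶠ q in 𝓝 p, index q = index p
  regular_chart : ∀ p ∈ curve, p ∉ crossings → ∃ e, toDiagramData.IsRegularChart p e
  crossing_chart : ∀ p ∈ crossings, ∃ e, toDiagramData.IsCrossingChart p e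

/-! ## Shadow colorings -/

/-- A shadow coloring of `D` by the quandle `X`: the regions are the connected components of the
complement of the curves, so a map on regions is a locally constant function there; the arcs
run from one under-crossing to the next one, so a map on arcs is a function on the curves which is
locally constant away from the crossings and locally constant along the over-strand at each
crossing. -/
@[ext]
structure ShadowColoring (X : Type u) [Quandle X] (D : LinkDiagram) where
  region : {p : Square // p ∉ D.curve} → X
  arc : {p : Square // p ∈ D.curve} → X
  region_locally_constant : IsLocallyConstant region
  arc_locally_constant : ∀ p : {p : Square // p ∈ D.curve}, p.1 ∉ D.crossings →
    ∀ᶠ q in 𝓝 p, arc q = arc p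
  over_arc : ∀ p : {p : Square // p ∈ D.curve}, p.1 ∈ D.crossings →
    ∀ᶠ q in 𝓝 p, q.1 ∈ D.overStrand p.1 → arc q = arc p
  /-- At a crossing with over-arc colored `b`, the under-arc on the right side of the over-strand
  is colored `a` and the one on the left side is colored `a * b`. -/
  under_arc : ∀ p : {p : Square // p ∈ D.curve}, p.1 ∈ D.crossings →
    ∀ e, D.IsCrossingChart p.1 e → ∃ U ∈ 𝓝 p.1, U ⊆ e.source ∧
      ∀ q q' : {p : Square // p ∈ D.curve}, q.1 ∈ U → q'.1 ∈ U →
        (e q.1).1 = 0 → (e q.1).2 < 0 → (e q'.1).1 = 0 → 0 < (e q'.1).2 →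
        arc q' = arc p ◃ arc q
  /-- If an arc is colored `a` and the region on its right side is colored `r`, then the region on
  its left side is colored `r * a`. -/
  region_arc : ∀ p : {p : Square // p ∈ D.curve}, p.1 ∉ D.crossings →
    ∃ U ∈ 𝓝 p.1, ∀ q q' : {p : Square // p ∉ D.curve}, q.1 ∈ U → q'.1 ∈ U →
      D.index q'.1 = D.index q.1 + 1 → region q' = arc p ◃ region q

theorem LinkDiagram.zero_notMem_curve (D : LinkDiagram) : (0 : Square) ∉ D.curve := fun h =>
  Set.disjoint_left.mp D.disjoint_boundary h ⟨0, Or.inl rfl⟩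

/-- The color of the `∞`-region, i.e. of the region adjacent to the boundary of the square. -/
def ShadowColoring.outer {X : Type u} [Quandle X] {D : LinkDiagram} (C : ShadowColoring X D) : X :=
  C.region ⟨0, D.zero_notMem_curve⟩

/-! ## The map defined by a shadow coloring -/

/-- `ψ : (I², ∂I²) → (B_X X, r)` is a map that assigns the labeled dual cells of the diagram to the
cells of the extended rack space with the same label:
* points in a region are mapped to the dual cell of the vertex labeled by the color of the region;
* near a strand, `ψ` traverses the edge `(r, a)` transversally (with the coordinate `τ`), where `r` is
  the color of the region on the right of the strand and `a` is the color of the strand: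
  the diagram is mapped to the midpoint of the edge, and its right and left sides to
  the two halves of the edge containing `r` and `r * a` respectively;
* near a crossing, `ψ` is in the square `(r, a, b)`, where `r` is the color of the source
  region, `a` is the color of the under-arc adjoining the source region and `b` is
  the color of the over-arc: the under-strand and the over-strand are mapped to the midlines of the
  square, and the four regions around the crossing to the corresponding quarters.

"In the edge" and "in the square" are meant up to further cell coordinates, which are away from
`1/2` (`Rounds`): an edge of the decomposition is adjacent to squares. -/
structure IsShadowMap {X : Type u} [Quandle X] {D : LinkDiagram} (C : ShadowColoring X D) {r₀ : X}
    (ψ : Ω^ (Fin 2) (ExtendedRackSpace X) (rackVertex r₀)) : Prop where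
  at_region : ∀ p : {p : Square // p ∉ D.curve},
    (extendedRackCubes X).Rounds (ψ p.1) (n := 0) ![C.region p] ![]
  at_strand : ∀ p : {p : Square // p ∈ D.curve}, p.1 ∉ D.crossings →
    ∃ e, D.IsRegularChart p.1 e ∧ ∃ r : X, ∃ τ : Square → I, ∃ U ∈ 𝓝 p.1,
      U ⊆ e.source ∧ ContinuousOn τ U ∧
      (∀ q : {p : Square // p ∉ D.curve}, q.1 ∈ U → (e q.1).1 < 0 → C.region q = r) ∧
      ∀ q ∈ U, SignType.sign ((τ q : ℝ) - 1 / 2) = SignType.sign (e q).1 ∧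
        (extendedRackCubes X).Rounds (ψ q) (n := 1) ![r, C.arc p] ![τ q]
  at_crossing : ∀ p : {p : Square // p ∈ D.curve}, p.1 ∈ D.crossings →
    ∃ e, D.IsCrossingChart p.1 e ∧ ∃ r a : X, ∃ τ υ : Square → I, ∃ U ∈ 𝓝 p.1,
      U ⊆ e.source ∧ ContinuousOn τ U ∧ ContinuousOn υ U ∧
      (∀ q : {p : Square // p ∉ D.curve}, q.1 ∈ U → (e q.1).1 < 0 → (e q.1).2 < 0 →
        C.region q = r) ∧
      (∀ q : {p : Square // p ∈ D.curve}, q.1 ∈ U → (e q.1).1 = 0 → (e q.1).2 < 0 →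
        C.arc q = a) ∧
      ∀ q ∈ U, SignType.sign ((τ q : ℝ) - 1 / 2) = SignType.sign (e q).1 ∧
        SignType.sign ((υ q : ℝ) - 1 / 2) = SignType.sign (e q).2 ∧
        (extendedRackCubes X).Rounds (ψ q) (n := 2) ![r, a, C.arc p] ![τ q, υ q]

/-- The composition of a map `(I², ∂I²) → (Y, y)` with a continuous map `Y → Z`. -/
def pushLoop {Y Z : Type*} [TopologicalSpace Y] [TopologicalSpace Z] (j : C(Y, Z)) {y : Y}
    (ψ : Ω^ (Fin 2) Y y) : Ω^ (Fin 2) Z (j y) :=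
  ⟨j.comp ψ.1, fun p hp => congrArg j (ψ.2 p hp)⟩

/-- The second homotopy group of the action or extended quandle space at the vertex labeled by
`r`. -/
abbrev QuandlePi2 (X : Type u) [Quandle X] (k : SpaceKind) (m : SpaceModel) (r : X) : Type u :=
  π_ 2 (QuandleSpace X k m) (toQuandleSpace X k m (rackVertex r))

/-- The homotopy classes in `π₂`, at the vertex `r`, of the maps `ψ_X(D; C)`. -/
def shadowClasses {X : Type u} [Quandle X] (k : SpaceKind) (m : SpaceModel) {D : LinkDiagram}
    (C : ShadowColoring X D) (r : X) : Set (QuandlePi2 X k m r) :=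
  {κ | ∃ ψ : Ω^ (Fin 2) (ExtendedRackSpace X) (rackVertex r), IsShadowMap C ψ ∧
    κ = Quotient.mk _ (pushLoop (toQuandleSpace X k m) ψ)}

/-- The homotopy class of `ψ_X(D; C)` in `π₂`, at the vertex labeled by the color of the
`∞`-region. -/
noncomputable def shadowClass {X : Type u} [Quandle X] (k : SpaceKind) (m : SpaceModel)
    {D : LinkDiagram} (C : ShadowColoring X D) : QuandlePi2 X k m C.outer :=
  Classical.epsilon fun κ => κ ∈ shadowClasses k m C C.outer

/-- The state sum `∑_C [ψ_X(D; C)]` over all shadow colorings (a finite set if `X` is finite), where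
the groups `π₂` at the different vertices are compared with a fixed `G` (for connected `X`, one
of these groups) by means of maps `T r`.  For a group `G`, `G →₀ ℤ` underlies the group
ring `ℤ[G]`. -/
noncomputable def shadowStateSum {X : Type u} [Quandle X] {k : SpaceKind} {m : SpaceModel}
    {G : Type v} (T : (r : X) → QuandlePi2 X k m r → G) (D : LinkDiagram) : G →₀ ℤ :=
  ∑ᶠ C : ShadowColoring X D, Finsupp.single (T C.outer (shadowClass k m C)) 1

/-! ## Reidemeister moves -/

/-- A picture in the square `[-1,1]²`: curves, crossings, and the over-strand at each
crossing. -/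
structure LocalPicture where
  curve : Set (ℝ × ℝ)
  crossings : Set (ℝ × ℝ)
  overStrand : ℝ × ℝ → Set (ℝ × ℝ)

/-- The square `[-1,1]²`. -/
def pictureBox : Set (ℝ × ℝ) := Set.Icc (-1) 1 ×ˢ Set.Icc (-1) 1

/-- The picture consisting of the strands `S 0, …, S (n-1)`, listed from the bottom to the top. -/
def LocalPicture.ofStrands {n : ℕ} (S : Fin n → Set (ℝ × ℝ)) : LocalPicture where
  curve := ⋃ i, S i
  crossings := {z | ∃ i j, i < j ∧ z ∈ S i ∧ z ∈ S j}
  overStrand z := {w | ∃ i j, i < j ∧ z ∈ S i ∧ z ∈ S j ∧ w ∈ S j}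

/-- A single strand without crossing. -/
def pictureI : LocalPicture :=
  LocalPicture.ofStrands (n := 1) ![{z | 4 * z.2 ^ 2 = z.1 + 1 / 2}]

/-- The kink `4 y² = x² (x + 1/2)`; it has the same end points as the strand of `pictureI`
and a crossing at the origin, where the over-strand is the branch with `x y ≥ 0`. -/
noncomputable def pictureI' : LocalPicture where
  curve := {z | 4 * z.2 ^ 2 = z.1 ^ 2 * (z.1 + 1 / 2)}
  crossings := {0}
  overStrand _ := {z | 4 * z.2 ^ 2 = z.1 ^ 2 * (z.1 + 1 / 2) ∧ 0 ≤ z.1 * z.2}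

/-- The strands of the two pictures of the second Reidemeister move: a line, and a curve which is
disjoint from the line (`bent = false`) or meets it twice (`bent = true`). -/
def strandsII (bent : Bool) : Fin 2 → Set (ℝ × ℝ) :=
  ![{z | z.2 = 0}, {z | z.2 = if bent then z.1 ^ 2 - 1 / 2 else 1 / 2}]

/-- The strands of the two pictures of the third Reidemeister move: two crossing lines, and a
curve passing above (`moved = false`) or below (`moved = true`) of their crossing. -/
def strandsIII (moved : Bool) : Fin 3 → Set (ℝ × ℝ) :=
  ![{z | 2 * z.2 = z.1}, {z | 2 * z.2 = -z.1},
    {z | 2 * z.2 = if moved then -(1 - z.1 ^ 2) else 1 - z.1 ^ 2}]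

/-- The pairs of pictures of the Reidemeister moves of type I, II and III.  The permutation `ρ`
determines the heights of the strands. All further variants are obtained by a
reflection of the picture; the orientations of the strands are not specified, hence arbitrary. -/
inductive ReidemeisterPictures : LocalPicture → LocalPicture → Prop
  | typeI : ReidemeisterPictures pictureI pictureI'
  | typeII (ρ : Equiv.Perm (Fin 2)) : ReidemeisterPictures
      (LocalPicture.ofStrands (strandsII false ∘ ρ)) (LocalPicture.ofStrands (strandsII true ∘ ρ))
  | typeIII (ρ : Equiv.Perm (Fin 3)) : ReidemeisterPictures
      (LocalPicture.ofStrands (strandsIII false ∘ ρ)) (LocalPicture.ofStrands (strandsIII true ∘ ρ))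

namespace LinkDiagram

/-- In the disc `e⁻¹([-1,1]²)`, the diagram `D` is the picture `P`. -/
def LooksLike (D : LinkDiagram) (e : OpenPartialHomeomorph Square (ℝ × ℝ)) (P : LocalPicture) :
    Prop :=
  ∀ q ∈ e.source, e q ∈ pictureBox →
    (q ∈ D.curve ↔ e q ∈ P.curve) ∧ (q ∈ D.crossings ↔ e q ∈ P.crossings) ∧
    (q ∈ D.crossings → ∀ᶠ w in 𝓝 q, w ∈ D.overStrand q ↔ e w ∈ P.overStrand (e q))

/-- Outside `B`, the diagrams `D` and `D'` (with their crossings and orientations) are the same. -/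
def AgreesOutside (B : Set Square) (D D' : LinkDiagram) : Prop :=
  ∀ p, p ∉ B → (p ∈ D.curve ↔ p ∈ D'.curve) ∧ (p ∈ D.crossings ↔ p ∈ D'.crossings) ∧
    (p ∈ D.crossings → ∀ᶠ w in 𝓝 p, w ∈ D.overStrand p ↔ w ∈ D'.overStrand p) ∧
    (p ∉ D.curve → D.index p = D'.index p)

/-- `D'` is obtained from `D` by a Reidemeister move (of type I, II or III, in the
direction of `ReidemeisterPictures`) in the disc `B` in the interior of the square. -/
def ReidemeisterMove (B : Set Square) (D D' : LinkDiagram) : Prop :=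
  ∃ (e : OpenPartialHomeomorph Square (ℝ × ℝ)) (P P' : LocalPicture),
    pictureBox ⊆ e.target ∧ Disjoint e.source (Cube.boundary (Fin 2)) ∧
    B = e.symm '' pictureBox ∧ ReidemeisterPictures P P' ∧
    D.LooksLike e P ∧ D'.LooksLike e P' ∧ AgreesOutside B D D'

/-- `D'` is the image of `D` under a homeomorphism of the square which fixes its
boundary pointwise (such a homeomorphism is isotopic to the identity relative to the boundary). -/
def PlanarIsotopic (D D' : LinkDiagram) : Prop :=
  ∃ φ : Square ≃ₜ Square, (∀ p ∈ Cube.boundary (Fin 2), φ p = p) ∧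
    ∀ p, (p ∈ D.curve ↔ φ p ∈ D'.curve) ∧ (p ∈ D.crossings ↔ φ p ∈ D'.crossings) ∧
      (p ∈ D.crossings → ∀ᶠ w in 𝓝 p, w ∈ D.overStrand p ↔ φ w ∈ D'.overStrand (φ p)) ∧
      (p ∉ D.curve → D.index p = D'.index (φ p))

/-- The equivalence relation on diagrams generated by planar isotopies and Reidemeister moves. -/
def Equivalent : LinkDiagram → LinkDiagram → Prop :=
  Relation.EqvGen fun D D' => PlanarIsotopic D D' ∨ ∃ B, ReidemeisterMove B D D'

end LinkDiagram

/-- The shadow colorings `C` and `C'` are the same outside `B`. -/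
def ShadowColoring.AgreesOutside {X : Type u} [Quandle X] {D D' : LinkDiagram} (B : Set Square)
    (C : ShadowColoring X D) (C' : ShadowColoring X D') : Prop :=
  ∀ p, p ∉ B → (∀ h h', C.region ⟨p, h⟩ = C'.region ⟨p, h'⟩) ∧
    (∀ h h', C.arc ⟨p, h⟩ = C'.arc ⟨p, h'⟩)

/-!
The map `ψ` is prescribed only up to the rounding of cell coordinates: a point of `I²` may go to
a cell of higher dimension than expected, as long as the additional coordinates are not `1/2`. So
the first step is to *sharpen* coordinates: those at distance at least `ε/2` from `1/2` are rounded
to `0` or `1`, and those in between are stretched. Sharpening is homotopic to the identity of the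
extended rack space, relative to the vertices (`exists_sharpen_path`). For small `ε`, a sharpened
map goes, near a given point, into the cell prescribed by the diagram (`exists_sharpen_eq`). Hence
maps and homotopies can be defined locally, inside a single cell; local functions depending on `ε`
which agree near each point for all small `ε` are glued by compactness (`eventually_exists_patch`).

*Existence and uniqueness.* The sharpened signed distances to the strands are coordinates which
define `ψ` (`exists_isShadowMap`). Where two colored diagrams agree, the two sharpened maps go to
the same cell and are on the same sides of its midlines, so the straight homotopies in the cells
fit together (`homotopic_of_agree`). This gives the uniqueness of the class
(`IsShadowMap.homotopic`).

*The second and the third move.* Here the strands in the disc are graphs of at most three functions,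
which are totally ordered by over/under. The colors in the disc are the labels of the faces of a
cube `(r, a₀, a₁, a₂)`, by self-distributivity, and these labels can be read off on the frontier of
the disc (`StrandMove.labels_eq`). So colorings correspond uniquely, and both maps go to
the same 3-cube; they are homotopic by the straight homotopy there (`StrandMove.homotopic`).

*The first move.* Since `a * a = a`, all the arcs in the disc have the same color `a`
(`exists_monochromeForm_I'`), and the color of a region is determined by its index through the
powers of the action of `a`. The indices in the disc take at most three consecutive values, so both
maps lift to the square `(r, a, a)`. The sides `t = ε` and `u = ε` of this square are the same
edge; folded along this identification, it is coned off in each of the quandle spaces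
(`exists_foldBall`). A lift is continuous only up to the folding, but the path between two lifts
over the apex of the cone is well defined. The homotopy uses this path near the crossing, and is
straight near the frontier of the disc, where it has to fit the straight homotopy outside
(`LevelDisc.homotopic`).

*Homeomorphisms.* A homeomorphism of `I²` which fixes the boundary is homotopic to the identity by
the straight homotopy in `I²` (`homotopic_compHomeomorph`), and carries `ψ` to a map of the image
diagram (`IsShadowMap.comp_homeomorph`).
-/

open Filter Set LinkDiagram
open SignType (sign)

section

variable {X : Type u} [Quandle X] {Z : Type v} [TopologicalSpace Z] {D D' : LinkDiagram}
  {V B : Set Square} {C : ShadowColoring X D} {C' : ShadowColoring X D'} {r₀ : X}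

/-! ### Abbreviations -/

/-- Local coordinates in the square. -/
abbrev PlaneChart := OpenPartialHomeomorph Square (ℝ × ℝ)

/-- A ball around the origin of the plane, in the sup norm. -/
abbrev planeBall (δ : ℝ) : Set (ℝ × ℝ) := Metric.ball 0 δ

/-- The maps `(I², ∂I²) → (B_X X, r₀)`. -/
abbrev RackLoop (r₀ : X) := Ω^ (Fin 2) (ExtendedRackSpace X) (rackVertex r₀)

/-- The part of the square over the closed picture box. -/
abbrev boxOf (e : PlaneChart) : Set Square := e.symm '' pictureBox

/-- The filter of the pairs of a small positive number and a point near `q`. -/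
abbrev nhdsPos {Q : Type*} [TopologicalSpace Q] (q : Q) : Filter (ℝ × Q) := 𝓝[>] (0 : ℝ) ×ˢ 𝓝 q

variable {j : C(ExtendedRackSpace X, Z)} {p q z : Square} {e : PlaneChart}

/-! ### Locally constant functions and patching of local functions -/

/-- A function on a dense subset `T` of a preconnected set `S` which is constant near every point
of `S` (and not only of `T`) is constant. -/
theorem IsPreconnected.eq_of_eventually_eq {α β : Type*} [TopologicalSpace α] {S T : Set α}
    (hS : IsPreconnected S) (hT : T ⊆ S) (hd : S ⊆ closure T) {g : α → β}
    (hg : ∀ q ∈ S, ∃ v, ∀ᶠ z in 𝓝 q, z ∈ T → g z = v) {x y : α} (hx : x ∈ T) (hy : y ∈ T) :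
    g x = g y := by
  have hg' : ∀ q : S, ∃ v, ∀ᶠ z in 𝓝 q.1, z ∈ T → g z = v := fun q => hg q.1 q.2
  choose h hh using hg'
  have hT' : ∀ z (hz : z ∈ T), h ⟨z, hT hz⟩ = g z := fun z hz =>
    ((hh ⟨z, hT hz⟩).self_of_nhds hz).symm
  have hl : IsLocallyConstant h := by
    rw [IsLocallyConstant.iff_eventually_eq]
    intro q
    have h1 : ∀ᶠ q' in 𝓝 q, ∀ᶠ z in 𝓝 q'.1, z ∈ T → g z = h q :=
      continuous_subtype_val.continuousAt.eventually (hh q).eventually_nhds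
    filter_upwards [h1] with q' hq'
    obtain ⟨z, hz, hzT⟩ := ((mem_closure_iff_frequently.mp (hd q'.2)).and_eventually
      (hq'.and (hh q'))).exists
    rw [← hzT.1 hz, ← hzT.2 hz]
  have : PreconnectedSpace S := Subtype.preconnectedSpace hS
  rw [← hT' x hx, ← hT' y hy]
  exact hl.apply_eq_of_preconnectedSpace _ _

/-- The case `T = S`. -/
theorem IsPreconnected.eq_of_locally_eq {α β : Type*} [TopologicalSpace α] {S : Set α}
    (hS : IsPreconnected S) {g : α → β}
    (hg : ∀ q ∈ S, ∀ᶠ z in 𝓝 q, z ∈ S → g z = g q) {x y : α} (hx : x ∈ S) (hy : y ∈ S) :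
    g x = g y :=
  hS.eq_of_eventually_eq subset_rfl subset_closure (fun q hq => ⟨_, hg q hq⟩) hx hy

/-- Patching of a family of local functions `F q ε`, which depend on a small parameter `ε`.  If near
each point `q'` of the domain `U q` of `F q ε` the functions `F q ε` and `F q' ε` are the same for
all small `ε`, then for all small `ε` there is a global continuous function which is
locally one of the functions `F q ε`.  By compactness only finitely many `q` are needed, so the
smallness of `ε` may depend on `q`. -/
theorem eventually_exists_patch {Q Y : Type*} [TopologicalSpace Q] [CompactSpace Q] [T2Space Q]
    [TopologicalSpace Y] (F : Q → ℝ → Q → Y) (U : Q → Set Q) (A : Q → ℝ → Prop)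
    (hU : ∀ q, U q ∈ 𝓝 q) (hA : ∀ q, ∀ᶠ ε in 𝓝[>] (0 : ℝ), A q ε)
    (hc : ∀ q ε, A q ε → ContinuousOn (F q ε) (U q))
    (hF : ∀ q, ∀ q' ∈ U q, ∀ᶠ p in nhdsPos q', F q p.1 p.2 = F q' p.1 p.2) :
    ∀ᶠ ε in 𝓝[>] (0 : ℝ), ∃ G : C(Q, Y), ∀ z, ∃ q, z ∈ U q ∧ A q ε ∧ G =ᶠ[𝓝 z] F q ε := by
  classical
  -- sets `V q` whose closure is in `U q`: at a point which is not in this closure,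
  -- membership in `V q` fails nearby, so no condition on `F q` is needed there
  have h1 : ∀ q, ∃ V, IsOpen V ∧ q ∈ V ∧ closure V ⊆ U q := by
    intro q
    obtain ⟨K, hK, hKc, hKU⟩ := exists_mem_nhds_isClosed_subset (hU q)
    exact ⟨interior K, isOpen_interior, mem_interior_iff_mem_nhds.mpr hK,
      (closure_minimal interior_subset hKc).trans hKU⟩
  choose V hVo hqV hVU using h1
  obtain ⟨s, hs⟩ := isCompact_univ.elim_finite_subcover V hVo
    (fun q _ => mem_iUnion.mpr ⟨q, hqV q⟩)
  -- near each point `z₀`, for small `ε`, the relevant functions all agree with `F z₀ ε`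
  have h2 : ∀ z₀ : Q, ∃ N ∈ 𝓝 z₀, ∀ᶠ ε in 𝓝[>] (0 : ℝ), ∀ z ∈ N, ∀ q ∈ s, z ∈ V q →
      F q ε z = F z₀ ε z := by
    intro z₀
    have h3 : ∀ q ∈ s, ∀ᶠ p in nhdsPos z₀, p.2 ∈ V q → F q p.1 p.2 = F z₀ p.1 p.2 := by
      intro q _
      by_cases hq : z₀ ∈ closure (V q)
      · exact (hF q z₀ (hVU q hq)).mono fun p hp _ => hp
      · have : ∀ᶠ z in 𝓝 z₀, z ∉ V q :=
          (isClosed_closure.isOpen_compl.eventually_mem hq).mono fun z hz hzV =>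
            hz (subset_closure hzV)
        exact (this.prod_inr _).mono fun p hp hpV => absurd hpV hp
    obtain ⟨pa, ha, pb, hb, hab⟩ := eventually_prod_iff.mp ((s.eventually_all).mpr h3)
    exact ⟨{z | pb z}, hb, ha.mono fun ε hε z hz q hq hzq => hab hε hz q hq hzq⟩
  choose N hN hNF using h2
  obtain ⟨s', hs'⟩ := isCompact_univ.elim_nhds_subcover N (fun q _ => hN q)
  filter_upwards [(s.eventually_all).mpr fun q _ => hA q,
    (s'.eventually_all).mpr fun q _ => hNF q] with ε hε1 hε2
  have h4 : ∀ z, ∃ q ∈ s, z ∈ V q := by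
    intro z
    simpa using hs (mem_univ z)
  choose i his hiV using h4
  have h5 : ∀ q ∈ s, ∀ z ∈ V q, F (i z) ε z = F q ε z := by
    intro q hq z hz
    obtain ⟨z₀, hz₀, hzN⟩ : ∃ z₀ ∈ s', z ∈ N z₀ := by simpa using hs'.2 (mem_univ z)
    rw [hε2 z₀ hz₀ z hzN _ (his z) (hiV z), hε2 z₀ hz₀ z hzN _ hq hz]
  have h6 : ∀ z, (fun z => F (i z) ε z) =ᶠ[𝓝 z] F (i z) ε := fun z => by
    filter_upwards [(hVo (i z)).mem_nhds (hiV z)] with w hw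
    exact h5 _ (his z) w hw
  have hVU' : ∀ q, V q ⊆ U q := fun q => subset_closure.trans (hVU q)
  refine ⟨⟨fun z => F (i z) ε z, continuous_iff_continuousAt.mpr fun z => ?_⟩, fun z =>
    ⟨i z, hVU' _ (hiV z), hε1 _ (his z), h6 z⟩⟩
  refine ContinuousAt.congr ?_ (h6 z).symm
  exact (hc _ _ (hε1 _ (his z))).continuousAt
    (mem_of_superset ((hVo (i z)).mem_nhds (hiV z)) (hVU' _))

/-! ### Sharpening of coordinates -/

/-- The coordinate `1/2 + t/ε`, clamped to the unit interval. -/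
noncomputable def sharp (ε t : ℝ) : I := projIcc 0 1 zero_le_one (1 / 2 + t / ε)

theorem continuous_sharp (ε : ℝ) : Continuous (sharp ε) := continuous_projIcc.comp (by fun_prop)

theorem sharp_eq_zero {ε t : ℝ} (hε : 0 < ε) (h : t ≤ -(ε / 2)) : sharp ε t = 0 := by
  refine projIcc_of_le_left _ ?_
  have : t / ε ≤ -(1 / 2) := by
    rw [div_le_iff₀ hε]; linarith
  linarith

theorem sharp_eq_one {ε t : ℝ} (hε : 0 < ε) (h : ε / 2 ≤ t) : sharp ε t = 1 := by
  refine projIcc_of_right_le _ ?_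
  have : 1 / 2 ≤ t / ε := by
    rw [le_div_iff₀ hε]; linarith
  linarith

theorem coe_sharp (ε t : ℝ) : (sharp ε t : ℝ) = max 0 (min 1 (1 / 2 + t / ε)) := coe_projIcc ..

theorem half_lt_sharp_iff {ε t : ℝ} (hε : 0 < ε) : 1 / 2 < (sharp ε t : ℝ) ↔ 0 < t := by
  rw [coe_sharp, lt_max_iff, lt_min_iff]
  have : 0 < t / ε ↔ 0 < t := div_pos_iff_of_pos_right hε
  rw [← this]
  constructor
  · rintro (h | ⟨_, h⟩) <;> linarith
  · intro h; right; constructor <;> linarith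

theorem sharp_lt_half_iff {ε t : ℝ} (hε : 0 < ε) : (sharp ε t : ℝ) < 1 / 2 ↔ t < 0 := by
  rw [coe_sharp, max_lt_iff, min_lt_iff]
  have : t / ε < 0 ↔ t < 0 := by
    rw [div_lt_iff₀ hε, zero_mul]
  rw [← this]
  constructor
  · rintro ⟨_, h | h⟩ <;> linarith
  · intro h; refine ⟨by norm_num, Or.inr (by linarith)⟩

theorem sign_sharp {ε : ℝ} (hε : 0 < ε) (t : ℝ) : sign ((sharp ε t : ℝ) - 1 / 2) = sign t := by
  rcases lt_trichotomy t 0 with h | h | h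
  · rw [sign_neg h, sign_neg (by linarith [(sharp_lt_half_iff hε).mpr h])]
  · subst h
    have : (sharp ε 0 : ℝ) = 1 / 2 := by rw [coe_sharp]; norm_num
    rw [this]; simp
  · rw [sign_pos h, sign_pos (by linarith [(half_lt_sharp_iff hε).mpr h])]

/-- A coordinate away from `0` is sharpened to an end point. -/
theorem eventually_sharp_eq {Q : Type*} [TopologicalSpace Q] {c : Q → ℝ} {q : Q}
    (hc : ContinuousAt c q) (h : c q ≠ 0) : ∀ᶠ p in nhdsPos q,
      sharp p.1 (c p.2) = cubeEnd (decide (0 < c q)) := by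
  have hpos : ∀ᶠ ε in 𝓝[>] (0 : ℝ), 0 < ε := self_mem_nhdsWithin
  have hlt : ∀ᶠ ε in 𝓝[>] (0 : ℝ), ε < |c q| :=
    eventually_nhdsWithin_of_eventually_nhds (eventually_lt_nhds (abs_pos.mpr h))
  rcases h.lt_or_gt with h | h
  · have h1 : ∀ᶠ z in 𝓝 q, c z < c q / 2 := hc.eventually_lt_const (by linarith)
    filter_upwards [(hpos.and hlt).prod_mk h1] with p hp
    rw [abs_of_neg h] at hp
    rw [sharp_eq_zero hp.1.1 (by linarith), decide_eq_false h.not_gt]; rfl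
  · have h1 : ∀ᶠ z in 𝓝 q, c q / 2 < c z := hc.eventually_const_lt (by linarith)
    filter_upwards [(hpos.and hlt).prod_mk h1] with p hp
    rw [abs_of_pos h] at hp
    rw [sharp_eq_one hp.1.1 (by linarith), decide_eq_true h]; rfl

/-! ### Maps on realizations of pre-cubic sets -/

namespace PreCubicSet

variable (K : PreCubicSet.{u})

theorem continuous_point {n : ℕ} (x : K.cells n) : Continuous (K.point x) :=
  continuous_quot_mk.comp (continuous_sigmaMk.comp (continuous_sigmaMk (i := x)))

theorem point_eq_of_end {n : ℕ} (x : K.cells (n + 1)) (t : Fin (n + 1) → I) (i : Fin (n + 1))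
    (ε : Bool) (h : t i = cubeEnd ε) : K.point x t = K.point (K.face i ε x) (i.removeNth t) := by
  have := Quot.sound (Glue.face x i ε (i.removeNth t))
  rwa [← h, Fin.insertNth_self_removeNth] at this

variable {K}

theorem continuous_of_cells {Y : Type*} [TopologicalSpace Y] {g : K.Realization → Y}
    (h : ∀ n (x : K.cells n), Continuous fun t => g (K.point x t)) : Continuous g := by
  refine (isQuotientMap_quot_mk (r := Glue K)).continuous_iff.mpr ?_
  exact continuous_sigma fun n => continuous_sigma fun x => h n x

/-- Functions on the realization, defined on the cubes. -/
def Realization.lift {Y : Type*} (g : K.Cubes → Y) (h : ∀ w z, Glue K w z → g w = g z) :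
    K.Realization → Y := Quot.lift g h

variable (K)

/-- The sum of the values of `φ` at the coordinates of a point, where `φ 0 = φ 1 = 0`. -/
noncomputable def coordSum (φ : I → ℝ) (h : ∀ ε, φ (cubeEnd ε) = 0) : K.Realization → ℝ :=
  Realization.lift (fun w => ∑ i, φ (w.2.2 i)) (by
    rintro _ _ ⟨x, i, ε, t⟩
    simp [Fin.sum_univ_succAbove _ i, h])

theorem coordSum_point (φ : I → ℝ) (h : ∀ ε, φ (cubeEnd ε) = 0) {n : ℕ} (x : K.cells n)
    (t : Fin n → I) : K.coordSum φ h (K.point x t) = ∑ i, φ (t i) := rfl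

theorem continuous_coordSum {φ : I → ℝ} (h : ∀ ε, φ (cubeEnd ε) = 0) (hφ : Continuous φ) :
    Continuous (K.coordSum φ h) :=
  continuous_of_cells fun n x => by
    simp only [coordSum_point]; fun_prop

theorem sharp_cubeEnd {δ : ℝ} (hδ : 0 < δ ∧ δ ≤ 1) (ε : Bool) :
    sharp δ ((cubeEnd ε : I) - 1 / 2) = cubeEnd ε := by
  cases ε
  · exact sharp_eq_zero hδ.1 (by simp [cubeEnd]; linarith)
  · exact sharp_eq_one hδ.1 (by simp [cubeEnd]; linarith)

theorem point_comp_face (θ : I → I) (hθ : ∀ ε, θ (cubeEnd ε) = cubeEnd ε) {w z : K.Cubes}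
    (h : Glue K w z) : K.point w.2.1 (θ ∘ w.2.2) = K.point z.2.1 (θ ∘ z.2.2) := by
  obtain ⟨x, i, ε, t⟩ := h
  rw [K.point_eq_of_end _ _ i ε (by simp [hθ])]
  congr 1
  funext j
  simp [Fin.removeNth]

open scoped Classical in
/-- The self-map of the realization which sharpens all coordinates: those at a
distance of at least `ε/2` from `1/2` are rounded to `0` or `1`.  (Used for `0 < ε ≤ 1`.) -/
noncomputable def sharpen (δ : ℝ) : K.Realization → K.Realization := if hδ : 0 < δ ∧ δ ≤ 1 then
    Realization.lift (fun w => K.point w.2.1 ((fun t : I => sharp δ (t - 1 / 2)) ∘ w.2.2))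
      (fun _ _ h => K.point_comp_face _ (sharp_cubeEnd hδ) h)
  else id

theorem sharpen_point {δ : ℝ} (hδ : 0 < δ ∧ δ ≤ 1) {n : ℕ} (x : K.cells n) (t : Fin n → I) :
    K.sharpen δ (K.point x t) = K.point x fun i => sharp δ (t i - 1 / 2) := by
  rw [sharpen, dif_pos hδ]; rfl

theorem convexComb_sharp_cubeEnd {δ : ℝ} (hδ : 0 < δ ∧ δ ≤ 1) (s : I) (ε : Bool) :
    Icc.convexComb (cubeEnd ε) (sharp δ ((cubeEnd ε : I) - 1 / 2)) s = cubeEnd ε := by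
  rw [sharp_cubeEnd hδ, Icc.convexComb_eq]

/-- Sharpening is homotopic to the identity, relative to the vertices. -/
theorem exists_sharpen_path {δ : ℝ} (hδ : 0 < δ ∧ δ ≤ 1) :
    ∃ H : C(K.Realization, C(I, K.Realization)), (∀ b, H b 0 = b) ∧ (∀ b, H b 1 = K.sharpen δ b) ∧
      ∀ (x : K.cells 0) t s, H (K.point x t) s = K.point x t := by
  have hc : ∀ {n : ℕ} (x : K.cells n), Continuous fun p : (Fin n → I) × I =>
      K.point x ((fun t : I => Icc.convexComb t (sharp δ (t - 1 / 2)) p.2) ∘ p.1) := by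
    intro n x
    refine (K.continuous_point x).comp (continuous_pi fun i => ?_)
    have h1 : Continuous fun p : (Fin n → I) × I => sharp δ ((p.1 i : ℝ) - 1 / 2) :=
      (continuous_sharp δ).comp (by fun_prop)
    exact Icc.continuous_convexComb_prod.comp
      (((continuous_apply i).comp continuous_fst).prodMk (h1.prodMk continuous_snd))
  let H : K.Realization → C(I, K.Realization) := Realization.lift (fun w => ⟨fun s => K.point w.2.1
        ((fun t : I => Icc.convexComb t (sharp δ (t - 1 / 2)) s) ∘ w.2.2),
        (hc w.2.1).comp (Continuous.prodMk_right w.2.2)⟩)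
      (fun w z h => ContinuousMap.ext fun s =>
        K.point_comp_face _ (convexComb_sharp_cubeEnd hδ s) h)
  have hH : ∀ {n : ℕ} (x : K.cells n) t s, H (K.point x t) s =
      K.point x ((fun t : I => Icc.convexComb t (sharp δ (t - 1 / 2)) s) ∘ t) :=
    fun x t s => rfl
  refine ⟨⟨H, continuous_of_cells fun n x => ?_⟩, ?_, ?_, ?_⟩
  · exact ContinuousMap.continuous_of_continuous_uncurry _ (hc x)
  · rintro ⟨n, x, t⟩
    refine (hH x t 0).trans ?_
    simp only [Function.comp_def, Icc.convexComb_zero]; rfl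
  · rintro ⟨n, x, t⟩
    refine (hH x t 1).trans ?_
    simp only [Function.comp_def, Icc.convexComb_one]
    exact (K.sharpen_point hδ x t).symm
  · intro x t s
    exact (hH x t s).trans (congrArg _ (Subsingleton.elim _ _))

theorem sharpen_vertex (δ : ℝ) (x : K.cells 0) (t : Fin 0 → I) :
    K.sharpen δ (K.point x t) = K.point x t := by
  by_cases hδ : 0 < δ ∧ δ ≤ 1
  · rw [sharpen_point K hδ]; exact congrArg _ (Subsingleton.elim _ _)
  · rw [sharpen, dif_neg hδ]; rfl

/-- A bump function at `1/2` of width `η`. -/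
noncomputable def bump (η : ℝ) (t : I) : ℝ := max 0 (η - |(t : ℝ) - 1 / 2|)

theorem continuous_bump (η : ℝ) : Continuous (bump η) := by unfold bump; fun_prop

theorem bump_nonneg (η : ℝ) (t : I) : 0 ≤ bump η t := le_max_left _ _

theorem bump_cubeEnd {η : ℝ} (hη : η ≤ 1 / 2) (ε : Bool) : bump η (cubeEnd ε) = 0 := by
  refine max_eq_left ?_
  cases ε <;> simp [cubeEnd] <;> norm_num [abs_of_pos] <;> linarith

variable {K}

theorem RoundsTo.sum_bump_le {w z : K.Cubes} (h : K.RoundsTo w z) (η : ℝ) :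
    ∑ i, bump η (z.2.2 i) ≤ ∑ i, bump η (w.2.2 i) := by
  induction h with
  | refl => exact le_rfl
  | down x t i z ht h ih | up x t i z ht h ih =>
    refine ih.trans ?_
    simp only [Fin.sum_univ_succAbove _ i]
    exact le_add_of_nonneg_left (bump_nonneg _ _)

/-- The coordinates which are rounded are not `1/2`, so narrow bumps at `1/2` vanish there. -/
theorem RoundsTo.eventually_sum_bump_eq {w z : K.Cubes} (h : K.RoundsTo w z) :
    ∀ᶠ η in 𝓝[>] (0 : ℝ), ∑ i, bump η (w.2.2 i) = ∑ i, bump η (z.2.2 i) := by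
  induction h with
  | refl => exact .of_forall fun _ => rfl
  | down x t i z ht h ih | up x t i z ht h ih =>
    have h1 : (0 : ℝ) < |(t i : ℝ) - 1 / 2| := abs_pos.mpr (by linarith)
    filter_upwards [ih, eventually_nhdsWithin_of_eventually_nhds (eventually_lt_nhds h1)]
      with η hη hη1
    rw [← hη]
    simp only [Fin.sum_univ_succAbove _ i]
    have : bump η (t i) = 0 := max_eq_left (by linarith)
    rw [this, zero_add]; rfl

/-- If the coordinates which are rounded are not too close to `1/2`, then they are
rounded by sharpening. -/
theorem RoundsTo.sharpen_eq {w z : K.Cubes} (h : K.RoundsTo w z) {η δ : ℝ} (hδ : 0 < δ ∧ δ ≤ 1)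
    (hδη : δ ≤ η) (hs : ∑ i, bump η (w.2.2 i) ≤ ∑ i, bump η (z.2.2 i) + η / 2) :
    K.sharpen δ (Quot.mk _ w) = K.point z.2.1 fun i => sharp δ (z.2.2 i - 1 / 2) := by
  induction h with
  | refl z => exact K.sharpen_point hδ z.2.1 z.2.2
  | down x t i z ht h ih =>
    have h1 := h.sum_bump_le η
    simp only [Fin.sum_univ_succAbove _ i] at hs
    have h2 := bump_nonneg η (t i)
    have h3 : bump η (t i) ≤ η / 2 := by
      simp only [Fin.removeNth] at h1; linarith
    have h4 : sharp δ (t i - 1 / 2) = cubeEnd false := by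
      refine sharp_eq_zero hδ.1 ?_
      have := (le_max_right _ _).trans h3
      rw [abs_of_neg (by linarith)] at this
      linarith
    rw [← ih (by simp only [Fin.removeNth]; linarith)]
    refine (K.sharpen_point hδ x t).trans ?_
    rw [K.point_eq_of_end _ _ i false h4]
    exact (K.sharpen_point hδ _ _).symm
  | up x t i z ht h ih =>
    have h1 := h.sum_bump_le η
    simp only [Fin.sum_univ_succAbove _ i] at hs
    have h2 := bump_nonneg η (t i)
    have h3 : bump η (t i) ≤ η / 2 := by
      simp only [Fin.removeNth] at h1; linarith
    have h4 : sharp δ (t i - 1 / 2) = cubeEnd true := by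
      refine sharp_eq_one hδ.1 ?_
      have := (le_max_right _ _).trans h3
      rw [abs_of_pos (by linarith)] at this
      linarith
    rw [← ih (by simp only [Fin.removeNth]; linarith)]
    refine (K.sharpen_point hδ x t).trans ?_
    rw [K.point_eq_of_end _ _ i true h4]
    exact (K.sharpen_point hδ _ _).symm

/-- If a continuous function rounds to the cell `y`, with continuous coordinates, then near a
given point it is sharpened into the cell `y`. -/
theorem exists_sharpen_eq {Q : Type*} [TopologicalSpace Q] {f : Q → K.Realization} {q : Q}
    (hf : ContinuousAt f q) {n : ℕ} {y : K.cells n} {c : Q → Fin n → I} (hc : ContinuousAt c q)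
    (h : ∀ᶠ z in 𝓝 q, K.Rounds (f z) y (c z)) :
    ∃ η > 0, ∀ᶠ z in 𝓝 q, ∀ δ, 0 < δ → δ ≤ η →
      K.sharpen δ (f z) = K.point y fun i => sharp δ (c z i - 1 / 2) := by
  obtain ⟨w, hw, hwz⟩ := h.self_of_nhds
  have hη0 : ∀ᶠ η in 𝓝[>] (0 : ℝ), 0 < η ∧ η ≤ 1 / 2 := (eventually_mem_nhdsWithin).and
      (eventually_nhdsWithin_of_eventually_nhds (eventually_le_nhds (by norm_num)))
  obtain ⟨η, ⟨h0, h1⟩, h2⟩ := (hη0.and hwz.eventually_sum_bump_eq).exists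
  refine ⟨η, h0, ?_⟩
  -- the sum of the bumps over all the coordinates is a continuous function on the realization; it
  -- agrees at `q` with the sum over the coordinates `c`, so that nearby the coordinates which are
  -- rounded contribute little, that is, they are not close to `1/2`
  have h3 : ContinuousAt (fun z => K.coordSum (bump η) (bump_cubeEnd h1) (f z) -
      ∑ i, bump η (c z i)) q := by
    refine ((K.continuous_coordSum _ (continuous_bump η)).continuousAt.comp hf).sub ?_
    refine ContinuousAt.comp (g := fun t : Fin n → I => ∑ i, bump η (t i)) ?_ hc
    exact (continuous_finsetSum _ fun i _ =>
      (continuous_bump η).comp (continuous_apply i)).continuousAt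
  have h4 := h3.eventually_lt_const (u := η / 2) (by
    beta_reduce
    rw [← hw]
    change ∑ i, bump η (w.2.2 i) - _ < _
    rw [h2, sub_self]; linarith)
  filter_upwards [h, h4] with z ⟨w', hw', hwz'⟩ hz δ hδ hδη
  rw [← hw'] at hz ⊢
  refine hwz'.sharpen_eq ⟨hδ, by linarith⟩ hδη ?_
  change ∑ i, bump η (w'.2.2 i) - _ < _ at hz
  change _ ≤ ∑ i, bump η (c z i) + _
  linarith

end PreCubicSet

/-- The sharpening of the coordinates of the extended rack space. -/
noncomputable abbrev sharpenRack (δ : ℝ) : ExtendedRackSpace X → ExtendedRackSpace X :=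
  (extendedRackCubes X).sharpen δ

/-! ### The cells of the extended rack space -/

section RackCells

/-- The action of `a` if `s` is true, and the identity otherwise. -/
def actIf (s : Bool) (a x : X) : X := if s then a ◃ x else x

@[simp] theorem actIf_true (a x : X) : actIf true a x = a ◃ x := rfl
@[simp] theorem actIf_false (a x : X) : actIf false a x = x := rfl

/-- The point with coordinates `t` of the `3`-cube labeled by `(r, a 0, a 1, a 2)`. -/
def rackCube (r : X) (a : Fin 3 → X) (t : Fin 3 → I) : ExtendedRackSpace X :=
  (extendedRackCubes X).point (n := 3) ![r, a 0, a 1, a 2] t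

theorem continuous_rackCube (r : X) (a : Fin 3 → X) : Continuous (rackCube r a) :=
  PreCubicSet.continuous_point _ _

theorem rackCube_eq_square_zero (r : X) (a : Fin 3 → X) {t : Fin 3 → I} {s : Bool}
    (h : t 0 = cubeEnd s) :
    rackCube r a t = rackSquare (actIf s (a 0) r) (a 1) (a 2) (t 1) (t 2) := by
  refine ((extendedRackCubes X).point_eq_of_end (n := 2) _ t 0 s h).trans ?_
  refine congrArg₂ (fun y t => (extendedRackCubes X).point (n := 2) y t) ?_ ?_
  · funext k; fin_cases k <;> cases s <;> rfl
  · funext k; fin_cases k <;> rfl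

theorem rackCube_eq_square_one (r : X) (a : Fin 3 → X) {t : Fin 3 → I} {s : Bool}
    (h : t 1 = cubeEnd s) :
    rackCube r a t = rackSquare (actIf s (a 1) r) (actIf s (a 1) (a 0)) (a 2) (t 0) (t 2) := by
  refine ((extendedRackCubes X).point_eq_of_end (n := 2) _ t 1 s h).trans ?_
  refine congrArg₂ (fun y t => (extendedRackCubes X).point (n := 2) y t) ?_ ?_
  · funext k; fin_cases k <;> cases s <;> rfl
  · funext k; fin_cases k <;> rfl

theorem rackCube_eq_square_two (r : X) (a : Fin 3 → X) {t : Fin 3 → I} {s : Bool}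
    (h : t 2 = cubeEnd s) :
    rackCube r a t = rackSquare (actIf s (a 2) r) (actIf s (a 2) (a 0)) (actIf s (a 2) (a 1))
      (t 0) (t 1) := by
  refine ((extendedRackCubes X).point_eq_of_end (n := 2) _ t 2 s h).trans ?_
  refine congrArg₂ (fun y t => (extendedRackCubes X).point (n := 2) y t) ?_ ?_
  · funext k; fin_cases k <;> cases s <;> rfl
  · funext k; fin_cases k <;> rfl

theorem rackSquare_left (r a b : X) (s : Bool) (u : I) :
    rackSquare r a b (cubeEnd s) u = rackEdge (actIf s a r) b u := by
  refine ((extendedRackCubes X).point_eq_of_end (n := 1) _ _ 0 s rfl).trans ?_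
  refine congrArg₂ (fun y t => (extendedRackCubes X).point (n := 1) y t) ?_ ?_
  · funext k; fin_cases k <;> cases s <;> rfl
  · funext k; fin_cases k; rfl

theorem rackSquare_right (r a b : X) (s : Bool) (t : I) :
    rackSquare r a b t (cubeEnd s) = rackEdge (actIf s b r) (actIf s b a) t := by
  refine ((extendedRackCubes X).point_eq_of_end (n := 1) _ _ 1 s rfl).trans ?_
  refine congrArg₂ (fun y t => (extendedRackCubes X).point (n := 1) y t) ?_ ?_
  · funext k; fin_cases k <;> cases s <;> rfl
  · funext k; fin_cases k; rfl

theorem rackEdge_end (r a : X) (s : Bool) :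
    rackEdge r a (cubeEnd s) = rackVertex (actIf s a r) := by
  refine ((extendedRackCubes X).point_eq_of_end (n := 0) _ _ 0 s rfl).trans ?_
  refine congrArg₂ (fun y t => (extendedRackCubes X).point (n := 0) y t) ?_ ?_
  · funext k; fin_cases k; cases s <;> rfl
  · exact Subsingleton.elim _ _

/-- A point of an edge which is in the same half as another point, and is the same point of
the realization, has the same coordinate. -/
theorem eq_of_rackEdge_eq {r a : X} {t t' : I} (h : rackEdge r a t = rackEdge r a t')
    (hs : sign ((t : ℝ) - 1 / 2) = sign ((t' : ℝ) - 1 / 2)) : t = t' := by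
  have h0 : ∀ ε, (fun t : I => min (t : ℝ) (1 - t)) (cubeEnd ε) = 0 := by
    intro ε; cases ε <;> simp [cubeEnd]
  have h1 : ∑ i : Fin 1, min ((![t] i : I) : ℝ) (1 - (![t] i : I)) =
      ∑ i : Fin 1, min ((![t'] i : I) : ℝ) (1 - (![t'] i : I)) :=
    congrArg ((extendedRackCubes X).coordSum (fun t : I => min (t : ℝ) (1 - t)) h0) h
  simp only [Fin.sum_univ_one, Matrix.cons_val_zero] at h1
  apply Subtype.ext
  rcases lt_trichotomy ((t : ℝ) - 1 / 2) 0 with h2 | h2 | h2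
  · rw [sign_neg h2, eq_comm, sign_eq_neg_one_iff] at hs
    rwa [min_eq_left (by linarith), min_eq_left (by linarith)] at h1
  · rw [h2, sign_zero, eq_comm, sign_eq_zero_iff] at hs
    linarith
  · rw [sign_pos h2, eq_comm, sign_eq_one_iff] at hs
    rw [min_eq_right (by linarith), min_eq_right (by linarith)] at h1
    linarith

end RackCells

/-! ### Charts of a diagram -/

theorem IsPreconnected.pos_of_ne_zero {α : Type*} [TopologicalSpace α] {S : Set α}
    (hS : IsPreconnected S) {f : α → ℝ} (hf : ContinuousOn f S) (h0 : ∀ x ∈ S, f x ≠ 0)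
    {x y : α} (hx : x ∈ S) (hy : y ∈ S) (h : 0 < f x) : 0 < f y := by
  by_contra hn
  obtain ⟨z, hz, hz0⟩ := hS.intermediate_value hy hx hf ⟨not_lt.mp hn, h.le⟩
  exact h0 z hz hz0

theorem IsPreconnected.neg_of_ne_zero {α : Type*} [TopologicalSpace α] {S : Set α}
    (hS : IsPreconnected S) {f : α → ℝ} (hf : ContinuousOn f S) (h0 : ∀ x ∈ S, f x ≠ 0)
    {x y : α} (hx : x ∈ S) (hy : y ∈ S) (h : f x < 0) : f y < 0 := by
  have := hS.pos_of_ne_zero (f := fun x => -f x) hf.neg (fun x hx => neg_ne_zero.mpr (h0 x hx))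
    hx hy (by linarith)
  linarith

/-- The open quadrants (for `s, s' ≠ 0`) and half-planes (if one of `s` and `s'` is zero) in a
ball of the plane. -/
def ballSector (δ s s' : ℝ) : Set (ℝ × ℝ) :=
  {v | v ∈ planeBall δ ∧ (s ≠ 0 → 0 < s * v.1) ∧ (s' ≠ 0 → 0 < s' * v.2)}

theorem convex_ballSector (δ s s' : ℝ) : Convex ℝ (ballSector δ s s') := by
  refine (convex_ball _ _).inter (Convex.inter (s := {v : ℝ × ℝ | s ≠ 0 → 0 < s * v.1})
    (t := {v : ℝ × ℝ | s' ≠ 0 → 0 < s' * v.2}) ?_ ?_)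
  · by_cases h : s = 0
    · simp [h, convex_univ]
    · simpa [h] using convex_halfSpace_gt (𝕜 := ℝ) (f := fun v : ℝ × ℝ => s * v.1)
        ⟨by intros; simp; ring, by intros; simp; ring⟩ 0
  · by_cases h : s' = 0
    · simp [h, convex_univ]
    · simpa [h] using convex_halfSpace_gt (𝕜 := ℝ) (f := fun v : ℝ × ℝ => s' * v.2)
        ⟨by intros; simp; ring, by intros; simp; ring⟩ 0

theorem mem_ball_prod {δ : ℝ} {v : ℝ × ℝ} : v ∈ planeBall δ ↔ |v.1| < δ ∧ |v.2| < δ := by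
  rw [mem_ball_zero_iff, Prod.norm_def, max_lt_iff, Real.norm_eq_abs, Real.norm_eq_abs]

theorem abs_half_lt {δ : ℝ} (hδ : 0 < δ) : |δ / 2| < δ := by
  rw [abs_of_pos (by linarith)]; linarith

theorem exists_ball_subset_target
    (hp : p ∈ e.source) (h0 : e p = 0) {P : Square → Prop} (hP : ∀ᶠ z in 𝓝 p, P z) :
    ∃ δ > 0, planeBall δ ⊆ e.target ∧ ∀ v ∈ planeBall δ, P (e.symm v) := by
  have h1 := (e.eventually_nhds' P hp).mpr hP
  have h2 : ∀ᶠ v in 𝓝 (e p), v ∈ e.target := e.open_target.mem_nhds (e.map_source hp)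
  rw [h0] at h1 h2
  obtain ⟨δ, hδ, h⟩ := Metric.eventually_nhds_iff_ball.mp (h2.and h1)
  exact ⟨δ, hδ, fun v hv => (h v hv).1, fun v hv => (h v hv).2⟩

/-- Every property which holds near the center of a chart holds at points in all directions. -/
theorem exists_sign_chart_eq (hp : p ∈ e.source) (h0 : e p = 0) (s t : SignType)
    {P : Square → Prop} (hP : ∀ᶠ z in 𝓝 p, P z) :
    ∃ z ∈ e.source, P z ∧ sign (e z).1 = s ∧ sign (e z).2 = t := by
  obtain ⟨δ, hδ, h1, h2⟩ := exists_ball_subset_target hp h0 hP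
  have hv : ((s * (δ / 2), t * (δ / 2)) : ℝ × ℝ) ∈ planeBall δ := by
    rw [mem_ball_prod]
    constructor
    · cases s <;> simp [abs_half_lt hδ, hδ]
    · cases t <;> simp [abs_half_lt hδ, hδ]
  refine ⟨_, e.map_target (h1 hv), h2 _ hv, ?_⟩
  rw [e.right_inv (h1 hv)]
  exact ⟨by cases s <;> simp [hδ], by cases t <;> simp [hδ]⟩

theorem eventually_mem_ball
    (hp : p ∈ e.source) (h0 : e p = 0) {δ : ℝ} (hδ : 0 < δ) :
    ∀ᶠ z in 𝓝 p, z ∈ e.source ∧ e z ∈ planeBall δ := by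
  refine (e.open_source.eventually_mem hp).and ?_
  have := e.continuousAt hp
  rw [ContinuousAt, h0] at this
  exact this.eventually (Metric.ball_mem_nhds _ hδ)

theorem eventually_notMem_boundary (hp : p ∈ D.curve) : ∀ᶠ q in 𝓝 p, q ∉ Cube.boundary (Fin 2) := by
  have hcl : IsClosed (Cube.boundary (Fin 2)) := by
    have : Cube.boundary (Fin 2) = ⋃ i : Fin 2, {y | y i = 0} ∪ {y | y i = 1} := by
      ext y; simp [Cube.boundary]
    rw [this]
    exact isClosed_iUnion_of_finite fun i =>
      (isClosed_singleton.preimage (continuous_apply i)).union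
        (isClosed_singleton.preimage (continuous_apply i))
  exact hcl.isOpen_compl.eventually_mem fun h => disjoint_left.mp D.disjoint_boundary hp h

namespace LinkDiagram

variable {e e' : PlaneChart}

theorem eventually_notMem_crossings (h : p ∉ D.crossings) : ∀ᶠ z in 𝓝 p, z ∉ D.crossings :=
  D.crossings.finite_toSet.isClosed.isOpen_compl.eventually_mem (by simpa using h)

theorem eventually_mem_crossings_eq (D : LinkDiagram) (p : Square) :
    ∀ᶠ z in 𝓝 p, z ∈ D.crossings → z = p := by
  have : IsClosed ((D.crossings.erase p : Finset Square) : Set Square) :=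
    (Finset.finite_toSet _).isClosed
  filter_upwards [this.isOpen_compl.eventually_mem (x := p) (by simp)] with z hz h
  by_contra hne
  exact hz (by simp [h, hne])

theorem eventually_notMem_curve (h : p ∉ D.curve) : ∀ᶠ z in 𝓝 p, z ∉ D.curve :=
  D.isClosed_curve.isOpen_compl.eventually_mem h

/-- `k` is the index on the right side of the strand through `p`. -/
def IsRightIndex (D : LinkDiagram) (p : Square) (k : ℤ) : Prop :=
  (∀ᶠ z in 𝓝 p, z ∉ D.curve → D.index z = k ∨ D.index z = k + 1) ∧
    (∃ᶠ z in 𝓝 p, z ∉ D.curve ∧ D.index z = k) ∧ (∃ᶠ z in 𝓝 p, z ∉ D.curve ∧ D.index z = k + 1)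

theorem IsRightIndex.eq {k k' : ℤ} (h : D.IsRightIndex p k)
    (h' : ∀ᶠ z in 𝓝 p, z ∉ D.curve → D.index z = k' ∨ D.index z = k' + 1) : k = k' := by
  obtain ⟨z, hz, hz'⟩ := (h.2.1.and_eventually h').exists
  obtain ⟨w, hw, hw'⟩ := (h.2.2.and_eventually h').exists
  have := hz' hz.1
  have := hw' hw.1
  omega

theorem exists_rightIndex_of_chart (h : D.IsRegularChart p e) : ∃ k, D.IsRightIndex p k ∧
    ∀ q ∈ e.source, (q ∈ D.curve ↔ (e q).1 = 0) ∧ ((e q).1 < 0 → D.index q = k) ∧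
      (0 < (e q).1 → D.index q = k + 1) := by
  obtain ⟨k, hk⟩ := h.index_eq
  refine ⟨k, ⟨?_, ?_, ?_⟩, fun q hq => ⟨h.mem_curve_iff q hq, hk q hq⟩⟩
  · filter_upwards [e.open_source.eventually_mem h.mem_source] with z hz hzc
    rw [h.mem_curve_iff z hz] at hzc
    exact (lt_or_gt_of_ne hzc).imp (hk z hz).1 (hk z hz).2
  · rw [Filter.frequently_iff]
    intro N hN
    obtain ⟨z, hz, hzN, h1, -⟩ := exists_sign_chart_eq h.mem_source h.map_center (-1) 0 hN
    have h1 := sign_eq_neg_one_iff.mp h1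
    exact ⟨z, hzN, fun hc => h1.ne ((h.mem_curve_iff z hz).mp hc), (hk z hz).1 h1⟩
  · rw [Filter.frequently_iff]
    intro N hN
    obtain ⟨z, hz, hzN, h1, -⟩ := exists_sign_chart_eq h.mem_source h.map_center 1 0 hN
    have h1 := sign_eq_one_iff.mp h1
    exact ⟨z, hzN, fun hc => h1.ne' ((h.mem_curve_iff z hz).mp hc), (hk z hz).2 h1⟩

theorem exists_rightIndex (hp : p ∈ D.curve) (hp' : p ∉ D.crossings) : ∃ k, D.IsRightIndex p k := by
  obtain ⟨e, he⟩ := D.regular_chart p hp hp'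
  obtain ⟨k, hk, _⟩ := exists_rightIndex_of_chart he
  exact ⟨k, hk⟩

/-- A map of a ball which preserves both coordinate axes and the number of positive coordinates (up
to a constant) preserves all signs. -/
theorem sign_eq_of_quadrants {δ : ℝ} {φ : ℝ × ℝ → ℝ × ℝ}
    (hφ : ContinuousOn φ (Metric.ball 0 δ))
    (h1 : ∀ v ∈ planeBall δ, v.1 = 0 ↔ (φ v).1 = 0)
    (h2 : ∀ v ∈ planeBall δ, v.2 = 0 ↔ (φ v).2 = 0) {m m' : ℤ}
    (h3 : ∀ v ∈ planeBall δ, v.1 ≠ 0 → v.2 ≠ 0 →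
      m + (if 0 < v.1 then 1 else 0) + (if 0 < v.2 then 1 else 0) =
        m' + (if 0 < (φ v).1 then 1 else 0) + (if 0 < (φ v).2 then 1 else 0))
    {v : ℝ × ℝ} (hv : v ∈ planeBall δ) :
    sign v.1 = sign (φ v).1 ∧ sign v.2 = sign (φ v).2 := by
  have hδ : 0 < δ := Metric.pos_of_mem_ball hv
  have hb : ∀ s s' : ℝ, |s| < δ → |s'| < δ → (s, s') ∈ planeBall δ :=
    fun s s' h h' => mem_ball_prod.mpr ⟨h, h'⟩
  have hd : |δ / 2| < δ := abs_half_lt hδ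
  have hd' : |-(δ / 2)| < δ := by rwa [abs_neg]
  have hmm : m = m' := by
    have a := h3 _ (hb _ _ hd hd) (by simp; linarith) (by simp; linarith)
    have b := h3 _ (hb _ _ hd' hd') (by simp; linarith) (by simp; linarith)
    have c1 : ¬ (0 : ℝ) < -(δ / 2) := by linarith
    have c2 : (0 : ℝ) < δ / 2 := by linarith
    simp only [c1, c2, if_true, if_false] at a b
    split_ifs at a b <;> omega
  subst hmm
  -- the values of `φ` in the first and in the third quadrant
  have hpp : ∀ v ∈ planeBall δ, 0 < v.1 → 0 < v.2 → 0 < (φ v).1 ∧ 0 < (φ v).2 := by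
    intro v hv a b
    have c := h3 v hv a.ne' b.ne'
    simp only [a, b, if_true] at c
    constructor <;> by_contra hn <;> simp only [hn, if_false] at c <;> split_ifs at c <;> omega
  have hnn : ∀ v ∈ planeBall δ, v.1 < 0 → v.2 < 0 → (φ v).1 < 0 ∧ (φ v).2 < 0 := by
    intro v hv a b
    have c := h3 v hv a.ne b.ne
    simp only [a.not_gt, b.not_gt, if_false] at c
    constructor
    · refine lt_of_le_of_ne (not_lt.mp fun hn => ?_) fun h => a.ne ((h1 v hv).mpr h)
      simp only [hn, if_true] at c; split_ifs at c <;> omega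
    · refine lt_of_le_of_ne (not_lt.mp fun hn => ?_) fun h => b.ne ((h2 v hv).mpr h)
      simp only [hn, if_true] at c; split_ifs at c <;> omega
  have hsub : ∀ s s', ballSector δ s s' ⊆ Metric.ball 0 δ := fun s s' v hv => hv.1
  have hc1 : ContinuousOn (fun v => (φ v).1) (Metric.ball 0 δ) :=
    continuous_fst.comp_continuousOn hφ
  have hc2 : ContinuousOn (fun v => (φ v).2) (Metric.ball 0 δ) :=
    continuous_snd.comp_continuousOn hφ
  constructor
  · rcases lt_trichotomy v.1 0 with h | h | h
    · rw [sign_neg h, sign_neg]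
      refine (convex_ballSector δ (-1) 0).isPreconnected.neg_of_ne_zero (x := (-(δ / 2), -(δ / 2)))
        (hc1.mono (hsub _ _)) (fun x hx h => ?_) ⟨hb _ _ hd' hd', by simpa, by simp⟩
        ⟨hv, by simpa, by simp⟩ (hnn _ (hb _ _ hd' hd') (by simpa) (by simpa)).1
      have := hx.2.1 (by norm_num)
      rw [(h1 x hx.1).mpr h] at this; simp at this
    · rw [h, (h1 v hv).mp h]
    · rw [sign_pos h, sign_pos]
      refine (convex_ballSector δ 1 0).isPreconnected.pos_of_ne_zero (x := (δ / 2, δ / 2))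
        (hc1.mono (hsub _ _)) (fun x hx h => ?_) ⟨hb _ _ hd hd, by simpa, by simp⟩
        ⟨hv, by simpa, by simp⟩ (hpp _ (hb _ _ hd hd) (by simpa) (by simpa)).1
      have := hx.2.1 (by norm_num)
      rw [(h1 x hx.1).mpr h] at this; simp at this
  · rcases lt_trichotomy v.2 0 with h | h | h
    · rw [sign_neg h, sign_neg]
      refine (convex_ballSector δ 0 (-1)).isPreconnected.neg_of_ne_zero (x := (-(δ / 2), -(δ / 2)))
        (hc2.mono (hsub _ _)) (fun x hx h => ?_) ⟨hb _ _ hd' hd', by simp, by simpa⟩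
        ⟨hv, by simp, by simpa⟩ (hnn _ (hb _ _ hd' hd') (by simpa) (by simpa)).2
      have := hx.2.2 (by norm_num)
      rw [(h2 x hx.1).mpr h] at this; simp at this
    · rw [h, (h2 v hv).mp h]
    · rw [sign_pos h, sign_pos]
      refine (convex_ballSector δ 0 1).isPreconnected.pos_of_ne_zero (x := (δ / 2, δ / 2))
        (hc2.mono (hsub _ _)) (fun x hx h => ?_) ⟨hb _ _ hd hd, by simp, by simpa⟩
        ⟨hv, by simp, by simpa⟩ (hpp _ (hb _ _ hd hd) (by simpa) (by simpa)).2
      have := hx.2.2 (by norm_num)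
      rw [(h2 x hx.1).mpr h] at this; simp at this

/-- Two diagrams are the same near `p`. -/
def AgreeNear (D D' : LinkDiagram) (p : Square) : Prop :=
  ∀ᶠ z in 𝓝 p, (z ∈ D.curve ↔ z ∈ D'.curve) ∧ (z ∈ D.crossings ↔ z ∈ D'.crossings) ∧
    (p ∈ D.crossings → (z ∈ D.overStrand p ↔ z ∈ D'.overStrand p)) ∧
    (z ∉ D.curve → D.index z = D'.index z)

theorem AgreeNear.refl (D : LinkDiagram) (p : Square) : AgreeNear D D p :=
  .of_forall fun _ => ⟨Iff.rfl, Iff.rfl, fun _ => Iff.rfl, fun _ => rfl⟩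

/-- The signs of the coordinates of a crossing chart do not depend on the chart. -/
theorem AgreeNear.sign_crossing_eq (ha : AgreeNear D D' p) (hp : p ∈ D.crossings)
    (h : D.IsCrossingChart p e) (h' : D'.IsCrossingChart p e') :
    ∀ᶠ z in 𝓝 p, sign (e z).1 = sign (e' z).1 ∧ sign (e z).2 = sign (e' z).2 := by
  obtain ⟨δ, hδ, h1, h2⟩ := exists_ball_subset_target h.mem_source h.map_center
    (ha.and (e'.open_source.eventually_mem h'.mem_source))
  obtain ⟨m, hm⟩ := h.index_eq
  obtain ⟨m', hm'⟩ := h'.index_eq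
  have hs : ∀ v ∈ planeBall δ, e.symm v ∈ e.source ∧ e (e.symm v) = v :=
    fun v hv => ⟨e.map_target (h1 hv), e.right_inv (h1 hv)⟩
  have h0 : e.symm 0 = p := by rw [← h.map_center, e.left_inv h.mem_source]
  have hy : ∀ v ∈ planeBall δ, v.2 = 0 ↔ (e' (e.symm v)).2 = 0 := by
    intro v hv
    rw [← h'.mem_over_iff _ (h2 v hv).2, ← (h2 v hv).1.2.2.1 hp, h.mem_over_iff _ (hs v hv).1,
      (hs v hv).2]
  have hxy : ∀ v ∈ planeBall δ, (v.1 = 0 ∨ v.2 = 0) ↔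
      ((e' (e.symm v)).1 = 0 ∨ (e' (e.symm v)).2 = 0) := by
    intro v hv
    rw [← h'.mem_curve_iff _ (h2 v hv).2, ← (h2 v hv).1.1, h.mem_curve_iff _ (hs v hv).1,
      (hs v hv).2]
  -- the over-strand is `y = 0` in both charts; a point of the curve off the over-strand, or the
  -- crossing itself, has `x = 0`
  have hx : ∀ v ∈ planeBall δ, v.1 = 0 ↔ (e' (e.symm v)).1 = 0 := by
    intro v hv
    by_cases hv2 : v.2 = 0
    · have a := (hy v hv).mp hv2
      constructor
      · intro hv1
        have : v = 0 := Prod.ext hv1 hv2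
        rw [this, h0, h'.map_center]; rfl
      · intro hv1
        have h3 : e' (e.symm v) = e' p := by
          rw [h'.map_center]; exact Prod.ext hv1 a
        have h4 : e.symm v = p := e'.injOn (h2 v hv).2 h'.mem_source h3
        have h5 : v = e p := by rw [← h4, (hs v hv).2]
        rw [h5, h.map_center]; rfl
    · have := hxy v hv
      have a := (hy v hv).not.mp hv2
      tauto
  have hφ : ContinuousOn (fun v => e' (e.symm v)) (Metric.ball 0 δ) :=
    e'.continuousOn.comp (e.symm.continuousOn.mono h1) fun v hv => (h2 v hv).2
  filter_upwards [eventually_mem_ball h.mem_source h.map_center hδ] with z hz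
  have := sign_eq_of_quadrants hφ hx hy (m := m) (m' := m') ?_ hz.2
  · rwa [e.left_inv hz.1] at this
  · intro v hv hv1 hv2
    have a := hm _ (hs v hv).1
    rw [(hs v hv).2] at a
    rw [← a hv1 hv2, ← hm' _ (h2 v hv).2 ((hx v hv).not.mp hv1) ((hy v hv).not.mp hv2)]
    refine (h2 v hv).1.2.2.2 ?_
    rw [h.mem_curve_iff _ (hs v hv).1, (hs v hv).2]
    tauto

end LinkDiagram

/-! ### Shadow colorings near a point -/

section LocalForms

namespace ShadowColoring

open scoped Classical in
/-- The color of the region containing a point (with a junk value on the curves). -/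
noncomputable def reg (C : ShadowColoring X D) (p : Square) : X :=
  if h : p ∉ D.curve then C.region ⟨p, h⟩ else C.outer

open scoped Classical in
/-- The color of the arc containing a point (with a junk value off the curves). -/
noncomputable def col (C : ShadowColoring X D) (p : Square) : X :=
  if h : p ∈ D.curve then C.arc ⟨p, h⟩ else C.outer

variable (C)

theorem region_eq (p : {p : Square // p ∉ D.curve}) : C.region p = C.reg p.1 := by
  rw [reg, dif_pos p.2]

theorem arc_eq (p : {p : Square // p ∈ D.curve}) : C.arc p = C.col p.1 := by
  rw [col, dif_pos p.2]

theorem ext_reg_col {C C' : ShadowColoring X D} (h : ∀ p ∉ D.curve, C.reg p = C'.reg p)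
    (h' : ∀ p ∈ D.curve, C.col p = C'.col p) : C = C' := by
  ext p
  · rw [region_eq, region_eq, h _ p.2]
  · rw [arc_eq, arc_eq, h' _ p.2]

theorem eventually_reg_eq (hp : p ∉ D.curve) : ∀ᶠ z in 𝓝 p, C.reg z = C.reg p := by
  have h1 := (IsLocallyConstant.iff_eventually_eq _).mp C.region_locally_constant ⟨p, hp⟩
  rw [nhds_subtype_eq_comap, eventually_comap] at h1
  filter_upwards [h1, D.eventually_notMem_curve hp] with z hz hzc
  have := hz ⟨z, hzc⟩ rfl
  rwa [region_eq, region_eq] at this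

theorem eventually_col_eq (hp : p ∈ D.curve) (hp' : p ∉ D.crossings) :
    ∀ᶠ z in 𝓝 p, z ∈ D.curve → C.col z = C.col p := by
  have h1 := C.arc_locally_constant ⟨p, hp⟩ hp'
  rw [nhds_subtype_eq_comap, eventually_comap] at h1
  filter_upwards [h1] with z hz hzc
  have := hz ⟨z, hzc⟩ rfl
  rwa [arc_eq, arc_eq] at this

theorem eventually_over_col_eq (hp : p ∈ D.crossings) :
    ∀ᶠ z in 𝓝 p, z ∈ D.curve → z ∈ D.overStrand p → C.col z = C.col p := by
  have h1 := C.over_arc ⟨p, D.crossings_subset hp⟩ hp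
  rw [nhds_subtype_eq_comap, eventually_comap] at h1
  filter_upwards [h1] with z hz hzc hzo
  have := hz ⟨z, hzc⟩ rfl hzo
  rwa [arc_eq, arc_eq] at this

theorem eventually_under_col_eq (hp : p ∈ D.crossings) (he : D.IsCrossingChart p e) :
    ∃ U ∈ 𝓝 p, ∀ q ∈ U, ∀ q' ∈ U, q ∈ D.curve → q' ∈ D.curve → (e q).1 = 0 → (e q).2 < 0 →
      (e q').1 = 0 → 0 < (e q').2 → C.col q' = C.col p ◃ C.col q := by
  obtain ⟨U, hU, -, h⟩ := C.under_arc ⟨p, D.crossings_subset hp⟩ hp e he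
  refine ⟨U, hU, fun q hq q' hq' hc hc' h1 h2 h3 h4 => ?_⟩
  have := h ⟨q, hc⟩ ⟨q', hc'⟩ hq hq' h1 h2 h3 h4
  rwa [arc_eq, arc_eq, arc_eq] at this

theorem eventually_region_arc (hp : p ∈ D.curve) (hp' : p ∉ D.crossings) :
    ∃ U ∈ 𝓝 p, ∀ q ∈ U, ∀ q' ∈ U, q ∉ D.curve → q' ∉ D.curve →
      D.index q' = D.index q + 1 → C.reg q' = C.col p ◃ C.reg q := by
  obtain ⟨U, hU, h⟩ := C.region_arc ⟨p, hp⟩ hp'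
  refine ⟨U, hU, fun q hq q' hq' hc hc' h1 => ?_⟩
  have := h ⟨q, hc⟩ ⟨q', hc'⟩ hq hq' h1
  rwa [region_eq, region_eq, arc_eq] at this

end ShadowColoring

/-- The form of a shadow coloring at the points `z` near a point `p` of a strand: `k` is the index
and `r` is the color on the right side. -/
def StrandBody (D : LinkDiagram) (reg col : Square → X) (p : Square) (k : ℤ) (r : X)
    (z : Square) : Prop :=
  z ∉ D.crossings ∧ (z ∈ D.curve → col z = col p) ∧
    (z ∉ D.curve → (D.index z = k ∧ reg z = r) ∨ (D.index z = k + 1 ∧ reg z = col p ◃ r))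

/-- The form of a shadow coloring near a point of a strand. -/
def StrandForm (D : LinkDiagram) (reg col : Square → X) (p : Square) (k : ℤ) (r : X) : Prop :=
  ∀ᶠ z in 𝓝 p, StrandBody D reg col p k r z

/-- The form of a shadow coloring at the points `z` near a crossing `p` with the chart `e`: `m` is
the index and `r` is the color of the source region, and `a` is the color of the under-arc
adjoining it. -/
def CrossBody (D : LinkDiagram) (reg col : Square → X) (p : Square)
    (e : PlaneChart) (m : ℤ) (r a : X) (z : Square) : Prop :=
  z ∈ e.source ∧ (z ∈ D.crossings → z = p) ∧
    (z ∈ D.curve ↔ (e z).1 = 0 ∨ (e z).2 = 0) ∧ ((e z).2 = 0 → col z = col p) ∧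
    ((e z).1 = 0 → (e z).2 < 0 → col z = a) ∧ ((e z).1 = 0 → 0 < (e z).2 → col z = col p ◃ a) ∧
    ((e z).1 < 0 → (e z).2 < 0 → D.index z = m ∧ reg z = r) ∧
    (0 < (e z).1 → (e z).2 < 0 → D.index z = m + 1 ∧ reg z = a ◃ r) ∧
    ((e z).1 < 0 → 0 < (e z).2 → D.index z = m + 1 ∧ reg z = col p ◃ r) ∧
    (0 < (e z).1 → 0 < (e z).2 → D.index z = m + 2 ∧ reg z = col p ◃ (a ◃ r))

/-- The form of a shadow coloring near a crossing. -/
def CrossForm (D : LinkDiagram) (reg col : Square → X) (p : Square)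
    (e : PlaneChart) (m : ℤ) (r a : X) : Prop :=
  ∀ᶠ z in 𝓝 p, CrossBody D reg col p e m r a z

namespace ShadowColoring

variable (C)

theorem reg_eq_of_isPreconnected {S : Set Square} (hS : IsPreconnected S)
    (h : ∀ z ∈ S, z ∉ D.curve) {x y : Square} (hx : x ∈ S) (hy : y ∈ S) : C.reg x = C.reg y :=
  hS.eq_of_locally_eq (fun q hq => (C.eventually_reg_eq (h q hq)).mono fun _ h _ => h) hx hy

theorem reg_chart_eq {δ s s' : ℝ} (h1 : planeBall δ ⊆ e.target)
    (h : ∀ v ∈ ballSector δ s s', e.symm v ∉ D.curve) {v w : ℝ × ℝ}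
    (hv : v ∈ ballSector δ s s') (hw : w ∈ ballSector δ s s') :
    C.reg (e.symm v) = C.reg (e.symm w) := by
  refine C.reg_eq_of_isPreconnected (S := e.symm '' ballSector δ s s') ?_ ?_
    (mem_image_of_mem _ hv) (mem_image_of_mem _ hw)
  · exact (convex_ballSector δ s s').isPreconnected.image _
      (e.symm.continuousOn.mono fun v hv => h1 hv.1)
  · rintro _ ⟨v, hv, rfl⟩
    exact h v hv

/-- The colors and indices near a point of a strand, away from the crossings. -/
theorem exists_strandForm (hp : p ∈ D.curve) (hp' : p ∉ D.crossings) {k : ℤ}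
    (hk : D.IsRightIndex p k) : ∃ r, StrandForm D C.reg C.col p k r := by
  obtain ⟨e, he⟩ := D.regular_chart p hp hp'
  obtain ⟨k', hk', hidx⟩ := LinkDiagram.exists_rightIndex_of_chart he
  obtain rfl : k' = k := hk'.eq hk.1
  obtain ⟨U, hU, hU'⟩ := C.eventually_region_arc hp hp'
  obtain ⟨δ, hδ, h1, h2⟩ := exists_ball_subset_target he.mem_source he.map_center
    (((eventually_notMem_crossings hp').and (C.eventually_col_eq hp hp')).and hU)
  have hs : ∀ v ∈ planeBall δ, e.symm v ∈ e.source ∧ e (e.symm v) = v :=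
    fun v hv => ⟨e.map_target (h1 hv), e.right_inv (h1 hv)⟩
  have hm : ((-(δ / 2), 0) : ℝ × ℝ) ∈ ballSector δ (-1) 0 :=
    ⟨by rw [mem_ball_prod]; simp [abs_half_lt hδ, hδ], by simpa, by simp⟩
  have hq : ((δ / 2, 0) : ℝ × ℝ) ∈ ballSector δ 1 0 :=
    ⟨by rw [mem_ball_prod]; simp [abs_half_lt hδ, hδ], by simpa, by simp⟩
  have hcm : ∀ v ∈ ballSector δ (-1) 0, e.symm v ∉ D.curve := fun v hv => by
    have := hv.2.1 (by norm_num)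
    rw [(hidx _ (hs v hv.1).1).1, (hs v hv.1).2]; linarith
  have hcq : ∀ v ∈ ballSector δ 1 0, e.symm v ∉ D.curve := fun v hv => by
    have := hv.2.1 (by norm_num)
    rw [(hidx _ (hs v hv.1).1).1, (hs v hv.1).2]; linarith
  refine ⟨C.reg (e.symm (-(δ / 2), 0)), ?_⟩
  filter_upwards [eventually_mem_ball he.mem_source he.map_center hδ] with z hz
  have hz2 := h2 _ hz.2
  rw [e.left_inv hz.1] at hz2
  refine ⟨hz2.1.1, hz2.1.2, fun hzc => ?_⟩
  rw [(hidx z hz.1).1] at hzc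
  rcases lt_or_gt_of_ne hzc with h | h
  · left
    refine ⟨(hidx z hz.1).2.1 h, ?_⟩
    have := C.reg_chart_eq h1 hcm (v := e z) ⟨hz.2, by simpa, by simp⟩ hm
    rwa [e.left_inv hz.1] at this
  · right
    refine ⟨(hidx z hz.1).2.2 h, ?_⟩
    have := C.reg_chart_eq h1 hcq (v := e z) ⟨hz.2, by simpa, by simp⟩ hq
    rw [e.left_inv hz.1] at this
    rw [this]
    refine hU' _ (h2 _ hm.1).2 _ (h2 _ hq.1).2 (hcm _ hm) (hcq _ hq) ?_
    rw [(hidx _ (hs _ hm.1).1).2.1 (by rw [(hs _ hm.1).2]; simpa),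
      (hidx _ (hs _ hq.1).1).2.2 (by rw [(hs _ hq.1).2]; simpa)]

/-- The colors of the two sides of a strand of a chart around a crossing. -/
theorem reg_sector_eq {δ : ℝ} (h1 : planeBall δ ⊆ e.target) {v₀ w : ℝ × ℝ}
    (hv₀ : v₀ ∈ planeBall δ) (hc : e.symm v₀ ∈ D.curve)
    (hc' : e.symm v₀ ∉ D.crossings) {r r' : X}
    (hoff : ∀ᶠ η in 𝓝[>] (0 : ℝ), (e.symm (v₀ + η • w) ∉ D.curve ∧
      C.reg (e.symm (v₀ + η • w)) = r') ∧ (e.symm (v₀ - η • w) ∉ D.curve ∧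
      C.reg (e.symm (v₀ - η • w)) = r) ∧
      D.index (e.symm (v₀ + η • w)) = D.index (e.symm (v₀ - η • w)) + 1) :
    r' = C.col (e.symm v₀) ◃ r := by
  obtain ⟨U, hU, hU'⟩ := C.eventually_region_arc hc hc'
  have h2 : ContinuousAt e.symm v₀ := e.symm.continuousAt (h1 hv₀)
  have t1 : Tendsto (fun η : ℝ => v₀ + η • w) (𝓝[>] 0) (𝓝 v₀) := by
    have : Continuous fun η : ℝ => v₀ + η • w := by fun_prop
    simpa using (this.tendsto 0).mono_left nhdsWithin_le_nhds
  have t2 : Tendsto (fun η : ℝ => v₀ - η • w) (𝓝[>] 0) (𝓝 v₀) := by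
    have : Continuous fun η : ℝ => v₀ - η • w := by fun_prop
    simpa using (this.tendsto 0).mono_left nhdsWithin_le_nhds
  obtain ⟨η, ⟨⟨a1, a2⟩, ⟨b1, b2⟩, c⟩, d1, d2⟩ := (hoff.and
    (((h2.tendsto.comp t1).eventually hU).and ((h2.tendsto.comp t2).eventually hU))).exists
  rw [← a2, ← b2]
  exact hU' _ d2 _ d1 b1 a1 c

/-- The colors and indices near a crossing: the colors of the four quadrants are constant, and
related by the conditions at the four half-strands. -/
theorem exists_crossForm (hp : p ∈ D.crossings) (he : D.IsCrossingChart p e) :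
    ∃ m r a, CrossForm D C.reg C.col p e m r a := by
  obtain ⟨m, hm⟩ := he.index_eq
  obtain ⟨U, hU, hU'⟩ := C.eventually_under_col_eq hp he
  obtain ⟨δ, hδ, h1, h2⟩ := exists_ball_subset_target he.mem_source he.map_center
    (((LinkDiagram.eventually_mem_crossings_eq D p).and (C.eventually_over_col_eq hp)).and hU)
  have hs : ∀ v ∈ planeBall δ, e.symm v ∈ e.source ∧ e (e.symm v) = v :=
    fun v hv => ⟨e.map_target (h1 hv), e.right_inv (h1 hv)⟩
  have hb : ∀ s s' : ℝ, |s| < δ → |s'| < δ → (s, s') ∈ planeBall δ :=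
    fun s s' h h' => mem_ball_prod.mpr ⟨h, h'⟩
  have hd : |δ / 2| < δ := abs_half_lt hδ
  have hd' : |-(δ / 2)| < δ := by rwa [abs_neg]
  have h00 : |(0 : ℝ)| < δ := by simpa
  have hcur : ∀ v ∈ planeBall δ, e.symm v ∈ D.curve ↔ v.1 = 0 ∨ v.2 = 0 := by
    intro v hv
    rw [he.mem_curve_iff _ (hs v hv).1, (hs v hv).2]
  have hover : ∀ v ∈ planeBall δ, v.2 = 0 → C.col (e.symm v) = C.col p := by
    intro v hv hv2
    refine (h2 v hv).1.2 ((hcur v hv).mpr (Or.inr hv2)) ?_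
    rw [he.mem_over_iff _ (hs v hv).1, (hs v hv).2, hv2]
  have hidx : ∀ v ∈ planeBall δ, v.1 ≠ 0 → v.2 ≠ 0 → D.index (e.symm v) =
      m + (if 0 < v.1 then 1 else 0) + (if 0 < v.2 then 1 else 0) := by
    intro v hv
    have := hm _ (hs v hv).1
    rwa [(hs v hv).2] at this
  have hne : ∀ v ∈ planeBall δ, v ≠ 0 → e.symm v ∉ D.crossings := by
    intro v hv hv0 hc
    apply hv0
    rw [← (hs v hv).2, (h2 v hv).1.1 hc, he.map_center]
  set R : ℝ → ℝ → X := fun s s' => C.reg (e.symm (s * (δ / 2), s' * (δ / 2))) with hR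
  have hreg : ∀ s s' : ℝ, |s| = 1 → |s'| = 1 → ∀ v ∈ ballSector δ s s',
      C.reg (e.symm v) = R s s' := by
    intro s s' hs1 hs1' v hv
    have hne1 : s ≠ 0 := by rintro rfl; simp at hs1
    have hne2 : s' ≠ 0 := by rintro rfl; simp at hs1'
    refine C.reg_chart_eq h1 (fun v hv => ?_) hv ⟨hb _ _ ?_ ?_, fun _ => ?_, fun _ => ?_⟩
    · have a := hv.2.1 hne1
      have b := hv.2.2 hne2
      rw [hcur v hv.1]
      rintro (h | h)
      · rw [h] at a; simp at a
      · rw [h] at b; simp at b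
    · rwa [abs_mul, hs1, one_mul]
    · rwa [abs_mul, hs1', one_mul]
    · rw [← mul_assoc, ← sq, ← sq_abs, hs1]; simpa
    · rw [← mul_assoc, ← sq, ← sq_abs, hs1']; simpa
  have hR0 : ∀ s s' : ℝ, |s| = 1 → |s'| = 1 → ∀ v : ℝ × ℝ, |v.1| < δ → |v.2| < δ →
      0 < s * v.1 → 0 < s' * v.2 → C.reg (e.symm v) = R s s' := fun s s' a b v c d f g =>
    hreg s s' a b v ⟨hb _ _ c d, fun _ => f, fun _ => g⟩
  have hpos : ∀ᶠ η in 𝓝[>] (0 : ℝ), 0 < η ∧ η < δ := (eventually_mem_nhdsWithin).and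
    (eventually_nhdsWithin_of_eventually_nhds (eventually_lt_nhds hδ))
  have c1 : ¬ (0 : ℝ) < -(δ / 2) := by linarith
  have c2 : (0 : ℝ) < δ / 2 := by linarith
  have hδ2 : δ ≠ 0 := hδ.ne'
  -- crossing the under-strand
  have hxside : ∀ s' : ℝ, |s'| = 1 → R 1 s' = C.col (e.symm (0, s' * (δ / 2))) ◃ R (-1) s' := by
    intro s' hs'
    have hs0 : s' ≠ 0 := by rintro rfl; simp at hs'
    have hss : 0 < s' * (s' * (δ / 2)) := by rw [← mul_assoc, ← sq, ← sq_abs, hs']; simpa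
    have hlt : |s' * (δ / 2)| < δ := by rwa [abs_mul, hs', one_mul]
    have hv₀ := hb 0 (s' * (δ / 2)) h00 hlt
    refine C.reg_sector_eq (w := (1, 0)) h1 hv₀ ((hcur _ hv₀).mpr (Or.inl rfl))
      (hne _ hv₀ (by simp [hs0, hδ2])) ?_
    filter_upwards [hpos] with η hη
    have hη' : |η| < δ := by rw [abs_of_pos hη.1]; exact hη.2
    have e1 : ((0, s' * (δ / 2)) + η • (1, 0) : ℝ × ℝ) = (η, s' * (δ / 2)) := by simp
    have e2 : ((0, s' * (δ / 2)) - η • (1, 0) : ℝ × ℝ) = (-η, s' * (δ / 2)) := by simp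
    have b1 := hb η _ hη' hlt
    have b2 := hb (-η) _ (by rwa [abs_neg]) hlt
    rw [e1, e2, hcur _ b1, hcur _ b2, hidx _ b1 hη.1.ne' (by simp [hs0, hδ2]),
      hidx _ b2 (by simp [hη.1.ne']) (by simp [hs0, hδ2])]
    refine ⟨⟨by simp [hη.1.ne', hs0, hδ2], hR0 _ _ (by simp) hs' _ hη' hlt (by simp [hη.1]) hss⟩,
      ⟨by simp [hη.1.ne', hs0, hδ2], hR0 _ _ (by simp) hs' _ (by rwa [abs_neg]) hlt (by simp [hη.1])
      hss⟩, ?_⟩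
    simp only [hη.1, if_true, show ¬ (0 < -η) by linarith [hη.1], if_false]; ring
  -- crossing the over-strand
  have hyside : ∀ s : ℝ, |s| = 1 → R s 1 = C.col (e.symm (s * (δ / 2), 0)) ◃ R s (-1) := by
    intro s' hs'
    have hs0 : s' ≠ 0 := by rintro rfl; simp at hs'
    have hss : 0 < s' * (s' * (δ / 2)) := by rw [← mul_assoc, ← sq, ← sq_abs, hs']; simpa
    have hlt : |s' * (δ / 2)| < δ := by rwa [abs_mul, hs', one_mul]
    have hv₀ := hb (s' * (δ / 2)) 0 hlt h00
    refine C.reg_sector_eq (w := (0, 1)) h1 hv₀ ((hcur _ hv₀).mpr (Or.inr rfl))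
      (hne _ hv₀ (by simp [hs0, hδ2])) ?_
    filter_upwards [hpos] with η hη
    have hη' : |η| < δ := by rw [abs_of_pos hη.1]; exact hη.2
    have e1 : ((s' * (δ / 2), 0) + η • (0, 1) : ℝ × ℝ) = (s' * (δ / 2), η) := by simp
    have e2 : ((s' * (δ / 2), 0) - η • (0, 1) : ℝ × ℝ) = (s' * (δ / 2), -η) := by simp
    have b1 := hb _ η hlt hη'
    have b2 := hb _ (-η) hlt (by rwa [abs_neg])
    rw [e1, e2, hcur _ b1, hcur _ b2, hidx _ b1 (by simp [hs0, hδ2]) hη.1.ne',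
      hidx _ b2 (by simp [hs0, hδ2]) (by simp [hη.1.ne'])]
    refine ⟨⟨by simp [hη.1.ne', hs0, hδ2], hR0 _ _ hs' (by simp) _ hlt hη' hss (by simp [hη.1])⟩,
      ⟨by simp [hη.1.ne', hs0, hδ2], hR0 _ _ hs' (by simp) _ hlt (by rwa [abs_neg]) hss
      (by simp [hη.1])⟩, ?_⟩
    simp only [hη.1, if_true, show ¬ (0 < -η) by linarith [hη.1], if_false]; ring
  set a := C.col (e.symm (0, -1 * (δ / 2))) with ha
  have bm := hb 0 (-(δ / 2)) h00 hd'
  have bp := hb 0 (δ / 2) h00 hd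
  have hup : ∀ v ∈ planeBall δ, v.1 = 0 → 0 < v.2 → C.col (e.symm v) = C.col p ◃ a := by
    intro v hv hv1 hv2
    refine hU' _ (h2 _ (by simpa using bm)).2 _ (h2 v hv).2 ((hcur _ (by simpa using bm)).mpr
      (Or.inl rfl)) ((hcur v hv).mpr (Or.inl hv1)) ?_ ?_ ?_ ?_
    · rw [(hs _ (by simpa using bm)).2]
    · rw [(hs _ (by simpa using bm)).2]; simpa
    · rw [(hs v hv).2, hv1]
    · rwa [(hs v hv).2]
  have hdown : ∀ v ∈ planeBall δ, v.1 = 0 → v.2 < 0 → C.col (e.symm v) = a := by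
    intro v hv hv1 hv2
    have := hU' _ (h2 v hv).2 _ (h2 _ bp).2 ((hcur v hv).mpr (Or.inl hv1))
      ((hcur _ bp).mpr (Or.inl rfl)) (by rw [(hs v hv).2, hv1]) (by rwa [(hs v hv).2])
      (by rw [(hs _ bp).2]) (by rwa [(hs _ bp).2])
    rw [hup _ bp rfl c2] at this
    exact ((Rack.left_cancel _).mp this).symm
  refine ⟨m, R (-1) (-1), a, ?_⟩
  filter_upwards [eventually_mem_ball he.mem_source he.map_center hδ] with z hz
  have hz2 := h2 _ hz.2
  have hi := hidx _ hz.2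
  have hov := hover _ hz.2
  have hu := hup _ hz.2
  have hdn := hdown _ hz.2
  have hr := fun s s' hs hs' => hreg s s' hs hs' (e z)
  rw [e.left_inv hz.1] at hz2 hi hov hu hdn
  simp only [e.left_inv hz.1] at hr
  have x1 : R 1 (-1) = a ◃ R (-1) (-1) := hxside (-1) (by simp)
  have y1 : R (-1) 1 = C.col p ◃ R (-1) (-1) := by
    rw [hyside (-1) (by simp), hover _ (hb _ _ (by simpa using hd') h00) rfl]
  have y2 : R 1 1 = C.col p ◃ (a ◃ R (-1) (-1)) := by
    rw [hyside 1 (by simp), hover _ (hb _ _ (by simpa using hd) h00) rfl, x1]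
  refine ⟨hz.1, hz2.1.1, he.mem_curve_iff z hz.1, hov, hdn, hu, fun a1 a2 => ⟨?_, ?_⟩,
    fun a1 a2 => ⟨?_, ?_⟩, fun a1 a2 => ⟨?_, ?_⟩, fun a1 a2 => ⟨?_, ?_⟩⟩
  · rw [hi a1.ne a2.ne, if_neg a1.not_gt, if_neg a2.not_gt]; ring
  · exact hr _ _ (by simp) (by simp) ⟨hz.2, by simpa, by simpa⟩
  · rw [hi a1.ne' a2.ne, if_pos a1, if_neg a2.not_gt]; ring
  · rw [← x1]; exact hr _ _ (by simp) (by simp) ⟨hz.2, by simpa, by simpa⟩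
  · rw [hi a1.ne a2.ne', if_neg a1.not_gt, if_pos a2]; ring
  · rw [← y1]; exact hr _ _ (by simp) (by simp) ⟨hz.2, by simpa, by simpa⟩
  · rw [hi a1.ne' a2.ne', if_pos a1, if_pos a2]; ring
  · rw [← y2]; exact hr _ _ (by simp) (by simp) ⟨hz.2, by simpa, by simpa⟩

end ShadowColoring

/-- Functions with the local form of a shadow coloring define a shadow coloring. -/
theorem exists_shadowColoring {reg col : Square → X}
    (h0 : ∀ p ∉ D.curve, ∀ᶠ z in 𝓝 p, reg z = reg p)
    (h1 : ∀ p ∈ D.curve, p ∉ D.crossings → ∃ k r, StrandForm D reg col p k r)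
    (h2 : ∀ p ∈ D.crossings, ∃ e m r a, D.IsCrossingChart p e ∧ CrossForm D reg col p e m r a) :
    ∃ C : ShadowColoring X D,
      (∀ p ∉ D.curve, C.reg p = reg p) ∧ ∀ p ∈ D.curve, C.col p = col p := by
  refine ⟨⟨fun p => reg p.1, fun p => col p.1, ?_, ?_, ?_, ?_, ?_⟩, fun p hp => ?_, fun p hp => ?_⟩
  · rw [IsLocallyConstant.iff_eventually_eq]
    intro p
    exact continuous_subtype_val.continuousAt.eventually (h0 p.1 p.2)
  · intro p hp
    obtain ⟨k, r, h⟩ := h1 p.1 p.2 hp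
    filter_upwards [continuous_subtype_val.continuousAt.eventually h] with q hq
    exact hq.2.1 q.2
  · intro p hp
    obtain ⟨e, m, r, a, he, h⟩ := h2 p.1 hp
    filter_upwards [continuous_subtype_val.continuousAt.eventually h] with q hq hqo
    exact hq.2.2.2.1 ((he.mem_over_iff _ hq.1).mp hqo)
  · intro p hp e' he'
    obtain ⟨e, m, r, a, he, h⟩ := h2 p.1 hp
    have hsg := (LinkDiagram.AgreeNear.refl D p.1).sign_crossing_eq hp he he'
    refine ⟨_, h.and (hsg.and (e'.open_source.eventually_mem he'.mem_source)),
      fun q hq => hq.2.2, ?_⟩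
    rintro q q' ⟨hq, hqs, -⟩ ⟨hq', hqs', -⟩ a1 a2 a3 a4
    rw [a1, sign_zero, sign_eq_zero_iff, sign_neg a2, sign_eq_neg_one_iff] at hqs
    rw [a3, sign_zero, sign_eq_zero_iff, sign_pos a4, sign_eq_one_iff] at hqs'
    rw [hq.2.2.2.2.1 hqs.1 hqs.2, hq'.2.2.2.2.2.1 hqs'.1 hqs'.2]
  · intro p hp
    obtain ⟨k, r, h⟩ := h1 p.1 p.2 hp
    refine ⟨_, h, fun q q' hq hq' hi => ?_⟩
    have a := hq.2.2 q.2
    have b := hq'.2.2 q'.2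
    rcases a with a | a <;> rcases b with b | b <;> first | omega | rw [b.2, a.2]
  · rw [ShadowColoring.reg, dif_pos hp]
  · rw [ShadowColoring.col, dif_pos hp]

end LocalForms

/-! ### Existence of the map defined by a shadow coloring -/

/-- The distance to a set is local at the points of the set. -/
theorem eventually_infDist_eq {α : Type*} [PseudoMetricSpace α] {S T : Set α} {q : α} (hq : q ∈ S)
    (h : ∀ᶠ z in 𝓝 q, z ∈ S ↔ z ∈ T) :
    ∀ᶠ z in 𝓝 q, Metric.infDist z S = Metric.infDist z T := by
  have key : ∀ {S T : Set α}, q ∈ S → ∀ ρ > 0, (∀ z ∈ Metric.ball q ρ, z ∈ S ↔ z ∈ T) →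
      ∀ z ∈ Metric.ball q (ρ / 3), Metric.infDist z T ≤ Metric.infDist z S := by
    intro S T hq ρ hρ h z hz
    refine le_of_forall_gt fun r hr => ?_
    have h1 : Metric.infDist z S < min r (ρ / 3) :=
      lt_min hr ((Metric.infDist_le_dist_of_mem hq).trans_lt hz)
    obtain ⟨y, hy, hyz⟩ := (Metric.infDist_lt_iff ⟨q, hq⟩).mp h1
    have hyT : y ∈ T := by
      refine (h y ?_).mp hy
      rw [Metric.mem_ball] at hz ⊢
      have := dist_triangle y z q
      have := (hyz.trans_le (min_le_right _ _))
      rw [dist_comm] at this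
      linarith
    exact (Metric.infDist_le_dist_of_mem hyT).trans_lt (hyz.trans_le (min_le_left _ _))
  obtain ⟨ρ, hρ, h1⟩ := Metric.eventually_nhds_iff_ball.mp h
  filter_upwards [Metric.ball_mem_nhds q (show 0 < ρ / 3 by linarith)] with z hz
  exact le_antisymm (key ((h1 q (Metric.mem_ball_self hρ)).mp hq) ρ hρ
    (fun z hz => (h1 z hz).symm) z hz) (key hq ρ hρ h1 z hz)

theorem isPreconnected_boundary : IsPreconnected (Cube.boundary (Fin 2)) := by
  have h0 : IsPreconnected (range fun t : I => (![0, t] : Square)) :=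
    isPreconnected_range (by fun_prop)
  have h1 : IsPreconnected (range fun t : I => (![1, t] : Square)) :=
    isPreconnected_range (by fun_prop)
  have h2 : IsPreconnected (range fun t : I => (![t, 0] : Square)) :=
    isPreconnected_range (by fun_prop)
  have h3 : IsPreconnected (range fun t : I => (![t, 1] : Square)) :=
    isPreconnected_range (by fun_prop)
  have h := IsPreconnected.union ![0, 1] (Or.inl (Or.inl (mem_range_self 1))) (mem_range_self 0)
    (IsPreconnected.union ![1, 0] (Or.inr (mem_range_self 1)) (mem_range_self 0)
      (IsPreconnected.union ![0, 0] (mem_range_self 0) (mem_range_self 0) h0 h2) h1) h3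
  convert h using 1
  ext p
  have hp : ∀ a b : I, (![a, b] : Square) = p ↔ a = p 0 ∧ b = p 1 := by
    intro a b
    rw [funext_iff, Fin.forall_fin_two]; rfl
  simp only [Cube.boundary, mem_ofPred_eq, Fin.exists_fin_two, mem_union, mem_range, hp]
  constructor
  · rintro ((h | h) | (h | h)) <;> simp [h]
  · rintro (((⟨_, h, _⟩ | ⟨_, _, h⟩) | ⟨_, h, _⟩) | ⟨_, _, h⟩) <;> simp [← h]

section Rounding

theorem rounds_edge (r a : X) (t : I) :
    (extendedRackCubes X).Rounds (rackEdge r a t) (n := 1) ![r, a] ![t] :=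
  ⟨_, rfl, .refl _⟩

theorem rounds_square (r a b : X) (t u : I) :
    (extendedRackCubes X).Rounds (rackSquare r a b t u) (n := 2) ![r, a, b] ![t, u] :=
  ⟨_, rfl, .refl _⟩

theorem rounds_vertex (r : X) : (extendedRackCubes X).Rounds (rackVertex r) (n := 0) ![r] ![] :=
  ⟨_, rfl, .refl _⟩

namespace PreCubicSet

/-- A coordinate which is not `1/2` may be rounded. -/
theorem RoundsTo.step {K : PreCubicSet.{u}} {n : ℕ} {x : K.cells (n + 1)} {t : Fin (n + 1) → I}
    (i : Fin (n + 1)) {s : Bool} (hs : if s then 1 / 2 < (t i : ℝ) else (t i : ℝ) < 1 / 2)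
    {y : K.cells n} {t' : Fin n → I} (hy : K.face i s x = y) (ht : i.removeNth t = t')
    {z : K.Cubes} (h : K.RoundsTo ⟨n, y, t'⟩ z) : K.RoundsTo ⟨n + 1, x, t⟩ z := by
  subst hy ht
  cases s
  · exact .down x t i z (by simpa using hs) h
  · exact .up x t i z (by simpa using hs) h

end PreCubicSet

open PreCubicSet in
theorem roundsTo_edge_vertex (r a : X) {t : I} {s : Bool}
    (hs : if s then 1 / 2 < (t : ℝ) else (t : ℝ) < 1 / 2) :
    (extendedRackCubes X).RoundsTo ⟨1, (![r, a] : Fin 2 → X), ![t]⟩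
      ⟨0, (![actIf s a r] : Fin 1 → X), ![]⟩ := by
  refine RoundsTo.step (K := extendedRackCubes X) (n := 0) 0 (s := s) (by simpa using hs) ?_
    (Subsingleton.elim _ _) (.refl _)
  funext k; fin_cases k; cases s <;> rfl

open PreCubicSet in
theorem roundsTo_square_left (r a b : X) {t u : I} {s : Bool}
    (hs : if s then 1 / 2 < (t : ℝ) else (t : ℝ) < 1 / 2) {z : (extendedRackCubes X).Cubes}
    (h : (extendedRackCubes X).RoundsTo ⟨1, (![actIf s a r, b] : Fin 2 → X), ![u]⟩ z) :
    (extendedRackCubes X).RoundsTo ⟨2, (![r, a, b] : Fin 3 → X), ![t, u]⟩ z := by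
  refine RoundsTo.step (K := extendedRackCubes X) (n := 1) 0 (s := s) (by simpa using hs) ?_ ?_ h
  · funext k; fin_cases k <;> cases s <;> rfl
  · funext k; fin_cases k; rfl

open PreCubicSet in
theorem roundsTo_square_right (r a b : X) {t u : I} {s : Bool}
    (hs : if s then 1 / 2 < (u : ℝ) else (u : ℝ) < 1 / 2) {z : (extendedRackCubes X).Cubes}
    (h : (extendedRackCubes X).RoundsTo ⟨1, (![actIf s b r, actIf s b a] : Fin 2 → X), ![t]⟩ z) :
    (extendedRackCubes X).RoundsTo ⟨2, (![r, a, b] : Fin 3 → X), ![t, u]⟩ z := by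
  refine RoundsTo.step (K := extendedRackCubes X) (n := 1) 1 (s := s) (by simpa using hs) ?_ ?_ h
  · funext k; fin_cases k <;> cases s <;> rfl
  · funext k; fin_cases k; rfl

theorem rounds_edge_vertex (r a : X) {t : I} {s : Bool}
    (hs : if s then 1 / 2 < (t : ℝ) else (t : ℝ) < 1 / 2) :
    (extendedRackCubes X).Rounds (rackEdge r a t) (n := 0) ![actIf s a r] ![] :=
  ⟨_, rfl, roundsTo_edge_vertex r a hs⟩

theorem rounds_square_left (r a b : X) {t u : I} {s : Bool}
    (hs : if s then 1 / 2 < (t : ℝ) else (t : ℝ) < 1 / 2) :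
    (extendedRackCubes X).Rounds (rackSquare r a b t u) (n := 1) ![actIf s a r, b] ![u] :=
  ⟨_, rfl, roundsTo_square_left r a b hs (.refl _)⟩

theorem rounds_square_right (r a b : X) {t u : I} {s : Bool}
    (hs : if s then 1 / 2 < (u : ℝ) else (u : ℝ) < 1 / 2) :
    (extendedRackCubes X).Rounds (rackSquare r a b t u) (n := 1)
      ![actIf s b r, actIf s b a] ![t] :=
  ⟨_, rfl, roundsTo_square_right r a b hs (.refl _)⟩

theorem rounds_square_vertex (r a b : X) {t u : I} {s s' : Bool}
    (hs : if s then 1 / 2 < (t : ℝ) else (t : ℝ) < 1 / 2)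
    (hs' : if s' then 1 / 2 < (u : ℝ) else (u : ℝ) < 1 / 2) :
    (extendedRackCubes X).Rounds (rackSquare r a b t u) (n := 0) ![actIf s' b (actIf s a r)] ![] :=
  ⟨_, rfl, roundsTo_square_left r a b hs (roundsTo_edge_vertex _ _ hs')⟩

end Rounding

theorem sharp_side {ε t : ℝ} (hε : 0 < ε) (ht : t ≠ 0) :
    if decide (0 < t) then 1 / 2 < (sharp ε t : ℝ) else (sharp ε t : ℝ) < 1 / 2 := by
  rcases ht.lt_or_gt with h | h
  · simpa [h.not_gt] using (sharp_lt_half_iff hε).mpr h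
  · simpa [h] using (half_lt_sharp_iff hε).mpr h

namespace LinkDiagram

variable (D)

open scoped Classical in
/-- The index on the right side of the strand through `p`. -/
noncomputable def rightIndex (p : Square) : ℤ := if h : ∃ k, D.IsRightIndex p k then h.choose else 0

variable {D} in
theorem isRightIndex (hp : p ∈ D.curve) (hp' : p ∉ D.crossings) :
    D.IsRightIndex p (D.rightIndex p) := by
  rw [rightIndex, dif_pos (D.exists_rightIndex hp hp')]
  exact (D.exists_rightIndex hp hp').choose_spec

open scoped Classical in
/-- The side of the strand through `p` on which a point near `p` lies: `-1` on the right, `1` on the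
left. -/
noncomputable def strandSign (p z : Square) : SignType :=
  if z ∈ D.curve then 0 else if D.index z = D.rightIndex p then -1 else 1

/-- The distance to the curves, with the negative sign on the right side of the strand
through `p`. -/
noncomputable def strandDist (p z : Square) : ℝ := D.strandSign p z * Metric.infDist z D.curve

variable {D}

theorem sign_chart_eq
    (h : D.IsRegularChart p e) (hq : q ∈ e.source) :
    sign (e q).1 = D.strandSign p q := by
  obtain ⟨k, hk, hk'⟩ := exists_rightIndex_of_chart h
  have hr : D.rightIndex p = k := by
    have : ∃ k, D.IsRightIndex p k := ⟨k, hk⟩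
    rw [rightIndex, dif_pos this]
    exact this.choose_spec.eq hk.1
  obtain ⟨h1, h2, h3⟩ := hk' q hq
  rw [strandSign, h1, hr]
  rcases lt_trichotomy (e q).1 0 with a | a | a
  · rw [sign_neg a, if_neg a.ne, if_pos (h2 a)]
  · rw [a, sign_zero, if_pos rfl]
  · rw [sign_pos a, if_neg a.ne', if_neg (by rw [h3 a]; omega)]

theorem abs_sign_mul_le (s : SignType) {x : ℝ} (hx : 0 ≤ x) : |(s : ℝ) * x| ≤ x := by
  rw [abs_mul, abs_of_nonneg hx]
  refine mul_le_of_le_one_left hx ?_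
  rcases s with _ | _ | _ <;> simp

theorem continuous_of_abs_infDist {Q : Type*} [PseudoMetricSpace Q] {S : Set Q} {g : Q → ℝ} {q : Q}
    (hg : ∀ᶠ z in 𝓝 q, |g z| ≤ Metric.infDist z S) (hq : q ∈ S) : ContinuousAt g q := by
  have h0 : g q = 0 := by
    have := hg.self_of_nhds
    rw [Metric.infDist_zero_of_mem hq] at this
    exact abs_nonpos_iff.mp this
  rw [ContinuousAt, h0]
  refine squeeze_zero_norm' (a := fun z => Metric.infDist z S) hg ?_
  have := (Metric.continuous_infDist_pt S).tendsto q
  rwa [Metric.infDist_zero_of_mem hq] at this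

theorem continuous_strandDist (p : Square) : Continuous (D.strandDist p) := by
  refine continuous_iff_continuousAt.mpr fun q => ?_
  by_cases hq : q ∈ D.curve
  · exact continuous_of_abs_infDist (.of_forall fun z => abs_sign_mul_le _ Metric.infDist_nonneg) hq
  · have : D.strandDist p =ᶠ[𝓝 q] fun z => D.strandSign p q * Metric.infDist z D.curve := by
      filter_upwards [D.index_locally_constant q hq, eventually_notMem_curve hq] with z hz hzc
      rw [strandDist, strandSign, strandSign, if_neg hzc, if_neg hq, hz]
    exact (continuous_const.mul (Metric.continuous_infDist_pt _)).continuousAt.congr this.symm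

theorem infDist_curve_pos (hp : p ∈ D.curve) (hz : z ∉ D.curve) : 0 < Metric.infDist z D.curve :=
  (D.isClosed_curve.notMem_iff_infDist_pos ⟨p, hp⟩).mp hz

theorem sign_strandDist (hp : p ∈ D.curve) (z : Square) :
    sign (D.strandDist p z) = D.strandSign p z := by
  by_cases hz : z ∈ D.curve
  · rw [strandDist, strandSign, if_pos hz]; simp
  · have := infDist_curve_pos hp hz
    rw [strandDist, strandSign, if_neg hz]
    split_ifs
    · rw [sign_eq_neg_one_iff]; simpa
    · rw [sign_eq_one_iff]; simpa

end LinkDiagram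

theorem DiagramData.IsCrossingChart.snd_ne_zero (he : D.IsCrossingChart p e) (hz : z ∈ e.source)
    (hne : z ≠ p) (h1 : (e z).1 = 0) : (e z).2 ≠ 0 := fun h2 =>
  hne (e.injOn hz he.mem_source ((Prod.ext h1 h2).trans he.map_center.symm))

section ChartDist

variable {g : ℝ × ℝ → ℝ}

/-- The zero set of the coordinate `g` of a chart. -/
def chartZero (e : PlaneChart) (g : ℝ × ℝ → ℝ) : Set Square := {w | w ∈ e.source ∧ g (e w) = 0}

/-- The distance to the zero set of a coordinate of a chart, with the sign of the coordinate. -/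
noncomputable def chartDist (e : PlaneChart) (g : ℝ × ℝ → ℝ)
    (z : Square) : ℝ :=
  sign (g (e z)) * Metric.infDist z (chartZero e g)

theorem sign_chartDist (hg : Continuous g) (hp : p ∈ chartZero e g)
    (hz : z ∈ e.source) : sign (chartDist e g z) = sign (g (e z)) := by
  by_cases h0 : g (e z) = 0
  · rw [chartDist, h0]; simp
  · have hpos : 0 < Metric.infDist z (chartZero e g) := by
      refine lt_of_le_of_ne Metric.infDist_nonneg fun h => ?_
      have hcl := (Metric.mem_closure_iff_infDist_zero ⟨p, hp⟩).mpr h.symm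
      have hc : ContinuousAt (fun w => g (e w)) z := hg.continuousAt.comp (e.continuousAt hz)
      obtain ⟨w, hw, hw'⟩ := ((mem_closure_iff_frequently.mp hcl).and_eventually
        (hc.eventually_ne h0)).exists
      exact hw' hw.2
    rw [chartDist]
    rcases lt_or_gt_of_ne h0 with h | h
    · rw [sign_neg h, sign_eq_neg_one_iff]; simpa
    · rw [sign_pos h, sign_eq_one_iff]; simpa

theorem continuousAt_chartDist (hg : Continuous g) (hz : z ∈ e.source) :
    ContinuousAt (chartDist e g) z := by
  by_cases h0 : g (e z) = 0
  · exact LinkDiagram.continuous_of_abs_infDist (.of_forall fun z =>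
      LinkDiagram.abs_sign_mul_le _ Metric.infDist_nonneg) (S := chartZero e g) ⟨hz, h0⟩
  · have hc : ContinuousAt (fun w => g (e w)) z := hg.continuousAt.comp (e.continuousAt hz)
    have : chartDist e g =ᶠ[𝓝 z] fun w =>
        ((sign (g (e z)) : SignType) : ℝ) * Metric.infDist w (chartZero e g) := by
      rcases lt_or_gt_of_ne h0 with h | h
      · filter_upwards [hc.eventually_lt_const h] with w hw
        rw [chartDist, sign_neg hw, sign_neg h]
      · filter_upwards [hc.eventually_const_lt h] with w hw
        rw [chartDist, sign_pos hw, sign_pos h]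
    refine ContinuousAt.congr ?_ this.symm
    exact (continuous_const.mul (Metric.continuous_infDist_pt _)).continuousAt

end ChartDist

section Existence

variable (C)

open scoped Classical in
/-- The color on the right side of the strand through `p`. -/
noncomputable def ShadowColoring.rightColor (p : Square) : X :=
  if h : ∃ r, StrandForm D C.reg C.col p (D.rightIndex p) r then h.choose else C.outer

theorem ShadowColoring.strandForm (hp : p ∈ D.curve) (hp' : p ∉ D.crossings) :
    StrandForm D C.reg C.col p (D.rightIndex p) (C.rightColor p) := by
  have := C.exists_strandForm hp hp' (D.isRightIndex hp hp')
  rw [ShadowColoring.rightColor, dif_pos this]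
  exact this.choose_spec

/-- The index and the color on the right side of a strand are determined by the values nearby. -/
theorem ShadowColoring.right_eq (hp : p ∈ D.curve) (hp' : p ∉ D.crossings) {k : ℤ} {r r' : X}
    (h : ∀ᶠ z in 𝓝 p, z ∉ D.curve →
      (D.index z = k ∧ C.reg z = r) ∨ (D.index z = k + 1 ∧ C.reg z = r')) :
    D.rightIndex p = k ∧ C.rightColor p = r ∧ C.col p ◃ C.rightColor p = r' := by
  have h1 := D.isRightIndex hp hp'
  have hk : D.rightIndex p = k := h1.eq (h.mono fun z hz hc => (hz hc).imp And.left And.left)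
  refine ⟨hk, ?_⟩
  have hs := C.strandForm hp hp'
  rw [hk] at h1 hs
  constructor
  · obtain ⟨z, ⟨hz, hz1⟩, hz2, hz3⟩ := (h1.2.1.and_eventually (h.and hs)).exists
    have a := hz2 hz
    have b := hz3.2.2 hz
    rcases a with a | a
    · rcases b with b | b
      · rw [← b.2, a.2]
      · omega
    · omega
  · obtain ⟨z, ⟨hz, hz1⟩, hz2, hz3⟩ := (h1.2.2.and_eventually (h.and hs)).exists
    have a := hz2 hz
    have b := hz3.2.2 hz
    rcases a with a | a
    · omega
    · rcases b with b | b
      · omega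
      · rw [← b.2, a.2]

/-- If the strand through `p` is the zero set of the coordinate `x`, then it has the right side
`x < 0`. -/
theorem ShadowColoring.right_eq_of_coord (hp : p ∈ D.curve) (hp' : p ∉ D.crossings) {k : ℤ}
    {r r' : X} {x : Square → ℝ} (h : ∀ᶠ z in 𝓝 p, (z ∈ D.curve ↔ x z = 0) ∧
      (x z < 0 → D.index z = k ∧ C.reg z = r) ∧ (0 < x z → D.index z = k + 1 ∧ C.reg z = r')) :
    D.rightIndex p = k ∧ C.rightColor p = r ∧ ∀ᶠ z in 𝓝 p, sign (x z) = D.strandSign p z := by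
  obtain ⟨h1, h2, -⟩ := C.right_eq hp hp' (h.mono fun z hz hc =>
    (Ne.lt_or_gt fun h0 => hc (hz.1.mpr h0)).imp hz.2.1 hz.2.2)
  refine ⟨h1, h2, h.mono fun z hz => ?_⟩
  rw [strandSign, hz.1, h1]
  rcases lt_trichotomy (x z) 0 with h0 | h0 | h0
  · rw [sign_neg h0, if_neg h0.ne, if_pos (hz.2.1 h0).1]
  · rw [h0, sign_zero, if_pos rfl]
  · rw [sign_pos h0, if_neg h0.ne', if_neg (by rw [(hz.2.2 h0).1]; omega)]

theorem CrossBody.ne_zero {reg col : Square → X} {m : ℤ} {r a : X}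
    (h : CrossBody D reg col p e m r a z) (hz : z ∉ D.curve) : (e z).1 ≠ 0 ∧ (e z).2 ≠ 0 :=
  not_or.mp (h.2.2.1.not.mp hz)

theorem CrossBody.eq_of_notMem {reg col : Square → X} {m : ℤ} {r a : X}
    (h : CrossBody D reg col p e m r a z) (hz : z ∉ D.curve) :
    D.index z =
      m + (if decide (0 < (e z).1) then 1 else 0) + (if decide (0 < (e z).2) then 1 else 0) ∧
    reg z = actIf (decide (0 < (e z).2)) (col p) (actIf (decide (0 < (e z).1)) a r) := by
  obtain ⟨hx, hy⟩ := h.ne_zero hz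
  obtain ⟨-, -, -, -, -, -, h1, h2, h3, h4⟩ := h
  rcases hx.lt_or_gt with hx | hx <;> rcases hy.lt_or_gt with hy | hy
  · simp [hx.not_gt, hy.not_gt, h1 hx hy]
  · simp [hx.not_gt, hy, h3 hx hy]
  · simp [hx, hy.not_gt, h2 hx hy]
  · simp [hx, hy, h4 hx hy]; ring

theorem eventually_decide_pos_eq {g : Square → ℝ} (hg : ContinuousAt g z) (h : g z ≠ 0) :
    ∀ᶠ w in 𝓝 z, decide (0 < g w) = decide (0 < g z) := by
  rcases h.lt_or_gt with h | h
  · filter_upwards [hg.eventually_lt continuousAt_const h] with w hw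
    rw [decide_eq_decide]
    exact ⟨fun h' => absurd h' hw.not_gt, fun h' => absurd h' h.not_gt⟩
  · filter_upwards [continuousAt_const.eventually_lt hg h] with w hw
    simp [hw, h]

/-- Near a crossing, the strands have the colors and indices given by the chart. -/
theorem CrossForm.right_eq {m : ℤ} {r a : X}
    (h : ∀ᶠ z in 𝓝 p, CrossBody D C.reg C.col q e m r a z) (hp' : p ∉ D.crossings) :
    ((e p).1 = 0 → (e p).2 ≠ 0 → C.rightColor p = actIf (decide (0 < (e p).2)) (C.col q) r ∧
      C.col p = actIf (decide (0 < (e p).2)) (C.col q) a ∧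
      (∀ᶠ z in 𝓝 p, sign (e z).1 = D.strandSign p z) ∧
      D.rightIndex p = m + if decide (0 < (e p).2) then 1 else 0) ∧
    ((e p).2 = 0 → (e p).1 ≠ 0 →
      C.rightColor p = actIf (decide (0 < (e p).1)) a r ∧ C.col p = C.col q ∧
      (∀ᶠ z in 𝓝 p, sign (e z).2 = D.strandSign p z) ∧
      D.rightIndex p = m + if decide (0 < (e p).1) then 1 else 0) := by
  have h0 := h.self_of_nhds
  have hc := e.continuousAt h0.1
  refine ⟨fun h1 h2 => ?_, fun h2 h1 => ?_⟩
  · obtain ⟨k1, k2, k3⟩ := C.right_eq_of_coord (h0.2.2.1.mpr (.inl h1)) hp'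
      (x := fun z => (e z).1) (k := m + if decide (0 < (e p).2) then 1 else 0)
      (r := actIf (decide (0 < (e p).2)) (C.col q) r)
      (r' := actIf (decide (0 < (e p).2)) (C.col q) (a ◃ r)) (by
        filter_upwards [h, eventually_decide_pos_eq hc.snd h2, hc.snd.eventually_ne h2]
          with z z1 z2 z3
        refine ⟨by rw [z1.2.2.1]; simp [z3], fun hx => ?_, fun hx => ?_⟩ <;>
          obtain ⟨i, j⟩ := z1.eq_of_notMem (by simp [z1.2.2.1, hx.ne, hx.ne', z3]) <;> rw [i, j, z2]
        · simp [hx.not_gt]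
        · simp [hx]; ring)
    refine ⟨k2, ?_, k3, k1⟩
    rcases h2.lt_or_gt with hs | hs
    · simp [h0.2.2.2.2.1 h1 hs, hs.not_gt]
    · simp [h0.2.2.2.2.2.1 h1 hs, hs]
  · obtain ⟨k1, k2, k3⟩ := C.right_eq_of_coord (h0.2.2.1.mpr (.inr h2)) hp'
      (x := fun z => (e z).2) (k := m + if decide (0 < (e p).1) then 1 else 0)
      (r := actIf (decide (0 < (e p).1)) a r)
      (r' := C.col q ◃ actIf (decide (0 < (e p).1)) a r) (by
        filter_upwards [h, eventually_decide_pos_eq hc.fst h1, hc.fst.eventually_ne h1]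
          with z z1 z2 z3
        refine ⟨by rw [z1.2.2.1]; simp [z3], fun hx => ?_, fun hx => ?_⟩ <;>
          obtain ⟨i, j⟩ := z1.eq_of_notMem (by simp [z1.2.2.1, hx.ne, hx.ne', z3]) <;> rw [i, j, z2]
        · simp [hx.not_gt]
        · simp [hx])
    exact ⟨k2, h0.2.2.2.1 h2, k3, k1⟩

/-- A strand near a crossing is part of the under-strand or of the over-strand. -/
theorem CrossForm.strand_cases (he : D.IsCrossingChart q e) (hq : q ∈ D.crossings) {m : ℤ} {r a : X}
    (h : ∀ᶠ z in 𝓝 p, CrossBody D C.reg C.col q e m r a z) (hc : p ∈ D.curve)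
    (hp' : p ∉ D.crossings) :
    ((e p).2 ≠ 0 ∧ C.rightColor p = actIf (decide (0 < (e p).2)) (C.col q) r ∧
      C.col p = actIf (decide (0 < (e p).2)) (C.col q) a ∧
      (∀ᶠ z in 𝓝 p, sign (e z).1 = D.strandSign p z) ∧
      D.rightIndex p = m + if decide (0 < (e p).2) then 1 else 0) ∨
    ((e p).1 ≠ 0 ∧ C.rightColor p = actIf (decide (0 < (e p).1)) a r ∧ C.col p = C.col q ∧
      (∀ᶠ z in 𝓝 p, sign (e z).2 = D.strandSign p z) ∧
      D.rightIndex p = m + if decide (0 < (e p).1) then 1 else 0) := by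
  obtain ⟨h1, h2⟩ := CrossForm.right_eq C h hp'
  have h0 := h.self_of_nhds
  have hne := he.snd_ne_zero h0.1 (ne_of_mem_of_not_mem hq hp').symm
  rcases h0.2.2.1.mp hc with h3 | h3
  · exact .inl ⟨hne h3, h1 h3 (hne h3)⟩
  · exact .inr ⟨fun h4 => hne h4 h3, h2 h3 fun h4 => hne h4 h3⟩

end Existence

section Existence

theorem StrandBody.reg_eq {reg col : Square → X} {r : X}
    (h : StrandBody D reg col p (D.rightIndex p) r z) (hz : z ∉ D.curve) :
    reg z = actIf (decide (D.strandSign p z = 1)) (col p) r := by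
  rcases h.2.2 hz with ⟨h1, h2⟩ | ⟨h1, h2⟩
  · rw [strandSign, if_neg hz, if_pos h1, h2]; rfl
  · rw [strandSign, if_neg hz, if_neg (by omega), h2]; rfl

theorem StrandBody.of_eventually
    (h : ∀ᶠ z in 𝓝 q, StrandBody D C.reg C.col p (D.rightIndex p) (C.rightColor p) z)
    (hq : q ∈ D.curve) : D.rightIndex q = D.rightIndex p ∧ C.rightColor q = C.rightColor p ∧
      C.col q = C.col p := by
  have h0 := h.self_of_nhds
  have := C.right_eq hq h0.1 (h.mono fun z hz => hz.2.2)
  exact ⟨this.1, this.2.1, h0.2.1 hq⟩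

theorem strandSign_congr (h : D.rightIndex p = D.rightIndex q) :
    D.strandSign p = D.strandSign q := by
  funext z; rw [strandSign, strandSign, h]

theorem decide_pos_eq_of_sign {a b : ℝ} (h : sign a = sign b) :
    decide (0 < a) = decide (0 < b) := by
  rw [decide_eq_decide, ← sign_eq_one_iff, h, sign_eq_one_iff]

theorem ne_zero_of_sign {a b : ℝ} (h : sign a = sign b) (hb : b ≠ 0) : a ≠ 0 := by
  rw [← sign_ne_zero] at hb ⊢
  rwa [h]

theorem eventually_chartDist_eq {m : ℤ} {r a : X} {g : ℝ × ℝ → ℝ} (hq : q ∈ D.curve)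
    (h : ∀ᶠ z in 𝓝 q, CrossBody D C.reg C.col p e m r a z)
    (hs : ∀ᶠ z in 𝓝 q, sign (g (e z)) = D.strandSign q z) :
    ∀ᶠ z in 𝓝 q, chartDist e g z = D.strandDist q z := by
  have h1 : ∀ᶠ z in 𝓝 q, z ∈ D.curve ↔ z ∈ chartZero e g := by
    filter_upwards [h, hs] with z hz hz'
    have : g (e z) = 0 ↔ z ∈ D.curve := by
      rw [← sign_eq_zero_iff, hz', strandSign]
      split_ifs <;> simp_all
    rw [← this]
    exact ⟨fun h => ⟨hz.1, h⟩, fun h => h.2⟩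
  filter_upwards [eventually_infDist_eq hq h1, hs] with z hz hz'
  rw [chartDist, strandDist, hz, hz']

/-- Every shadow coloring defines a map to the extended rack space: the cell
coordinates are the signed distances to the strands, sharpened so much that only the nearest
strands matter. -/
theorem exists_isShadowMap (C : ShadowColoring X D) : ∃ ψ : RackLoop C.outer, IsShadowMap C ψ := by
  classical
  have hcr : ∀ p (hp : p ∈ D.crossings), ∃ e m r a, D.IsCrossingChart p e ∧
      CrossForm D C.reg C.col p e m r a := by
    intro p hp
    obtain ⟨e, he⟩ := D.crossing_chart p hp
    obtain ⟨m, r, a, h⟩ := C.exists_crossForm hp he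
    exact ⟨e, m, r, a, he, h⟩
  choose e m r a he hform using hcr
  have hmem : ∀ p (hp : p ∈ D.crossings) (g : ℝ × ℝ → ℝ), g 0 = 0 → p ∈ chartZero (e p hp) g :=
    fun p hp g hg => ⟨(he p hp).mem_source, by rw [(he p hp).map_center, hg]⟩
  -- the local maps: a square at a crossing, an edge at a strand, a vertex in a region
  let F : Square → ℝ → Square → ExtendedRackSpace X := fun p ε z =>
    if hp : p ∈ D.crossings then rackSquare (r p hp) (a p hp) (C.col p)
      (sharp ε (chartDist (e p hp) Prod.fst z)) (sharp ε (chartDist (e p hp) Prod.snd z))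
    else if p ∈ D.curve then rackEdge (C.rightColor p) (C.col p) (sharp ε (D.strandDist p z))
    else rackVertex (C.reg p)
  -- the points near which the diagram is determined by the local form at `p`
  let U : Square → Set Square := fun p =>
    {q | if hp : p ∈ D.crossings then q ∉ Cube.boundary (Fin 2) ∧
      ∀ᶠ z in 𝓝 q, CrossBody D C.reg C.col p (e p hp) (m p hp) (r p hp) (a p hp) z
    else if p ∈ D.curve then q ∉ Cube.boundary (Fin 2) ∧
      ∀ᶠ z in 𝓝 q, StrandBody D C.reg C.col p (D.rightIndex p) (C.rightColor p) z
    else q ∉ D.curve ∧ C.reg q = C.reg p}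
  have F1 : ∀ p (hp : p ∈ D.crossings) ε z, F p ε z = rackSquare (r p hp) (a p hp) (C.col p)
      (sharp ε (chartDist (e p hp) Prod.fst z)) (sharp ε (chartDist (e p hp) Prod.snd z)) :=
    fun p hp ε z => dif_pos hp
  have F2 : ∀ p, p ∉ D.crossings → p ∈ D.curve → ∀ ε z,
      F p ε z = rackEdge (C.rightColor p) (C.col p) (sharp ε (D.strandDist p z)) :=
    fun p hp hp' ε z => (dif_neg hp).trans (if_pos hp')
  have F3 : ∀ p, p ∉ D.curve → ∀ ε z, F p ε z = rackVertex (C.reg p) :=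
    fun p hp ε z => (dif_neg (fun h => hp (D.crossings_subset h))).trans (if_neg hp)
  have U1 : ∀ p (hp : p ∈ D.crossings), ∀ q ∈ U p, q ∉ Cube.boundary (Fin 2) ∧
      ∀ᶠ z in 𝓝 q, CrossBody D C.reg C.col p (e p hp) (m p hp) (r p hp) (a p hp) z :=
    fun p hp q hq => by simpa only [U, mem_ofPred_eq, dif_pos hp] using hq
  have U2 : ∀ p, p ∉ D.crossings → p ∈ D.curve → ∀ q ∈ U p, q ∉ Cube.boundary (Fin 2) ∧
      ∀ᶠ z in 𝓝 q, StrandBody D C.reg C.col p (D.rightIndex p) (C.rightColor p) z :=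
    fun p hp hp' q hq => by simpa only [U, mem_ofPred_eq, dif_neg hp, if_pos hp'] using hq
  have U3 : ∀ p, p ∉ D.curve → ∀ q ∈ U p, q ∉ D.curve ∧ C.reg q = C.reg p := fun p hp q hq => by
      have hp' : p ∉ D.crossings := fun h => hp (D.crossings_subset h)
      simpa only [U, mem_ofPred_eq, dif_neg hp', if_neg hp] using hq
  have hU : ∀ p, U p ∈ 𝓝 p := by
    intro p
    by_cases hp : p ∈ D.crossings
    · filter_upwards [eventually_notMem_boundary (D.crossings_subset hp),
        (hform p hp).eventually_nhds] with q h1 h2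
      simpa only [U, mem_ofPred_eq, dif_pos hp] using ⟨h1, h2⟩
    · by_cases hp' : p ∈ D.curve
      · filter_upwards [eventually_notMem_boundary hp', (C.strandForm hp' hp).eventually_nhds]
          with q h1 h2
        simpa only [U, mem_ofPred_eq, dif_neg hp, if_pos hp'] using ⟨h1, h2⟩
      · filter_upwards [D.eventually_notMem_curve hp', C.eventually_reg_eq hp'] with q h1 h2
        simpa only [U, mem_ofPred_eq, dif_neg hp, if_neg hp'] using ⟨h1, h2⟩
  have hc : ∀ p ε, 0 < ε → ContinuousOn (F p ε) (U p) := by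
    intro p ε _
    by_cases hp : p ∈ D.crossings
    · rw [show F p ε = _ from funext (F1 p hp ε)]
      intro q hq
      have hqs := (U1 p hp q hq).2.self_of_nhds.1
      have h1 := continuousAt_chartDist continuous_fst hqs
      have h2 := continuousAt_chartDist continuous_snd hqs
      refine ContinuousAt.continuousWithinAt ?_
      refine (PreCubicSet.continuous_point _ _).continuousAt.comp
        (f := fun z => ![sharp ε (chartDist (e p hp) Prod.fst z),
          sharp ε (chartDist (e p hp) Prod.snd z)]) ?_
      rw [continuousAt_pi, Fin.forall_fin_two]
      exact ⟨(continuous_sharp ε).continuousAt.comp h1, (continuous_sharp ε).continuousAt.comp h2⟩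
    · by_cases hp' : p ∈ D.curve
      · rw [show F p ε = _ from funext (F2 p hp hp' ε)]
        refine Continuous.continuousOn ?_
        refine (PreCubicSet.continuous_point _ _).comp (continuous_pi fun i => ?_)
        fin_cases i
        exact (continuous_sharp ε).comp (D.continuous_strandDist p)
      · rw [show F p ε = _ from funext (F3 p hp' ε)]
        exact continuousOn_const
  have hεpos : ∀ᶠ ε in 𝓝[>] (0 : ℝ), 0 < ε := eventually_mem_nhdsWithin
  -- at a point where fewer strands meet, the remaining coordinates are sharpened to end points,
  -- which are the faces of the cell
  have hF : ∀ q, ∀ q' ∈ U q, ∀ᶠ p in nhdsPos q', F q p.1 p.2 = F q' p.1 p.2 := by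
    intro q q' hq'
    by_cases hq : q ∈ D.crossings
    · have hb := (U1 q hq q' hq').2
      have hb0 := hb.self_of_nhds
      by_cases hqq : q' ∈ D.crossings
      · rw [hb0.2.1 hqq]; exact .of_forall fun _ => rfl
      · have c1 := continuousAt_chartDist continuous_fst hb0.1
        have c2 := continuousAt_chartDist continuous_snd hb0.1
        have s1 := sign_chartDist continuous_fst (hmem q hq Prod.fst rfl) hb0.1
        have s2 := sign_chartDist continuous_snd (hmem q hq Prod.snd rfl) hb0.1
        by_cases hqc : q' ∈ D.curve
        · obtain ⟨h0, a1, a2, a3, -⟩ | ⟨h0, a1, a2, a3, -⟩ :=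
            CrossForm.strand_cases C (he q hq) hq hb hqc hqq
          · filter_upwards [eventually_sharp_eq c2 (ne_zero_of_sign s2 h0),
              (eventually_chartDist_eq (g := Prod.fst) hqc hb a3).prod_inr _] with p hp1 hp2
            rw [F1 q hq, F2 q' hqq hqc, hp1, hp2, rackSquare_right, a1, a2,
              decide_pos_eq_of_sign s2]
          · filter_upwards [eventually_sharp_eq c1 (ne_zero_of_sign s1 h0),
              (eventually_chartDist_eq (g := Prod.snd) hqc hb a3).prod_inr _] with p hp1 hp2
            rw [F1 q hq, F2 q' hqq hqc, hp1, hp2, rackSquare_left, a1, a2, decide_pos_eq_of_sign s1]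
        · have h0 := hb0.ne_zero hqc
          filter_upwards [eventually_sharp_eq c1 (ne_zero_of_sign s1 h0.1),
            eventually_sharp_eq c2 (ne_zero_of_sign s2 h0.2)] with p hp1 hp2
          rw [F1 q hq, F3 q' hqc, hp1, hp2, rackSquare_left, rackEdge_end, (hb0.eq_of_notMem hqc).2,
            decide_pos_eq_of_sign s1, decide_pos_eq_of_sign s2]
    · by_cases hqc : q ∈ D.curve
      · have hb := (U2 q hq hqc q' hq').2
        have hb0 := hb.self_of_nhds
        by_cases hqc' : q' ∈ D.curve
        · obtain ⟨a1, a2, a3⟩ := StrandBody.of_eventually hb hqc'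
          refine .of_forall fun p => ?_
          rw [F2 q hq hqc, F2 q' hb0.1 hqc', a2, a3, strandDist, strandDist, strandSign_congr a1]
        · have hs := D.sign_strandDist hqc q'
          have hne : D.strandDist q q' ≠ 0 := by
            rw [← sign_ne_zero, hs, strandSign, if_neg hqc']
            split_ifs <;> decide
          filter_upwards [eventually_sharp_eq (D.continuous_strandDist q).continuousAt hne]
            with p hp
          rw [F2 q hq hqc, F3 q' hqc', hp, rackEdge_end, hb0.reg_eq hqc', ← hs]
          simp only [sign_eq_one_iff]
      · obtain ⟨a1, a2⟩ := U3 q hqc q' hq'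
        refine .of_forall fun p => ?_
        rw [F3 q hqc, F3 q' a1, a2]
  -- the boundary of the square is in one region; then the conditions on regions, strands, crossings
  obtain ⟨ε, ⟨G, hG⟩, hε⟩ := ((eventually_exists_patch F U (fun _ ε => 0 < ε) hU
    (fun _ => hεpos) hc hF).and hεpos).exists
  refine ⟨⟨G, fun p hp => ?_⟩, ?_, ?_, ?_⟩
  · obtain ⟨q, hqU, -, hGq⟩ := hG p
    rw [hGq.self_of_nhds]
    by_cases hq : q ∈ D.crossings
    · exact absurd hp (U1 q hq p hqU).1
    · by_cases hqc : q ∈ D.curve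
      · exact absurd hp (U2 q hq hqc p hqU).1
      · rw [F3 q hqc, ← (U3 q hqc p hqU).2]
        have h0 : C.outer = C.reg 0 := C.region_eq ⟨0, D.zero_notMem_curve⟩
        rw [h0]
        congr 1
        exact C.reg_eq_of_isPreconnected isPreconnected_boundary
          (fun z hz hzc => disjoint_left.mp D.disjoint_boundary hzc hz) hp ⟨0, Or.inl rfl⟩
  · intro p
    obtain ⟨q, hqU, -, hGq⟩ := hG p.1
    rw [C.region_eq]
    have : G p.1 = F q ε p.1 := hGq.self_of_nhds
    change (extendedRackCubes X).Rounds (G p.1) (n := 0) ![C.reg p.1] ![]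
    rw [this]
    by_cases hq : q ∈ D.crossings
    · have hb0 := (U1 q hq p.1 hqU).2.self_of_nhds
      have s1 := sign_chartDist continuous_fst (hmem q hq Prod.fst rfl) hb0.1
      have s2 := sign_chartDist continuous_snd (hmem q hq Prod.snd rfl) hb0.1
      have h0 := hb0.ne_zero p.2
      rw [F1 q hq, (hb0.eq_of_notMem p.2).2, ← decide_pos_eq_of_sign s1, ← decide_pos_eq_of_sign s2]
      exact rounds_square_vertex _ _ _ (sharp_side hε (ne_zero_of_sign s1 h0.1))
        (sharp_side hε (ne_zero_of_sign s2 h0.2))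
    · by_cases hqc : q ∈ D.curve
      · have hb0 := (U2 q hq hqc p.1 hqU).2.self_of_nhds
        have hs := D.sign_strandDist hqc p.1
        have hne : D.strandDist q p.1 ≠ 0 := by
          rw [← sign_ne_zero, hs, strandSign, if_neg p.2]
          split_ifs <;> decide
        rw [F2 q hq hqc, hb0.reg_eq p.2, ← hs]
        simp only [sign_eq_one_iff]
        exact rounds_edge_vertex _ _ (sharp_side hε hne)
      · rw [F3 q hqc, ← (U3 q hqc p.1 hqU).2]
        exact rounds_vertex _
  · intro p hp
    obtain ⟨q, hqU, -, hGq⟩ := hG p.1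
    obtain ⟨e', he'⟩ := D.regular_chart p.1 p.2 hp
    have hsrc := e'.open_source.eventually_mem he'.mem_source
    refine ⟨e', he', C.rightColor p.1, fun z => sharp ε (D.strandDist p.1 z), ?_⟩
    have hcont : Continuous fun z => sharp ε (D.strandDist p.1 z) :=
      (continuous_sharp ε).comp (D.continuous_strandDist p.1)
    have key : ∀ᶠ z in 𝓝 p.1, (extendedRackCubes X).Rounds (G z) (n := 1)
        ![C.rightColor p.1, C.col p.1] ![sharp ε (D.strandDist p.1 z)] := by
      by_cases hq : q ∈ D.crossings
      · have hb := (U1 q hq p.1 hqU).2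
        have hb0 := hb.self_of_nhds
        have hcont := (e q hq).continuousAt hb0.1
        have sg : ∀ {g : ℝ × ℝ → ℝ}, Continuous g → g 0 = 0 → g (e q hq p.1) ≠ 0 →
            ∀ᶠ z in 𝓝 p.1, (if decide (0 < g (e q hq p.1)) then
              1 / 2 < (sharp ε (chartDist (e q hq) g z) : ℝ) else
              (sharp ε (chartDist (e q hq) g z) : ℝ) < 1 / 2) := by
          intro g hg hg0 hne
          have hgc : ContinuousAt (fun z => g (e q hq z)) p.1 := hg.continuousAt.comp hcont
          filter_upwards [eventually_decide_pos_eq hgc hne, hgc.eventually_ne hne,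
            (e q hq).open_source.eventually_mem hb0.1] with z z1 z2 z3
          have s1 := sign_chartDist hg (hmem q hq g hg0) z3
          rw [← z1, ← decide_pos_eq_of_sign s1]
          exact sharp_side hε (ne_zero_of_sign s1 z2)
        obtain ⟨h0, a1, a2, a3, -⟩ | ⟨h0, a1, a2, a3, -⟩ :=
          CrossForm.strand_cases C (he q hq) hq hb p.2 hp
        · filter_upwards [hGq, sg continuous_snd rfl h0,
            eventually_chartDist_eq (g := Prod.fst) p.2 hb a3] with z hz hz1 hz2
          rw [hz, F1 q hq, a1, a2, ← hz2]
          exact rounds_square_right _ _ _ hz1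
        · filter_upwards [hGq, sg continuous_fst rfl h0,
            eventually_chartDist_eq (g := Prod.snd) p.2 hb a3] with z hz hz1 hz2
          rw [hz, F1 q hq, a1, a2, ← hz2]
          exact rounds_square_left _ _ _ hz1
      · by_cases hqc : q ∈ D.curve
        · have hb := (U2 q hq hqc p.1 hqU).2
          obtain ⟨a1, a2, a3⟩ := StrandBody.of_eventually hb p.2
          filter_upwards [hGq] with z hz
          rw [hz, F2 q hq hqc, a2, a3, strandDist, strandDist, strandSign_congr a1]
          exact rounds_edge _ _ _
        · exact absurd p.2 (U3 q hqc p.1 hqU).1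
    refine ⟨_, (hsrc.and (key.and (C.strandForm p.2 hp))), fun z hz => hz.1, hcont.continuousOn,
      fun z hz hz' => ?_, fun z hz => ⟨?_, ?_⟩⟩
    · have hs := D.sign_chart_eq he' hz.1
      rw [C.region_eq, hz.2.2.reg_eq z.2, ← hs, sign_neg hz']; rfl
    · rw [sign_sharp hε, D.sign_strandDist p.2, D.sign_chart_eq he' hz.1]
    · rw [C.arc_eq]; exact hz.2.1
  · intro p hp
    obtain ⟨q, hqU, -, hGq⟩ := hG p.1
    -- a crossing is covered only by its own neighborhood
    have hqp : q = p.1 := by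
      by_cases hq : q ∈ D.crossings
      · exact ((U1 q hq p.1 hqU).2.self_of_nhds.2.1 hp).symm
      · by_cases hqc : q ∈ D.curve
        · exact absurd hp (U2 q hq hqc p.1 hqU).2.self_of_nhds.1
        · exact absurd p.2 (U3 q hqc p.1 hqU).1
    rw [hqp] at hGq
    have hcont : ∀ g : ℝ × ℝ → ℝ, Continuous g → ContinuousOn
        (fun z => sharp ε (chartDist (e p.1 hp) g z)) (e p.1 hp).source := fun g hg z hz =>
      ((continuous_sharp ε).continuousAt.comp (continuousAt_chartDist hg hz)).continuousWithinAt
    refine ⟨e p.1 hp, he p.1 hp, r p.1 hp, a p.1 hp,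
      fun z => sharp ε (chartDist (e p.1 hp) Prod.fst z),
      fun z => sharp ε (chartDist (e p.1 hp) Prod.snd z), _, hGq.and (hform p.1 hp),
      fun z hz => hz.2.1, (hcont _ continuous_fst).mono fun z hz => hz.2.1,
      (hcont _ continuous_snd).mono fun z hz => hz.2.1, ?_, ?_, ?_⟩
    · intro z hz h1 h2
      rw [C.region_eq]
      exact (hz.2.2.2.2.2.2.2.1 h1 h2).2
    · intro z hz h1 h2
      rw [C.arc_eq]
      exact hz.2.2.2.2.2.1 h1 h2
    · intro z hz
      refine ⟨?_, ?_, ?_⟩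
      · rw [sign_sharp hε, sign_chartDist continuous_fst (hmem _ hp _ rfl) hz.2.1]
      · rw [sign_sharp hε, sign_chartDist continuous_snd (hmem _ hp _ rfl) hz.2.1]
      · change (extendedRackCubes X).Rounds (G z) (n := 2) _ _
        rw [hz.1, F1 p.1 hp, C.arc_eq]
        exact rounds_square _ _ _ _ _

end Existence

/-! ### Patching homotopies -/

section Homotopy

theorem homotopicRel_of_curry {Q : Type*} [TopologicalSpace Q] {f g : C(Q, Z)} {S : Set Q}
    (G : C(Q, C(I, Z))) (h0 : ∀ z, G z 0 = f z) (h1 : ∀ z, G z 1 = g z)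
    (hS : ∀ z ∈ S, ∀ s, G z s = f z) : f.HomotopicRel g S :=
  ⟨{ toFun := fun p => G p.2 p.1
     continuous_toFun := by fun_prop
     map_zero_left := h0
     map_one_left := h1
     prop' := fun s z hz => hS z hz s }⟩

/-- Two maps to the extended rack space are homotopic if there are local homotopies between
their sharpenings which fit together. -/
theorem homotopic_of_patch (j : C(ExtendedRackSpace X, Z))
    (f g : RackLoop r₀)
    (F : Square → ℝ → Square → C(I, Z)) (U : Square → Set Square) (η : Square → ℝ)
    (hη : ∀ q, 0 < η q) (hU : ∀ q, U q ∈ 𝓝 q)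
    (hc : ∀ q ε, 0 < ε → ε ≤ η q → ContinuousOn (F q ε) (U q))
    (hF : ∀ q, ∀ q' ∈ U q, ∀ᶠ p in nhdsPos q', F q p.1 p.2 = F q' p.1 p.2)
    (h0 : ∀ q ε z, 0 < ε → ε ≤ η q → z ∈ U q → F q ε z 0 = j (sharpenRack ε (f z)))
    (h1 : ∀ q ε z, 0 < ε → ε ≤ η q → z ∈ U q → F q ε z 1 = j (sharpenRack ε (g z)))
    (hb : ∀ q ε z, 0 < ε → ε ≤ η q → z ∈ U q → z ∈ Cube.boundary (Fin 2) →
      ∀ s, F q ε z s = j (rackVertex r₀)) :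
    GenLoop.Homotopic (pushLoop j f) (pushLoop j g) := by
  have hpos : ∀ᶠ ε in 𝓝[>] (0 : ℝ), 0 < ε := self_mem_nhdsWithin
  have hle : ∀ η : ℝ, 0 < η → ∀ᶠ ε in 𝓝[>] (0 : ℝ), ε ≤ η := fun η hη =>
    eventually_nhdsWithin_of_eventually_nhds (eventually_le_nhds hη)
  obtain ⟨ε, ⟨G, hG⟩, hε0, hε1⟩ := ((eventually_exists_patch F U (fun q ε => 0 < ε ∧ ε ≤ η q) hU
    (fun q => hpos.and (hle _ (hη q))) (fun q ε hA => hc q ε hA.1 hA.2) hF).and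
    (hpos.and (hle 1 one_pos))).exists
  obtain ⟨H, H0, H1, H2⟩ := (extendedRackCubes X).exists_sharpen_path ⟨hε0, hε1⟩
  have hsc : Continuous (sharpenRack (X := X) ε) := by
    have : sharpenRack (X := X) ε = fun b => H b 1 := funext fun b => (H1 b).symm
    rw [this]; fun_prop
  -- a map is homotopic to its sharpening
  have key : ∀ f : RackLoop r₀,
      (pushLoop j f).1.HomotopicRel (j.comp ((ContinuousMap.mk _ hsc).comp f.1))
        (Cube.boundary (Fin 2)) := by
    intro f
    refine homotopicRel_of_curry ⟨fun z => j.comp (H (f.1 z)), by fun_prop⟩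
      (fun z => congrArg j (H0 _)) (fun z => congrArg j (H1 _)) (fun z hz s => congrArg j ?_)
    rw [f.2 z hz]
    exact H2 _ _ _
  refine ((key f).trans ?_).trans (key g).symm
  have hv : ∀ f : RackLoop r₀, ∀ z ∈ Cube.boundary (Fin 2),
      sharpenRack ε (f.1 z) = rackVertex r₀ := by
    intro f z hz
    rw [f.2 z hz]
    exact PreCubicSet.sharpen_vertex _ _ _ _
  refine homotopicRel_of_curry G (fun z => ?_) (fun z => ?_) (fun z hz s => ?_)
  · obtain ⟨q, hq, hA, hGq⟩ := hG z
    exact (congrArg (fun c : C(I, Z) => c 0) hGq.self_of_nhds).trans (h0 q ε z hA.1 hA.2 hq)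
  · obtain ⟨q, hq, hA, hGq⟩ := hG z
    exact (congrArg (fun c : C(I, Z) => c 1) hGq.self_of_nhds).trans (h1 q ε z hA.1 hA.2 hq)
  · obtain ⟨q, hq, hA, hGq⟩ := hG z
    exact ((congrArg (fun c : C(I, Z) => c s) hGq.self_of_nhds).trans
      (hb q ε z hA.1 hA.2 hq hz s)).trans (congrArg j (hv f z hz)).symm

end Homotopy

/-! ### Local coordinates of the map defined by a shadow coloring -/

section Frames

variable {f : RackLoop r₀}

theorem IsShadowMap.eventually_sharpen_region (hf : IsShadowMap C f) (hp : p ∉ D.curve) :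
    ∃ η > 0, ∀ᶠ z in 𝓝 p, ∀ ε, 0 < ε → ε ≤ η → sharpenRack ε (f z) = rackVertex (C.reg p) := by
  have h : ∀ᶠ z in 𝓝 p, (extendedRackCubes X).Rounds (f.1 z) (n := 0) ![C.reg p] ![] := by
    filter_upwards [C.eventually_reg_eq hp, eventually_notMem_curve hp] with z hz hzc
    have := hf.at_region ⟨z, hzc⟩
    rwa [C.region_eq, hz] at this
  obtain ⟨η, h0, h1⟩ := PreCubicSet.exists_sharpen_eq (f.1.continuous.continuousAt)
    (continuousAt_const (y := (![] : Fin 0 → I))) h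
  refine ⟨η, h0, h1.mono fun z hz ε hε hε' => (hz ε hε hε').trans ?_⟩
  exact congrArg _ (Subsingleton.elim _ _)

/-- Near a point of a strand, the sharpening of `f` is in an edge, with the sharpened coordinate
`c`. -/
theorem IsShadowMap.exists_strandCoord (hf : IsShadowMap C f) (hp : p ∈ D.curve)
    (hp' : p ∉ D.crossings) : ∃ c : Square → ℝ, ∃ η > 0, ∀ᶠ z in 𝓝 p, ContinuousAt c z ∧
      sign (c z) = D.strandSign p z ∧ ∀ ε, 0 < ε → ε ≤ η → sharpenRack ε (f z) =
          rackEdge (C.rightColor p) (C.col p) (sharp ε (c z)) := by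
  obtain ⟨e, he, r, τ, U, hU, hUs, hτ, hr, h⟩ := hf.at_strand ⟨p, hp⟩ hp'
  have hr' : r = C.rightColor p := by
    obtain ⟨z, hs, ⟨a1, a2⟩, b0, -⟩ := exists_sign_chart_eq he.mem_source he.map_center (-1) 0
      ((eventually_mem_nhds_iff.mpr hU).and (C.strandForm hp hp'))
    have hneg := sign_eq_neg_one_iff.mp b0
    have hc : z ∉ D.curve := by
      rw [he.mem_curve_iff _ hs]; exact hneg.ne
    have b1 := hr ⟨_, hc⟩ (mem_of_mem_nhds a1) hneg
    rw [C.region_eq] at b1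
    rw [← b1, a2.reg_eq hc, ← D.sign_chart_eq he hs, b0]; rfl
  have hτp := hτ.continuousAt hU
  have hcc : ContinuousAt (fun z => (![τ z] : Fin 1 → I)) p :=
    continuousAt_pi.mpr fun i => by fin_cases i; exact hτp
  obtain ⟨η, h0, h1⟩ := PreCubicSet.exists_sharpen_eq (f.1.continuous.continuousAt) hcc
    (mem_of_superset hU fun z hz => (h z hz).2)
  refine ⟨fun z => τ z - 1 / 2, η, h0, ?_⟩
  filter_upwards [h1, eventually_mem_nhds_iff.mpr hU] with z hz hzU
  refine ⟨?_, ?_, fun ε hε hε' => (hz ε hε hε').trans ?_⟩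
  · have := hτ.continuousAt hzU
    fun_prop
  · rw [(h z (mem_of_mem_nhds hzU)).1, D.sign_chart_eq he (hUs (mem_of_mem_nhds hzU))]
  · rw [hr', C.arc_eq]
    exact congrArg _ (funext fun i => by fin_cases i; rfl)

/-- Near a crossing, the sharpening of `f` is in a square, with the sharpened coordinates
`c` and `c'`. -/
theorem IsShadowMap.exists_crossCoord (hf : IsShadowMap C f) (hp : p ∈ D.crossings) :
    ∃ e m r a, D.IsCrossingChart p e ∧ CrossForm D C.reg C.col p e m r a ∧
      ∃ c c' : Square → ℝ, ∃ η > 0, ∀ᶠ z in 𝓝 p, ContinuousAt c z ∧ ContinuousAt c' z ∧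
        sign (c z) = sign (e z).1 ∧
        sign (c' z) = sign (e z).2 ∧ ∀ ε, 0 < ε → ε ≤ η → sharpenRack ε (f z) =
            rackSquare r a (C.col p) (sharp ε (c z)) (sharp ε (c' z)) := by
  obtain ⟨e, he, r, a, τ, υ, U, hU, hUs, hτ, hυ, hr, ha, h⟩ :=
    hf.at_crossing ⟨p, D.crossings_subset hp⟩ hp
  obtain ⟨m, r', a', hform⟩ := C.exists_crossForm hp he
  have key := fun s t => exists_sign_chart_eq he.mem_source he.map_center s t
    ((eventually_mem_nhds_iff.mpr hU).and hform)
  have hr' : r = r' := by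
    obtain ⟨z, -, ⟨a1, a2⟩, h1, h2⟩ := key (-1) (-1)
    rw [sign_eq_neg_one_iff] at h1 h2
    have hc : z ∉ D.curve := by
      rw [a2.2.2.1, not_or]; exact ⟨h1.ne, h2.ne⟩
    have b1 := hr ⟨_, hc⟩ (mem_of_mem_nhds a1) h1 h2
    rw [C.region_eq] at b1
    rw [← b1, (a2.2.2.2.2.2.2.1 h1 h2).2]
  have ha' : a = a' := by
    obtain ⟨z, -, ⟨a1, a2⟩, h1, h2⟩ := key 0 (-1)
    rw [sign_eq_zero_iff] at h1
    rw [sign_eq_neg_one_iff] at h2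
    have b1 := ha ⟨_, a2.2.2.1.mpr (Or.inl h1)⟩ (mem_of_mem_nhds a1) h1 h2
    rw [C.arc_eq] at b1
    rw [← b1, a2.2.2.2.2.1 h1 h2]
  have hcc : ContinuousAt (fun z => (![τ z, υ z] : Fin 2 → I)) p := continuousAt_pi.mpr fun i => by
      fin_cases i
      · exact hτ.continuousAt hU
      · exact hυ.continuousAt hU
  obtain ⟨η, h0, h3⟩ := PreCubicSet.exists_sharpen_eq (f.1.continuous.continuousAt) hcc
    (mem_of_superset hU fun z hz => (h z hz).2.2)
  refine ⟨e, m, r', a', he, hform, fun z => τ z - 1 / 2, fun z => υ z - 1 / 2, η, h0, ?_⟩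
  filter_upwards [h3, eventually_mem_nhds_iff.mpr hU] with z hz hzU
  have hz0 := h z (mem_of_mem_nhds hzU)
  refine ⟨?_, ?_, hz0.1, hz0.2.1, fun ε hε hε' => (hz ε hε hε').trans ?_⟩
  · have := hτ.continuousAt hzU
    fun_prop
  · have := hυ.continuousAt hzU
    fun_prop
  · rw [hr', ha', C.arc_eq]
    exact congrArg _ (funext fun i => by fin_cases i <;> rfl)

end Frames

/-! ### Homotopies at the points where two diagrams agree -/

section StraightPath

/-- The path between two points of a cell with characteristic map `Φ` which is straight in the
coordinates of the cell, reparametrized by `θ`, as a function of the two end points. -/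
def straightPath {n : ℕ} (Φ : C(Fin n → I, Z)) (θ : C(I, I)) :
    C((Fin n → I) × (Fin n → I), C(I, Z)) :=
  ContinuousMap.curry ⟨fun p : ((Fin n → I) × (Fin n → I)) × I =>
    Φ fun i => Icc.convexComb (p.1.1 i) (p.1.2 i) (θ p.2), by
      refine Φ.continuous.comp (continuous_pi fun i => ?_)
      exact Icc.continuous_convexComb_prod.comp
        (f := fun p : ((Fin n → I) × (Fin n → I)) × I => (p.1.1 i, p.1.2 i, θ p.2)) (by fun_prop)⟩

end StraightPath

section AgreeingPoints

/-- Near `q`, the homotopy `G` is constant, with value the vertex `r`. -/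
def VertexNear (j : C(ExtendedRackSpace X, Z)) (G : ℝ → Square → C(I, Z)) (q : Square) (r : X) :
    Prop :=
  ∀ᶠ p in nhdsPos q, ∀ s, G p.1 p.2 s = j (rackVertex r)

/-- Near `q`, the homotopy `G` is the straight homotopy between the sharpenings of `f` and `g`
in the edge `(r, a)`; the maps `f` and `g` are on the sides `κ` and `κ'` of the midpoint. -/
def EdgeNear (j : C(ExtendedRackSpace X, Z)) (θ : C(I, I)) (f g : Square → ExtendedRackSpace X)
    (G : ℝ → Square → C(I, Z)) (q : Square) (r a : X) (κ κ' : Square → SignType) : Prop :=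
  ∃ c c' : ℝ → Square → I, ∀ᶠ p in nhdsPos q, (sharpenRack p.1 (f p.2) = rackEdge r a (c p.1 p.2) ∧
      sign ((c p.1 p.2 : ℝ) - 1 / 2) = κ p.2) ∧
    (sharpenRack p.1 (g p.2) = rackEdge r a (c' p.1 p.2) ∧
      sign ((c' p.1 p.2 : ℝ) - 1 / 2) = κ' p.2) ∧
    ∀ s, G p.1 p.2 s = j (rackEdge r a (Icc.convexComb (c p.1 p.2) (c' p.1 p.2) (θ s)))

variable {θ : C(I, I)}

theorem VertexNear.eventually_eq {G G' : ℝ → Square → C(I, Z)} {r : X}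
    (h : VertexNear j G q r) (h' : VertexNear j G' q r) :
    ∀ᶠ p in nhdsPos q, G p.1 p.2 = G' p.1 p.2 := by
  filter_upwards [h, h'] with p hp hp'
  ext s
  rw [hp, hp']

/-- The straight homotopy in an edge is determined by its end points and the sides. -/
theorem EdgeNear.eventually_eq {f g : Square → ExtendedRackSpace X} {G G' : ℝ → Square → C(I, Z)}
    {r a : X} {κ κ' : Square → SignType} (h : EdgeNear j θ f g G q r a κ κ')
    (h' : EdgeNear j θ f g G' q r a κ κ') :
    ∀ᶠ p in nhdsPos q, G p.1 p.2 = G' p.1 p.2 := by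
  obtain ⟨c, c', h⟩ := h
  obtain ⟨d, d', h'⟩ := h'
  filter_upwards [h, h'] with p hp hp'
  ext s
  have h1 : c p.1 p.2 = d p.1 p.2 :=
    eq_of_rackEdge_eq (hp.1.1.symm.trans hp'.1.1) (hp.1.2.trans hp'.1.2.symm)
  have h2 : c' p.1 p.2 = d' p.1 p.2 :=
    eq_of_rackEdge_eq (hp.2.1.1.symm.trans hp'.2.1.1) (hp.2.1.2.trans hp'.2.1.2.symm)
  rw [hp.2.2, hp'.2.2, h1, h2]

/-- The shadow colorings `C` and `C'` assign the same cell to the point `p`. -/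
inductive AgreeAt (C : ShadowColoring X D) (C' : ShadowColoring X D') (p : Square) : Prop
  | region (h : p ∉ D.curve) (h' : p ∉ D'.curve) (hi : D.index p = D'.index p)
      (hr : C.reg p = C'.reg p)
  | strand (h : p ∈ D.curve) (hx : p ∉ D.crossings) (h' : p ∈ D'.curve) (hx' : p ∉ D'.crossings)
      (hi : D.rightIndex p = D'.rightIndex p) (hr : C.rightColor p = C'.rightColor p)
      (hc : C.col p = C'.col p)
  | crossing (h : p ∈ D.crossings) (h' : p ∈ D'.crossings) (ha : LinkDiagram.AgreeNear D D' p)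
      (hc : ∀ᶠ z in 𝓝 p, (z ∉ D.curve → C.reg z = C'.reg z) ∧ (z ∈ D.curve → C.col z = C'.col z))

/-- The source region and the under-arc adjoining it have the same colors for both colorings. -/
theorem CrossForm.eq_of_agree {e e' : PlaneChart}
    {m m' : ℤ} {r r' a a' : X} (he : D.IsCrossingChart p e) (he' : D'.IsCrossingChart p e')
    (h : CrossForm D C.reg C.col p e m r a) (h' : CrossForm D' C'.reg C'.col p e' m' r' a')
    (hp : p ∈ D.crossings) (ha : LinkDiagram.AgreeNear D D' p)
    (hc : ∀ᶠ z in 𝓝 p, (z ∉ D.curve → C.reg z = C'.reg z) ∧ (z ∈ D.curve → C.col z = C'.col z)) :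
    r = r' ∧ a = a' := by
  have key := fun s t => exists_sign_chart_eq he.mem_source he.map_center s t
    (((h.and h').and hc).and (ha.sign_crossing_eq hp he he'))
  constructor
  · obtain ⟨z, -, ⟨⟨⟨a1, a2⟩, a3⟩, s1, s2⟩, h1, h2⟩ := key (-1) (-1)
    rw [h1, eq_comm, sign_eq_neg_one_iff] at s1
    rw [h2, eq_comm, sign_eq_neg_one_iff] at s2
    rw [sign_eq_neg_one_iff] at h1 h2
    have hc : z ∉ D.curve := by
      rw [a1.2.2.1, not_or]; exact ⟨h1.ne, h2.ne⟩
    rw [← (a1.2.2.2.2.2.2.1 h1 h2).2, ← (a2.2.2.2.2.2.2.1 s1 s2).2, a3.1 hc]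
  · obtain ⟨z, -, ⟨⟨⟨a1, a2⟩, a3⟩, s1, s2⟩, h1, h2⟩ := key 0 (-1)
    rw [h1, eq_comm, sign_eq_zero_iff] at s1
    rw [h2, eq_comm, sign_eq_neg_one_iff] at s2
    rw [sign_eq_zero_iff] at h1
    rw [sign_eq_neg_one_iff] at h2
    rw [← a1.2.2.2.2.1 h1 h2, ← a2.2.2.2.2.1 s1 s2, a3.2 (a1.2.2.1.mpr (Or.inl h1))]

variable {f g : RackLoop r₀}

/-- The properties, at the points `z` near `q`, of the local homotopy `G` at a point `q` where the
colorings agree. -/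
structure AgreeFrame (j : C(ExtendedRackSpace X, Z)) (θ : C(I, I)) (C : ShadowColoring X D)
    (C' : ShadowColoring X D') (f g : RackLoop r₀) (q : Square)
    (G : ℝ → Square → C(I, Z)) (η : ℝ) (z : Square) : Prop where
  continuousAt : ∀ ε, 0 < ε → ε ≤ η → ContinuousAt (G ε) z
  map_zero : ∀ ε, 0 < ε → ε ≤ η → G ε z 0 = j (sharpenRack ε (f z))
  map_one : ∀ ε, 0 < ε → ε ≤ η → G ε z 1 = j (sharpenRack ε (g z))
  boundary : z ∈ Cube.boundary (Fin 2) → ∀ ε, 0 < ε → ε ≤ η → ∀ s, G ε z s = j (rackVertex r₀)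
  crossing : z ≠ q → z ∉ D.crossings ∧ z ∉ D'.crossings
  region : z ∉ D.curve → z ∉ D'.curve → D.index z = D'.index z → VertexNear j G z (C.reg z)
  strand : z ∈ D.curve → z ∉ D.crossings → z ∈ D'.curve → z ∉ D'.crossings →
    EdgeNear j θ f g G z (C.rightColor z) (C.col z) (D.strandSign z) (D'.strandSign z)
  center_region : q ∉ D.curve → VertexNear j G z (C.reg q)
  center_strand : q ∈ D.curve → q ∉ D.crossings →
    EdgeNear j θ f g G z (C.rightColor q) (C.col q) (D.strandSign q) (D'.strandSign q)

theorem eventually_prod_of_le {η : ℝ} (hη : 0 < η) {P : ℝ → Square → Prop}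
    (h : ∀ᶠ z in 𝓝 q, ∀ ε, 0 < ε → ε ≤ η → P ε z) :
    ∀ᶠ p in nhdsPos q, 0 < p.1 ∧ P p.1 p.2 := by
  have hpos : ∀ᶠ ε in 𝓝[>] (0 : ℝ), 0 < ε := self_mem_nhdsWithin
  have hle : ∀ᶠ ε in 𝓝[>] (0 : ℝ), ε ≤ η :=
    eventually_nhdsWithin_of_eventually_nhds (eventually_le_nhds hη)
  filter_upwards [(hpos.and hle).prod_mk h] with p hp
  exact ⟨hp.1.1, hp.2 _ hp.1.1 hp.1.2⟩

theorem AgreeAt.exists_frame_region (hf : IsShadowMap C f) (hg : IsShadowMap C' g)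
    (h : q ∉ D.curve) (h' : q ∉ D'.curve) (hr : C.reg q = C'.reg q) :
    ∃ G : ℝ → Square → C(I, Z), ∃ η > 0, ∀ᶠ z in 𝓝 q, AgreeFrame j θ C C' f g q G η z := by
  obtain ⟨η, hη, h1⟩ := hf.eventually_sharpen_region h
  obtain ⟨η', hη', h2⟩ := hg.eventually_sharpen_region h'
  refine ⟨fun _ _ => ContinuousMap.const I (j (rackVertex (C.reg q))), min η η', lt_min hη hη', ?_⟩
  filter_upwards [h1, h2, C.eventually_reg_eq h, eventually_notMem_curve h,
    eventually_notMem_curve h'] with z z1 z2 z3 z4 z5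
  refine ⟨fun _ _ _ => continuousAt_const, fun ε e1 e2 => ?_, fun ε e1 e2 => ?_,
    fun hz ε e1 e2 s => ?_, fun _ => ⟨fun h => z4 (D.crossings_subset h),
    fun h => z5 (D'.crossings_subset h)⟩, fun _ _ _ => ?_, fun h => absurd h z4, fun _ => ?_,
    fun hh => absurd hh h⟩
  · rw [z1 ε e1 (e2.trans (min_le_left _ _))]; rfl
  · rw [z2 ε e1 (e2.trans (min_le_right _ _)), ← hr]; rfl
  · have := z1 ε e1 (e2.trans (min_le_left _ _))
    rw [show f z = rackVertex r₀ from f.2 z hz] at this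
    have h3 : sharpenRack ε (rackVertex r₀) = rackVertex r₀ := PreCubicSet.sharpen_vertex _ _ _ _
    rw [ContinuousMap.const_apply, ← this, h3]
  · exact .of_forall fun p s => by rw [z3]; rfl
  · exact .of_forall fun p s => rfl

theorem AgreeAt.exists_frame_strand (hθ0 : θ 0 = 0) (hθ1 : θ 1 = 1) (hf : IsShadowMap C f)
    (hg : IsShadowMap C' g)
    (h : q ∈ D.curve) (hx : q ∉ D.crossings) (h' : q ∈ D'.curve) (hx' : q ∉ D'.crossings)
    (hi : D.rightIndex q = D'.rightIndex q) (hr : C.rightColor q = C'.rightColor q)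
    (hc : C.col q = C'.col q) :
    ∃ G : ℝ → Square → C(I, Z), ∃ η > 0, ∀ᶠ z in 𝓝 q, AgreeFrame j θ C C' f g q G η z := by
  obtain ⟨c, η, hη, h1⟩ := hf.exists_strandCoord h hx
  obtain ⟨c', η', hη', h2⟩ := hg.exists_strandCoord h' hx'
  let Φ : C(Fin 1 → I, Z) := ⟨fun t => j (rackEdge (C.rightColor q) (C.col q) (t 0)),
    j.continuous.comp ((PreCubicSet.continuous_point _ _).comp
      (continuous_pi fun i => by fin_cases i; exact continuous_apply 0))⟩
  let G : ℝ → Square → C(I, Z) := fun ε z =>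
    straightPath Φ θ (fun _ => sharp ε (c z), fun _ => sharp ε (c' z))
  have hG : ∀ ε z s, G ε z s = j (rackEdge (C.rightColor q) (C.col q)
    (Icc.convexComb (sharp ε (c z)) (sharp ε (c' z)) (θ s))) := fun _ _ _ => rfl
  have hedge : ∀ᶠ z in 𝓝 q, EdgeNear j θ f g G z (C.rightColor q) (C.col q) (D.strandSign q)
      (D'.strandSign q) := by
    filter_upwards [h1.eventually_nhds, h2.eventually_nhds]
      with z z1 z2
    refine ⟨fun ε z => sharp ε (c z), fun ε z => sharp ε (c' z), ?_⟩
    filter_upwards [eventually_prod_of_le hη (z1.mono fun _ h => h.2.2),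
      eventually_prod_of_le hη' (z2.mono fun _ h => h.2.2),
      (z1.mono fun _ h => h.2.1).prod_inr _,
      (z2.mono fun _ h => h.2.1).prod_inr _] with p p1 p2 p3 p4
    refine ⟨⟨p1.2, ?_⟩, ⟨?_, ?_⟩, fun s => hG _ _ _⟩
    · rw [sign_sharp p1.1, p3]
    · rw [p2.2, hr, hc]
    · rw [sign_sharp p1.1, p4]
  refine ⟨G, min η η', lt_min hη hη', ?_⟩
  filter_upwards [h1, h2, hedge, eventually_notMem_boundary h,
    eventually_notMem_crossings hx, eventually_notMem_crossings hx',
    (C.strandForm h hx).eventually_nhds,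
    (C'.strandForm h' hx').eventually_nhds]
    with z z1 z2 z3 z4 z5 z6 z7 z8
  refine ⟨fun ε e1 e2 => ?_, fun ε e1 e2 => ?_, fun ε e1 e2 => ?_, fun hz => absurd hz z4,
    fun _ => ⟨z5, z6⟩, fun k1 k2 k3 => ?_, fun k1 k2 k3 k4 => ?_, fun hh => absurd h hh,
    fun _ _ => z3⟩
  · refine (straightPath Φ θ).continuous.continuousAt.comp (ContinuousAt.prodMk ?_ ?_)
    · exact continuousAt_pi.mpr fun _ => (continuous_sharp ε).continuousAt.comp z1.1
    · exact continuousAt_pi.mpr fun _ => (continuous_sharp ε).continuousAt.comp z2.1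
  · rw [hG, hθ0, Icc.convexComb_zero, z1.2.2 ε e1 (e2.trans (min_le_left _ _))]
  · rw [hG, hθ1, Icc.convexComb_one, z2.2.2 ε e1 (e2.trans (min_le_right _ _)), hr, hc]
  · have hs : D.strandSign q z = D'.strandSign q z := by
      rw [strandSign, strandSign, if_neg k1, if_neg k2, k3, hi]
    have hs1 : sign (c z) = sign (c' z) := by rw [z1.2.1, z2.2.1, hs]
    have hne : c z ≠ 0 := by
      rw [← sign_ne_zero, z1.2.1, strandSign, if_neg k1]
      split_ifs <;> decide
    have hne' : c' z ≠ 0 := ne_zero_of_sign hs1.symm hne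
    filter_upwards [eventually_sharp_eq z1.1 hne, eventually_sharp_eq z2.1 hne'] with p p1 p2 s
    rw [hG, p1, p2, decide_pos_eq_of_sign hs1, Icc.convexComb_eq, rackEdge_end,
      z7.self_of_nhds.reg_eq k1, ← z1.2.1]
    simp only [sign_eq_one_iff, decide_pos_eq_of_sign hs1]
  · obtain ⟨y1, y2, y3⟩ := StrandBody.of_eventually z7 k1
    have y4 := (StrandBody.of_eventually z8 k3).1
    rw [y2, y3, strandSign_congr y1, strandSign_congr y4]
    exact z3

end AgreeingPoints

section AgreeingCrossings

variable {θ : C(I, I)} {f g : RackLoop r₀}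

theorem AgreeAt.exists_frame_crossing (hθ0 : θ 0 = 0) (hθ1 : θ 1 = 1) (hf : IsShadowMap C f)
    (hg : IsShadowMap C' g)
    (h : q ∈ D.crossings) (h' : q ∈ D'.crossings) (ha : LinkDiagram.AgreeNear D D' q)
    (hc : ∀ᶠ z in 𝓝 q, (z ∉ D.curve → C.reg z = C'.reg z) ∧ (z ∈ D.curve → C.col z = C'.col z)) :
    ∃ G : ℝ → Square → C(I, Z), ∃ η > 0, ∀ᶠ z in 𝓝 q, AgreeFrame j θ C C' f g q G η z := by
  obtain ⟨e, m, r, a, he, hform, c, d, η, hη, h1⟩ := hf.exists_crossCoord h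
  obtain ⟨e', m', r', a', he', hform', c', d', η', hη', h2⟩ := hg.exists_crossCoord h'
  have hsg := ha.sign_crossing_eq h he he'
  obtain ⟨rfl, rfl⟩ := CrossForm.eq_of_agree he he' hform hform' h ha hc
  have hcol : C.col q = C'.col q := hc.self_of_nhds.2 (D.crossings_subset h)
  let Φ : C(Fin 2 → I, Z) := ⟨fun t => j (rackSquare r a (C.col q) (t 0) (t 1)),
    j.continuous.comp ((PreCubicSet.continuous_point _ _).comp
      (continuous_pi fun i => by
        fin_cases i
        · exact continuous_apply 0
        · exact continuous_apply 1))⟩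
  let G : ℝ → Square → C(I, Z) := fun ε z =>
    straightPath Φ θ (![sharp ε (c z), sharp ε (d z)], ![sharp ε (c' z), sharp ε (d' z)])
  have hG : ∀ ε z s, G ε z s = j (rackSquare r a (C.col q)
    (Icc.convexComb (sharp ε (c z)) (sharp ε (c' z)) (θ s))
    (Icc.convexComb (sharp ε (d z)) (sharp ε (d' z)) (θ s))) := fun _ _ _ => rfl
  have hqc := D.crossings_subset h
  refine ⟨G, min η η', lt_min hη hη', ?_⟩
  filter_upwards [h1.eventually_nhds, h2.eventually_nhds,
    eventually_notMem_boundary hqc, D.eventually_mem_crossings_eq q,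
    D'.eventually_mem_crossings_eq q, hform.eventually_nhds,
    hform'.eventually_nhds, hsg.eventually_nhds]
    with z z1 z2 z3 z4 z5 z6 z7 z8
  have y1 := z1.self_of_nhds
  have y2 := z2.self_of_nhds
  have y6 := z6.self_of_nhds
  have y8 := z8.self_of_nhds
  have sc : sign (c z) = sign (c' z) := by rw [y1.2.2.1, y2.2.2.1, y8.1]
  have sd : sign (d z) = sign (d' z) := by rw [y1.2.2.2.1, y2.2.2.2.1, y8.2]
  refine ⟨fun ε e1 e2 => ?_, fun ε e1 e2 => ?_, fun ε e1 e2 => ?_, fun hz => absurd hz z3,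
    fun hne => ⟨fun h => hne (z4 h), fun h => hne (z5 h)⟩, fun k1 k2 _ => ?_,
    fun k1 k2 k3 k4 => ?_, fun hh => absurd hqc hh, fun _ hh => absurd h hh⟩
  · refine (straightPath Φ θ).continuous.continuousAt.comp (ContinuousAt.prodMk ?_ ?_)
    · refine continuousAt_pi.mpr fun i => ?_
      fin_cases i
      · exact (continuous_sharp ε).continuousAt.comp y1.1
      · exact (continuous_sharp ε).continuousAt.comp y1.2.1
    · refine continuousAt_pi.mpr fun i => ?_
      fin_cases i
      · exact (continuous_sharp ε).continuousAt.comp y2.1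
      · exact (continuous_sharp ε).continuousAt.comp y2.2.1
  · rw [hG, hθ0, Icc.convexComb_zero, Icc.convexComb_zero,
      y1.2.2.2.2 ε e1 (e2.trans (min_le_left _ _))]
  · rw [hG, hθ1, Icc.convexComb_one, Icc.convexComb_one,
      y2.2.2.2.2 ε e1 (e2.trans (min_le_right _ _)), hcol]
  · have hzc := y6.ne_zero k1
    have n1 : c z ≠ 0 := ne_zero_of_sign y1.2.2.1 hzc.1
    have n2 : d z ≠ 0 := ne_zero_of_sign y1.2.2.2.1 hzc.2
    filter_upwards [eventually_sharp_eq y1.1 n1, eventually_sharp_eq y1.2.1 n2,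
      eventually_sharp_eq y2.1 (ne_zero_of_sign sc.symm n1),
      eventually_sharp_eq y2.2.1 (ne_zero_of_sign sd.symm n2)] with p p1 p2 p3 p4 s
    rw [hG, p1, p2, p3, p4, ← decide_pos_eq_of_sign sc, ← decide_pos_eq_of_sign sd,
      Icc.convexComb_eq, Icc.convexComb_eq, rackSquare_left, rackEdge_end, (y6.eq_of_notMem k1).2,
      decide_pos_eq_of_sign y1.2.2.1, decide_pos_eq_of_sign y1.2.2.2.1]
  · have hr := CrossForm.right_eq C z6 k2
    have hr' := CrossForm.right_eq C' z7 k4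
    have hne := he.snd_ne_zero y6.1 (ne_of_mem_of_not_mem h k2).symm
    have sz : ∀ {x y : ℝ}, sign x = sign y → x = 0 → y = 0 := by
      intro x y hxy hx
      rwa [hx, sign_zero, eq_comm, sign_eq_zero_iff] at hxy
    have ed := eventually_prod_of_le hη (z1.mono fun _ h => h.2.2.2.2)
    have ed' := eventually_prod_of_le hη' (z2.mono fun _ h => h.2.2.2.2)
    rcases y6.2.2.1.mp k1 with h0 | h0
    · have n0 := hne h0
      obtain ⟨b1, b2, b3, -⟩ := hr.1 h0 n0
      obtain ⟨-, -, b3', -⟩ := hr'.1 (sz y8.1 h0) (ne_zero_of_sign y8.2.symm n0)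
      have n2 : d z ≠ 0 := ne_zero_of_sign y1.2.2.2.1 n0
      refine ⟨fun ε z => sharp ε (c z), fun ε z => sharp ε (c' z), ?_⟩
      filter_upwards [ed, ed', eventually_sharp_eq y1.2.1 n2,
        eventually_sharp_eq y2.2.1 (ne_zero_of_sign sd.symm n2), b3.prod_inr _,
        b3'.prod_inr _, z1.prod_inr _, z2.prod_inr _]
        with p p1 p2 p3 p4 p5 p6 p7 p8
      rw [b1, b2, ← decide_pos_eq_of_sign y1.2.2.2.1]
      refine ⟨⟨?_, ?_⟩, ⟨?_, ?_⟩, fun s => ?_⟩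
      · rw [p1.2, p3, rackSquare_right]
      · rw [sign_sharp p1.1, p7.2.2.1, p5]
      · rw [p2.2, p4, rackSquare_right, decide_pos_eq_of_sign sd, hcol]
      · rw [sign_sharp p1.1, p8.2.2.1, p6]
      · rw [hG, p3, p4, ← decide_pos_eq_of_sign sd, Icc.convexComb_eq, rackSquare_right]
    · have n0 : (e z).1 ≠ 0 := fun h => hne h h0
      obtain ⟨b1, b2, b3, -⟩ := hr.2 h0 n0
      obtain ⟨-, -, b3', -⟩ := hr'.2 (sz y8.2 h0) (ne_zero_of_sign y8.1.symm n0)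
      have n2 : c z ≠ 0 := ne_zero_of_sign y1.2.2.1 n0
      refine ⟨fun ε z => sharp ε (d z), fun ε z => sharp ε (d' z), ?_⟩
      filter_upwards [ed, ed', eventually_sharp_eq y1.1 n2,
        eventually_sharp_eq y2.1 (ne_zero_of_sign sc.symm n2), b3.prod_inr _,
        b3'.prod_inr _, z1.prod_inr _, z2.prod_inr _]
        with p p1 p2 p3 p4 p5 p6 p7 p8
      rw [b1, b2, ← decide_pos_eq_of_sign y1.2.2.1]
      refine ⟨⟨?_, ?_⟩, ⟨?_, ?_⟩, fun s => ?_⟩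
      · rw [p1.2, p3, rackSquare_left]
      · rw [sign_sharp p1.1, p7.2.2.2.1, p5]
      · rw [p2.2, p4, rackSquare_left, decide_pos_eq_of_sign sc, hcol]
      · rw [sign_sharp p1.1, p8.2.2.2.1, p6]
      · rw [hG, p3, p4, ← decide_pos_eq_of_sign sc, Icc.convexComb_eq, rackSquare_left]

theorem AgreeAt.exists_frame (hθ0 : θ 0 = 0) (hθ1 : θ 1 = 1) (hf : IsShadowMap C f)
    (hg : IsShadowMap C' g) (hq : AgreeAt C C' q) :
    ∃ G : ℝ → Square → C(I, Z), ∃ η > 0, ∀ᶠ z in 𝓝 q, AgreeFrame j θ C C' f g q G η z := by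
  cases hq with
  | region h h' hi hr => exact AgreeAt.exists_frame_region hf hg h h' hr
  | strand h hx h' hx' hi hr hc =>
    exact AgreeAt.exists_frame_strand hθ0 hθ1 hf hg h hx h' hx' hi hr hc
  | crossing h h' ha hc => exact AgreeAt.exists_frame_crossing hθ0 hθ1 hf hg h h' ha hc

/-- The properties, at the points `z` near `q`, of a local homotopy `G` at a point `q` outside the
set `S` of points where the colorings agree. -/
structure InnerFrame (j : C(ExtendedRackSpace X, Z)) (S : Set Square)
    (f g : RackLoop r₀)
    (G : ℝ → Square → C(I, Z)) (η : ℝ) (z : Square) : Prop where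
  notMem : z ∉ S
  notMem_boundary : z ∉ Cube.boundary (Fin 2)
  continuousAt : ∀ ε, 0 < ε → ε ≤ η → ContinuousAt (G ε) z
  map_zero : ∀ ε, 0 < ε → ε ≤ η → G ε z 0 = j (sharpenRack ε (f z))
  map_one : ∀ ε, 0 < ε → ε ≤ η → G ε z 1 = j (sharpenRack ε (g z))

/-- The maps defined by two colorings which agree on a set `S` are homotopic, if there
are local homotopies outside `S` which fit together with each other and, on the frontier of
`S`, with the straight homotopies on `S`. -/
theorem homotopic_of_agree (hθ0 : θ 0 = 0) (hθ1 : θ 1 = 1) (hf : IsShadowMap C f)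
    (hg : IsShadowMap C' g) {S : Set Square} (hS : ∀ q ∈ S, AgreeAt C C' q)
    (G : Square → ℝ → Square → C(I, Z)) (η : Square → ℝ) (hη : ∀ q ∉ S, 0 < η q)
    (hG : ∀ q ∉ S, ∀ᶠ z in 𝓝 q, InnerFrame j S f g (G q) (η q) z)
    (hGG : ∀ q ∉ S, ∀ᶠ z in 𝓝 q, z ∉ S → ∀ᶠ p in nhdsPos z, G q p.1 p.2 = G z p.1 p.2)
    (hcr : ∀ q ∈ S, q ∈ D.crossings → ∀ᶠ z in 𝓝 q, z ∈ S)
    (hst : ∀ q ∈ S, q ∈ D.curve → q ∉ D.crossings → ∀ᶠ z in 𝓝 q, z ∉ S → EdgeNear j θ f g (G z) z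
      (C.rightColor q) (C.col q) (D.strandSign q) (D'.strandSign q))
    (hre : ∀ q ∈ S, q ∉ D.curve → ∀ᶠ z in 𝓝 q, z ∉ S → VertexNear j (G z) z (C.reg q)) :
    GenLoop.Homotopic (pushLoop j f) (pushLoop j g) := by
  classical
  have h1 : ∀ q, ∃ G : ℝ → Square → C(I, Z), ∃ η > 0, q ∈ S →
      ∀ᶠ z in 𝓝 q, AgreeFrame j θ C C' f g q G η z := by
    intro q
    by_cases hq : q ∈ S
    · obtain ⟨G, η, h0, h⟩ := (hS q hq).exists_frame (j := j) hθ0 hθ1 hf hg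
      exact ⟨G, η, h0, fun _ => h⟩
    · exact ⟨fun _ _ => ContinuousMap.const I (j (rackVertex r₀)), 1, one_pos, fun h => absurd h hq⟩
  choose G' η' hη' hG' using h1
  let F : Square → ℝ → Square → C(I, Z) := fun q => if q ∈ S then G' q else G q
  have F1 : ∀ q ∈ S, F q = G' q := fun q hq => if_pos hq
  have F2 : ∀ q ∉ S, F q = G q := fun q hq => if_neg hq
  have hnhds : ∀ q : Square, ∃ (U : Set Square) (ζ : ℝ), U ∈ 𝓝 q ∧ 0 < ζ ∧
      (∀ ε, 0 < ε → ε ≤ ζ → ContinuousOn (F q ε) U) ∧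
      (∀ q' ∈ U, ∀ᶠ p in nhdsPos q', F q p.1 p.2 = F q' p.1 p.2) ∧
      (∀ ε z, 0 < ε → ε ≤ ζ → z ∈ U → F q ε z 0 = j (sharpenRack ε (f z))) ∧
      (∀ ε z, 0 < ε → ε ≤ ζ → z ∈ U → F q ε z 1 = j (sharpenRack ε (g z))) ∧
      (∀ ε z, 0 < ε → ε ≤ ζ → z ∈ U → z ∈ Cube.boundary (Fin 2) →
        ∀ s, F q ε z s = j (rackVertex r₀)) := by
    intro q
    by_cases hq : q ∈ S
    -- near a point `q` of `S`, the local homotopies at the points outside `S` are required to be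
    -- constant or straight in the same cell
    · have hinner : ∀ᶠ z in 𝓝 q, z ∉ S → ∀ᶠ p in nhdsPos z, G' q p.1 p.2 = G z p.1 p.2 := by
        by_cases hqc : q ∈ D.curve
        · by_cases hqx : q ∈ D.crossings
          · exact (hcr q hq hqx).mono fun z hz hz' => absurd hz hz'
          · filter_upwards [hG' q hq, hst q hq hqc hqx] with z z1 z2 z3
            exact (z1.center_strand hqc hqx).eventually_eq (z2 z3)
        · filter_upwards [hG' q hq, hre q hq hqc] with z z1 z2 z3
          exact (z1.center_region hqc).eventually_eq (z2 z3)
      refine ⟨_, η' q, (hG' q hq).and hinner, hη' q, ?_, ?_, ?_, ?_, ?_⟩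
      · intro ε e1 e2 z hz
        rw [F1 q hq]
        exact (hz.1.continuousAt ε e1 e2).continuousWithinAt
      · intro q' hq'
        rw [F1 q hq]
        by_cases hqS : q' ∈ S
        · rw [F1 q' hqS]
          have a1 := hq'.1
          have a2 := (hG' q' hqS).self_of_nhds
          cases hS q' hqS with
          | region h h' hi hr =>
            exact (a1.region h h' hi).eventually_eq (a2.region h h' hi)
          | strand h hx h' hx' hi hr hc =>
            exact (a1.strand h hx h' hx').eventually_eq (a2.strand h hx h' hx')
          | crossing h h' ha hc =>
            obtain rfl : q' = q := by
              by_contra hne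
              exact (a1.crossing hne).1 h
            exact .of_forall fun _ => rfl
        · rw [F2 q' hqS]
          exact hq'.2 hqS
      · intro ε z e1 e2 hz
        rw [F1 q hq]
        exact hz.1.map_zero ε e1 e2
      · intro ε z e1 e2 hz
        rw [F1 q hq]
        exact hz.1.map_one ε e1 e2
      · intro ε z e1 e2 hz hzb
        rw [F1 q hq]
        exact hz.1.boundary hzb ε e1 e2
    · refine ⟨_, η q, (hG q hq).and (hGG q hq), hη q hq, ?_, ?_, ?_, ?_, ?_⟩
      · intro ε e1 e2 z hz
        rw [F2 q hq]
        exact (hz.1.continuousAt ε e1 e2).continuousWithinAt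
      · intro q' hq'
        rw [F2 q hq, F2 q' hq'.1.notMem]
        exact hq'.2 hq'.1.notMem
      · intro ε z e1 e2 hz
        rw [F2 q hq]
        exact hz.1.map_zero ε e1 e2
      · intro ε z e1 e2 hz
        rw [F2 q hq]
        exact hz.1.map_one ε e1 e2
      · intro ε z e1 e2 hz hzb
        exact absurd hzb hz.1.notMem_boundary
  choose U ζ hU hζ k1 k2 k3 k4 k5 using hnhds
  exact homotopic_of_patch j f g F U ζ hζ hU k1 k2 k3 k4 k5

/-- Any two maps defined by the same shadow coloring are homotopic. -/
theorem IsShadowMap.homotopic (j : C(ExtendedRackSpace X, Z)) {g : Ω^ (Fin 2) _ (rackVertex r₀)}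
    (hf : IsShadowMap C f) (hg : IsShadowMap C g) :
    GenLoop.Homotopic (pushLoop j f) (pushLoop j g) := by
  refine homotopic_of_agree (θ := ContinuousMap.id I) (S := univ) rfl rfl hf hg (fun q _ => ?_)
    (fun _ _ _ => ContinuousMap.const I (j (rackVertex r₀))) (fun _ => 1)
    (fun q hq => absurd (mem_univ q) hq) (fun q hq => absurd (mem_univ q) hq)
    (fun q hq => absurd (mem_univ q) hq) (fun q _ _ => .of_forall fun z => mem_univ z)
    (fun q _ _ _ => .of_forall fun z hz => absurd (mem_univ z) hz)
    (fun q _ _ => .of_forall fun z hz => absurd (mem_univ z) hz)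
  by_cases hq : q ∈ D.curve
  · by_cases hx : q ∈ D.crossings
    · exact .crossing hx hx (LinkDiagram.AgreeNear.refl D q)
        (.of_forall fun _ => ⟨fun _ => rfl, fun _ => rfl⟩)
    · exact .strand hq hx hq hx rfl rfl rfl
  · exact .region hq hq rfl rfl

end AgreeingCrossings

/-! ### Labels of the faces of a cube -/

section Labels

/-- The color of the region on the sides `s` of three strands, listed from the bottom to the
top: `r` is the color of the region on the right of all strands and `a` are the colors of
the parts of the strands which are on the right of all higher strands. -/
def regLabel (r : X) (a : Fin 3 → X) (s : Fin 3 → Bool) : X :=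
  actIf (s 2) (a 2) (actIf (s 1) (a 1) (actIf (s 0) (a 0) r))

/-- The color of the part of the strand `i` on the sides `s` of the higher strands. -/
def colLabel (a : Fin 3 → X) (s : Fin 3 → Bool) : Fin 3 → X :=
  ![actIf (s 2) (a 2) (actIf (s 1) (a 1) (a 0)), actIf (s 2) (a 2) (a 1), a 2]

/-- Self-distributivity, in the form in which it identifies the labels of the faces of a cube. -/
theorem actIf_actIf (s s' : Bool) (a b x : X) :
    actIf s a (actIf s' b x) = actIf s' (actIf s a b) (actIf s a x) := by
  cases s <;> cases s' <;> first | rfl | exact Shelf.self_distrib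

theorem actIf_injective (s : Bool) (a : X) : Function.Injective (actIf s a) := by
  intro x y h
  cases s
  · exact h
  · exact (Rack.left_cancel a).mp h

theorem actIf_surjective (s : Bool) (a : X) : Function.Surjective (actIf s a) := by
  intro x
  cases s
  · exact ⟨x, rfl⟩
  · exact (Rack.act' a).surjective x

variable (r : X) (a : Fin 3 → X) (s : Fin 3 → Bool)

/-- The colors on the two sides of a strand satisfy the condition on regions. -/
theorem regLabel_update (i : Fin 3) (b : Bool) : regLabel r a (Function.update s i b) =
    actIf b (colLabel a s i) (regLabel r a (Function.update s i false)) := by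
  fin_cases i
  · simp [regLabel, colLabel, actIf_actIf (s 1) b, actIf_actIf (s 2) b]
  · simp [regLabel, colLabel, actIf_actIf (s 2)]
  · simp [regLabel, colLabel]

/-- The colors of the two parts of a lower strand satisfy the condition on crossings. -/
theorem colLabel_update {i j : Fin 3} (h : i < j) (b : Bool) :
    colLabel a (Function.update s j b) i =
      actIf b (colLabel a s j) (colLabel a (Function.update s j false) i) := by
  fin_cases i <;> fin_cases j <;> first | exact absurd h (by decide) | skip
  · simp [colLabel, actIf_actIf (s 2)]
  · simp [colLabel]
  · simp [colLabel]

theorem colLabel_congr {s s' : Fin 3 → Bool} {i : Fin 3} (h : ∀ j, i < j → s j = s' j) :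
    colLabel a s i = colLabel a s' i := by
  fin_cases i
  · simp [colLabel, h 1 (by decide), h 2 (by decide)]
  · simp [colLabel, h 2 (by decide)]
  · simp [colLabel]

theorem colLabel_congr_left {a a' : Fin 3 → X} {i : Fin 3} (h : ∀ j, i ≤ j → a j = a' j) :
    colLabel a s i = colLabel a' s i := by
  fin_cases i
  · simp [colLabel, h 0 (by decide), h 1 (by decide), h 2 (by decide)]
  · simp [colLabel, h 1 (by decide), h 2 (by decide)]
  · simp [colLabel, h 2 (by decide)]

theorem colLabel_injective {a a' : Fin 3 → X} {i : Fin 3} (h : ∀ j, i < j → a j = a' j)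
    (h' : colLabel a s i = colLabel a' s i) : a i = a' i := by
  fin_cases i
  · simp only [colLabel, h 1 (by decide), h 2 (by decide)] at h'
    exact actIf_injective _ _ (actIf_injective _ _ h')
  · simp only [colLabel, h 2 (by decide)] at h'
    exact actIf_injective _ _ h'
  · exact h'

theorem exists_colLabel_eq (i : Fin 3) (x : X) : ∃ v, colLabel (Function.update a i v) s i = x := by
  fin_cases i
  · obtain ⟨v, hv⟩ := ((actIf_surjective (s 2) (a 2)).comp (actIf_surjective (s 1) (a 1))) x
    exact ⟨v, by simpa [colLabel] using hv⟩
  · obtain ⟨v, hv⟩ := actIf_surjective (s 2) (a 2) x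
    exact ⟨v, by simpa [colLabel] using hv⟩
  · exact ⟨x, by simp [colLabel]⟩

theorem regLabel_injective {r r' : X} (h : regLabel r a s = regLabel r' a s) : r = r' :=
  actIf_injective _ _ (actIf_injective _ _ (actIf_injective _ _ h))

theorem exists_regLabel_eq (x : X) : ∃ r, regLabel r a s = x :=
  ((actIf_surjective (s 2) (a 2)).comp ((actIf_surjective (s 1) (a 1)).comp
    (actIf_surjective (s 0) (a 0)))) x

variable {t : Fin 3 → I}

/-- The faces of the cube `(r, a)` carry the colors at the corresponding crossings. -/
theorem rackCube_eq_square {i j : Fin 3} (hij : i < j)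
    (h : ∀ k, k ≠ i → k ≠ j → t k = cubeEnd (s k)) :
    rackCube r a t = rackSquare (regLabel r a (Function.update (Function.update s i false) j false))
        (colLabel a (Function.update s j false) i) (colLabel a s j) (t i) (t j) := by
  fin_cases i <;> fin_cases j <;> first | exact absurd hij (by decide) | skip
  · rw [rackCube_eq_square_two r a (h 2 (by decide) (by decide))]
    simp [regLabel, colLabel]
  · rw [rackCube_eq_square_one r a (h 1 (by decide) (by decide))]
    simp [regLabel, colLabel]
  · rw [rackCube_eq_square_zero r a (h 0 (by decide) (by decide))]
    simp [regLabel, colLabel]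

theorem rackCube_eq_edge (i : Fin 3) (h : ∀ k, k ≠ i → t k = cubeEnd (s k)) :
    rackCube r a t =
      rackEdge (regLabel r a (Function.update s i false)) (colLabel a s i) (t i) := by
  fin_cases i
  · rw [rackCube_eq_square_two r a (h 2 (by decide)),
      show t 1 = cubeEnd (s 1) from h 1 (by decide), rackSquare_right]
    simp [regLabel, colLabel, actIf_actIf (s 2)]
  · rw [rackCube_eq_square_two r a (h 2 (by decide)),
      show t 0 = cubeEnd (s 0) from h 0 (by decide), rackSquare_left]
    simp [regLabel, colLabel, actIf_actIf (s 2) (s 0)]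
  · rw [rackCube_eq_square_one r a (h 1 (by decide)),
      show t 0 = cubeEnd (s 0) from h 0 (by decide), rackSquare_left]
    simp [regLabel, colLabel, actIf_actIf (s 1)]

theorem rackCube_eq_vertex (h : ∀ k, t k = cubeEnd (s k)) :
    rackCube r a t = rackVertex (regLabel r a s) := by
  rw [rackCube_eq_edge r a s 0 fun k _ => h k, h 0, rackEdge_end, ← regLabel_update,
    Function.update_eq_self]

end Labels

/-! ### Strands in a disc -/

/-- A coordinate of a chart and another function with the same zero set have, up to orientation,
the same signs, if the function takes both signs. -/
theorem exists_sign_fst_eq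
    (hp : p ∈ e.source) (h0 : e p = 0) {h : Square → ℝ} (hc : ∀ᶠ z in 𝓝 p, ContinuousAt h z)
    (hz : ∀ᶠ z in 𝓝 p, h z = 0 ↔ (e z).1 = 0) (hpos : ∃ᶠ z in 𝓝 p, 0 < h z)
    (hneg : ∃ᶠ z in 𝓝 p, h z < 0) : ∃ o : ℝ, (o = 1 ∨ o = -1) ∧
      ∀ᶠ z in 𝓝 p, sign (e z).1 = sign (o * h z) := by
  obtain ⟨δ, hδ, h1, h2⟩ := exists_ball_subset_target hp h0 (hc.and hz)
  have hs : ∀ v ∈ planeBall δ, e (e.symm v) = v := fun v hv => e.right_inv (h1 hv)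
  have hev := eventually_mem_ball hp h0 hδ
  have hS : ∀ s : ℝ, s ≠ 0 → ∀ v ∈ ballSector δ s 0, ∀ w ∈ ballSector δ s 0,
      0 < h (e.symm v) → 0 < h (e.symm w) := by
    intro s hs0 v hv w hw
    refine (convex_ballSector δ s 0).isPreconnected.pos_of_ne_zero
      (f := fun v => h (e.symm v)) (fun v hv => ?_) (fun v hv => ?_) hv hw
    · exact ((h2 v hv.1).1.comp (e.symm.continuousAt (h1 hv.1))).continuousWithinAt
    · rw [Ne, (h2 v hv.1).2, hs v hv.1]
      have := hv.2.1 hs0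
      rintro h
      rw [h, mul_zero] at this
      exact this.false
  have mem : ∀ z, z ∈ e.source ∧ e z ∈ planeBall δ →
      e.symm (e z) = z ∧ (0 < (e z).1 → e z ∈ ballSector δ 1 0) ∧
      ((e z).1 < 0 → e z ∈ ballSector δ (-1) 0) := fun z hz =>
    ⟨e.left_inv hz.1, fun h => ⟨hz.2, by simpa, by simp⟩, fun h => ⟨hz.2, by simpa, by simp⟩⟩
  have nz : ∀ z, z ∈ e.source ∧ e z ∈ planeBall δ → (h z = 0 ↔ (e z).1 = 0) := by
    intro z hz
    have := (h2 (e z) hz.2).2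
    rwa [e.left_inv hz.1] at this
  obtain ⟨z1, p1, b1⟩ := (hpos.and_eventually hev).exists
  obtain ⟨z2, p2, b2⟩ := (hneg.and_eventually hev).exists
  have key : ∀ z w, z ∈ e.source ∧ e z ∈ planeBall δ → w ∈ e.source ∧ e w ∈ planeBall δ →
      ((0 < (e z).1 ∧ 0 < (e w).1) ∨ ((e z).1 < 0 ∧ (e w).1 < 0)) → 0 < h z → 0 < h w := by
    intro z w bz bw hzw hh
    have mz := mem z bz
    have mw := mem w bw
    rcases hzw with ⟨a, b⟩ | ⟨a, b⟩
    · have := hS 1 (by norm_num) _ (mz.2.1 a) _ (mw.2.1 b)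
      rw [mz.1, mw.1] at this
      exact this hh
    · have := hS (-1) (by norm_num) _ (mz.2.2 a) _ (mw.2.2 b)
      rw [mz.1, mw.1] at this
      exact this hh
  have n1 : (e z1).1 ≠ 0 := fun h => p1.ne' ((nz z1 b1).mpr h)
  have n2 : (e z2).1 ≠ 0 := fun h => p2.ne ((nz z2 b2).mpr h)
  rcases n1.lt_or_gt with c1 | c1
  · -- `h` is positive on the negative side
    have c2 : 0 < (e z2).1 := by
      rcases n2.lt_or_gt with c2 | c2
      · exact absurd (key z1 z2 b1 b2 (Or.inr ⟨c1, c2⟩) p1) p2.not_gt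
      · exact c2
    refine ⟨-1, Or.inr rfl, hev.mono fun z bz => ?_⟩
    rcases lt_trichotomy (e z).1 0 with a | a | a
    · have := key z1 z b1 bz (Or.inr ⟨c1, a⟩) p1
      rw [sign_neg a, sign_neg (by linarith)]
    · rw [a, (nz z bz).mpr a, mul_zero]
    · have : h z < 0 := by
        refine lt_of_le_of_ne (not_lt.mp fun hh => ?_) fun hh => a.ne' ((nz z bz).mp hh)
        exact p2.not_gt (key z z2 bz b2 (Or.inl ⟨a, c2⟩) hh)
      rw [sign_pos a, sign_pos (by linarith)]
  · have c2 : (e z2).1 < 0 := by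
      rcases n2.lt_or_gt with c2 | c2
      · exact c2
      · exact absurd (key z1 z2 b1 b2 (Or.inl ⟨c1, c2⟩) p1) p2.not_gt
    refine ⟨1, Or.inl rfl, hev.mono fun z bz => ?_⟩
    rcases lt_trichotomy (e z).1 0 with a | a | a
    · have : h z < 0 := by
        refine lt_of_le_of_ne (not_lt.mp fun hh => ?_) fun hh => a.ne ((nz z bz).mp hh)
        exact p2.not_gt (key z z2 bz b2 (Or.inr ⟨a, c2⟩) hh)
      rw [sign_neg a, sign_neg (by linarith)]
    · rw [a, (nz z bz).mpr a, mul_zero]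
    · have := key z1 z b1 bz (Or.inl ⟨c1, a⟩) p1
      rw [sign_pos a, sign_pos (by linarith)]

theorem exists_sign_snd_eq
    (hp : p ∈ e.source) (h0 : e p = 0) {h : Square → ℝ} (hc : ∀ᶠ z in 𝓝 p, ContinuousAt h z)
    (hz : ∀ᶠ z in 𝓝 p, h z = 0 ↔ (e z).2 = 0) (hpos : ∃ᶠ z in 𝓝 p, 0 < h z)
    (hneg : ∃ᶠ z in 𝓝 p, h z < 0) : ∃ o : ℝ, (o = 1 ∨ o = -1) ∧
      ∀ᶠ z in 𝓝 p, sign (e z).2 = sign (o * h z) :=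
  exists_sign_fst_eq (e := e.transHomeomorph (Homeomorph.prodComm ℝ ℝ)) (p := p) hp
    (by simp [h0]) hc hz hpos hneg

namespace LinkDiagram

theorem eventually_rightIndex_eq (hp : p ∈ D.curve) (hp' : p ∉ D.crossings) :
    ∀ᶠ z in 𝓝 p, z ∈ D.curve → D.rightIndex z = D.rightIndex p := by
  filter_upwards [(D.isRightIndex hp hp').1.eventually_nhds,
    eventually_notMem_crossings hp'] with z hz hzx hzc
  exact (D.isRightIndex hzc hzx).eq hz

theorem frequently_notMem_curve (D : LinkDiagram) (p : Square) : ∃ᶠ z in 𝓝 p, z ∉ D.curve := by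
  by_cases hp : p ∈ D.curve
  · by_cases hx : p ∈ D.crossings
    · obtain ⟨e, he⟩ := D.crossing_chart p hx
      rw [Filter.frequently_iff]
      intro N hN
      obtain ⟨z, hz, hzN, h1, h2⟩ := exists_sign_chart_eq he.mem_source he.map_center 1 1 hN
      refine ⟨z, hzN, ?_⟩
      rw [he.mem_curve_iff z hz, not_or]
      exact ⟨(sign_eq_one_iff.mp h1).ne', (sign_eq_one_iff.mp h2).ne'⟩
    · exact (D.isRightIndex hp hx).2.1.mono fun z hz => hz.1
  · exact (D.eventually_notMem_curve hp).frequently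

end LinkDiagram

/-- In the set `B` with interior `V`, the diagram `D` consists of at most three strands, the zero
sets of the functions `h 0`, `h 1` and `h 2`, in this order from the bottom to the top. -/
structure StrandDisc (D : LinkDiagram) (V B : Set Square) (h : Fin 3 → Square → ℝ) : Prop where
  isOpen : IsOpen V
  subset : V ⊆ B
  subset_closure : B ⊆ closure V
  isPreconnected : IsPreconnected V
  continuousAt : ∀ i, ∀ z ∈ B, ContinuousAt (h i) z
  mem_curve_iff : ∀ z ∈ B, z ∈ D.curve ↔ ∃ i, h i z = 0
  mem_crossings_iff : ∀ z ∈ B, z ∈ D.crossings ↔ ∃ i j, i < j ∧ h i z = 0 ∧ h j z = 0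
  overStrand_iff : ∀ z ∈ V, ∀ i j, i < j → h i z = 0 → h j z = 0 →
    ∀ᶠ w in 𝓝 z, w ∈ D.overStrand z ↔ h j w = 0
  isPreconnected_strand : ∀ i, IsPreconnected {z | z ∈ V ∧ h i z = 0}
  exists_ne_zero : ∀ z ∈ B, ∃ i, h i z ≠ 0
  crossings_subset : ∀ z ∈ B, z ∈ D.crossings → z ∈ V
  mem_closure : ∀ i, ∀ z ∈ B, h i z = 0 → z ∈ closure {w | w ∈ V ∧ h i w = 0}
  pos : ∀ i, ∀ z ∈ V, h i z = 0 → ∃ᶠ w in 𝓝 z, 0 < h i w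
  neg : ∀ i, ∀ z ∈ V, h i z = 0 → ∃ᶠ w in 𝓝 z, h i w < 0

namespace StrandDisc

variable {h : Fin 3 → Square → ℝ} {i j : Fin 3}

theorem eventually_mem (S : StrandDisc D V B h) (hp : p ∈ V) : ∀ᶠ z in 𝓝 p, z ∈ V :=
  S.isOpen.eventually_mem hp

theorem eventually_ne_zero (S : StrandDisc D V B h) (hp : p ∈ B) (h0 : h i p ≠ 0) :
    ∀ᶠ z in 𝓝 p, h i z ≠ 0 := (S.continuousAt i p hp).eventually_ne h0

theorem ne_zero_of_notMem_crossings (S : StrandDisc D V B h) (hp : p ∈ B) (hx : p ∉ D.crossings)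
    (h0 : h i p = 0) {k : Fin 3} (hk : k ≠ i) : h k p ≠ 0 := by
  intro hk0
  rw [S.mem_crossings_iff p hp] at hx
  rcases hk.lt_or_gt with hlt | hlt
  · exact hx ⟨_, _, hlt, hk0, h0⟩
  · exact hx ⟨_, _, hlt, h0, hk0⟩

theorem eventually_mem_curve_iff (S : StrandDisc D V B h) (hp : p ∈ B) (hx : p ∉ D.crossings)
    (h0 : h i p = 0) : ∀ᶠ z in 𝓝 p, z ∈ B → (z ∈ D.curve ↔ h i z = 0) := by
  have h1 : ∀ᶠ z in 𝓝 p, ∀ k, k ≠ i → h k z ≠ 0 := eventually_all.mpr fun k => by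
      by_cases hk : k = i
      · exact .of_forall fun _ h => absurd hk h
      · exact (S.eventually_ne_zero hp (S.ne_zero_of_notMem_crossings hp hx h0 hk)).mono
          fun _ h _ => h
  filter_upwards [h1] with z hz hzB
  rw [S.mem_curve_iff z hzB]
  refine ⟨fun ⟨k, hk⟩ => ?_, fun h => ⟨i, h⟩⟩
  by_contra hne
  exact hz k (fun h => hne (h ▸ hk)) hk

/-- Near a point of a strand, the strand has one of its two orientations. -/
theorem exists_sign_strand (S : StrandDisc D V B h) (hp : p ∈ V) (hx : p ∉ D.crossings)
    (h0 : h i p = 0) : ∃ o : ℝ, (o = 1 ∨ o = -1) ∧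
      ∀ᶠ z in 𝓝 p, D.strandSign p z = sign (o * h i z) := by
  have hc := (S.mem_curve_iff p (S.subset hp)).mpr ⟨i, h0⟩
  obtain ⟨e, he⟩ := D.regular_chart p hc hx
  obtain ⟨o, ho, hev⟩ := exists_sign_fst_eq he.mem_source he.map_center
    ((S.eventually_mem hp).mono fun z hz => S.continuousAt i z (S.subset hz)) (by
      filter_upwards [S.eventually_mem_curve_iff (S.subset hp) hx h0, S.eventually_mem hp,
        e.open_source.eventually_mem he.mem_source] with z z1 z2 z3
      rw [← z1 (S.subset z2), he.mem_curve_iff z z3]) (S.pos i p hp h0) (S.neg i p hp h0)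
  refine ⟨o, ho, ?_⟩
  filter_upwards [hev, e.open_source.eventually_mem he.mem_source] with z z1 z2
  rw [← D.sign_chart_eq he z2, z1]

theorem eventually_zero_iff (S : StrandDisc D V B h) (hp : p ∈ V) (hij : i < j) (hi : h i p = 0)
    (hj : h j p = 0) (he : D.IsCrossingChart p e) :
    ∀ᶠ z in 𝓝 p, (h i z = 0 ↔ (e z).1 = 0) ∧ (h j z = 0 ↔ (e z).2 = 0) := by
  have h1 : ∀ᶠ z in 𝓝 p, ∀ k, k ≠ i → k ≠ j → h k z ≠ 0 := eventually_all.mpr fun k => by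
      by_cases hk : k ≠ i ∧ k ≠ j
      · have : h k p ≠ 0 := by
          intro hk0
          obtain ⟨l, hl⟩ := S.exists_ne_zero p (S.subset hp)
          have : l = i ∨ l = j ∨ l = k := by
            have := hij.ne; have h1 := hk.1; have h2 := hk.2
            clear * - this h1 h2
            revert i j k l; decide
          rcases this with rfl | rfl | rfl <;> contradiction
        exact (S.eventually_ne_zero (S.subset hp) this).mono fun _ h _ _ => h
      · exact .of_forall fun _ h h' => absurd ⟨h, h'⟩ hk
  filter_upwards [h1, S.eventually_mem hp, e.open_source.eventually_mem he.mem_source,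
    S.overStrand_iff p hp i j hij hi hj, D.eventually_mem_crossings_eq p] with z z1 z2 z3 z4 z5
  have hz2 : h j z = 0 ↔ (e z).2 = 0 := by rw [← z4, he.mem_over_iff z z3]
  have hc := he.mem_curve_iff z z3
  have hc' := S.mem_curve_iff z (S.subset z2)
  refine ⟨⟨fun hz => ?_, fun hz => ?_⟩, hz2⟩
  · rcases hc.mp (hc'.mpr ⟨i, hz⟩) with h | h
    · exact h
    · have := z5 ((S.mem_crossings_iff z (S.subset z2)).mpr ⟨i, j, hij, hz, hz2.mpr h⟩)
      rw [this, he.map_center]; rfl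
  · obtain ⟨k, hk⟩ := hc'.mp (hc.mpr (Or.inl hz))
    by_cases hki : k = i
    · exact hki ▸ hk
    · by_cases hkj : k = j
      · have : e z = e p := by
          rw [he.map_center]; exact Prod.ext hz (hz2.mp (hkj ▸ hk))
        rw [e.injOn z3 he.mem_source this, hi]
      · exact absurd hk (z1 k hki hkj)

theorem exists_sign_crossing (S : StrandDisc D V B h) (hp : p ∈ V) (hij : i < j) (hi : h i p = 0)
    (hj : h j p = 0) (he : D.IsCrossingChart p e) :
    (∃ o : ℝ, (o = 1 ∨ o = -1) ∧ ∀ᶠ z in 𝓝 p, sign (e z).1 = sign (o * h i z)) ∧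
    ∃ o : ℝ, (o = 1 ∨ o = -1) ∧ ∀ᶠ z in 𝓝 p, sign (e z).2 = sign (o * h j z) := by
  have h1 := S.eventually_zero_iff hp hij hi hj he
  exact ⟨exists_sign_fst_eq he.mem_source he.map_center
    ((S.eventually_mem hp).mono fun z hz => S.continuousAt i z (S.subset hz))
    (h1.mono fun z hz => hz.1) (S.pos i p hp hi) (S.neg i p hp hi),
    exists_sign_snd_eq he.mem_source he.map_center
    ((S.eventually_mem hp).mono fun z hz => S.continuousAt j z (S.subset hz))
    (h1.mono fun z hz => hz.2) (S.pos j p hp hj) (S.neg j p hp hj)⟩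

/-- Near a crossing, there are points on all four ends of the two strands. -/
theorem frequently_crossing (S : StrandDisc D V B h) (hp : p ∈ V) (hij : i < j) (hi : h i p = 0)
    (hj : h j p = 0) (he : D.IsCrossingChart p e)
    (s : ℝ) (hs : s = 1 ∨ s = -1) :
    (∃ᶠ z in 𝓝 p, z ∈ V ∧ h i z = 0 ∧ z ∉ D.crossings ∧ (e z).1 = 0 ∧ 0 < s * (e z).2) ∧
    ∃ᶠ z in 𝓝 p, z ∈ V ∧ h j z = 0 ∧ z ∉ D.crossings ∧ (e z).2 = 0 ∧ 0 < s * (e z).1 := by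
  have hs2 : s * s = 1 := by rcases hs with rfl | rfl <;> norm_num
  have habs : |s| = 1 := by rcases hs with rfl | rfl <;> norm_num
  have hev := ((S.eventually_zero_iff hp hij hi hj he).and (S.eventually_mem hp)).and
    (D.eventually_mem_crossings_eq p)
  constructor <;> rw [Filter.frequently_iff] <;> intro N hN <;>
    obtain ⟨δ, hδ, h1, h2⟩ := exists_ball_subset_target he.mem_source he.map_center
      (hev.and hN)
  · have hv : ((0, s * (δ / 2)) : ℝ × ℝ) ∈ planeBall δ := by
      rw [mem_ball_prod]; simp [abs_mul, habs, abs_half_lt hδ, hδ]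
    obtain ⟨⟨⟨⟨a1, -⟩, a2⟩, a3⟩, a4⟩ := h2 _ hv
    have hr := e.right_inv (h1 hv)
    refine ⟨_, a4, a2, a1.mpr (by rw [hr]), fun h => ?_, by rw [hr], ?_⟩
    · rw [a3 h, he.map_center] at hr
      have := congrArg (fun v : ℝ × ℝ => s * v.2) hr
      simp only [Prod.snd_zero, ← mul_assoc, hs2] at this
      linarith
    · rw [hr]; simp only [← mul_assoc, hs2]; linarith
  · have hv : ((s * (δ / 2), 0) : ℝ × ℝ) ∈ planeBall δ := by
      rw [mem_ball_prod]; simp [abs_mul, habs, abs_half_lt hδ, hδ]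
    obtain ⟨⟨⟨⟨-, a1⟩, a2⟩, a3⟩, a4⟩ := h2 _ hv
    have hr := e.right_inv (h1 hv)
    refine ⟨_, a4, a2, a1.mpr (by rw [hr]), fun h => ?_, by rw [hr], ?_⟩
    · rw [a3 h, he.map_center] at hr
      have := congrArg (fun v : ℝ × ℝ => s * v.1) hr
      simp only [Prod.fst_zero, ← mul_assoc, hs2] at this
      linarith
    · rw [hr]; simp only [← mul_assoc, hs2]; linarith

theorem frequently_strand (S : StrandDisc D V B h) (hp : p ∈ V) (hi : h i p = 0) :
    ∃ᶠ z in 𝓝 p, z ∈ V ∧ h i z = 0 ∧ z ∉ D.crossings := by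
  by_cases hx : p ∈ D.crossings
  · obtain ⟨e, he⟩ := D.crossing_chart p hx
    obtain ⟨k, l, hkl, hk, hl⟩ := (S.mem_crossings_iff p (S.subset hp)).mp hx
    obtain ⟨f1, f2⟩ := S.frequently_crossing hp hkl hk hl he 1 (Or.inl rfl)
    obtain ⟨m, hm⟩ := S.exists_ne_zero p (S.subset hp)
    have : i = k ∨ i = l := by
      have := hkl.ne
      have h1 : m ≠ k := fun h => hm (h ▸ hk)
      have h2 : m ≠ l := fun h => hm (h ▸ hl)
      have h3 : m ≠ i := fun h => hm (h ▸ hi)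
      clear * - this h1 h2 h3
      revert i k l m; decide
    rcases this with rfl | rfl
    · exact f1.mono fun z hz => ⟨hz.1, hz.2.1, hz.2.2.1⟩
    · exact f2.mono fun z hz => ⟨hz.1, hz.2.1, hz.2.2.1⟩
  · intro hev
    exact hev.self_of_nhds ⟨hp, hi, hx⟩

theorem orientation_unique (S : StrandDisc D V B h) (hp : p ∈ V) (hi : h i p = 0) {o o' : ℝ}
    (ho : o = 1 ∨ o = -1) (ho' : o' = 1 ∨ o' = -1)
    (hev : ∀ᶠ z in 𝓝 p, sign (o * h i z) = sign (o' * h i z)) : o = o' := by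
  obtain ⟨z, hz, hz'⟩ := ((S.pos i p hp hi).and_eventually hev).exists
  rcases ho with rfl | rfl <;> rcases ho' with rfl | rfl
  · rfl
  · rw [sign_pos (by linarith), sign_neg (by linarith)] at hz'
    exact absurd hz' (by decide)
  · rw [sign_neg (by linarith), sign_pos (by linarith)] at hz'
    exact absurd hz' (by decide)
  · rfl

/-- Each strand has an orientation. -/
theorem exists_orientation (S : StrandDisc D V B h) (C : ShadowColoring X D) (i : Fin 3) :
    ∃ o : ℝ, (o = 1 ∨ o = -1) ∧ ∀ p ∈ V, h i p = 0 → p ∉ D.crossings →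
      ∀ᶠ z in 𝓝 p, D.strandSign p z = sign (o * h i z) := by
  classical
  have h1 : ∀ p : Square, ∃ o : ℝ, (o = 1 ∨ o = -1) ∧ (p ∈ V → h i p = 0 → p ∉ D.crossings →
      ∀ᶠ z in 𝓝 p, D.strandSign p z = sign (o * h i z)) := by
    intro p
    by_cases hp : p ∈ V ∧ h i p = 0 ∧ p ∉ D.crossings
    · obtain ⟨o, ho, hev⟩ := S.exists_sign_strand hp.1 hp.2.2 hp.2.1
      exact ⟨o, ho, fun _ _ _ => hev⟩
    · exact ⟨1, Or.inl rfl, fun a b c => absurd ⟨a, b, c⟩ hp⟩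
  choose g hg hg' using h1
  let T : Set Square := {z | z ∈ V ∧ h i z = 0 ∧ z ∉ D.crossings}
  by_cases hT : T.Nonempty
  · obtain ⟨p₀, hp₀⟩ := hT
    refine ⟨g p₀, hg p₀, fun p hp hp0 hpx => ?_⟩
    have : g p₀ = g p := by
      refine (S.isPreconnected_strand i).eq_of_eventually_eq (T := T)
        (fun z hz => ⟨hz.1, hz.2.1⟩) (fun z hz => ?_) (fun q hq => ?_) hp₀ ⟨hp, hp0, hpx⟩
      · exact mem_closure_iff_frequently.mpr (S.frequently_strand hz.1 hz.2)
      · obtain ⟨hqV, hq0⟩ := hq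
        have hqc := (S.mem_curve_iff q (S.subset hqV)).mpr ⟨i, hq0⟩
        by_cases hqx : q ∈ D.crossings
        · obtain ⟨e, he⟩ := D.crossing_chart q hqx
          obtain ⟨m, r, a, hform⟩ := C.exists_crossForm hqx he
          obtain ⟨k, l, hkl, hk, hl⟩ := (S.mem_crossings_iff q (S.subset hqV)).mp hqx
          have hzero := S.eventually_zero_iff hqV hkl hk hl he
          obtain ⟨⟨o, ho, hev⟩, o', ho', hev'⟩ := S.exists_sign_crossing hqV hkl hk hl he
          obtain ⟨n, hn⟩ := S.exists_ne_zero q (S.subset hqV)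
          have hikl : i = k ∨ i = l := by
            have := hkl.ne
            have h1 : n ≠ k := fun h => hn (h ▸ hk)
            have h2 : n ≠ l := fun h => hn (h ▸ hl)
            have h3 : n ≠ i := fun h => hn (h ▸ hq0)
            clear * - this h1 h2 h3
            revert i k l n; decide
          rcases hikl with rfl | rfl
          · refine ⟨o, ?_⟩
            filter_upwards [hform.eventually_nhds, hev.eventually_nhds, hzero] with z z1 z2 z3 hzT
            obtain ⟨hzV, hz0, hzx⟩ := hzT
            have hne : (e z).2 ≠ 0 := fun h => hzx ((S.mem_crossings_iff z (S.subset hzV)).mpr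
              ⟨_, _, hkl, hz0, z3.2.mpr h⟩)
            have hr := ((CrossForm.right_eq C z1 hzx).1 (z3.1.mp hz0) hne).2.2.1
            refine S.orientation_unique hzV hz0 (hg z) ho ?_
            filter_upwards [hr, z2, hg' z hzV hz0 hzx] with w w1 w2 w3
            rw [← w3, ← w2, w1]
          · refine ⟨o', ?_⟩
            filter_upwards [hform.eventually_nhds, hev'.eventually_nhds, hzero] with z z1 z2 z3 hzT
            obtain ⟨hzV, hz0, hzx⟩ := hzT
            have hne : (e z).1 ≠ 0 := fun h => hzx ((S.mem_crossings_iff z (S.subset hzV)).mpr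
              ⟨_, _, hkl, z3.1.mpr h, hz0⟩)
            have hr := ((CrossForm.right_eq C z1 hzx).2 (z3.2.mp hz0) hne).2.2.1
            refine S.orientation_unique hzV hz0 (hg z) ho' ?_
            filter_upwards [hr, z2, hg' z hzV hz0 hzx] with w w1 w2 w3
            rw [← w3, ← w2, w1]
        · refine ⟨g q, ?_⟩
          filter_upwards [(hg' q hqV hq0 hqx).eventually_nhds,
            D.eventually_rightIndex_eq hqc hqx] with z z1 z2 hzT
          obtain ⟨hzV, hz0, hzx⟩ := hzT
          have hs := strandSign_congr (z2 ((S.mem_curve_iff z (S.subset hzV)).mpr ⟨i, hz0⟩))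
          refine S.orientation_unique hzV hz0 (hg z) (hg q) ?_
          filter_upwards [z1, hg' z hzV hz0 hzx] with w w1 w3
          rw [← w3, ← w1, hs]
    rw [this]
    exact hg' p hp hp0 hpx
  · exact ⟨1, Or.inl rfl, fun p hp hp0 hpx => absurd ⟨p, hp, hp0, hpx⟩ hT⟩

end StrandDisc

/-- A diagram in a disc as in `StrandDisc`, where the left sides of the strands are the sides on
which the functions `h i` are positive. -/
structure OrientedStrandDisc (D : LinkDiagram) (V B : Set Square) (h : Fin 3 → Square → ℝ) : Prop
    extends StrandDisc D V B h where
  strandSign_eq : ∀ i, ∀ p ∈ V, h i p = 0 → p ∉ D.crossings →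
    ∀ᶠ z in 𝓝 p, D.strandSign p z = sign (h i z)

variable {h : Fin 3 → Square → ℝ}

theorem StrandDisc.exists_oriented (S : StrandDisc D V B h) (C : ShadowColoring X D) :
    ∃ o : Fin 3 → ℝ, (∀ i, o i = 1 ∨ o i = -1) ∧ (∀ i, (∀ z ∈ V, h i z ≠ 0) → o i = 1) ∧
      OrientedStrandDisc D V B fun i z => o i * h i z := by
  have h1 : ∀ i, ∃ o : ℝ, (o = 1 ∨ o = -1) ∧ ((∀ z ∈ V, h i z ≠ 0) → o = 1) ∧
      ∀ p ∈ V, h i p = 0 → p ∉ D.crossings →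
        ∀ᶠ z in 𝓝 p, D.strandSign p z = sign (o * h i z) := fun i => by
    by_cases hi : ∀ z ∈ V, h i z ≠ 0
    · exact ⟨1, Or.inl rfl, fun _ => rfl, fun p hp h0 => absurd h0 (hi p hp)⟩
    · obtain ⟨o, ho, ho'⟩ := S.exists_orientation C i
      exact ⟨o, ho, fun hh => absurd hh hi, ho'⟩
  choose o ho ho1 ho' using h1
  have hne : ∀ i, o i ≠ 0 := fun i => by rcases ho i with h | h <;> rw [h] <;> norm_num
  have hz : ∀ i z, o i * h i z = 0 ↔ h i z = 0 := fun i z => by simp [hne i]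
  refine ⟨o, ho, ho1, ⟨⟨S.isOpen, S.subset, S.subset_closure, S.isPreconnected, fun i z hzB =>
    (S.continuousAt i z hzB).const_mul (o i), ?_, ?_, ?_, ?_, ?_, S.crossings_subset, ?_, ?_, ?_⟩,
      ?_⟩⟩
  · simpa only [hz] using S.mem_curve_iff
  · simpa only [hz] using S.mem_crossings_iff
  · simpa only [hz] using S.overStrand_iff
  · simpa only [hz] using S.isPreconnected_strand
  · simpa only [Ne, hz] using S.exists_ne_zero
  · simpa only [hz] using S.mem_closure
  · intro i z hzV h0
    rw [hz] at h0
    rcases ho i with h | h <;> rw [h]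
    · simpa using S.pos i z hzV h0
    · simpa using S.neg i z hzV h0
  · intro i z hzV h0
    rw [hz] at h0
    rcases ho i with h | h <;> rw [h]
    · simpa using S.neg i z hzV h0
    · simpa using S.pos i z hzV h0
  · intro i p hp h0 hpx
    rw [hz] at h0
    exact ho' i p hp h0 hpx

/-- The signs of the coordinates of a crossing chart are given by the oriented strands. -/
theorem OrientedStrandDisc.sign_crossing (S : OrientedStrandDisc D V B h) (C : ShadowColoring X D)
    (hp : p ∈ V) {i j : Fin 3} (hij : i < j) (hi : h i p = 0) (hj : h j p = 0)
    (he : D.IsCrossingChart p e) :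
    ∀ᶠ z in 𝓝 p, sign (e z).1 = sign (h i z) ∧ sign (e z).2 = sign (h j z) := by
  have hpx := (S.mem_crossings_iff p (S.subset hp)).mpr ⟨i, j, hij, hi, hj⟩
  obtain ⟨m, r, a, hform⟩ := C.exists_crossForm hpx he
  have hzero := S.eventually_zero_iff hp hij hi hj he
  obtain ⟨⟨o, ho, hev⟩, o', ho', hev'⟩ := S.exists_sign_crossing hp hij hi hj he
  have h1 : o = 1 := by
    obtain ⟨z, hzT, (z1 : ∀ᶠ w in 𝓝 z, _), (z2 : ∀ᶠ w in 𝓝 z, _), z3⟩ :=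
      ((S.frequently_strand hp hi).and_eventually ((hform.eventually_nhds).and
        ((hev.eventually_nhds).and hzero))).exists
    obtain ⟨hzV, hz0, hzx⟩ := hzT
    have hne : (e z).2 ≠ 0 := fun h => hzx ((S.mem_crossings_iff z (S.subset hzV)).mpr
      ⟨_, _, hij, hz0, z3.2.mpr h⟩)
    have hr := ((CrossForm.right_eq C z1 hzx).1 (z3.1.mp hz0) hne).2.2.1
    refine S.orientation_unique hzV hz0 ho (Or.inl rfl) ?_
    filter_upwards [hr, z2, S.strandSign_eq i z hzV hz0 hzx] with w w1 w2 w3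
    rw [one_mul, ← w3, ← w2, w1]
  have h2 : o' = 1 := by
    obtain ⟨z, hzT, (z1 : ∀ᶠ w in 𝓝 z, _), (z2 : ∀ᶠ w in 𝓝 z, _), z3⟩ :=
      ((S.frequently_strand hp hj).and_eventually ((hform.eventually_nhds).and
        ((hev'.eventually_nhds).and hzero))).exists
    obtain ⟨hzV, hz0, hzx⟩ := hzT
    have hne : (e z).1 ≠ 0 := fun h => hzx ((S.mem_crossings_iff z (S.subset hzV)).mpr
      ⟨_, _, hij, z3.1.mpr h, hz0⟩)
    have hr := ((CrossForm.right_eq C z1 hzx).2 (z3.2.mp hz0) hne).2.2.1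
    refine S.orientation_unique hzV hz0 ho' (Or.inl rfl) ?_
    filter_upwards [hr, z2, S.strandSign_eq j z hzV hz0 hzx] with w w1 w2 w3
    rw [one_mul, ← w3, ← w2, w1]
  filter_upwards [hev, hev'] with z z1 z2
  rw [z1, z2, h1, h2, one_mul, one_mul]
  exact ⟨rfl, rfl⟩

/-! ### Colorings of strands in a disc -/

section NormalForm

variable {h : Fin 3 → Square → ℝ} {i j : Fin 3}

/-- The strands on whose left side the point `z` is. -/
noncomputable def sides (h : Fin 3 → Square → ℝ) (z : Square) : Fin 3 → Bool :=
  fun i => decide (0 < h i z)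

/-- The number of strands on whose left side a point is. -/
def sideCount (s : Fin 3 → Bool) : ℤ := ∑ i, if s i then 1 else 0

theorem sideCount_update (s : Fin 3 → Bool) (i : Fin 3) (b : Bool) :
    sideCount (Function.update s i b) =
      sideCount (Function.update s i false) + if b then 1 else 0 := by
  fin_cases i <;> simp only [sideCount, Fin.sum_univ_three] <;> simp <;> ring

theorem StrandDisc.eventually_sides_eq (S : StrandDisc D V B h) (hp : p ∈ B) (h0 : h i p ≠ 0) :
    ∀ᶠ z in 𝓝 p, sides h z i = sides h p i := by
  rcases h0.lt_or_gt with hlt | hlt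
  · filter_upwards [(S.continuousAt i p hp).eventually_lt_const hlt] with z hz
    simp [sides, hz.not_gt, hlt.not_gt]
  · filter_upwards [(S.continuousAt i p hp).eventually_const_lt hlt] with z hz
    simp [sides, hz, hlt]

theorem sides_of_zero (h0 : h i p = 0) : sides h p i = false := by simp [sides, h0]

theorem update_sides_of_zero (h0 : h i p = 0) :
    Function.update (sides h p) i false = sides h p := by
  rw [← sides_of_zero (h := h) h0, Function.update_eq_self]

/-- Near a point of a strand which is not a crossing, only the side of this strand changes. -/
theorem StrandDisc.eventually_sides_eq_update (S : StrandDisc D V B h) (hp : p ∈ B)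
    (hx : p ∉ D.crossings) (h0 : h i p = 0) :
    ∀ᶠ z in 𝓝 p, sides h z = Function.update (sides h p) i (decide (0 < h i z)) := by
  have h1 : ∀ᶠ z in 𝓝 p, ∀ k, k ≠ i → sides h z k = sides h p k := eventually_all.mpr fun k => by
      by_cases hk : k = i
      · exact .of_forall fun _ h => absurd hk h
      · exact (S.eventually_sides_eq hp (S.ne_zero_of_notMem_crossings hp hx h0 hk)).mono
          fun _ h _ => h
  filter_upwards [h1] with z hz
  funext k
  by_cases hk : k = i
  · subst hk; simp [sides]
  · rw [hz k hk, Function.update_of_ne hk]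

theorem StrandDisc.ne_zero_third (S : StrandDisc D V B h) (hp : p ∈ B) (hij : i ≠ j)
    (hi : h i p = 0) (hj : h j p = 0) {k : Fin 3} (hki : k ≠ i) (hkj : k ≠ j) : h k p ≠ 0 := by
  intro hk0
  obtain ⟨l, hl⟩ := S.exists_ne_zero p hp
  have : l = i ∨ l = j ∨ l = k := by
    clear * - hij hki hkj
    revert i j k l; decide
  rcases this with rfl | rfl | rfl <;> contradiction

theorem StrandDisc.eventually_sides_eq_update_update (S : StrandDisc D V B h) (hp : p ∈ B)
    (hij : i ≠ j) (hi : h i p = 0) (hj : h j p = 0) :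
    ∀ᶠ z in 𝓝 p, sides h z = Function.update (Function.update (sides h p) j (decide (0 < h j z)))
      i (decide (0 < h i z)) := by
  have h1 : ∀ᶠ z in 𝓝 p, ∀ k, k ≠ i → k ≠ j → sides h z k = sides h p k :=
    eventually_all.mpr fun k => by
      by_cases hk : k ≠ i ∧ k ≠ j
      · exact (S.eventually_sides_eq hp (S.ne_zero_third hp hij hi hj hk.1 hk.2)).mono
          fun _ h _ _ => h
      · exact .of_forall fun _ h h' => absurd ⟨h, h'⟩ hk
  filter_upwards [h1] with z hz
  funext k
  by_cases hki : k = i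
  · subst hki; simp [sides]
  · by_cases hkj : k = j
    · subst hkj; rw [Function.update_of_ne hki]; simp [sides]
    · rw [hz k hki hkj, Function.update_of_ne hki, Function.update_of_ne hkj]

/-- The colors of the strand `i` in the interior of the disc are given by the labels `a`. -/
def StrandColored (C : ShadowColoring X D) (V : Set Square) (h : Fin 3 → Square → ℝ) (a : Fin 3 → X)
    (i : Fin 3) : Prop :=
  ∀ z ∈ V, h i z = 0 → (∀ j, i < j → h j z ≠ 0) → C.col z = colLabel a (sides h z) i

/-- The normalized color of the strand `i` is locally constant. -/
theorem OrientedStrandDisc.exists_eventually_col (S : OrientedStrandDisc D V B h)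
    (C : ShadowColoring X D) {a : Fin 3 → X} (ha : ∀ j, i < j → StrandColored C V h a j)
    (hp : p ∈ V) (h0 : h i p = 0) : ∃ v, (∀ᶠ z in 𝓝 p, z ∈ V → h i z = 0 → z ∉ D.crossings →
      C.col z = colLabel (Function.update a i v) (sides h z) i) ∧
      ((∀ j, i < j → h j p ≠ 0) → C.col p = colLabel (Function.update a i v) (sides h p) i) := by
  have hpB := S.subset hp
  have hpc := (S.mem_curve_iff p hpB).mpr ⟨i, h0⟩
  by_cases hx : p ∈ D.crossings
  · by_cases hj : ∃ j, i < j ∧ h j p = 0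
    · -- the strand `i` is the under-strand
      obtain ⟨j, hij, hj0⟩ := hj
      obtain ⟨e, he⟩ := D.crossing_chart p hx
      obtain ⟨m, r, α, hform⟩ := C.exists_crossForm hx he
      obtain ⟨v, hv⟩ := exists_colLabel_eq a (Function.update (sides h p) j false) i α
      refine ⟨v, ?_, fun hn => absurd hj0 (hn j hij)⟩
      have hcolp : C.col p = colLabel a (sides h p) j := ha j hij p hp hj0 fun k hk hk0 =>
        S.ne_zero_third hpB hij.ne h0 hj0 (hij.trans hk).ne' hk.ne' hk0
      filter_upwards [hform, S.sign_crossing C hp hij h0 hj0 he, S.eventually_zero_iff hp hij h0 hj0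
        he,
        S.eventually_sides_eq_update_update hpB hij.ne h0 hj0] with z z1 z2 z3 z4 hzV hz0 hzx
      have hne : (e z).2 ≠ 0 := fun hh => hzx ((S.mem_crossings_iff z (S.subset hzV)).mpr
        ⟨_, _, hij, hz0, z3.2.mpr hh⟩)
      have hs : colLabel (Function.update a i v) (sides h z) i = colLabel (Function.update a i v)
          (Function.update (sides h p) j (decide (0 < h j z))) i := by
        refine colLabel_congr _ fun k hk => ?_
        rw [z4, Function.update_of_ne hk.ne']
      have hj' : colLabel (Function.update a i v) (sides h p) j = colLabel a (sides h p) j :=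
        colLabel_congr_left _ fun k hk => Function.update_of_ne (hij.trans_le hk).ne' _ _
      rw [hs, colLabel_update _ _ hij, hj', ← hcolp, hv, ← decide_pos_eq_of_sign z2.2]
      rcases hne.lt_or_gt with hlt | hlt
      · rw [z1.2.2.2.2.1 (z3.1.mp hz0) hlt, decide_eq_false hlt.not_gt]; rfl
      · rw [z1.2.2.2.2.2.1 (z3.1.mp hz0) hlt, decide_eq_true hlt]; rfl
    · -- the strand `i` is the over-strand
      have hn : ∀ j, i < j → h j p ≠ 0 := fun j hij hj0 => hj ⟨j, hij, hj0⟩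
      obtain ⟨k, l, hkl, hk0, hl0⟩ := (S.mem_crossings_iff p hpB).mp hx
      have hil : i = l := by
        by_contra hne
        have hik : i ≠ k := fun h => hn l (h ▸ hkl) hl0
        exact S.ne_zero_third hpB hkl.ne hk0 hl0 hik hne h0
      subst hil
      obtain ⟨v, hv⟩ := exists_colLabel_eq a (sides h p) i (C.col p)
      refine ⟨v, ?_, fun _ => hv.symm⟩
      filter_upwards [C.eventually_over_col_eq hx, S.overStrand_iff p hp k i hkl hk0 hl0,
        S.eventually_sides_eq_update_update hpB hkl.ne hk0 hl0] with z z1 z2 z3 hzV hz0 hzx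
      rw [z1 ((S.mem_curve_iff z (S.subset hzV)).mpr ⟨i, hz0⟩) (z2.mpr hz0), ← hv]
      refine colLabel_congr _ fun m hm => ?_
      rw [z3, Function.update_of_ne (hkl.trans hm).ne', Function.update_of_ne hm.ne']
  · obtain ⟨v, hv⟩ := exists_colLabel_eq a (sides h p) i (C.col p)
    refine ⟨v, ?_, fun _ => hv.symm⟩
    filter_upwards [C.eventually_col_eq hpc hx, S.eventually_sides_eq_update hpB hx h0]
      with z z1 z3 hzV hz0 hzx
    rw [z1 ((S.mem_curve_iff z (S.subset hzV)).mpr ⟨i, hz0⟩), ← hv]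
    refine colLabel_congr _ fun m hm => ?_
    rw [z3, Function.update_of_ne hm.ne']

theorem OrientedStrandDisc.exists_strandColored (S : OrientedStrandDisc D V B h)
    (C : ShadowColoring X D) {a : Fin 3 → X} (ha : ∀ j, i < j → StrandColored C V h a j) (x : X) :
    ∃ v, StrandColored C V h (Function.update a i v) i ∧ ((∀ z ∈ V, h i z ≠ 0) → v = x) := by
  by_cases hne : ∃ z ∈ V, h i z = 0
  · obtain ⟨p₀, hp₀, hp0⟩ := hne
    have hg : ∀ z, ∃ v, colLabel (Function.update a i v) (sides h z) i = C.col z :=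
      fun z => exists_colLabel_eq a _ i _
    choose g hg using hg
    have huniq : ∀ z v, C.col z = colLabel (Function.update a i v) (sides h z) i → g z = v := by
      intro z v hv
      have := colLabel_injective (i := i) (a := Function.update a i (g z))
        (a' := Function.update a i v) (sides h z) (fun j hj => by
          rw [Function.update_of_ne hj.ne', Function.update_of_ne hj.ne']) ((hg z).trans hv)
      simpa using this
    obtain ⟨p₁, hp₁V, hp₁0, hp₁x⟩ := (S.frequently_strand hp₀ hp0).exists
    have key : ∀ z, z ∈ V → h i z = 0 → z ∉ D.crossings → g z = g p₁ := by
      intro z hz hz0 hzx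
      refine (S.isPreconnected_strand i).eq_of_eventually_eq
        (T := {z | z ∈ V ∧ h i z = 0 ∧ z ∉ D.crossings}) (fun z hz => ⟨hz.1, hz.2.1⟩)
        (fun z hz => mem_closure_iff_frequently.mpr (S.frequently_strand hz.1 hz.2))
        (fun q hq => ?_) ⟨hz, hz0, hzx⟩ ⟨hp₁V, hp₁0, hp₁x⟩
      obtain ⟨v, hv, -⟩ := S.exists_eventually_col C ha hq.1 hq.2
      exact ⟨v, hv.mono fun z hz hzT => huniq z v (hz hzT.1 hzT.2.1 hzT.2.2)⟩
    refine ⟨g p₁, fun z hz hz0 hn => ?_, fun hh => absurd hp0 (hh p₀ hp₀)⟩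
    obtain ⟨v, hv, hv'⟩ := S.exists_eventually_col C ha hz hz0
    obtain ⟨w, hwT, hw⟩ := ((S.frequently_strand hz hz0).and_eventually hv).exists
    have := huniq w v (hw hwT.1 hwT.2.1 hwT.2.2)
    rw [key w hwT.1 hwT.2.1 hwT.2.2] at this
    rw [this]
    exact hv' hn
  · exact ⟨x, fun z hz hz0 => absurd ⟨z, hz, hz0⟩ hne, fun _ => rfl⟩

/-- There are labels for the colors of all strands. -/
theorem OrientedStrandDisc.exists_labels (S : OrientedStrandDisc D V B h) (C : ShadowColoring X D)
    (x : X) : ∃ a : Fin 3 → X, (∀ i, StrandColored C V h a i) ∧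
      ∀ i, (∀ z ∈ V, h i z ≠ 0) → a i = x := by
  have hcongr : ∀ {a a' : Fin 3 → X} {i : Fin 3}, (∀ j, i ≤ j → a j = a' j) →
      StrandColored C V h a i → StrandColored C V h a' i := by
    intro a a' i haa hc z hz hz0 hn
    rw [hc z hz hz0 hn, colLabel_congr_left _ haa]
  obtain ⟨a2, h2, e2⟩ := S.exists_strandColored C (i := 2) (a := fun _ => x)
    (fun j hj => absurd hj (by revert j; decide)) x
  obtain ⟨a1, h1, e1⟩ := S.exists_strandColored C (i := 1)
    (a := Function.update (fun _ => x) 2 a2)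
    (fun j hj => by
      obtain rfl : j = 2 := by revert j; decide
      exact h2) x
  have h2' : StrandColored C V h (Function.update (Function.update (fun _ => x) 2 a2) 1 a1) 2 :=
    hcongr (fun j hj => by
      rw [Function.update_of_ne (a := j) (a' := 1) (by rintro rfl; exact absurd hj (by decide))]) h2
  obtain ⟨a0, h0, e0⟩ := S.exists_strandColored C (i := 0)
    (a := Function.update (Function.update (fun _ => x) 2 a2) 1 a1)
    (fun j hj => by
      have : j = 1 ∨ j = 2 := by revert j; decide
      rcases this with rfl | rfl
      · exact h1
      · exact h2') x
  refine ⟨Function.update (Function.update (Function.update (fun _ => x) 2 a2) 1 a1) 0 a0,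
    fun i => ?_, fun i hi => ?_⟩
  · fin_cases i
    · exact h0
    · exact hcongr (fun j hj => by
        rw [Function.update_of_ne (a := j) (a' := 0) (by rintro rfl; exact absurd hj (by decide))])
          h1
    · exact hcongr (fun j hj => by
        rw [Function.update_of_ne (a := j) (a' := 0) (by rintro rfl; exact absurd hj (by decide))])
          h2'
  · fin_cases i
    · simpa using e0 hi
    · simpa using e1 hi
    · simpa using e2 hi

/-- The normalized index and color of the regions are locally constant. -/
theorem OrientedStrandDisc.exists_eventually_reg (S : OrientedStrandDisc D V B h)
    (C : ShadowColoring X D) {a : Fin 3 → X} (ha : ∀ i, StrandColored C V h a i) (hp : p ∈ V) :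
    ∃ v : ℤ × X, ∀ᶠ z in 𝓝 p, z ∉ D.curve → D.index z = v.1 + sideCount (sides h z) ∧
      C.reg z = regLabel v.2 a (sides h z) := by
  have hpB := S.subset hp
  by_cases hc : p ∈ D.curve
  · by_cases hx : p ∈ D.crossings
    · obtain ⟨e, he⟩ := D.crossing_chart p hx
      obtain ⟨m, r', α, hform⟩ := C.exists_crossForm hx he
      obtain ⟨i, j, hij, hi, hj⟩ := (S.mem_crossings_iff p hpB).mp hx
      have hsg := S.sign_crossing C hp hij hi hj he
      have hsides := S.eventually_sides_eq_update_update hpB hij.ne hi hj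
      have hcolp : C.col p = colLabel a (sides h p) j := ha j p hp hj fun k hk hk0 =>
        S.ne_zero_third hpB hij.ne hi hj (hij.trans hk).ne' hk.ne' hk0
      have hα : α = colLabel a (sides h p) i := by
        obtain ⟨z, hzT, z1, z2, z3⟩ := ((S.frequently_crossing hp hij hi hj he (-1)
          (Or.inr rfl)).1.and_eventually (hform.and (hsg.and hsides))).exists
        obtain ⟨hzV, hz0, hzx, hz1, hz2⟩ := hzT
        have hlt : (e z).2 < 0 := by linarith
        rw [← z1.2.2.2.2.1 hz1 hlt, ha i z hzV hz0 fun k hk =>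
          S.ne_zero_of_notMem_crossings (S.subset hzV) hzx hz0 hk.ne']
        refine colLabel_congr _ fun k hk => ?_
        rw [z3, Function.update_of_ne hk.ne', ← decide_pos_eq_of_sign z2.2, decide_eq_false
          hlt.not_gt,
          update_sides_of_zero hj]
      obtain ⟨r, hr⟩ := exists_regLabel_eq a (sides h p) r'
      refine ⟨(m - sideCount (sides h p), r), ?_⟩
      filter_upwards [hform, hsg, hsides] with z z1 z2 z3 hzc
      have hreg := (z1.eq_of_notMem hzc).2
      rw [decide_pos_eq_of_sign z2.1, decide_pos_eq_of_sign z2.2] at hreg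
      constructor
      · rw [z3, sideCount_update, Function.update_comm hij.ne', sideCount_update,
          update_sides_of_zero hi, update_sides_of_zero hj, ← decide_pos_eq_of_sign z2.1,
          ← decide_pos_eq_of_sign z2.2]
        rw [(z1.eq_of_notMem hzc).1]; ring
      · rw [hreg, z3, Function.update_comm hij.ne', regLabel_update, Function.update_comm hij.ne,
          regLabel_update, update_sides_of_zero hj, update_sides_of_zero hi, hr, hcolp, hα,
          colLabel_congr (s := Function.update (sides h p) i _) (s' := sides h p) a
            fun k hk => Function.update_of_ne (hij.trans hk).ne' _ _]
    · obtain ⟨i, hi⟩ := (S.mem_curve_iff p hpB).mp hc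
      obtain ⟨r, hr⟩ := exists_regLabel_eq a (sides h p) (C.rightColor p)
      have hcolp : C.col p = colLabel a (sides h p) i := ha i p hp hi fun k hk =>
        S.ne_zero_of_notMem_crossings hpB hx hi hk.ne'
      refine ⟨(D.rightIndex p - sideCount (sides h p), r), ?_⟩
      filter_upwards [C.strandForm hc hx, S.strandSign_eq i p hp hi hx,
        S.eventually_sides_eq_update hpB hx hi] with z z1 z2 z3 hzc
      have hreg := z1.reg_eq hzc
      rw [z3, sideCount_update, regLabel_update, update_sides_of_zero hi, hr, ← hcolp, hreg, z2]
      simp only [sign_eq_one_iff, and_true]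
      have hz := z2
      rw [strandSign, if_neg hzc] at hz
      rcases z1.2.2 hzc with ⟨b1, -⟩ | ⟨b1, -⟩
      · rw [if_pos b1, eq_comm, sign_eq_neg_one_iff] at hz
        rw [b1]; simp [hz.not_gt]
      · rw [if_neg (by omega), eq_comm, sign_eq_one_iff] at hz
        rw [b1]; simp [hz]; ring
  · obtain ⟨r, hr⟩ := exists_regLabel_eq a (sides h p) (C.reg p)
    refine ⟨(D.index p - sideCount (sides h p), r), ?_⟩
    have hs : ∀ᶠ z in 𝓝 p, ∀ k, sides h z k = sides h p k := eventually_all.mpr fun k =>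
      S.eventually_sides_eq hpB fun hk => hc ((S.mem_curve_iff p hpB).mpr ⟨k, hk⟩)
    filter_upwards [hs, C.eventually_reg_eq hc, D.index_locally_constant p hc] with z z1 z2 z3 _
    rw [show sides h z = sides h p from funext z1, z2, z3, hr]
    exact ⟨by ring, rfl⟩

/-- The index and the colors of a diagram in a disc are given by the sides of the strands, the
index `n` and the color `r` on the right of all strands, and the labels `a`. -/
structure NormalForm (C : ShadowColoring X D) (B : Set Square) (h : Fin 3 → Square → ℝ)
    (n : ℤ) (r : X) (a : Fin 3 → X) : Prop where
  region : ∀ z ∈ B, z ∉ D.curve → D.index z = n + sideCount (sides h z) ∧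
    C.reg z = regLabel r a (sides h z)
  strand : ∀ i, ∀ z ∈ B, h i z = 0 → z ∉ D.crossings →
    D.rightIndex z = n + sideCount (sides h z) ∧ C.rightColor z = regLabel r a (sides h z) ∧
      ∀ᶠ w in 𝓝 z, w ∈ B → D.strandSign z w = sign (h i w)
  col : ∀ i, ∀ z ∈ B, h i z = 0 → (∀ j, i < j → h j z ≠ 0) → C.col z = colLabel a (sides h z) i

/-- In a disc with totally ordered strands, a coloring is given by the labels of a 3-cube. The
labels of strands which do not meet the disc are arbitrary; they are set to `x`. -/
theorem OrientedStrandDisc.exists_normalForm (S : OrientedStrandDisc D V B h)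
    (C : ShadowColoring X D) (x : X) : ∃ n r a, NormalForm C B h n r a ∧
      ∀ i, (∀ z ∈ V, h i z ≠ 0) → a i = x := by
  obtain ⟨a, ha, hax⟩ := S.exists_labels C x
  have h1 : ∃ n r, ∀ z ∈ V, z ∉ D.curve → D.index z = n + sideCount (sides h z) ∧
      C.reg z = regLabel r a (sides h z) := by
    by_cases hne : ∃ z ∈ V, z ∉ D.curve
    · obtain ⟨p₀, hp₀, hc₀⟩ := hne
      have hg : ∀ z, ∃ r, regLabel r a (sides h z) = C.reg z := fun z => exists_regLabel_eq _ _ _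
      choose g hg using hg
      refine ⟨D.index p₀ - sideCount (sides h p₀), g p₀, fun z hz hzc => ?_⟩
      have key := S.isPreconnected.eq_of_eventually_eq (T := {z | z ∈ V ∧ z ∉ D.curve})
        (g := fun z => (D.index z - sideCount (sides h z), g z)) (fun z hz => hz.1)
        (fun z hz => mem_closure_iff_frequently.mpr
          (((D.frequently_notMem_curve z).and_eventually (S.eventually_mem hz)).mono
            fun w hw => ⟨hw.2, hw.1⟩)) (fun q hq => by
        obtain ⟨v, hv⟩ := S.exists_eventually_reg C ha hq
        refine ⟨v, hv.mono fun w hw hwT => ?_⟩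
        obtain ⟨b1, b2⟩ := hw hwT.2
        refine Prod.ext (by simp [b1]) ?_
        exact regLabel_injective a (sides h w) ((hg w).trans b2)) ⟨hp₀, hc₀⟩ ⟨hz, hzc⟩
      obtain ⟨k1, k2⟩ := Prod.ext_iff.mp key
      simp only at k1 k2
      exact ⟨by omega, by rw [k2, hg]⟩
    · exact ⟨0, x, fun z hz hzc => absurd ⟨z, hz, hzc⟩ hne⟩
  obtain ⟨n, r, hnr⟩ := h1
  have hreg : ∀ z ∈ B, z ∉ D.curve → D.index z = n + sideCount (sides h z) ∧
      C.reg z = regLabel r a (sides h z) := by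
    intro z hz hc
    have hs : ∀ᶠ w in 𝓝 z, ∀ k, sides h w k = sides h z k := eventually_all.mpr fun k =>
      S.eventually_sides_eq hz fun hk => hc ((S.mem_curve_iff z hz).mpr ⟨k, hk⟩)
    obtain ⟨w, hwV, w1, w2, w3, w4⟩ := ((mem_closure_iff_frequently.mp
      (S.subset_closure hz)).and_eventually (hs.and ((C.eventually_reg_eq hc).and
      ((D.index_locally_constant z hc).and (eventually_notMem_curve hc))))).exists
    have := hnr w hwV w4
    rwa [w2, w3, show sides h w = sides h z from funext w1] at this
  have hstrand : ∀ i, ∀ z ∈ V, h i z = 0 → z ∉ D.crossings →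
      D.rightIndex z = n + sideCount (sides h z) ∧ C.rightColor z = regLabel r a (sides h z) := by
    intro i z hz hz0 hzx
    have hzB := S.subset hz
    have key : ∀ᶠ w in 𝓝 z, w ∉ D.curve →
        (D.index w = n + sideCount (sides h z) ∧ C.reg w = regLabel r a (sides h z)) ∨
        (D.index w = n + sideCount (sides h z) + 1 ∧
          C.reg w = regLabel r a (Function.update (sides h z) i true)) := by
      filter_upwards [S.eventually_sides_eq_update hzB hzx hz0, S.eventually_mem hz]
        with w w1 w2 hwc
      obtain ⟨b1, b2⟩ := hnr w w2 hwc
      rw [w1, sideCount_update, update_sides_of_zero hz0] at b1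
      rw [w1] at b2
      by_cases hp : 0 < h i w
      · right
        rw [b1, b2]; simp [hp]; ring
      · left
        rw [b1, b2]; simp [hp, update_sides_of_zero hz0]
    obtain ⟨k1, k2, -⟩ := C.right_eq ((S.mem_curve_iff z hzB).mpr ⟨i, hz0⟩) hzx key
    exact ⟨k1, k2⟩
  refine ⟨n, r, a, ⟨hreg, fun i z hz hz0 hzx => ?_, fun i z hz hz0 hn => ?_⟩, hax⟩
  · have hzc := (S.mem_curve_iff z hz).mpr ⟨i, hz0⟩
    have hsides := S.eventually_sides_eq_update hz hzx hz0
    have hi : D.rightIndex z = n + sideCount (sides h z) ∧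
        C.rightColor z = regLabel r a (sides h z) := by
      obtain ⟨w, ⟨hwV, hw0⟩, w1, (w2 : ∀ᶠ y in 𝓝 w, _), w3⟩ := ((mem_closure_iff_frequently.mp
        (S.mem_closure i z hz hz0)).and_eventually (hsides.and
          (((C.strandForm hzc hzx).eventually_nhds).and
          (eventually_notMem_crossings hzx)))).exists
      obtain ⟨b1, b2, -⟩ := StrandBody.of_eventually w2
        ((S.mem_curve_iff w (S.subset hwV)).mpr ⟨i, hw0⟩)
      have hs : sides h w = sides h z := by
        rw [w1, hw0, decide_eq_false (lt_irrefl _), update_sides_of_zero hz0]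
      rw [← b1, ← b2, ← hs]
      exact hstrand i w hwV hw0 w3
    refine ⟨hi.1, hi.2, ?_⟩
    filter_upwards [hsides, S.eventually_mem_curve_iff hz hzx hz0] with w w1 w2 hwB
    by_cases hwc : w ∈ D.curve
    · rw [strandSign, if_pos hwc, (w2 hwB).mp hwc, sign_zero]
    · have hw0 : h i w ≠ 0 := fun hh => hwc ((w2 hwB).mpr hh)
      rw [strandSign, if_neg hwc, hi.1, (hreg w hwB hwc).1, w1, sideCount_update,
        update_sides_of_zero hz0]
      rcases hw0.lt_or_gt with hlt | hlt
      · rw [sign_neg hlt]; simp [hlt.not_gt]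
      · rw [sign_pos hlt]; simp [hlt]
  · by_cases hzx : z ∈ D.crossings
    · exact ha i z (S.crossings_subset z hz hzx) hz0 hn
    · have hzc := (S.mem_curve_iff z hz).mpr ⟨i, hz0⟩
      obtain ⟨w, ⟨hwV, hw0⟩, w1, w2, w3⟩ := ((mem_closure_iff_frequently.mp
        (S.mem_closure i z hz hz0)).and_eventually ((S.eventually_sides_eq_update hz hzx hz0).and
          ((C.eventually_col_eq hzc hzx).and
          (eventually_notMem_crossings hzx)))).exists
      have hs : sides h w = sides h z := by
        rw [w1, hw0, decide_eq_false (lt_irrefl _), update_sides_of_zero hz0]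
      rw [← w2 ((S.mem_curve_iff w (S.subset hwV)).mpr ⟨i, hw0⟩), ← hs]
      exact ha i w hwV hw0 fun k hk => S.ne_zero_of_notMem_crossings (S.subset hwV) w3 hw0 hk.ne'

end NormalForm

/-! ### Diagrams which differ only in a disc -/

/-- The diagrams `D` and `D'` agree outside the set `B` with interior `V` and, in the weak sense
that is available there, on the frontier of `B`. -/
structure LocalMove (D D' : LinkDiagram) (V B : Set Square) : Prop where
  isOpen : IsOpen V
  isClosed : IsClosed B
  subset : V ⊆ B
  disjoint : Disjoint B (Cube.boundary (Fin 2))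
  agree : LinkDiagram.AgreesOutside B D D'
  curve_iff : ∀ z ∈ B, z ∉ V → (z ∈ D.curve ↔ z ∈ D'.curve)
  notMem_crossings : ∀ z ∈ B, z ∉ V → z ∉ D.crossings ∧ z ∉ D'.crossings
  mem_closure : ∀ z ∈ B, z ∉ V → z ∈ closure Bᶜ
  mem_closure_curve : ∀ z ∈ B, z ∉ V → z ∈ D.curve → z ∈ closure (D.curve \ B)

section LocalMove

theorem LinkDiagram.AgreesOutside.symm (h : LinkDiagram.AgreesOutside B D D') :
    LinkDiagram.AgreesOutside B D' D := fun p hp => by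
  obtain ⟨h1, h2, h3, h4⟩ := h p hp
  refine ⟨h1.symm, h2.symm, fun hx => ?_, fun hc => (h4 fun hc' => hc (h1.mp hc')).symm⟩
  filter_upwards [h3 (h2.mpr hx)] with w hw using hw.symm

theorem LocalMove.symm (M : LocalMove D D' V B) : LocalMove D' D V B where
  isOpen := M.isOpen
  isClosed := M.isClosed
  subset := M.subset
  disjoint := M.disjoint
  agree := M.agree.symm
  curve_iff z hz hzV := (M.curve_iff z hz hzV).symm
  notMem_crossings z hz hzV := (M.notMem_crossings z hz hzV).symm
  mem_closure := M.mem_closure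
  mem_closure_curve z hz hzV hc := by
    have h1 : D'.curve \ B = D.curve \ B := by
      ext w
      exact and_congr_left fun hw => (M.agree w hw).1.symm
    rw [h1]
    exact M.mem_closure_curve z hz hzV ((M.curve_iff z hz hzV).mpr hc)

theorem ShadowColoring.AgreesOutside.reg_eq (h : C.AgreesOutside B C') (hp : p ∉ B)
    (hc : p ∉ D.curve) (hc' : p ∉ D'.curve) : C.reg p = C'.reg p := by
  have := (h p hp).1 hc hc'
  rwa [ShadowColoring.region_eq, ShadowColoring.region_eq] at this

theorem ShadowColoring.AgreesOutside.col_eq (h : C.AgreesOutside B C') (hp : p ∉ B)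
    (hc : p ∈ D.curve) (hc' : p ∈ D'.curve) : C.col p = C'.col p := by
  have := (h p hp).2 hc hc'
  rwa [ShadowColoring.arc_eq, ShadowColoring.arc_eq] at this

theorem ShadowColoring.AgreesOutside.symm (h : C.AgreesOutside B C') : C'.AgreesOutside B C :=
  fun p hp => ⟨fun a b => ((h p hp).1 b a).symm, fun a b => ((h p hp).2 b a).symm⟩

theorem ShadowColoring.outer_eq_reg (C : ShadowColoring X D) : C.outer = C.reg 0 :=
  C.region_eq ⟨0, D.zero_notMem_curve⟩

theorem LocalMove.outer_eq (M : LocalMove D D' V B) (hC : C.AgreesOutside B C') :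
    C'.outer = C.outer := by
  have h0 : (0 : Square) ∉ B := fun h => disjoint_left.mp M.disjoint h ⟨0, Or.inl rfl⟩
  rw [C.outer_eq_reg, C'.outer_eq_reg, hC.reg_eq h0 D.zero_notMem_curve D'.zero_notMem_curve]

theorem LocalMove.agreeAt_of_notMem (M : LocalMove D D' V B) (hC : C.AgreesOutside B C')
    (hq : q ∉ B) : AgreeAt C C' q := by
  have hev : ∀ᶠ z in 𝓝 q, z ∉ B := M.isClosed.isOpen_compl.eventually_mem hq
  have hcol : ∀ᶠ z in 𝓝 q, (z ∉ D.curve → C.reg z = C'.reg z) ∧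
      (z ∈ D.curve → C.col z = C'.col z) := by
    filter_upwards [hev] with z hz
    have h1 := (M.agree z hz).1
    exact ⟨fun h => hC.reg_eq hz h fun h' => h (h1.mpr h'), fun h => hC.col_eq hz h (h1.mp h)⟩
  obtain ⟨a1, a2, a3, a4⟩ := M.agree q hq
  by_cases hc : q ∈ D.curve
  · by_cases hx : q ∈ D.crossings
    · refine .crossing hx (a2.mp hx) ?_ hcol
      filter_upwards [hev, a3 hx] with z hz hz3
      obtain ⟨b1, b2, -, b4⟩ := M.agree z hz
      exact ⟨b1, b2, fun _ => hz3, b4⟩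
    · have hx' : q ∉ D'.crossings := fun h => hx (a2.mpr h)
      have key : ∀ᶠ z in 𝓝 q, z ∉ D'.curve →
          (D'.index z = D.rightIndex q ∧ C'.reg z = C.rightColor q) ∨
          (D'.index z = D.rightIndex q + 1 ∧ C'.reg z = C.col q ◃ C.rightColor q) := by
        filter_upwards [hev, hcol, C.strandForm hc hx] with z z1 z2 z3 hzc
        obtain ⟨b1, b2, -, b4⟩ := M.agree z z1
        have hzc' : z ∉ D.curve := fun h => hzc (b1.mp h)
        rw [← b4 hzc', ← z2.1 hzc']
        exact z3.2.2 hzc'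
      obtain ⟨k1, k2, -⟩ := C'.right_eq (a1.mp hc) hx' key
      exact .strand hc hx (a1.mp hc) hx' k1.symm k2.symm (hcol.self_of_nhds.2 hc)
  · exact .region hc (fun h => hc (a1.mpr h)) (a4 hc) (hcol.self_of_nhds.1 hc)

/-- On the frontier of the disc, the local data are limits of those at points outside the disc. -/
theorem LocalMove.agreeAt (M : LocalMove D D' V B) (hC : C.AgreesOutside B C') (hqV : q ∉ V) :
    AgreeAt C C' q := by
  by_cases hq : q ∈ B
  · have h1 := M.curve_iff q hq hqV
    obtain ⟨hx, hx'⟩ := M.notMem_crossings q hq hqV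
    by_cases hc : q ∈ D.curve
    · have hc' := h1.mp hc
      obtain ⟨w, hw, w1, w2, w3, w4, w5, w6, w7⟩ := ((mem_closure_iff_frequently.mp
        (M.mem_closure_curve q hq hqV hc)).and_eventually
        (((C.strandForm hc hx).eventually_nhds).and
        (((C'.strandForm hc' hx').eventually_nhds).and
        ((C.eventually_col_eq hc hx).and ((C'.eventually_col_eq hc' hx').and
        ((eventually_notMem_crossings hx).and
        ((eventually_notMem_crossings hx').and
        (D.eventually_rightIndex_eq hc hx)))))))).exists
      have b := M.agreeAt_of_notMem hC hw.2
      have hw' : w ∈ D'.curve := ((M.agree w hw.2).1).mp hw.1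
      obtain ⟨c1, c2, -⟩ := StrandBody.of_eventually w1 hw.1
      obtain ⟨d1, d2, -⟩ := StrandBody.of_eventually w2 hw'
      cases b with
      | region h h' hi hr => exact absurd hw.1 h
      | strand h hx1 h' hx1' hi hr hcc =>
        exact .strand hc hx hc' hx' (by rw [← c1, ← d1, hi]) (by rw [← c2, ← d2, hr])
          (by rw [← w3 hw.1, ← w4 hw', hcc])
      | crossing h h' ha hcc => exact absurd h w5
    · have hc' : q ∉ D'.curve := fun h => hc (h1.mpr h)
      obtain ⟨w, hw, w1, w2, w3, w4, w5, w6⟩ := ((mem_closure_iff_frequently.mp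
        (M.mem_closure q hq hqV)).and_eventually
        ((C.eventually_reg_eq hc).and ((C'.eventually_reg_eq hc').and
        ((D.index_locally_constant q hc).and ((D'.index_locally_constant q hc').and
        ((eventually_notMem_curve hc).and
        (eventually_notMem_curve hc'))))))).exists
      refine .region hc hc' ?_ ?_
      · rw [← w3, ← w4, (M.agree w hw).2.2.2 w5]
      · rw [← w1, ← w2, hC.reg_eq hw w5 w6]
  · exact M.agreeAt_of_notMem hC hq

end LocalMove

/-! ### Homotopies for the second and third Reidemeister move -/

section CubeFrames

variable {h : Fin 3 → Square → ℝ}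
  {f : RackLoop r₀} {n : ℤ} {r : X} {a : Fin 3 → X}

/-- At the points `z` near `p`, the sharpening of `f` is in the cube `(r, a)`, with the sharpened
coordinates `c`, which have the signs of the functions `h`. -/
structure CubeFrame (f : Square → ExtendedRackSpace X) (h : Fin 3 → Square → ℝ) (r : X)
    (a : Fin 3 → X) (c : Fin 3 → Square → ℝ) (η : ℝ) (z : Square) : Prop where
  continuousAt : ∀ i, ContinuousAt (c i) z
  sign_eq : ∀ i, sign (c i z) = sign (h i z)
  sharpen_eq : ∀ ε, 0 < ε → ε ≤ η → sharpenRack ε (f z) = rackCube r a fun i => sharp ε (c i z)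

theorem exists_of_eventually_prod {P : ℝ → Square → Prop}
    (hP : ∀ᶠ p in nhdsPos q, P p.1 p.2) :
    ∃ η > 0, ∀ᶠ z in 𝓝 q, ∀ ε, 0 < ε → ε ≤ η → P ε z := by
  obtain ⟨P1, h1, P2, h2, hh⟩ := eventually_prod_iff.mp hP
  obtain ⟨η, hη, hh1⟩ := mem_nhdsGT_iff_exists_Ioc_subset.mp h1
  exact ⟨η, hη, h2.mono fun z hz ε e1 e2 => hh (hh1 ⟨e1, e2⟩) hz⟩

theorem eventually_sharp_eq_sides {c : Fin 3 → Square → ℝ} {i : Fin 3}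
    (hc : ContinuousAt (c i) p) (hs : sign (c i p) = sign (h i p))
    (h0 : h i p ≠ 0) : ∀ᶠ q in nhdsPos p, sharp q.1 (c i q.2) = cubeEnd (sides h p i) := by
  have := eventually_sharp_eq hc (ne_zero_of_sign hs h0)
  rwa [decide_pos_eq_of_sign hs] at this

/-- The missing coordinates are supplied by the functions `h`: they are not zero, so they are
sharpened to the side of the cube on which the point lies. -/
theorem OrientedStrandDisc.exists_cubeFrame (S : OrientedStrandDisc D V B h) (hf : IsShadowMap C f)
    (N : NormalForm C B h n r a) (hp : p ∈ V) :
    ∃ c : Fin 3 → Square → ℝ, ∃ η > 0, ∀ᶠ z in 𝓝 p, CubeFrame f h r a c η z := by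
  have hpB := S.subset hp
  have hcont : ∀ᶠ z in 𝓝 p, ∀ i, ContinuousAt (h i) z :=
    (S.eventually_mem hp).mono fun z hz i => S.continuousAt i z (S.subset hz)
  by_cases hc : p ∈ D.curve
  · by_cases hx : p ∈ D.crossings
    · obtain ⟨i, j, hij, hi, hj⟩ := (S.mem_crossings_iff p hpB).mp hx
      obtain ⟨e, m, r', α, he, hform, c, d, η, hη, hev⟩ := hf.exists_crossCoord hx
      have hsg := S.sign_crossing C hp hij hi hj he
      let c' : Fin 3 → Square → ℝ := Function.update (Function.update h i c) j d
      have hci : c' i = c := by simp [c', hij.ne]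
      have hcj : c' j = d := by simp [c']
      have hck : ∀ k, k ≠ i → k ≠ j → c' k = h k := fun k h1 h2 => by simp [c', h1, h2]
      have hcol : C.col p = colLabel a (sides h p) j := N.col j p hpB hj fun k hk hk0 =>
        S.ne_zero_third hpB hij.ne hi hj (hij.trans hk).ne' hk.ne' hk0
      have hsides := S.eventually_sides_eq_update_update hpB hij.ne hi hj
      have hα : α = colLabel a (sides h p) i := by
        obtain ⟨z, hzT, z1, z2, z3⟩ := ((S.frequently_crossing hp hij hi hj he (-1)
          (Or.inr rfl)).1.and_eventually (hform.and (hsg.and hsides))).exists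
        obtain ⟨hzV, hz0, hzx, hz1, hz2⟩ := hzT
        have hlt : (e z).2 < 0 := by linarith
        rw [← z1.2.2.2.2.1 hz1 hlt, N.col i z (S.subset hzV) hz0 fun k hk =>
          S.ne_zero_of_notMem_crossings (S.subset hzV) hzx hz0 hk.ne']
        refine colLabel_congr _ fun k hk => ?_
        rw [z3, Function.update_of_ne hk.ne', ← decide_pos_eq_of_sign z2.2, decide_eq_false
          hlt.not_gt,
          update_sides_of_zero hj]
      have hr : r' = regLabel r a (sides h p) := by
        obtain ⟨z, hzT, (z1 : ∀ᶠ w in 𝓝 z, _), z2, z3⟩ :=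
          ((S.frequently_crossing hp hij hi hj he (-1)
          (Or.inr rfl)).1.and_eventually ((hform.eventually_nhds).and
            (hsg.and hsides))).exists
        obtain ⟨hzV, hz0, hzx, hz1, hz2⟩ := hzT
        have hlt : (e z).2 < 0 := by linarith
        have h1 := ((CrossForm.right_eq C z1 hzx).1 hz1 hlt.ne).1
        rw [decide_eq_false hlt.not_gt, (N.strand i z (S.subset hzV) hz0 hzx).2.1, z3,
          ← decide_pos_eq_of_sign z2.2, decide_eq_false hlt.not_gt, update_sides_of_zero hj, hz0,
          decide_eq_false (lt_irrefl _), update_sides_of_zero hi] at h1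
        exact h1.symm
      have hends : ∀ᶠ q in nhdsPos p, ∀ k, k ≠ i → k ≠ j →
          sharp q.1 (h k q.2) = cubeEnd (sides h p k) := eventually_all.mpr fun k => by
        by_cases hk : k ≠ i ∧ k ≠ j
        · exact (eventually_sharp_eq_sides (S.continuousAt k p hpB) rfl
            (S.ne_zero_third hpB hij.ne hi hj hk.1 hk.2)).mono fun _ h _ _ => h
        · exact .of_forall fun _ h h' => absurd ⟨h, h'⟩ hk
      obtain ⟨η', hη', hends'⟩ := exists_of_eventually_prod
        (P := fun ε z => ∀ k, k ≠ i → k ≠ j → sharp ε (h k z) = cubeEnd (sides h p k)) hends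
      refine ⟨c', min η η', lt_min hη hη', ?_⟩
      filter_upwards [hev, hcont, hsg, hends'] with z z1 z2 z3 z4
      refine ⟨fun k => ?_, fun k => ?_, fun ε e1 e2 => ?_⟩
      · by_cases hki : k = i
        · rw [hki, hci]; exact z1.1
        · by_cases hkj : k = j
          · rw [hkj, hcj]; exact z1.2.1
          · rw [hck k hki hkj]; exact z2 k
      · by_cases hki : k = i
        · rw [hki, hci, z1.2.2.1, z3.1]
        · by_cases hkj : k = j
          · rw [hkj, hcj, z1.2.2.2.1, z3.2]
          · rw [hck k hki hkj]
      · rw [z1.2.2.2.2 ε e1 (e2.trans (min_le_left _ _)), rackCube_eq_square r a (sides h p) hij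
          fun k k1 k2 => ?_]
        · rw [update_sides_of_zero hi, update_sides_of_zero hj, hci, hcj, hr, hα, hcol]
        · rw [hck k k1 k2]
          exact z4 ε e1 (e2.trans (min_le_right _ _)) k k1 k2
    · obtain ⟨i, hi⟩ := (S.mem_curve_iff p hpB).mp hc
      obtain ⟨c, η, hη, hev⟩ := hf.exists_strandCoord hc hx
      let c' : Fin 3 → Square → ℝ := Function.update h i c
      have hci : c' i = c := by simp [c']
      have hck : ∀ k, k ≠ i → c' k = h k := fun k h1 => by simp [c', h1]
      have hcol : C.col p = colLabel a (sides h p) i := N.col i p hpB hi fun k hk =>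
        S.ne_zero_of_notMem_crossings hpB hx hi hk.ne'
      have hends : ∀ᶠ q in nhdsPos p, ∀ k, k ≠ i →
          sharp q.1 (h k q.2) = cubeEnd (sides h p k) := eventually_all.mpr fun k => by
        by_cases hk : k = i
        · exact .of_forall fun _ h => absurd hk h
        · exact (eventually_sharp_eq_sides (S.continuousAt k p hpB) rfl
            (S.ne_zero_of_notMem_crossings hpB hx hi hk)).mono fun _ h _ => h
      obtain ⟨η', hη', hends'⟩ := exists_of_eventually_prod
        (P := fun ε z => ∀ k, k ≠ i → sharp ε (h k z) = cubeEnd (sides h p k)) hends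
      refine ⟨c', min η η', lt_min hη hη', ?_⟩
      filter_upwards [hev, hcont, S.strandSign_eq i p hp hi hx, hends'] with z z1 z2 z3 z4
      refine ⟨fun k => ?_, fun k => ?_, fun ε e1 e2 => ?_⟩
      · by_cases hki : k = i
        · rw [hki, hci]; exact z1.1
        · rw [hck k hki]; exact z2 k
      · by_cases hki : k = i
        · rw [hki, hci, z1.2.1, z3]
        · rw [hck k hki]
      · rw [z1.2.2 ε e1 (e2.trans (min_le_left _ _)), rackCube_eq_edge r a (sides h p) i
          fun k k1 => ?_]
        · rw [update_sides_of_zero hi, hci, ← (N.strand i p hpB hi hx).2.1, hcol]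
        · rw [hck k k1]
          exact z4 ε e1 (e2.trans (min_le_right _ _)) k k1
  · obtain ⟨η, hη, hev⟩ := hf.eventually_sharpen_region hc
    have hends : ∀ᶠ q in nhdsPos p, ∀ k,
        sharp q.1 (h k q.2) = cubeEnd (sides h p k) := eventually_all.mpr fun k =>
      eventually_sharp_eq_sides (S.continuousAt k p hpB) rfl
        fun hk => hc ((S.mem_curve_iff p hpB).mpr ⟨k, hk⟩)
    obtain ⟨η', hη', hends'⟩ := exists_of_eventually_prod
        (P := fun ε z => ∀ k, sharp ε (h k z) = cubeEnd (sides h p k)) hends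
    refine ⟨h, min η η', lt_min hη hη', ?_⟩
    filter_upwards [hev, hcont, hends'] with z z1 z2 z4
    refine ⟨z2, fun _ => rfl, fun ε e1 e2 => ?_⟩
    rw [z1 ε e1 (e2.trans (min_le_left _ _)), (N.region p hpB hc).2, rackCube_eq_vertex r a
      (sides h p)
      (z4 ε e1 (e2.trans (min_le_right _ _)))]

/-- Away from the crossings, the sharpened coordinates in the cube are unique. -/
theorem StrandDisc.eventually_sharp_coord_eq (S : StrandDisc D V B h) (hp : p ∈ V)
    (hx : p ∉ D.crossings) {c c' : Fin 3 → Square → ℝ} {η η' : ℝ} (hη : 0 < η) (hη' : 0 < η')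
    (hc : ∀ᶠ z in 𝓝 p, CubeFrame f h r a c η z) (hc' : ∀ᶠ z in 𝓝 p, CubeFrame f h r a c' η' z) :
    ∀ᶠ q in nhdsPos p, ∀ i, sharp q.1 (c i q.2) = sharp q.1 (c' i q.2) := by
  have k1 := hc.self_of_nhds
  have k2 := hc'.self_of_nhds
  have hpB := S.subset hp
  have hends : ∀ k, h k p ≠ 0 → ∀ᶠ q in nhdsPos p, sharp q.1 (c k q.2) = cubeEnd (sides h p k) ∧
      sharp q.1 (c' k q.2) = cubeEnd (sides h p k) := fun k hk =>
    (eventually_sharp_eq_sides (k1.continuousAt k) (k1.sign_eq k) hk).and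
      (eventually_sharp_eq_sides (k2.continuousAt k) (k2.sign_eq k) hk)
  refine eventually_all.mpr fun i => ?_
  by_cases hi : h i p = 0
  · have hends' : ∀ᶠ q in nhdsPos p, ∀ k, k ≠ i → sharp q.1 (c k q.2) = cubeEnd (sides h p k) ∧
        sharp q.1 (c' k q.2) = cubeEnd (sides h p k) := eventually_all.mpr fun k => by
      by_cases hk : k = i
      · exact .of_forall fun _ h => absurd hk h
      · exact (hends k (S.ne_zero_of_notMem_crossings hpB hx hi hk)).mono fun _ h _ => h
    filter_upwards [hends', eventually_prod_of_le hη (hc.mono fun _ h => h.sharpen_eq),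
      eventually_prod_of_le hη' (hc'.mono fun _ h => h.sharpen_eq),
      (hc.mono fun _ h => h.sign_eq i).prod_inr _,
      (hc'.mono fun _ h => h.sign_eq i).prod_inr _] with q q1 q2 q3 q4 q5
    have h1 := q2.2.symm.trans q3.2
    rw [rackCube_eq_edge r a (sides h p) i fun k hk => (q1 k hk).1,
      rackCube_eq_edge r a (sides h p) i fun k hk => (q1 k hk).2] at h1
    exact eq_of_rackEdge_eq h1 (by rw [sign_sharp q2.1, sign_sharp q2.1, q4, q5])
  · exact (hends i hi).mono fun q hq => hq.1.trans hq.2.symm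

end CubeFrames

/-! ### Invariance under moves of strands -/

/-- The constant coloring, by a quandle with a single element. -/
def LinkDiagram.trivialColoring (D : LinkDiagram) : ShadowColoring (Quandle.Conj Unit) D where
  region _ := 1
  arc _ := 1
  region_locally_constant := IsLocallyConstant.const _
  arc_locally_constant _ _ := .of_forall fun _ => rfl
  over_arc _ _ := .of_forall fun _ _ => rfl
  under_arc _ _ e he := ⟨e.source, e.open_source.mem_nhds he.mem_source, subset_rfl,
    fun _ _ _ _ _ _ _ _ => rfl⟩
  region_arc _ _ := ⟨univ, univ_mem, fun _ _ _ _ _ => rfl⟩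

/-- The diagrams `D` and `D'` differ in the disc `B` by a move of the strands `h 0`, `h 1`, `h 2`
to `h' 0`, `h' 1`, `h' 2`, which fixes the end points of the strands. -/
structure StrandMove (D D' : LinkDiagram) (V B : Set Square) (h h' : Fin 3 → Square → ℝ) :
    Prop where
  move : LocalMove D D' V B
  disc : OrientedStrandDisc D V B h
  disc' : OrientedStrandDisc D' V B h'
  sign_eq : ∀ i, ∀ z ∈ B, z ∉ V → sign (h i z) = sign (h' i z)
  exists_end : ∀ i, (∃ z ∈ V, h i z = 0 ∨ h' i z = 0) → ∃ z ∈ B, z ∉ V ∧ h i z = 0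
  exists_corner : ∃ z ∈ B, z ∉ V ∧ ∀ i, h i z ≠ 0

section StrandMove

variable {h h' : Fin 3 → Square → ℝ}
  {n n' : ℤ} {r r' : X} {a a' : Fin 3 → X} {x : X}

theorem eq_zero_of_sign {x y : ℝ} (h : sign x = sign y) (hx : x = 0) : y = 0 := by
  rwa [hx, sign_zero, eq_comm, sign_eq_zero_iff] at h

namespace StrandMove

theorem symm (M : StrandMove D D' V B h h') : StrandMove D' D V B h' h where
  move := M.move.symm
  disc := M.disc'
  disc' := M.disc
  sign_eq i z hz hzV := (M.sign_eq i z hz hzV).symm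
  exists_end i hi := by
    obtain ⟨z, hz, hzV, hz0⟩ := M.exists_end i (by simpa only [or_comm] using hi)
    exact ⟨z, hz, hzV, eq_zero_of_sign (M.sign_eq i z hz hzV) hz0⟩
  exists_corner := by
    obtain ⟨z, hz, hzV, h0⟩ := M.exists_corner
    exact ⟨z, hz, hzV, fun i => ne_zero_of_sign (M.sign_eq i z hz hzV).symm (h0 i)⟩

theorem sides_eq (M : StrandMove D D' V B h h') (hz : z ∈ B) (hzV : z ∉ V) :
    sides h z = sides h' z :=
  funext fun i => decide_pos_eq_of_sign (M.sign_eq i z hz hzV)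

/-- The labels of the strands are determined by the colors at their end points, from the top to the
bottom, and the color on the right of all strands by the color of a corner of the disc. -/
theorem labels_eq (M : StrandMove D D' V B h h') (hC : C.AgreesOutside B C')
    (N : NormalForm C B h n r a) (N' : NormalForm C' B h' n' r' a')
    (hx : ∀ i, (∀ z ∈ V, h i z ≠ 0) → a i = x) (hx' : ∀ i, (∀ z ∈ V, h' i z ≠ 0) → a' i = x) :
    n = n' ∧ r = r' ∧ a = a' := by
  have step : ∀ i, (∀ j, i < j → a j = a' j) → a i = a' i := by
    intro i hi
    by_cases he : ∃ z ∈ V, h i z = 0 ∨ h' i z = 0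
    · obtain ⟨z, hz, hzV, hz0⟩ := M.exists_end i he
      have hzx := M.move.notMem_crossings z hz hzV
      have hz0' := eq_zero_of_sign (M.sign_eq i z hz hzV) hz0
      have h1 := N.col i z hz hz0 fun j hj => M.disc.ne_zero_of_notMem_crossings hz hzx.1 hz0 hj.ne'
      have h2 := N'.col i z hz hz0' fun j hj =>
        M.disc'.ne_zero_of_notMem_crossings hz hzx.2 hz0' hj.ne'
      have hzc := (M.disc.mem_curve_iff z hz).mpr ⟨i, hz0⟩
      have h3 : C.col z = C'.col z := by
        cases M.move.agreeAt hC hzV with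
        | region h => exact absurd hzc h
        | strand _ _ _ _ _ _ hc => exact hc
        | crossing h => exact absurd h hzx.1
      rw [h1, h2, M.sides_eq hz hzV] at h3
      exact colLabel_injective _ hi h3
    · rw [hx i fun z hz h0 => he ⟨z, hz, Or.inl h0⟩, hx' i fun z hz h0 => he ⟨z, hz, Or.inr h0⟩]
  have h2 : a 2 = a' 2 := step 2 fun j hj => absurd hj (by revert j; decide)
  have h1 : a 1 = a' 1 := step 1 fun j hj => by
    obtain rfl : j = 2 := by revert j; decide
    exact h2
  have h0 : a 0 = a' 0 := step 0 fun j hj => by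
    have : j = 1 ∨ j = 2 := by revert j; decide
    rcases this with rfl | rfl <;> assumption
  obtain rfl : a = a' := funext fun i => by fin_cases i <;> assumption
  obtain ⟨z, hz, hzV, h0⟩ := M.exists_corner
  have hzc : z ∉ D.curve := fun hh => by
    obtain ⟨i, hi⟩ := (M.disc.mem_curve_iff z hz).mp hh
    exact h0 i hi
  have hzc' : z ∉ D'.curve := fun hh => hzc ((M.move.curve_iff z hz hzV).mpr hh)
  obtain ⟨b1, b2⟩ := N.region z hz hzc
  obtain ⟨b1', b2'⟩ := N'.region z hz hzc'
  rw [← M.sides_eq hz hzV] at b1' b2'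
  cases M.move.agreeAt hC hzV with
  | region _ _ hi hr =>
    refine ⟨by omega, regLabel_injective a _ (b2.symm.trans (hr.trans b2')), rfl⟩
  | strand h => exact absurd h hzc
  | crossing h => exact absurd (D.crossings_subset h) hzc

/-- A coloring of `D'` is determined by the coloring outside the disc. -/
theorem coloring_unique (M : StrandMove D D' V B h h') {C₁ C₂ : ShadowColoring X D'}
    (h1 : C.AgreesOutside B C₁) (h2 : C.AgreesOutside B C₂) : C₁ = C₂ := by
  obtain ⟨n, r, a, N, ha⟩ := M.disc.exists_normalForm C C.outer
  obtain ⟨n₁, r₁, a₁, N₁, ha₁⟩ := M.disc'.exists_normalForm C₁ C.outer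
  obtain ⟨n₂, r₂, a₂, N₂, ha₂⟩ := M.disc'.exists_normalForm C₂ C.outer
  obtain ⟨rfl, rfl, rfl⟩ := M.labels_eq h1 N N₁ ha ha₁
  obtain ⟨rfl, rfl, rfl⟩ := M.labels_eq h2 N N₂ ha ha₂
  refine ShadowColoring.ext_reg_col (fun p hp => ?_) fun p hp => ?_
  · by_cases hpB : p ∈ B
    · rw [(N₁.region p hpB hp).2, (N₂.region p hpB hp).2]
    · have hc : p ∉ D.curve := fun hh => hp ((M.move.agree p hpB).1.mp hh)
      rw [← h1.reg_eq hpB hc hp, ← h2.reg_eq hpB hc hp]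
  · by_cases hpB : p ∈ B
    · have : ∃ i, h' i p = 0 ∧ ∀ j, i < j → h' j p ≠ 0 := by
        obtain ⟨i, hi⟩ := (M.disc'.mem_curve_iff p hpB).mp hp
        by_cases e2 : h' 2 p = 0
        · exact ⟨2, e2, fun j hj => absurd hj (by revert j; decide)⟩
        · by_cases e1 : h' 1 p = 0
          · refine ⟨1, e1, fun j hj => ?_⟩
            obtain rfl : j = 2 := by revert j; decide
            exact e2
          · have e0 : i = 0 := by fin_cases i <;> first | rfl | contradiction
            refine ⟨0, e0 ▸ hi, fun j hj => ?_⟩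
            have : j = 1 ∨ j = 2 := by revert j; decide
            rcases this with rfl | rfl <;> assumption
      obtain ⟨i, hi, hj⟩ := this
      rw [N₁.col i p hpB hi hj, N₂.col i p hpB hi hj]
    · have hc := (M.move.agree p hpB).1.mpr hp
      rw [← h1.col_eq hpB hc hp, ← h2.col_eq hpB hc hp]

section Homotopy

variable {f g : RackLoop r₀}

/-- The move does not change the class of the map: in the disc, both maps are (after sharpening) in
the same cube, so they are connected by the straight homotopy in this cube. -/
theorem homotopic (M : StrandMove D D' V B h h') (j : C(ExtendedRackSpace X, Z))
    (hC : C.AgreesOutside B C') (hf : IsShadowMap C f) (hg : IsShadowMap C' g) :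
    GenLoop.Homotopic (pushLoop j f) (pushLoop j g) := by
  obtain ⟨n, r, a, N, ha⟩ := M.disc.exists_normalForm C C.outer
  obtain ⟨n', r', a', N', ha'⟩ := M.disc'.exists_normalForm C' C.outer
  obtain ⟨rfl, rfl, rfl⟩ := M.labels_eq hC N N' ha ha'
  have k1 : ∀ p, ∃ c : Fin 3 → Square → ℝ, ∃ η > 0,
      p ∈ V → ∀ᶠ z in 𝓝 p, CubeFrame f h r a c η z := fun p => by
    by_cases hp : p ∈ V
    · obtain ⟨c, η, hη, hev⟩ := M.disc.exists_cubeFrame hf N hp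
      exact ⟨c, η, hη, fun _ => hev⟩
    · exact ⟨fun _ _ => 0, 1, one_pos, fun hh => absurd hh hp⟩
  have k2 : ∀ p, ∃ c : Fin 3 → Square → ℝ, ∃ η > 0,
      p ∈ V → ∀ᶠ z in 𝓝 p, CubeFrame g h' r a c η z := fun p => by
    by_cases hp : p ∈ V
    · obtain ⟨c, η, hη, hev⟩ := M.disc'.exists_cubeFrame hg N' hp
      exact ⟨c, η, hη, fun _ => hev⟩
    · exact ⟨fun _ _ => 0, 1, one_pos, fun hh => absurd hh hp⟩
  choose c η hη hcf using k1
  choose c' η' hη' hcg using k2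
  let Φ : C(Fin 3 → I, Z) := ⟨fun t => j (rackCube r a t),
    j.continuous.comp (continuous_rackCube r a)⟩
  let θ : C(I, I) := ContinuousMap.id I
  let G : Square → ℝ → Square → C(I, Z) := fun p ε z =>
    straightPath Φ θ (fun i => sharp ε (c p i z), fun i => sharp ε (c' p i z))
  have hG : ∀ p ε z s, G p ε z s = j (rackCube r a fun i =>
    Icc.convexComb (sharp ε (c p i z)) (sharp ε (c' p i z)) s) := fun _ _ _ _ => rfl
  have hVB : ∀ q, q ∉ V → q ∉ B → ∀ᶠ z in 𝓝 q, z ∈ Vᶜ := fun q _ hq =>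
    (M.move.isClosed.isOpen_compl.eventually_mem hq).mono fun z hz hzV => hz (M.move.subset hzV)
  -- the sharpened coordinates of the strands which are away from the point `z`
  have hends : ∀ z ∈ V, ∀ i s, h i z ≠ 0 → h' i z ≠ 0 → sides h z i = s → sides h' z i = s →
      ∀ᶠ p in nhdsPos z, sharp p.1 (c z i p.2) = cubeEnd s ∧
        sharp p.1 (c' z i p.2) = cubeEnd s := by
    intro z hz i s h0 h0' hs hs'
    have y1 := (hcf z hz).self_of_nhds
    have y2 := (hcg z hz).self_of_nhds
    have e1 := eventually_sharp_eq_sides (y1.continuousAt i) (y1.sign_eq i) h0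
    have e2 := eventually_sharp_eq_sides (y2.continuousAt i) (y2.sign_eq i) h0'
    rw [hs] at e1
    rw [hs'] at e2
    exact e1.and e2
  refine homotopic_of_agree (θ := θ) rfl rfl hf hg (S := Vᶜ)
    (fun q hq => M.move.agreeAt hC hq) G (fun p => min (η p) (η' p))
    (fun p _ => lt_min (hη p) (hη' p)) (fun q hq => ?_) (fun q hq => ?_) (fun q hq hx => ?_)
    (fun q hq hc hx => ?_) fun q hq hc => ?_
  · rw [notMem_compl_iff] at hq
    filter_upwards [hcf q hq, hcg q hq, M.move.isOpen.eventually_mem hq] with z z1 z2 z3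
    refine ⟨fun hh => hh z3, fun hh => disjoint_left.mp M.move.disjoint (M.move.subset z3) hh,
      fun ε _ _ => ?_, fun ε e1 e2 => ?_, fun ε e1 e2 => ?_⟩
    · exact (straightPath Φ θ).continuous.continuousAt.comp (ContinuousAt.prodMk
        (continuousAt_pi.mpr fun i => (continuous_sharp ε).continuousAt.comp (z1.continuousAt i))
        (continuousAt_pi.mpr fun i => (continuous_sharp ε).continuousAt.comp (z2.continuousAt i)))
    · rw [hG, z1.sharpen_eq ε e1 (e2.trans (min_le_left _ _))]
      simp only [Icc.convexComb_zero]
    · rw [hG, z2.sharpen_eq ε e1 (e2.trans (min_le_right _ _))]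
      simp only [Icc.convexComb_one]
  · rw [notMem_compl_iff] at hq
    filter_upwards [(hcf q hq).eventually_nhds,
      (hcg q hq).eventually_nhds, D.eventually_mem_crossings_eq q,
      D'.eventually_mem_crossings_eq q] with z z1 z2 z3 z4 hzV
    rw [notMem_compl_iff] at hzV
    by_cases hzq : z = q
    · exact .of_forall fun p => by rw [hzq]
    · filter_upwards [M.disc.eventually_sharp_coord_eq hzV (fun hh => hzq (z3 hh)) (hη q) (hη z)
        z1 (hcf z hzV), M.disc'.eventually_sharp_coord_eq hzV (fun hh => hzq (z4 hh)) (hη' q)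
        (hη' z) z2 (hcg z hzV)] with p p1 p2
      ext s
      rw [hG, hG]
      simp only [p1, p2]
  · refine hVB q hq fun hqB => (M.move.notMem_crossings q hqB hq).1 hx
  · by_cases hqB : q ∈ B
    · obtain ⟨i, hi⟩ := (M.disc.mem_curve_iff q hqB).mp hc
      have hx' := (M.move.notMem_crossings q hqB hq).2
      have hi' := eq_zero_of_sign (M.sign_eq i q hqB hq) hi
      obtain ⟨-, hr, hs⟩ := N.strand i q hqB hi hx
      obtain ⟨-, -, hs'⟩ := N'.strand i q hqB hi' hx'
      have hcol : C.col q = colLabel a (sides h q) i := N.col i q hqB hi fun k hk =>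
        M.disc.ne_zero_of_notMem_crossings hqB hx hi hk.ne'
      have hne : ∀ᶠ z in 𝓝 q, ∀ k, k ≠ i → h k z ≠ 0 ∧ h' k z ≠ 0 := eventually_all.mpr fun k => by
          by_cases hk : k = i
          · exact .of_forall fun _ h => absurd hk h
          · exact ((M.disc.eventually_ne_zero hqB
              (M.disc.ne_zero_of_notMem_crossings hqB hx hi hk)).and
              (M.disc'.eventually_ne_zero hqB
              (M.disc'.ne_zero_of_notMem_crossings hqB hx' hi' hk))).mono fun _ h _ => h
      filter_upwards [hs.eventually_nhds, hs'.eventually_nhds,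
        M.disc.eventually_sides_eq_update hqB hx hi, M.disc'.eventually_sides_eq_update hqB hx' hi',
        hne] with z z1 z2 z3 z4 z5 hzV
      rw [notMem_compl_iff] at hzV
      have hk : ∀ᶠ p in nhdsPos z, ∀ k, k ≠ i → sharp p.1 (c z k p.2) = cubeEnd (sides h q k) ∧
          sharp p.1 (c' z k p.2) = cubeEnd (sides h q k) := eventually_all.mpr fun k => by
        by_cases hk : k = i
        · exact .of_forall fun _ h => absurd hk h
        · refine (hends z hzV k (sides h q k) (z5 k hk).1 (z5 k hk).2 ?_ ?_).mono fun _ h _ => h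
          · rw [z3, Function.update_of_ne hk]
          · rw [z4, Function.update_of_ne hk, M.sides_eq hqB hq]
      refine ⟨fun ε w => sharp ε (c z i w), fun ε w => sharp ε (c' z i w), ?_⟩
      filter_upwards [hk, eventually_prod_of_le (hη z) ((hcf z hzV).mono fun _ h => h.sharpen_eq),
        eventually_prod_of_le (hη' z) ((hcg z hzV).mono fun _ h => h.sharpen_eq),
        ((hcf z hzV).mono fun _ h => h.sign_eq i).prod_inr _,
        ((hcg z hzV).mono fun _ h => h.sign_eq i).prod_inr _,
        z1.prod_inr _, z2.prod_inr _,
        (M.move.isOpen.eventually_mem hzV).prod_inr _] with p p1 p2 p3 p4 p5 p6 p7 p8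
      rw [hcol, hr]
      refine ⟨⟨?_, ?_⟩, ⟨?_, ?_⟩, fun s => ?_⟩
      · rw [p2.2, rackCube_eq_edge r a (sides h q) i fun k hk => (p1 k hk).1,
          update_sides_of_zero hi]
      · rw [sign_sharp p2.1, p4, p6 (M.move.subset p8)]
      · rw [p3.2, rackCube_eq_edge r a (sides h q) i fun k hk => (p1 k hk).2,
          update_sides_of_zero hi]
      · rw [sign_sharp p2.1, p5, p7 (M.move.subset p8)]
      · rw [hG, rackCube_eq_edge r a (sides h q) i fun k hk => by
          rw [(p1 k hk).1, (p1 k hk).2, Icc.convexComb_eq], update_sides_of_zero hi]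
        rfl
    · exact (hVB q hq hqB).mono fun z hz hz' => absurd hz hz'
  · by_cases hqB : q ∈ B
    · have hc' : q ∉ D'.curve := fun hh => hc ((M.move.curve_iff q hqB hq).mpr hh)
      have hne : ∀ᶠ z in 𝓝 q, ∀ k, (h k z ≠ 0 ∧ h' k z ≠ 0) ∧ sides h z k = sides h q k ∧
          sides h' z k = sides h q k := eventually_all.mpr fun k => by
        have n1 : h k q ≠ 0 := fun hh => hc ((M.disc.mem_curve_iff q hqB).mpr ⟨k, hh⟩)
        have n2 : h' k q ≠ 0 := fun hh => hc' ((M.disc'.mem_curve_iff q hqB).mpr ⟨k, hh⟩)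
        have e2 := M.disc'.eventually_sides_eq hqB n2
        rw [← M.sides_eq hqB hq] at e2
        exact ((M.disc.eventually_ne_zero hqB n1).and (M.disc'.eventually_ne_zero hqB n2)).and
          ((M.disc.eventually_sides_eq hqB n1).and e2)
      filter_upwards [hne] with z z1 hzV
      rw [notMem_compl_iff] at hzV
      have hk : ∀ᶠ p in nhdsPos z, ∀ k, sharp p.1 (c z k p.2) = cubeEnd (sides h q k) ∧
          sharp p.1 (c' z k p.2) = cubeEnd (sides h q k) := eventually_all.mpr fun k =>
        hends z hzV k _ (z1 k).1.1 (z1 k).1.2 (z1 k).2.1 (z1 k).2.2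
      filter_upwards [hk] with p p1 s
      rw [hG, (N.region q hqB hc).2, rackCube_eq_vertex r a (sides h q) fun k => by
        rw [(p1 k).1, (p1 k).2, Icc.convexComb_eq]]
    · exact (hVB q hq hqB).mono fun z hz hz' => absurd hz hz'

end Homotopy

end StrandMove

end StrandMove

section

theorem StrandBody.transfer {reg col reg' col' : Square → X} {k : ℤ} {r : X}
    (h : StrandBody D reg col p k r z) (hx : z ∉ D'.crossings)
    (hc : z ∈ D.curve ↔ z ∈ D'.curve) (hi : z ∉ D.curve → D.index z = D'.index z)
    (hreg : z ∉ D.curve → reg' z = reg z) (hcol : z ∈ D.curve → col' z = col z)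
    (hp : col' p = col p) : StrandBody D' reg' col' p k r z := by
  refine ⟨hx, fun hz => ?_, fun hz => ?_⟩
  · rw [hcol (hc.mpr hz), h.2.1 (hc.mpr hz), hp]
  · have hz' : z ∉ D.curve := fun hh => hz (hc.mp hh)
    rw [hreg hz', ← hi hz', hp]
    exact h.2.2 hz'

theorem CrossBody.transfer {reg col reg' col' : Square → X}
    {e e' : PlaneChart} {m : ℤ} {r a : X}
    (h : CrossBody D reg col p e m r a z) (he' : z ∈ e'.source)
    (hx : z ∈ D'.crossings → z = p) (hs : sign (e z).1 = sign (e' z).1 ∧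
      sign (e z).2 = sign (e' z).2)
    (hc : z ∈ D.curve ↔ z ∈ D'.curve) (hi : z ∉ D.curve → D.index z = D'.index z)
    (hreg : z ∉ D.curve → reg' z = reg z) (hcol : z ∈ D.curve → col' z = col z)
    (hp : col' p = col p) : CrossBody D' reg' col' p e' m r a z := by
  have z1 : (e z).1 = 0 ↔ (e' z).1 = 0 := by rw [← sign_eq_zero_iff, hs.1, sign_eq_zero_iff]
  have z2 : (e z).2 = 0 ↔ (e' z).2 = 0 := by rw [← sign_eq_zero_iff, hs.2, sign_eq_zero_iff]
  have p1 : 0 < (e z).1 ↔ 0 < (e' z).1 := by rw [← sign_eq_one_iff, hs.1, sign_eq_one_iff]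
  have p2 : 0 < (e z).2 ↔ 0 < (e' z).2 := by rw [← sign_eq_one_iff, hs.2, sign_eq_one_iff]
  have n1 : (e z).1 < 0 ↔ (e' z).1 < 0 := by rw [← sign_eq_neg_one_iff, hs.1, sign_eq_neg_one_iff]
  have n2 : (e z).2 < 0 ↔ (e' z).2 < 0 := by rw [← sign_eq_neg_one_iff, hs.2, sign_eq_neg_one_iff]
  obtain ⟨-, -, h3, h4, h5, h6, h7, h8, h9, h10⟩ := h
  have hon1 : (e z).1 = 0 → col' z = col z := fun hz => hcol (h3.mpr (Or.inl hz))
  have hon2 : (e z).2 = 0 → col' z = col z := fun hz => hcol (h3.mpr (Or.inr hz))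
  have hoff : (e z).1 ≠ 0 → (e z).2 ≠ 0 → D'.index z = D.index z ∧ reg' z = reg z := by
    intro k1 k2
    have : z ∉ D.curve := fun hh => (h3.mp hh).elim k1 k2
    exact ⟨(hi this).symm, hreg this⟩
  simp only [CrossBody, ← z1, ← z2, ← p1, ← p2, ← n1, ← n2, ← hc, hp]
  refine ⟨he', hx, h3, fun k => ?_, fun k k' => ?_, fun k k' => ?_, fun k k' => ?_,
    fun k k' => ?_, fun k k' => ?_, fun k k' => ?_⟩
  · rw [hon2 k, h4 k]
  · rw [hon1 k, h5 k k']
  · rw [hon1 k, h6 k k']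
  · rw [(hoff k.ne k'.ne).1, (hoff k.ne k'.ne).2]; exact h7 k k'
  · rw [(hoff k.ne' k'.ne).1, (hoff k.ne' k'.ne).2]; exact h8 k k'
  · rw [(hoff k.ne k'.ne').1, (hoff k.ne k'.ne').2]; exact h9 k k'
  · rw [(hoff k.ne' k'.ne').1, (hoff k.ne' k'.ne').2]; exact h10 k k'

open scoped Classical in
/-- A coloring of the part of `D'` in the disc `B` which fits to the coloring `C` of `D` on the
frontier extends to a coloring of `D'` which agrees with `C` outside `B`. -/
theorem LocalMove.exists_coloring (M : LocalMove D D' V B) (C : ShadowColoring X D)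
    {reg col : Square → X}
    (h0 : ∀ p ∈ B, p ∉ D'.curve → ∀ᶠ z in 𝓝 p, z ∈ B → reg z = reg p)
    (h0' : ∀ p ∈ B, p ∉ V → p ∉ D'.curve → reg p = C.reg p)
    (h1 : ∀ p ∈ B, p ∈ D'.curve → p ∉ D'.crossings → ∃ k r,
      (∀ᶠ z in 𝓝 p, z ∈ B → StrandBody D' reg col p k r z) ∧
      (p ∉ V → k = D.rightIndex p ∧ r = C.rightColor p ∧ col p = C.col p))
    (h2 : ∀ p ∈ V, p ∈ D'.crossings → ∃ e m r a, D'.IsCrossingChart p e ∧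
      CrossForm D' reg col p e m r a) :
    ∃ C' : ShadowColoring X D', C.AgreesOutside B C' := by
  let reg' : Square → X := fun z => if z ∈ B then reg z else C.reg z
  let col' : Square → X := fun z => if z ∈ B then col z else C.col z
  have r1 : ∀ z ∈ B, reg' z = reg z := fun z hz => if_pos hz
  have r2 : ∀ z ∉ B, reg' z = C.reg z := fun z hz => if_neg hz
  have c1 : ∀ z ∈ B, col' z = col z := fun z hz => if_pos hz
  have c2 : ∀ z ∉ B, col' z = C.col z := fun z hz => if_neg hz
  have hB : ∀ p ∉ B, ∀ᶠ z in 𝓝 p, z ∉ B := fun p hp => M.isClosed.isOpen_compl.eventually_mem hp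
  have hV : ∀ p ∈ V, ∀ᶠ z in 𝓝 p, z ∈ B := fun p hp =>
    (M.isOpen.eventually_mem hp).mono fun z hz => M.subset hz
  suffices hC : ∃ C' : ShadowColoring X D', (∀ p ∉ D'.curve, C'.reg p = reg' p) ∧
      ∀ p ∈ D'.curve, C'.col p = col' p by
    obtain ⟨C', e1, e2⟩ := hC
    refine ⟨C', fun p hp => ⟨fun k k' => ?_, fun k k' => ?_⟩⟩
    · rw [ShadowColoring.region_eq, ShadowColoring.region_eq, e1 p k', r2 p hp]
    · rw [ShadowColoring.arc_eq, ShadowColoring.arc_eq, e2 p k', c2 p hp]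
  refine exists_shadowColoring (fun p hp => ?_) (fun p hp hx => ?_) fun p hp => ?_
  · by_cases hpB : p ∈ B
    · by_cases hpV : p ∈ V
      · filter_upwards [h0 p hpB hp, hV p hpV] with z z1 z2
        rw [r1 z z2, r1 p hpB, z1 z2]
      · have hc : p ∉ D.curve := fun hh => hp ((M.curve_iff p hpB hpV).mp hh)
        filter_upwards [h0 p hpB hp, C.eventually_reg_eq hc] with z z1 z2
        by_cases hz : z ∈ B
        · rw [r1 z hz, r1 p hpB, z1 hz]
        · rw [r2 z hz, r1 p hpB, z2, h0' p hpB hpV hp]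
    · have hc : p ∉ D.curve := fun hh => hp ((M.agree p hpB).1.mp hh)
      filter_upwards [hB p hpB, C.eventually_reg_eq hc] with z z1 z2
      rw [r2 z z1, r2 p hpB, z2]
  · by_cases hpB : p ∈ B
    · obtain ⟨k, r, k1, k2⟩ := h1 p hpB hp hx
      refine ⟨k, r, ?_⟩
      have inB : ∀ z ∈ B, StrandBody D' reg col p k r z → StrandBody D' reg' col' p k r z :=
        fun z hz h => h.transfer h.1 Iff.rfl (fun _ => rfl) (fun _ => r1 z hz) (fun _ => c1 z hz)
          (c1 p hpB)
      by_cases hpV : p ∈ V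
      · filter_upwards [k1, hV p hpV] with z z1 z2 using inB z z2 (z1 z2)
      · obtain ⟨rfl, rfl, k5⟩ := k2 hpV
        have hc := (M.curve_iff p hpB hpV).mpr hp
        filter_upwards [k1, C.strandForm hc (M.notMem_crossings p hpB hpV).1] with z z1 z2
        by_cases hz : z ∈ B
        · exact inB z hz (z1 hz)
        · obtain ⟨b1, b2, -, b4⟩ := M.agree z hz
          exact z2.transfer (fun hh => z2.1 (b2.mpr hh)) b1 b4 (fun _ => r2 z hz)
            (fun _ => c2 z hz) ((c1 p hpB).trans k5)
    · have hc := (M.agree p hpB).1.mpr hp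
      have hx' : p ∉ D.crossings := fun hh => hx ((M.agree p hpB).2.1.mp hh)
      refine ⟨D.rightIndex p, C.rightColor p, ?_⟩
      filter_upwards [hB p hpB, C.strandForm hc hx'] with z hz z2
      obtain ⟨b1, b2, -, b4⟩ := M.agree z hz
      exact z2.transfer (fun hh => z2.1 (b2.mpr hh)) b1 b4 (fun _ => r2 z hz)
        (fun _ => c2 z hz) (c2 p hpB)
  · by_cases hpB : p ∈ B
    · have hpV : p ∈ V := by
        by_contra hpV
        exact (M.notMem_crossings p hpB hpV).2 hp
      obtain ⟨e, m, r, a, he, hf⟩ := h2 p hpV hp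
      refine ⟨e, m, r, a, he, ?_⟩
      filter_upwards [hf, hV p hpV] with z z1 z2
      exact z1.transfer z1.1 z1.2.1 ⟨rfl, rfl⟩ Iff.rfl (fun _ => rfl) (fun _ => r1 z z2)
        (fun _ => c1 z z2) (c1 p hpB)
    · obtain ⟨-, a2, a3, -⟩ := M.agree p hpB
      have hp' := a2.mpr hp
      obtain ⟨e, he⟩ := D.crossing_chart p hp'
      obtain ⟨e', he'⟩ := D'.crossing_chart p hp
      obtain ⟨m, r, a, hf⟩ := C.exists_crossForm hp' he
      have hagree : LinkDiagram.AgreeNear D D' p := by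
        filter_upwards [hB p hpB, a3 hp'] with z hz hz3
        obtain ⟨b1, b2, -, b4⟩ := M.agree z hz
        exact ⟨b1, b2, fun _ => hz3, b4⟩
      refine ⟨e', m, r, a, he', ?_⟩
      filter_upwards [hf, hB p hpB, hagree.sign_crossing_eq hp' he he',
        e'.open_source.eventually_mem he'.mem_source, D'.eventually_mem_crossings_eq p]
        with z z1 z2 z3 z4 z5
      obtain ⟨b1, b2, -, b4⟩ := M.agree z z2
      exact z1.transfer z4 z5 z3 b1 b4 (fun _ => r2 z z2) (fun _ => c2 z z2) (c2 p hpB)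

end

section

variable {h h' : Fin 3 → Square → ℝ}

open scoped Classical in
/-- The color at the point `z` of the top one of the strands through `z`. -/
noncomputable def topLabel (a : Fin 3 → X) (h : Fin 3 → Square → ℝ) (z : Square) : X :=
  if hz : ∃ i, h i z = 0 ∧ ∀ j, i < j → h j z ≠ 0 then colLabel a (sides h z) hz.choose else a 0

theorem topLabel_eq (a : Fin 3 → X) {i : Fin 3} (hi : h i p = 0) (hj : ∀ j, i < j → h j p ≠ 0) :
    topLabel a h p = colLabel a (sides h p) i := by
  have hz : ∃ i, h i p = 0 ∧ ∀ j, i < j → h j p ≠ 0 := ⟨i, hi, hj⟩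
  rw [topLabel, dif_pos hz]
  have h1 := hz.choose_spec
  rcases lt_trichotomy hz.choose i with hlt | heq | hlt
  · exact absurd hi (h1.2 _ hlt)
  · rw [heq]
  · exact absurd h1.1 (hj _ hlt)

namespace StrandMove

/-- The labels of the coloring of `D`, placed on the moved strands, define a coloring. -/
theorem exists_coloring (M : StrandMove D D' V B h h') (C : ShadowColoring X D) :
    ∃ C' : ShadowColoring X D', C.AgreesOutside B C' := by
  obtain ⟨n, r, a, N, -⟩ := M.disc.exists_normalForm C C.outer
  -- the index of `D'` is determined by means of the trivial colorings
  obtain ⟨k, r₁, a₁, N₁, h₁⟩ := M.disc.exists_normalForm D.trivialColoring 1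
  obtain ⟨n', r₂, a₂, N₂, h₂⟩ := M.disc'.exists_normalForm D'.trivialColoring 1
  obtain ⟨rfl, -, -⟩ := M.labels_eq (fun _ _ => ⟨fun _ _ => rfl, fun _ _ => rfl⟩) N₁ N₂ h₁ h₂
  obtain rfl : n = k := by
    obtain ⟨z, hz, hzV, h0⟩ := M.exists_corner
    have hzc : z ∉ D.curve := fun hh => by
      obtain ⟨i, hi⟩ := (M.disc.mem_curve_iff z hz).mp hh
      exact h0 i hi
    have := (N.region z hz hzc).1.symm.trans (N₁.region z hz hzc).1
    omega
  refine M.move.exists_coloring C (reg := fun z => regLabel r a (sides h' z))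
    (col := topLabel a h') (fun p hp hc => ?_) (fun p hp hpV hc => ?_) (fun p hp hc hx => ?_)
    fun p hp hx => ?_
  · have : ∀ᶠ z in 𝓝 p, ∀ i, sides h' z i = sides h' p i := eventually_all.mpr fun i =>
      M.disc'.eventually_sides_eq hp fun h0 => hc ((M.disc'.mem_curve_iff p hp).mpr ⟨i, h0⟩)
    filter_upwards [this] with z hz _
    rw [show sides h' z = sides h' p from funext hz]
  · rw [← M.sides_eq hp hpV]
    exact (N.region p hp fun hh => hc ((M.move.curve_iff p hp hpV).mp hh)).2.symm
  · obtain ⟨i, hi⟩ := (M.disc'.mem_curve_iff p hp).mp hc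
    have hj : ∀ j, i < j → h' j p ≠ 0 := fun j hj =>
      M.disc'.ne_zero_of_notMem_crossings hp hx hi hj.ne'
    refine ⟨n + sideCount (sides h' p), regLabel r a (sides h' p), ?_, fun hpV => ?_⟩
    · filter_upwards [M.disc'.eventually_sides_eq_update hp hx hi,
        M.disc'.eventually_mem_curve_iff hp hx hi, eventually_notMem_crossings hx]
        with z z1 z2 z3 hzB
      refine ⟨z3, fun hzc => ?_, fun hzc => ?_⟩
      · have h0 := (z2 hzB).mp hzc
        rw [topLabel_eq a hi hj, topLabel_eq a h0 fun j hj =>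
          M.disc'.ne_zero_of_notMem_crossings hzB z3 h0 hj.ne', z1, h0,
          decide_eq_false (lt_irrefl _), update_sides_of_zero hi]
      · beta_reduce
        rw [(N₂.region z hzB hzc).1, z1, sideCount_update, regLabel_update,
          update_sides_of_zero hi, topLabel_eq a hi hj]
        by_cases h0 : 0 < h' i z
        · right; simp only [h0, decide_true, if_true]; exact ⟨by ring, rfl⟩
        · left; simp only [h0, decide_false]; exact ⟨by simp, rfl⟩
    · have hs := M.sides_eq hp hpV
      have h0 := eq_zero_of_sign (M.sign_eq i p hp hpV).symm hi
      have hx' := (M.move.notMem_crossings p hp hpV).1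
      obtain ⟨b1, b2, -⟩ := N.strand i p hp h0 hx'
      rw [topLabel_eq a hi hj, b1, b2, hs, N.col i p hp h0 fun j hj =>
        M.disc.ne_zero_of_notMem_crossings hp hx' h0 hj.ne', hs]
      exact ⟨rfl, rfl, rfl⟩
  · have hpB := M.disc'.subset hp
    obtain ⟨i, j, hij, hi, hj⟩ := (M.disc'.mem_crossings_iff p hpB).mp hx
    obtain ⟨e, he⟩ := D'.crossing_chart p hx
    have htop : ∀ k, j < k → h' k p ≠ 0 := fun k hk =>
      M.disc'.ne_zero_third hpB hij.ne hi hj (hij.trans hk).ne' hk.ne'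
    refine ⟨e, n + sideCount (sides h' p), regLabel r a (sides h' p), colLabel a (sides h' p) i, he,
      ?_⟩
    filter_upwards [M.disc'.sign_crossing D'.trivialColoring hp hij hi hj he,
      M.disc'.eventually_sides_eq_update_update hpB hij.ne hi hj, M.disc'.eventually_mem hp,
      e.open_source.eventually_mem he.mem_source, D'.eventually_mem_crossings_eq p,
      M.disc'.eventually_zero_iff hp hij hi hj he] with z z1 z2 zV z3 z4 z5
    have hzB := M.disc'.subset zV
    have hcur := he.mem_curve_iff z z3
    have hreg : regLabel r a (sides h' z) = actIf (decide (0 < (e z).2)) (topLabel a h' p)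
        (actIf (decide (0 < (e z).1)) (colLabel a (sides h' p) i) (regLabel r a (sides h' p))) := by
      rw [topLabel_eq a hj htop, z2, Function.update_comm hij.ne', regLabel_update,
        Function.update_comm hij.ne, regLabel_update, update_sides_of_zero hj,
        update_sides_of_zero hi, decide_pos_eq_of_sign z1.1, decide_pos_eq_of_sign z1.2,
        colLabel_congr (s := Function.update (sides h' p) i _) (s' := sides h' p) a
          fun k hk => Function.update_of_ne (hij.trans hk).ne' _ _]
    have hidx : (e z).1 ≠ 0 → (e z).2 ≠ 0 → D'.index z = n + sideCount (sides h' p) +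
        (if decide (0 < (e z).1) then 1 else 0) + (if decide (0 < (e z).2) then 1 else 0) := by
      intro k1 k2
      rw [(N₂.region z hzB fun hh => (hcur.mp hh).elim k1 k2).1, z2, sideCount_update,
        Function.update_comm hij.ne', sideCount_update, update_sides_of_zero hi,
        update_sides_of_zero hj, decide_pos_eq_of_sign z1.1, decide_pos_eq_of_sign z1.2]
      ring
    have hunder : (e z).1 = 0 → (e z).2 ≠ 0 → topLabel a h' z =
        actIf (decide (0 < (e z).2)) (topLabel a h' p) (colLabel a (sides h' p) i) := by
      intro k1 k2
      have hzi := z5.1.mpr k1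
      have hzx : z ∉ D'.crossings := fun hh => k2 (by rw [z4 hh, he.map_center]; rfl)
      rw [topLabel_eq a hzi fun k hk => M.disc'.ne_zero_of_notMem_crossings hzB hzx hzi hk.ne',
        topLabel_eq a hj htop, z2, colLabel_congr (s' := Function.update (sides h' p) j
          (decide (0 < h' j z))) a fun k hk => Function.update_of_ne hk.ne' _ _,
        colLabel_update _ _ hij, update_sides_of_zero hj, decide_pos_eq_of_sign z1.2]
    refine ⟨z3, z4, hcur, fun k => ?_, fun k k' => ?_, fun k k' => ?_, fun k k' => ?_,
      fun k k' => ?_, fun k k' => ?_, fun k k' => ?_⟩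
    · have hzj := z5.2.mpr k
      have hk : ∀ k, j < k → h' k z ≠ 0 := by
        intro k hk hk0
        by_cases hzi : h' i z = 0
        · exact M.disc'.ne_zero_third hzB hij.ne hzi hzj (hij.trans hk).ne' hk.ne' hk0
        · have hzx : z ∈ D'.crossings := (M.disc'.mem_crossings_iff z hzB).mpr ⟨_, _, hk, hzj, hk0⟩
          rw [z4 hzx] at hzi
          exact hzi hi
      rw [topLabel_eq a hzj hk, topLabel_eq a hj htop]
      refine colLabel_congr _ fun k hk => ?_
      rw [z2, Function.update_of_ne (hij.trans hk).ne', Function.update_of_ne hk.ne']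
    · rw [hunder k k'.ne, decide_eq_false k'.not_gt]; rfl
    · rw [hunder k k'.ne', decide_eq_true k']; rfl
    · beta_reduce
      rw [hreg, hidx k.ne k'.ne, decide_eq_false k.not_gt, decide_eq_false k'.not_gt]
      exact ⟨by simp, rfl⟩
    · beta_reduce
      rw [hreg, hidx k.ne' k'.ne, decide_eq_true k, decide_eq_false k'.not_gt]
      exact ⟨by simp, rfl⟩
    · beta_reduce
      rw [hreg, hidx k.ne k'.ne', decide_eq_false k.not_gt, decide_eq_true k']
      exact ⟨by simp, rfl⟩
    · beta_reduce
      rw [hreg, hidx k.ne' k'.ne', decide_eq_true k, decide_eq_true k']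
      exact ⟨by simp only [if_true]; ring, rfl⟩

end StrandMove

end

/-! ### Pictures in a disc -/

/-- The interior of the square `[-1,1]²`. -/
def openPictureBox : Set (ℝ × ℝ) := Ioo (-1) 1 ×ˢ Ioo (-1) 1

theorem openPictureBox_subset : openPictureBox ⊆ pictureBox :=
  prod_mono Ioo_subset_Icc_self Ioo_subset_Icc_self

theorem closure_openPictureBox : closure openPictureBox = pictureBox := by
  rw [openPictureBox, closure_prod_eq, closure_Ioo (by norm_num)]; rfl

theorem mem_pictureBox_iff {w : ℝ × ℝ} : w ∈ pictureBox ↔ |w.1| ≤ 1 ∧ |w.2| ≤ 1 := by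
  simp only [pictureBox, mem_prod, mem_Icc, abs_le]

theorem mem_openPictureBox_iff {w : ℝ × ℝ} : w ∈ openPictureBox ↔ |w.1| < 1 ∧ |w.2| < 1 := by
  simp only [openPictureBox, mem_prod, mem_Ioo, abs_lt]

theorem isOpen_openPictureBox : IsOpen openPictureBox := isOpen_Ioo.prod isOpen_Ioo

section PictureDisc

variable {w : ℝ × ℝ}

theorem mem_symm_image_iff {A : Set (ℝ × ℝ)} (hA : A ⊆ e.target) :
    z ∈ e.symm '' A ↔ z ∈ e.source ∧ e z ∈ A := by
  constructor
  · rintro ⟨w, hw, rfl⟩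
    exact ⟨e.map_target (hA hw), by rwa [e.right_inv (hA hw)]⟩
  · rintro ⟨h1, h2⟩
    exact ⟨e z, h2, e.left_inv h1⟩

theorem mem_openBoxOf_iff (hbox : pictureBox ⊆ e.target) :
    z ∈ e.symm '' openPictureBox ↔ z ∈ e.source ∧ e z ∈ openPictureBox :=
  mem_symm_image_iff (openPictureBox_subset.trans hbox)

theorem isOpen_openDisc (hbox : pictureBox ⊆ e.target) : IsOpen (e.symm '' openPictureBox) :=
  e.isOpen_image_symm_of_subset_target isOpen_openPictureBox (openPictureBox_subset.trans hbox)

theorem isClosed_disc (hbox : pictureBox ⊆ e.target) : IsClosed (boxOf e) :=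
  ((isCompact_Icc.prod isCompact_Icc).image_of_continuousOn
    (e.continuousOn_symm.mono hbox)).isClosed

theorem isPreconnected_openDisc (hbox : pictureBox ⊆ e.target) :
    IsPreconnected (e.symm '' openPictureBox) :=
  (isPreconnected_Ioo.prod isPreconnected_Ioo).image _
    (e.continuousOn_symm.mono (openPictureBox_subset.trans hbox))

theorem symm_mem_closure {A T : Set (ℝ × ℝ)} (hA : A ⊆ T) (hw : w ∈ e.target)
    (hwA : w ∈ closure A) :
    e.symm w ∈ closure (e.symm '' T) :=
  closure_mono (image_mono hA) ((e.continuousAt_symm hw).continuousWithinAt.mem_closure_image hwA)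

theorem disc_subset_closure (hbox : pictureBox ⊆ e.target) :
    boxOf e ⊆ closure (e.symm '' openPictureBox) := by
  rintro _ ⟨w, hw, rfl⟩
  exact symm_mem_closure subset_rfl (hbox hw) (by rwa [closure_openPictureBox])

theorem mem_closure_compl_disc (hbox : pictureBox ⊆ e.target)
    (hz : z ∈ boxOf e)
    (hz' : z ∉ e.symm '' openPictureBox) : z ∈ closure (boxOf e)ᶜ := by
  rw [mem_symm_image_iff hbox] at hz
  rw [mem_openBoxOf_iff hbox] at hz'
  have hw : e z ∉ openPictureBox := fun h => hz' ⟨hz.1, h⟩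
  -- the point `z` is the limit of points with slightly dilated coordinates
  have h1 : Tendsto (fun t : ℝ => t • e z) (𝓝[>] 1) (𝓝 (e z)) := by
    have : Continuous fun t : ℝ => t • e z := by fun_prop
    simpa using (this.tendsto 1).mono_left nhdsWithin_le_nhds
  have h2 := (e.continuousAt_symm (e.map_source hz.1)).tendsto.comp h1
  rw [e.left_inv hz.1] at h2
  refine mem_closure_of_tendsto h2 ?_
  filter_upwards [h1.eventually (e.open_target.eventually_mem (e.map_source hz.1)),
    self_mem_nhdsWithin] with t ht (ht1 : 1 < t)
  rw [mem_compl_iff, mem_symm_image_iff hbox, Function.comp_apply, e.right_inv ht,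
    mem_pictureBox_iff]
  rintro ⟨-, h3, h4⟩
  rw [mem_openPictureBox_iff] at hw
  simp only [Prod.smul_fst, Prod.smul_snd, smul_eq_mul, abs_mul] at h3 h4
  rw [abs_of_pos (by linarith)] at h3 h4
  refine hw ⟨?_, ?_⟩
  · nlinarith [abs_nonneg (e z).1]
  · nlinarith [abs_nonneg (e z).2]

end PictureDisc

/-- Two pictures in the square `[-1,1]²` which have the same end points, on the left and right
sides of the square, and are transverse to these sides, in the weak sense that the first
coordinate is injective on the curves near the end points. -/
structure PicturePair (P P' : LocalPicture) : Prop where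
  curve_iff : ∀ w ∈ pictureBox, w ∉ openPictureBox → (w ∈ P.curve ↔ w ∈ P'.curve)
  notMem_crossings : ∀ w ∈ pictureBox, w ∉ openPictureBox → w ∉ P.crossings ∧ w ∉ P'.crossings
  abs_fst : ∀ w ∈ pictureBox, w ∉ openPictureBox → w ∈ P.curve → |w.1| = 1
  injOn : ∀ w ∈ pictureBox, w ∉ openPictureBox → w ∈ P.curve →
    ∃ N ∈ 𝓝 w, InjOn Prod.fst (N ∩ (P.curve ∩ pictureBox))

/-- An injective continuous function on an interval has no extremum in the interior. -/
theorem not_injOn_of_abs_le {δ : ℝ} (hδ : 0 < δ) {g : ℝ → ℝ} (hg : ContinuousOn g (Ioo (-δ) δ))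
    (hle : ∀ t ∈ Ioo (-δ) δ, |g t| ≤ 1) (h0 : |g 0| = 1) : ¬ InjOn g (Ioo (-δ) δ) := by
  intro hinj
  have hm : (-(δ / 2)) ∈ Ioo (-δ) δ := ⟨by linarith, by linarith⟩
  have hp : δ / 2 ∈ Ioo (-δ) δ := ⟨by linarith, by linarith⟩
  have hz : (0 : ℝ) ∈ Ioo (-δ) δ := ⟨by linarith, by linarith⟩
  have l1 := abs_le.mp (hle _ hm)
  have l2 := abs_le.mp (hle _ hp)
  have hlt1 : -(δ / 2) < 0 := by linarith
  have hlt2 : 0 < δ / 2 := by linarith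
  rcases hg.strictMonoOn_of_injOn_Ioo (by linarith) hinj with h | h
  · have a1 := h hm hz hlt1
    have a2 := h hz hp hlt2
    rcases (abs_eq zero_le_one).mp h0 with h | h <;> linarith
  · have a1 := h hm hz hlt1
    have a2 := h hz hp hlt2
    rcases (abs_eq zero_le_one).mp h0 with h | h <;> linarith

/-- If a frontier point of the curve were not a limit of points of the curve outside the disc, then
the first coordinate would be injective near this point, with an extremum there. -/
theorem PicturePair.localMove {P P' : LocalPicture} (hP : PicturePair P P')
    (hbox : pictureBox ⊆ e.target)
    (hbd : Disjoint e.source (Cube.boundary (Fin 2))) (hD : D.LooksLike e P)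
    (hD' : D'.LooksLike e P') (hag : LinkDiagram.AgreesOutside (boxOf e) D D') :
    LocalMove D D' (e.symm '' openPictureBox) (boxOf e) := by
  have hbox' := openPictureBox_subset.trans hbox
  have hmem : ∀ z ∈ boxOf e, z ∉ e.symm '' openPictureBox →
      z ∈ e.source ∧ e z ∈ pictureBox ∧ e z ∉ openPictureBox := by
    intro z hz hz'
    rw [mem_symm_image_iff hbox] at hz
    rw [mem_symm_image_iff hbox'] at hz'
    exact ⟨hz.1, hz.2, fun h => hz' ⟨hz.1, h⟩⟩
  refine ⟨isOpen_openDisc hbox, isClosed_disc hbox, image_mono openPictureBox_subset, ?_, hag,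
    fun z hz hz' => ?_, fun z hz hz' => ?_, fun z hz hz' => mem_closure_compl_disc hbox hz hz',
    fun z hz hz' hc => ?_⟩
  · refine hbd.mono_left fun z hz => ?_
    exact ((mem_symm_image_iff hbox).mp hz).1
  · obtain ⟨h1, h2, h3⟩ := hmem z hz hz'
    rw [(hD z h1 h2).1, (hD' z h1 h2).1]
    exact hP.curve_iff _ h2 h3
  · obtain ⟨h1, h2, h3⟩ := hmem z hz hz'
    rw [(hD z h1 h2).2.1, (hD' z h1 h2).2.1]
    exact hP.notMem_crossings _ h2 h3
  · obtain ⟨h1, h2, h3⟩ := hmem z hz hz'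
    have hzP := (hD z h1 h2).1.mp hc
    have hx : z ∉ D.crossings := fun hh => (hP.notMem_crossings _ h2 h3).1 ((hD z h1 h2).2.1.mp hh)
    obtain ⟨N, hN, hinj⟩ := hP.injOn _ h2 h3 hzP
    obtain ⟨e₁, he₁⟩ := D.regular_chart z hc hx
    by_contra hcl
    rw [mem_closure_iff_frequently, not_frequently] at hcl
    obtain ⟨δ, hδ, d1, d2⟩ := exists_ball_subset_target he₁.mem_source he₁.map_center
      (hcl.and ((e.open_source.eventually_mem h1).and ((e.continuousAt h1).eventually_mem hN)))
    have hball : ∀ t ∈ Ioo (-δ) δ, ((0, t) : ℝ × ℝ) ∈ planeBall δ := fun t ht => by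
      rw [mem_ball_prod]; exact ⟨by simpa, abs_lt.mpr ht⟩
    have hcur : ∀ t ∈ Ioo (-δ) δ, e₁.symm (0, t) ∈ D.curve := fun t ht => by
      have hb := d1 (hball t ht)
      rw [he₁.mem_curve_iff _ (e₁.map_target hb), e₁.right_inv hb]
    have hin : ∀ t ∈ Ioo (-δ) δ, e₁.symm (0, t) ∈ e.source ∧ e (e₁.symm (0, t)) ∈ pictureBox ∧
        e (e₁.symm (0, t)) ∈ N ∩ (P.curve ∩ pictureBox) := fun t ht => by
      obtain ⟨k1, k2, k3⟩ := d2 _ (hball t ht)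
      have hB : e₁.symm (0, t) ∈ boxOf e := by
        by_contra hh
        exact k1 ⟨hcur t ht, hh⟩
      have k4 := ((mem_symm_image_iff hbox).mp hB).2
      exact ⟨k2, k4, k3, (hD _ k2 k4).1.mp (hcur t ht), k4⟩
    refine not_injOn_of_abs_le hδ (g := fun t => (e (e₁.symm (0, t))).1) ?_ (fun t ht => ?_) ?_ ?_
    · refine continuous_fst.comp_continuousOn (e.continuousOn.comp (e₁.continuousOn_symm.comp
        (by fun_prop) fun t ht => d1 (hball t ht)) fun t ht => (hin t ht).1)
    · exact (mem_pictureBox_iff.mp (hin t ht).2.1).1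
    · have : e₁.symm (0, 0) = z := by
        have := e₁.left_inv he₁.mem_source
        rwa [he₁.map_center] at this
      simp only [this]
      exact hP.abs_fst _ h2 h3 hzP
    · intro t ht t' ht' htt
      have k1 := hinj (hin t ht).2.2 (hin t' ht').2.2 htt
      have k2 := e.injOn (hin t ht).1 (hin t' ht').1 k1
      have k3 := e₁.symm.injOn (d1 (hball t ht)) (d1 (hball t' ht')) k2
      exact congrArg Prod.snd k3

/-! ### The second and the third Reidemeister move -/

/-- The picture `P` consists of the graphs of the functions `φ i`, in this order from the bottom
to the top.  Graphs above the square `[-1,1]²` are allowed, so that there may be less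
than three strands. -/
structure GraphPicture (P : LocalPicture) (φ : Fin 3 → ℝ → ℝ) : Prop where
  continuous : ∀ i, Continuous (φ i)
  curve_iff : ∀ w ∈ pictureBox, w ∈ P.curve ↔ ∃ i, w.2 = φ i w.1
  crossings_iff : ∀ w ∈ pictureBox, w ∈ P.crossings ↔ ∃ i j, i < j ∧ w.2 = φ i w.1 ∧ w.2 = φ j w.1
  overStrand_iff : ∀ w ∈ pictureBox, ∀ v ∈ pictureBox, v ∈ P.overStrand w ↔
    ∃ i j, i < j ∧ w.2 = φ i w.1 ∧ w.2 = φ j w.1 ∧ v.2 = φ j v.1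
  range : ∀ i, (∀ x, |x| ≤ 1 → |φ i x| < 1) ∨ ∀ x, 1 < φ i x
  exists_ne : ∀ x, |x| ≤ 1 → ∃ i j, φ i x ≠ φ j x
  ends : ∀ i j, i ≠ j → ∀ x, |x| = 1 → φ i x ≠ φ j x

section GraphPicture

variable {P P' : LocalPicture} {φ φ' : Fin 3 → ℝ → ℝ} {w : ℝ × ℝ} {i j : Fin 3}

theorem eq_of_notMem_openPictureBox (hw : w ∈ pictureBox) (hw' : w ∉ openPictureBox) :
    |w.1| = 1 ∨ |w.2| = 1 := by
  rw [mem_pictureBox_iff] at hw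
  rw [mem_openPictureBox_iff, not_and_or, not_lt, not_lt] at hw'
  exact hw'.imp (fun h => le_antisymm hw.1 h) fun h => le_antisymm hw.2 h

namespace GraphPicture

theorem abs_lt (G : GraphPicture P φ) (hw : w ∈ pictureBox) (h : w.2 = φ i w.1) :
    (∀ x, |x| ≤ 1 → |φ i x| < 1) ∧ |w.2| < 1 := by
  rw [mem_pictureBox_iff] at hw
  rcases G.range i with h1 | h1
  · exact ⟨h1, h ▸ h1 _ hw.1⟩
  · have := h1 w.1
    rw [← h] at this
    linarith [le_abs_self w.2]

theorem abs_fst (G : GraphPicture P φ) (hw : w ∈ pictureBox) (hw' : w ∉ openPictureBox)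
    (h : w.2 = φ i w.1) : |w.1| = 1 :=
  (eq_of_notMem_openPictureBox hw hw').resolve_right (G.abs_lt hw h).2.ne

theorem ne_of_crossing (G : GraphPicture P φ) (hw : w ∈ pictureBox) (hij : i ≠ j)
    (hi : w.2 = φ i w.1) (hj : w.2 = φ j w.1) : |w.1| < 1 :=
  lt_of_le_of_ne (mem_pictureBox_iff.mp hw).1 fun h => G.ends i j hij _ h (hi.symm.trans hj)

/-- At a crossing there is only one pair of strands. -/
theorem overStrand_iff' (G : GraphPicture P φ) (hw : w ∈ pictureBox) (hij : i < j)
    (hi : w.2 = φ i w.1) (hj : w.2 = φ j w.1) {v : ℝ × ℝ} (hv : v ∈ pictureBox) :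
    v ∈ P.overStrand w ↔ v.2 = φ j v.1 := by
  rw [G.overStrand_iff w hw v hv]
  refine ⟨?_, fun h => ⟨i, j, hij, hi, hj, h⟩⟩
  rintro ⟨i', j', hij', hi', hj', h⟩
  suffices j = j' by rwa [this]
  by_contra hne
  have hall : ∀ k, k = i ∨ k = j ∨ k = i' ∨ k = j' := by
    clear * - hij hij' hne
    revert i j i' j'; decide
  have hk : ∀ k, w.2 = φ k w.1 := fun k => by
    rcases hall k with rfl | rfl | rfl | rfl <;> assumption
  obtain ⟨k, l, hkl⟩ := G.exists_ne w.1 (mem_pictureBox_iff.mp hw).1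
  exact hkl ((hk k).symm.trans (hk l))

theorem picturePair (G : GraphPicture P φ) (G' : GraphPicture P' φ')
    (hends : ∀ i x, |x| = 1 → φ i x = φ' i x) : PicturePair P P' := by
  refine ⟨fun w hw hw' => ?_, fun w hw hw' => ⟨fun h => ?_, fun h => ?_⟩, fun w hw hw' h => ?_,
    fun w hw hw' h => ?_⟩
  · rw [G.curve_iff w hw, G'.curve_iff w hw]
    refine exists_congr fun i => ⟨fun h => ?_, fun h => ?_⟩
    · rw [← hends i _ (G.abs_fst hw hw' h), h]
    · rw [hends i _ (G'.abs_fst hw hw' h), h]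
  · obtain ⟨i, j, hij, hi, hj⟩ := (G.crossings_iff w hw).mp h
    exact (G.ne_of_crossing hw hij.ne hi hj).ne (G.abs_fst hw hw' hi)
  · obtain ⟨i, j, hij, hi, hj⟩ := (G'.crossings_iff w hw).mp h
    exact (G'.ne_of_crossing hw hij.ne hi hj).ne (G'.abs_fst hw hw' hi)
  · obtain ⟨i, hi⟩ := (G.curve_iff w hw).mp h
    exact G.abs_fst hw hw' hi
  · obtain ⟨i, hi⟩ := (G.curve_iff w hw).mp h
    have h1 := G.abs_fst hw hw' hi
    have h2 : ∀ᶠ v : ℝ × ℝ in 𝓝 w, ∀ j, j ≠ i → v.2 ≠ φ j v.1 := eventually_all.mpr fun j => by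
      by_cases hj : j = i
      · exact .of_forall fun _ h => absurd hj h
      · have : w.2 - φ j w.1 ≠ 0 := by
          rw [hi]
          exact sub_ne_zero.mpr (G.ends i j (Ne.symm hj) _ h1)
        have hc : Continuous fun v : ℝ × ℝ => v.2 - φ j v.1 :=
          continuous_snd.sub ((G.continuous j).comp continuous_fst)
        exact (hc.continuousAt.eventually_ne this).mono fun v hv _ h => hv (sub_eq_zero.mpr h)
    refine ⟨_, h2, ?_⟩
    rintro v ⟨hv1, hv2, hv3⟩ v' ⟨hv1', hv2', hv3'⟩ hvv
    have key : ∀ v ∈ P.curve, v ∈ pictureBox → (∀ j, j ≠ i → v.2 ≠ φ j v.1) → v.2 = φ i v.1 := by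
      intro v hv hb hne
      obtain ⟨k, hk⟩ := (G.curve_iff v hb).mp hv
      by_contra hh
      exact hne k (fun h => hh (h ▸ hk)) hk
    refine Prod.ext hvv ?_
    rw [key v hv2 hv3 hv1, key v' hv2' hv3' hv1', hvv]

/-- The function on the source of the chart `e` which vanishes on the graph of `φ`. -/
def _root_.graphDist (e : PlaneChart) (φ : Fin 3 → ℝ → ℝ) (i : Fin 3)
    (z : Square) : ℝ := (e z).2 - φ i (e z).1

theorem _root_.graphDist_eq_zero_iff : graphDist e φ i z = 0 ↔ (e z).2 = φ i (e z).1 := sub_eq_zero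

theorem _root_.graphDist_symm (hw : w ∈ e.target) : graphDist e φ i (e.symm w) = w.2 - φ i w.1 := by
  rw [graphDist, e.right_inv hw]

theorem strandDisc (G : GraphPicture P φ) (hbox : pictureBox ⊆ e.target) (hD : D.LooksLike e P) :
    StrandDisc D (e.symm '' openPictureBox) (boxOf e) (graphDist e φ) := by
  have hbox' := openPictureBox_subset.trans hbox
  have hB : ∀ z ∈ boxOf e, z ∈ e.source ∧ e z ∈ pictureBox := fun z hz =>
    (mem_symm_image_iff hbox).mp hz
  have hV : ∀ z ∈ e.symm '' openPictureBox, z ∈ e.source ∧ e z ∈ openPictureBox := fun z hz =>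
    (mem_symm_image_iff hbox').mp hz
  -- points on the vertical line through a point of the disc
  have hfreq : ∀ i, ∀ z ∈ e.symm '' openPictureBox, graphDist e φ i z = 0 → ∀ s : ℝ, s ≠ 0 →
      ∃ᶠ w in 𝓝 z, 0 < s * graphDist e φ i w := by
    intro i z hz h0 s hs
    obtain ⟨h1, h2⟩ := hV z hz
    have h3 : Tendsto (fun t : ℝ => ((e z).1, (e z).2 + s * t)) (𝓝[>] 0) (𝓝 (e z)) := by
      have : Continuous fun t : ℝ => ((e z).1, (e z).2 + s * t) := by fun_prop
      simpa using (this.tendsto 0).mono_left nhdsWithin_le_nhds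
    have h4 := (e.continuousAt_symm (e.map_source h1)).tendsto.comp h3
    rw [e.left_inv h1] at h4
    refine h4.frequently (Eventually.frequently ?_)
    filter_upwards [h3.eventually (e.open_target.eventually_mem (e.map_source h1)),
      self_mem_nhdsWithin] with t ht (ht0 : 0 < t)
    rw [Function.comp_apply, graphDist_symm ht]
    have h5 := graphDist_eq_zero_iff.mp h0
    have : 0 < s * s * t := mul_pos (mul_self_pos.mpr hs) ht0
    simp only [← h5]
    linarith
  refine ⟨isOpen_openDisc hbox, image_mono openPictureBox_subset, disc_subset_closure hbox,
    isPreconnected_openDisc hbox, fun i z hz => ?_, fun z hz => ?_, fun z hz => ?_,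
    fun z hz i j hij hi hj => ?_, fun i => ?_, fun z hz => ?_, fun z hz hx => ?_,
    fun i z hz h0 => ?_, fun i z hz h0 => ?_, fun i z hz h0 => ?_⟩
  · have h1 := e.continuousAt (hB z hz).1
    exact (continuous_snd.continuousAt.comp h1).sub
      (((G.continuous i).comp continuous_fst).continuousAt.comp h1)
  · obtain ⟨h1, h2⟩ := hB z hz
    simp only [(hD z h1 h2).1, G.curve_iff _ h2, graphDist_eq_zero_iff]
  · obtain ⟨h1, h2⟩ := hB z hz
    simp only [(hD z h1 h2).2.1, G.crossings_iff _ h2, graphDist_eq_zero_iff]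
  · obtain ⟨h1, h2⟩ := hV z hz
    have h2' := openPictureBox_subset h2
    rw [graphDist_eq_zero_iff] at hi hj
    have hx := (hD z h1 h2').2.1.mpr ((G.crossings_iff _ h2').mpr ⟨i, j, hij, hi, hj⟩)
    filter_upwards [(hD z h1 h2').2.2 hx, (isOpen_openDisc hbox).eventually_mem hz] with w w1 w2
    rw [w1, graphDist_eq_zero_iff]
    exact G.overStrand_iff' h2' hij hi hj (openPictureBox_subset (hV w w2).2)
  · rcases G.range i with hr | hr
    · have : {z | z ∈ e.symm '' openPictureBox ∧ graphDist e φ i z = 0} =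
          (fun x => e.symm (x, φ i x)) '' Ioo (-1) 1 := by
        ext z
        constructor
        · rintro ⟨hz, h0⟩
          obtain ⟨h1, h2⟩ := hV z hz
          refine ⟨(e z).1, h2.1, ?_⟩
          rw [graphDist_eq_zero_iff] at h0
          simp only [← h0]
          exact e.left_inv h1
        · rintro ⟨x, hx, rfl⟩
          have hx' : ((x, φ i x) : ℝ × ℝ) ∈ openPictureBox :=
            ⟨hx, _root_.abs_lt.mp (hr x (_root_.abs_lt.mpr hx).le)⟩
          exact ⟨mem_image_of_mem _ hx', by rw [graphDist_symm (hbox' hx')]; simp⟩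
      rw [this]
      refine isPreconnected_Ioo.image _ (e.continuousOn_symm.comp
        (continuous_id.prodMk (G.continuous i)).continuousOn fun x hx => hbox' ?_)
      exact ⟨hx, _root_.abs_lt.mp (hr x (_root_.abs_lt.mpr hx).le)⟩
    · have : {z | z ∈ e.symm '' openPictureBox ∧ graphDist e φ i z = 0} = ∅ := by
        refine eq_empty_of_forall_notMem ?_
        rintro z ⟨hz, h0⟩
        rw [graphDist_eq_zero_iff] at h0
        have h1 := hr (e z).1
        rw [← h0] at h1
        linarith [(hV z hz).2.2.2]
      rw [this]
      exact isPreconnected_empty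
  · by_contra hh
    push Not at hh
    obtain ⟨i, j, hij⟩ := G.exists_ne (e z).1 (mem_pictureBox_iff.mp (hB z hz).2).1
    exact hij ((graphDist_eq_zero_iff.mp (hh i)).symm.trans (graphDist_eq_zero_iff.mp (hh j)))
  · obtain ⟨h1, h2⟩ := hB z hz
    obtain ⟨i, j, hij, hi, hj⟩ := (G.crossings_iff _ h2).mp ((hD z h1 h2).2.1.mp hx)
    exact (mem_symm_image_iff hbox').mpr ⟨h1, mem_openPictureBox_iff.mpr
      ⟨G.ne_of_crossing h2 hij.ne hi hj, (G.abs_lt h2 hi).2⟩⟩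
  · obtain ⟨h1, h2⟩ := hB z hz
    rw [graphDist_eq_zero_iff] at h0
    have hr := (G.abs_lt h2 h0).1
    have hcl : (e z).1 ∈ closure (Ioo (-1 : ℝ) 1) := by
      rw [closure_Ioo (by norm_num)]; exact h2.1
    have hc : ContinuousAt (fun x => e.symm (x, φ i x)) (e z).1 := by
      refine ContinuousAt.comp (f := fun x => (x, φ i x)) (g := e.symm) (e.continuousAt_symm ?_)
        (continuous_id.prodMk (G.continuous i)).continuousAt
      simp only [← h0]
      exact e.map_source h1
    have := hc.continuousWithinAt.mem_closure_image hcl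
    rw [← h0, show ((e z).1, (e z).2) = e z from rfl, e.left_inv h1] at this
    refine closure_mono ?_ this
    rintro _ ⟨x, hx, rfl⟩
    have hx' : ((x, φ i x) : ℝ × ℝ) ∈ openPictureBox :=
      ⟨hx, _root_.abs_lt.mp (hr x (_root_.abs_lt.mpr hx).le)⟩
    exact ⟨mem_image_of_mem _ hx', by rw [graphDist_symm (hbox' hx')]; simp⟩
  · simpa using hfreq i z hz h0 1 one_ne_zero
  · simpa using hfreq i z hz h0 (-1) (by norm_num)

/-- The orientation of a strand is determined at its end point. -/
theorem orientation_eq (hbox : pictureBox ⊆ e.target) (hends : ∀ i x, |x| = 1 → φ i x = φ' i x)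
    (M : LocalMove D D' (e.symm '' openPictureBox) (boxOf e)) {o o' : Fin 3 → ℝ}
    (ho : ∀ i, o i = 1 ∨ o i = -1) (ho' : ∀ i, o' i = 1 ∨ o' i = -1)
    (S : OrientedStrandDisc D (e.symm '' openPictureBox) (boxOf e)
      fun i z => o i * graphDist e φ i z)
    (S' : OrientedStrandDisc D' (e.symm '' openPictureBox) (boxOf e)
      fun i z => o' i * graphDist e φ' i z) (hi : ∀ x, |x| ≤ 1 → |φ i x| < 1) : o i = o' i := by
  have hC : D.trivialColoring.AgreesOutside (boxOf e) D'.trivialColoring :=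
    fun _ _ => ⟨fun _ _ => rfl, fun _ _ => rfl⟩
  obtain ⟨n, r, a, N, -⟩ := S.exists_normalForm D.trivialColoring 1
  obtain ⟨n', r', a', N', -⟩ := S'.exists_normalForm D'.trivialColoring 1
  have hbd : ∀ t, |t| ≤ 1 → ((1, t) : ℝ × ℝ) ∈ pictureBox ∧
      e.symm (1, t) ∉ e.symm '' openPictureBox := fun t ht => by
    have h1 : ((1, t) : ℝ × ℝ) ∈ pictureBox := mem_pictureBox_iff.mpr ⟨by simp, ht⟩
    refine ⟨h1, fun h => ?_⟩
    have := ((mem_openBoxOf_iff hbox).mp h).2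
    rw [e.right_inv (hbox h1)] at this
    exact absurd this.1.2 (lt_irrefl _)
  have hlt := hi 1 (by simp)
  obtain ⟨hb, hbV⟩ := hbd _ hlt.le
  have hz : e.symm (1, φ i 1) ∈ boxOf e := mem_image_of_mem _ hb
  have hx := M.notMem_crossings _ hz hbV
  have h0 : o i * graphDist e φ i (e.symm (1, φ i 1)) = 0 := by
    rw [graphDist_symm (hbox hb)]; simp
  have h0' : o' i * graphDist e φ' i (e.symm (1, φ i 1)) = 0 := by
    rw [graphDist_symm (hbox hb), ← hends i 1 (by simp)]; simp
  obtain ⟨-, -, h1⟩ := N.strand i _ hz h0 hx.1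
  obtain ⟨-, -, h1'⟩ := N'.strand i _ hz h0' hx.2
  have hT : Tendsto (fun t : ℝ => ((1, φ i 1 + t) : ℝ × ℝ)) (𝓝[>] 0) (𝓝 (1, φ i 1)) := by
    have : Continuous fun t : ℝ => ((1, φ i 1 + t) : ℝ × ℝ) := by fun_prop
    simpa using (this.tendsto 0).mono_left nhdsWithin_le_nhds
  have hT' := (e.continuousAt_symm (hbox hb)).tendsto.comp hT
  have hsmall : ∀ᶠ t : ℝ in 𝓝[>] 0, |φ i 1 + t| ≤ 1 := by
    have : Continuous fun t : ℝ => |φ i 1 + t| := by fun_prop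
    refine eventually_nhdsWithin_of_eventually_nhds ?_
    exact (this.continuousAt.eventually_lt_const (u := 1) (by simpa using hlt)).mono fun _ h => h.le
  obtain ⟨t, t1, t2, t3, (t4 : 0 < t)⟩ := ((hT'.eventually h1).and ((hT'.eventually h1').and
    (hsmall.and self_mem_nhdsWithin))).exists
  obtain ⟨hb', hbV'⟩ := hbd _ t3
  have hzt : e.symm (1, φ i 1 + t) ∈ boxOf e := mem_image_of_mem _ hb'
  have s1 := t1 hzt
  have s2 := t2 hzt
  simp only [Function.comp_apply, graphDist_symm (hbox hb'), ← hends i 1 (by simp),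
    add_sub_cancel_left] at s1 s2
  have hidx : D.rightIndex (e.symm (1, φ i 1)) = D'.rightIndex (e.symm (1, φ i 1)) := by
    cases M.agreeAt hC hbV with
    | region h => exact absurd ((S.mem_curve_iff _ hz).mpr ⟨i, h0⟩) h
    | strand _ _ _ _ hi => exact hi
    | crossing h => exact absurd h hx.1
  have hc := M.curve_iff _ hzt hbV'
  have hsign : D.strandSign (e.symm (1, φ i 1)) (e.symm (1, φ i 1 + t)) =
      D'.strandSign (e.symm (1, φ i 1)) (e.symm (1, φ i 1 + t)) := by
    by_cases hcc : e.symm (1, φ i 1 + t) ∈ D.curve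
    · rw [strandSign, strandSign, if_pos hcc, if_pos (hc.mp hcc)]
    · rw [strandSign, strandSign, if_neg hcc, if_neg fun h => hcc (hc.mpr h), hidx]
      cases M.agreeAt hC hbV' with
      | region _ _ hi => rw [hi]
      | strand h => exact absurd h hcc
      | crossing h => exact absurd (D.crossings_subset h) hcc
  rw [s1, s2, sign_mul, sign_mul, sign_pos t4, mul_one, mul_one] at hsign
  rcases ho i with h | h <;> rcases ho' i with h' | h' <;> rw [h, h'] at hsign ⊢ <;> simp at hsign

theorem exists_strandMove (G : GraphPicture P φ) (G' : GraphPicture P' φ')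
    (hends : ∀ i x, |x| = 1 → φ i x = φ' i x) (hbox : pictureBox ⊆ e.target)
    (hbd : Disjoint e.source (Cube.boundary (Fin 2))) (hD : D.LooksLike e P)
    (hD' : D'.LooksLike e P') (hag : LinkDiagram.AgreesOutside (boxOf e) D D') :
    ∃ V h h', StrandMove D D' V (boxOf e) h h' := by
  have M := (G.picturePair G' hends).localMove hbox hbd hD hD' hag
  obtain ⟨o, ho, ho1, S⟩ := (G.strandDisc hbox hD).exists_oriented D.trivialColoring
  obtain ⟨o', ho', ho1', S'⟩ := (G'.strandDisc hbox hD').exists_oriented D'.trivialColoring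
  -- a graph above the square stays above the square
  have hrange : ∀ i, ((∀ x, |x| ≤ 1 → |φ i x| < 1) ∧ ∀ x, |x| ≤ 1 → |φ' i x| < 1) ∨
      ((∀ x, 1 < φ i x) ∧ ∀ x, 1 < φ' i x) := fun i => by
    have h1 := hends i 1 (by simp)
    rcases G.range i with h | h <;> rcases G'.range i with h' | h'
    · exact Or.inl ⟨h, h'⟩
    · have k := h' 1
      have k' := _root_.abs_lt.mp (h 1 (by simp))
      linarith
    · have k := h 1
      have k' := _root_.abs_lt.mp (h' 1 (by simp))
      linarith
    · exact Or.inr ⟨h, h'⟩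
  have hneg : ∀ {φ : Fin 3 → ℝ → ℝ} {i}, (∀ x, 1 < φ i x) → ∀ z ∈ boxOf e,
      graphDist e φ i z < 0 := fun {φ i} h z hz => by
    have h1 := ((mem_symm_image_iff hbox).mp hz).2.2.2
    have h2 := h (e z).1
    rw [graphDist]; linarith
  have hoo : ∀ i, o i = o' i := fun i => by
    rcases hrange i with h | h
    · exact orientation_eq hbox hends M ho ho' S S' h.1
    · rw [ho1 i fun z hz => (hneg h.1 z (M.subset hz)).ne,
        ho1' i fun z hz => (hneg h.2 z (M.subset hz)).ne]
  have hne : ∀ i, o i ≠ 0 := fun i => by rcases ho i with h | h <;> rw [h] <;> norm_num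
  obtain rfl : o = o' := funext hoo
  refine ⟨_, _, _, M, S, S', fun i z hz hzV => ?_, fun i => ?_, ?_⟩
  · obtain ⟨h1, h2⟩ := (mem_symm_image_iff hbox).mp hz
    have h3 : e z ∉ openPictureBox := fun h => hzV ((mem_openBoxOf_iff hbox).mpr ⟨h1, h⟩)
    rw [sign_mul, sign_mul]
    congr 1
    rcases eq_of_notMem_openPictureBox h2 h3 with h4 | h4
    · rw [graphDist, graphDist, hends i _ h4]
    · rcases hrange i with h | h
      · have k1 := _root_.abs_lt.mp (h.1 _ (mem_pictureBox_iff.mp h2).1)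
        have k2 := _root_.abs_lt.mp (h.2 _ (mem_pictureBox_iff.mp h2).1)
        rcases (abs_eq zero_le_one).mp h4 with h4 | h4
        · rw [graphDist, graphDist, sign_pos (by linarith), sign_pos (by linarith)]
        · rw [graphDist, graphDist, sign_neg (by linarith), sign_neg (by linarith)]
      · rw [sign_neg (hneg h.1 z hz), sign_neg (hneg h.2 z hz)]
  · rintro ⟨z, hz, h0⟩
    have hi : ∀ x, |x| ≤ 1 → |φ i x| < 1 := by
      rcases hrange i with h | h
      · exact h.1
      · exfalso
        have k1 := hneg h.1 z (M.subset hz)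
        have k2 := hneg h.2 z (M.subset hz)
        rcases h0 with h0 | h0
        · exact mul_ne_zero (hne i) k1.ne h0
        · exact mul_ne_zero (hne i) k2.ne h0
    have hb : ((1, φ i 1) : ℝ × ℝ) ∈ pictureBox :=
      mem_pictureBox_iff.mpr ⟨by simp, (hi 1 (by simp)).le⟩
    refine ⟨e.symm (1, φ i 1), mem_image_of_mem _ hb, fun h => ?_, ?_⟩
    · have := ((mem_openBoxOf_iff hbox).mp h).2
      rw [e.right_inv (hbox hb)] at this
      exact absurd this.1.2 (lt_irrefl _)
    · rw [graphDist_symm (hbox hb)]; simp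
  · have hb : ((1, 1) : ℝ × ℝ) ∈ pictureBox := mem_pictureBox_iff.mpr ⟨by simp, by simp⟩
    refine ⟨e.symm (1, 1), mem_image_of_mem _ hb, fun h => ?_, fun i => mul_ne_zero (hne i) ?_⟩
    · have := ((mem_openBoxOf_iff hbox).mp h).2
      rw [e.right_inv (hbox hb)] at this
      exact absurd this.1.2 (lt_irrefl _)
    · rw [graphDist_symm (hbox hb)]
      rcases G.range i with h | h
      · have := _root_.abs_lt.mp (h 1 (by simp))
        exact sub_ne_zero.mpr (by linarith)
      · exact sub_ne_zero.mpr (h 1).ne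

end GraphPicture

end GraphPicture

/-- The functions whose graphs are the strands of the second Reidemeister move. -/
noncomputable def graphsII (bent : Bool) : Fin 2 → ℝ → ℝ :=
  ![fun _ => 0, fun x => if bent then x ^ 2 - 1 / 2 else 1 / 2]

/-- The functions whose graphs are the strands of the third Reidemeister move. -/
noncomputable def graphsIII (moved : Bool) : Fin 3 → ℝ → ℝ :=
  ![fun x => x / 2, fun x => -x / 2, fun x => (if moved then -(1 - x ^ 2) else 1 - x ^ 2) / 2]

theorem abs_le_one_iff_sq {x : ℝ} : |x| ≤ 1 ↔ x ^ 2 ≤ 1 := by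
  rw [← sq_le_one_iff_abs_le_one]

/-- The missing third strand is the constant `2`, above the disc. -/
theorem graphPicture_II (bent : Bool) (ρ : Equiv.Perm (Fin 2)) :
    GraphPicture (LocalPicture.ofStrands (strandsII bent ∘ ρ))
      (Fin.snoc (α := fun _ => ℝ → ℝ) (fun i => graphsII bent (ρ i)) fun _ => 2) := by
  have hS : ∀ k w, w ∈ strandsII bent k ↔ w.2 = graphsII bent k w.1 := by
    intro k w
    fin_cases k <;> simp [strandsII, graphsII]
  have hr : ∀ k x, |x| ≤ 1 → |graphsII bent k x| < 1 := by
    intro k x hx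
    rw [abs_le_one_iff_sq] at hx
    have := sq_nonneg x
    rw [_root_.abs_lt]
    fin_cases k
    · simp [graphsII]
    · cases bent <;> simp only [graphsII] <;> simp <;> constructor <;> nlinarith
  have hc : ∀ k, Continuous (graphsII bent k) := by
    intro k
    fin_cases k
    · exact continuous_const
    · cases bent
      · exact continuous_const
      · simp only [graphsII]; simp; fun_prop
  have hends : ∀ k l, k ≠ l → ∀ x, |x| = 1 → graphsII bent k x ≠ graphsII bent l x := by
    intro k l hkl x hx
    have hx2 : x ^ 2 = 1 := by rw [← sq_abs, hx]; norm_num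
    fin_cases k <;> fin_cases l <;> first | exact absurd rfl hkl | skip <;> cases bent <;>
      simp [graphsII, hx2] <;> norm_num
  have hw2 : ∀ w ∈ pictureBox, w.2 ≠ 2 := fun w hw h => by
    have := hw.2.2
    rw [h] at this
    norm_num at this
  refine ⟨fun i => ?_, fun w hw => ?_, fun w hw => ?_, fun w hw v _ => ?_, fun i => ?_,
    fun x hx => ⟨Fin.last 2, Fin.castSucc 0, ?_⟩, fun i j hij x hx => ?_⟩
  · induction i using Fin.lastCases with
    | last => rw [Fin.snoc_last]; exact continuous_const
    | cast i => simpa using hc (ρ i)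
  · simp only [LocalPicture.ofStrands, mem_iUnion, Function.comp_apply, hS]
    constructor
    · rintro ⟨i, hi⟩
      exact ⟨i.castSucc, by simpa using hi⟩
    · rintro ⟨i, hi⟩
      induction i using Fin.lastCases with
      | last => exact absurd (by rwa [Fin.snoc_last] at hi) (hw2 w hw)
      | cast i => exact ⟨i, by simpa using hi⟩
  · simp only [LocalPicture.ofStrands, mem_ofPred_eq, Function.comp_apply, hS]
    constructor
    · rintro ⟨i, j, hij, hi, hj⟩
      exact ⟨i.castSucc, j.castSucc, by simpa using hij, by simpa using hi, by simpa using hj⟩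
    · rintro ⟨i, j, hij, hi, hj⟩
      induction i using Fin.lastCases with
      | last => exact absurd (by rwa [Fin.snoc_last] at hi) (hw2 w hw)
      | cast i =>
        induction j using Fin.lastCases with
        | last => exact absurd (by rwa [Fin.snoc_last] at hj) (hw2 w hw)
        | cast j => exact ⟨i, j, by simpa using hij, by simpa using hi, by simpa using hj⟩
  · simp only [LocalPicture.ofStrands, mem_ofPred_eq, Function.comp_apply, hS]
    constructor
    · rintro ⟨i, j, hij, hi, hj, hv⟩
      exact ⟨i.castSucc, j.castSucc, by simpa using hij, by simpa using hi, by simpa using hj,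
        by simpa using hv⟩
    · rintro ⟨i, j, hij, hi, hj, hv⟩
      induction i using Fin.lastCases with
      | last => exact absurd (by rwa [Fin.snoc_last] at hi) (hw2 w hw)
      | cast i =>
        induction j using Fin.lastCases with
        | last => exact absurd (by rwa [Fin.snoc_last] at hj) (hw2 w hw)
        | cast j =>
          exact ⟨i, j, by simpa using hij, by simpa using hi, by simpa using hj, by simpa using hv⟩
  · induction i using Fin.lastCases with
    | last => right; intro x; rw [Fin.snoc_last]; norm_num
    | cast i => left; intro x hx; simpa using hr (ρ i) x hx
  · have := (abs_lt.mp (hr (ρ 0) x hx)).2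
    simp only [Fin.snoc_last, Fin.snoc_castSucc]
    linarith
  · induction i using Fin.lastCases with
    | last =>
      induction j using Fin.lastCases with
      | last => exact absurd rfl hij
      | cast j =>
        have := (abs_lt.mp (hr (ρ j) x hx.le)).2
        simp only [Fin.snoc_last, Fin.snoc_castSucc]
        linarith
    | cast i =>
      induction j using Fin.lastCases with
      | last =>
        have := (abs_lt.mp (hr (ρ i) x hx.le)).2
        simp only [Fin.snoc_last, Fin.snoc_castSucc]
        linarith
      | cast j =>
        simp only [Fin.snoc_castSucc]
        exact hends _ _ (fun h => hij (by rw [ρ.injective h])) x hx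

theorem graphPicture_III (moved : Bool) (ρ : Equiv.Perm (Fin 3)) :
    GraphPicture (LocalPicture.ofStrands (strandsIII moved ∘ ρ))
      fun i => graphsIII moved (ρ i) := by
  have hS : ∀ k w, w ∈ strandsIII moved k ↔ w.2 = graphsIII moved k w.1 := by
    intro k w
    fin_cases k
    · simp only [strandsIII, graphsIII]; simp; constructor <;> intro <;> linarith
    · simp only [strandsIII, graphsIII]; simp; constructor <;> intro <;> linarith
    · cases moved <;> simp only [strandsIII, graphsIII] <;> simp <;> constructor <;> intro <;>
        linarith
  refine ⟨fun i => ?_, fun w _ => ?_, fun w _ => ?_, fun w _ v _ => ?_, fun i => Or.inl ?_,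
    fun x _ => ?_, fun i j hij x hx => ?_⟩
  · generalize ρ i = k
    fin_cases k
    · simp only [graphsIII]; simp; fun_prop
    · simp only [graphsIII]; simp; fun_prop
    · cases moved <;> simp only [graphsIII] <;> simp <;> fun_prop
  · simp only [LocalPicture.ofStrands, mem_iUnion, Function.comp_apply, hS]
  · simp only [LocalPicture.ofStrands, mem_ofPred_eq, Function.comp_apply, hS]
  · simp only [LocalPicture.ofStrands, mem_ofPred_eq, Function.comp_apply, hS]
  · intro x hx
    have hx2 := abs_le_one_iff_sq.mp hx
    obtain ⟨h1, h2⟩ := abs_le.mp hx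
    have := sq_nonneg x
    rw [abs_lt]
    generalize ρ i = k
    fin_cases k
    · simp only [graphsIII]; simp; constructor <;> linarith
    · simp only [graphsIII]; simp; constructor <;> linarith
    · cases moved <;> simp only [graphsIII] <;> simp <;> constructor <;> linarith
  · by_cases h0 : x = 0
    · refine ⟨ρ.symm 0, ρ.symm 2, ?_⟩
      subst h0
      cases moved <;> simp [graphsIII] <;> norm_num
    · refine ⟨ρ.symm 0, ρ.symm 1, ?_⟩
      simp only [Equiv.apply_symm_apply, graphsIII]
      simp
      intro h
      exact h0 (by linarith)
  · have hx2 : x ^ 2 = 1 := by rw [← sq_abs, hx]; norm_num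
    have h0 : x ≠ 0 := by rintro rfl; simp at hx
    have hkl : ρ i ≠ ρ j := fun h => hij (ρ.injective h)
    generalize ρ i = k at hkl ⊢
    generalize ρ j = l at hkl ⊢
    have h3 : (if moved then -(1 - x ^ 2) else 1 - x ^ 2) / 2 = 0 := by rw [hx2]; simp
    have h4 : ∀ m, graphsIII moved m x = ![x / 2, -x / 2, 0] m := by
      intro m
      fin_cases m <;> simp [graphsIII, hx2]
    rw [h4, h4]
    intro h
    refine h0 ?_
    fin_cases k <;> fin_cases l <;> first | exact absurd rfl hkl | skip <;> simp at h <;> linarith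

/-- The second and the third Reidemeister move are moves of strands. -/
theorem ReidemeisterPictures.eq_or_exists_graphPictures {P P' : LocalPicture}
    (h : ReidemeisterPictures P P') : (P = pictureI ∧ P' = pictureI') ∨ ∃ φ φ',
      GraphPicture P φ ∧ GraphPicture P' φ' ∧ ∀ i x, |x| = 1 → φ i x = φ' i x := by
  cases h with
  | typeI => exact .inl ⟨rfl, rfl⟩
  | typeII ρ =>
    refine .inr ⟨_, _, graphPicture_II false ρ, graphPicture_II true ρ, fun i x hx => ?_⟩
    have hx2 : x ^ 2 = 1 := by rw [← sq_abs, hx]; norm_num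
    induction i using Fin.lastCases with
    | last => rw [Fin.snoc_last, Fin.snoc_last]
    | cast i =>
      simp only [Fin.snoc_castSucc]
      generalize ρ i = k
      fin_cases k <;> simp [graphsII, hx2] <;> norm_num
  | typeIII ρ =>
    refine .inr ⟨_, _, graphPicture_III false ρ, graphPicture_III true ρ, fun i x hx => ?_⟩
    have hx2 : x ^ 2 = 1 := by rw [← sq_abs, hx]; norm_num
    generalize ρ i = k
    fin_cases k <;> simp [graphsIII, hx2]

/-! ### Discs in which all arcs have the same color -/

/-- The `n`-th power of the action of `a`. -/
def powAct (a : X) (n : ℤ) (x : X) : X := ((Rack.act' a : Equiv.Perm X) ^ n) x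

section PowAct

variable (a : X) (n : ℤ) (x : X)

theorem powAct_add_one : powAct a (n + 1) x = a ◃ powAct a n x := by
  rw [powAct, add_comm, zpow_one_add]; rfl

theorem powAct_add_ite (s : Bool) :
    powAct a (n + if s then 1 else 0) x = actIf s a (powAct a n x) := by
  cases s
  · simp [actIf]
  · simp [actIf, powAct_add_one]

theorem powAct_add_two : powAct a (n + 2) x = a ◃ (a ◃ powAct a n x) := by
  rw [← powAct_add_one, ← powAct_add_one]; congr 1; ring

theorem powAct_injective : Function.Injective (powAct a n) := Equiv.injective _

theorem exists_powAct_eq : ∃ y, powAct a n y = x := Equiv.surjective _ x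

end PowAct

/-- The set `B` with interior `V` is the closure of a connected open set, also along the curves, and
there are no crossings on its frontier. -/
structure CurveDisc (D : LinkDiagram) (V B : Set Square) : Prop where
  isOpen : IsOpen V
  subset : V ⊆ B
  subset_closure : B ⊆ closure V
  isPreconnected : IsPreconnected V
  mem_closure : ∀ z ∈ B, z ∈ D.curve → z ∈ closure (V ∩ D.curve)
  crossings_subset : ∀ z ∈ B, z ∈ D.crossings → z ∈ V

/-- All arcs in `B` have the color `a`, so that the color of a region is determined by its index. -/
structure MonochromeForm (C : ShadowColoring X D)
    (B : Set Square) (a r : X) : Prop where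
  col : ∀ z ∈ B, z ∈ D.curve → C.col z = a
  reg : ∀ z ∈ B, z ∉ D.curve → C.reg z = powAct a (D.index z) r

section Monochrome

variable {a r a' r' : X}

theorem eq_of_act_eq {x a : X} (h : a ◃ x = a) : x = a :=
  (Rack.left_cancel a).mp (h.trans Quandle.fix.symm)

theorem CurveDisc.exists_monochromeForm (S : CurveDisc D V B)
    (hcol : ∀ z ∈ V, z ∈ D.curve → C.col z = a) : ∃ r, MonochromeForm C B a r := by
  have hcolB : ∀ z ∈ B, z ∈ D.curve → C.col z = a := by
    intro z hz hc
    by_cases hx : z ∈ D.crossings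
    · exact hcol z (S.crossings_subset z hz hx) hc
    · obtain ⟨w, ⟨hwV, hwc⟩, hw⟩ := ((mem_closure_iff_frequently.mp
        (S.mem_closure z hz hc)).and_eventually (C.eventually_col_eq hc hx)).exists
      rw [← hw hwc, hcol w hwV hwc]
  have hg : ∀ z, ∃ y, powAct a (D.index z) y = C.reg z := fun z => exists_powAct_eq _ _ _
  choose g hg using hg
  have hgu : ∀ {z y}, C.reg z = powAct a (D.index z) y → g z = y := fun {z y} h =>
    powAct_injective a _ ((hg z).trans h)
  have hloc : ∀ q ∈ V, ∃ v, ∀ᶠ z in 𝓝 q, z ∈ {z | z ∈ V ∧ z ∉ D.curve} → g z = v := by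
    intro q hq
    by_cases hc : q ∈ D.curve
    · by_cases hx : q ∈ D.crossings
      · obtain ⟨e, he⟩ := D.crossing_chart q hx
        obtain ⟨m, r, α, hform⟩ := C.exists_crossForm hx he
        have hq' : C.col q = a := hcol q hq hc
        have hα : α = a := by
          obtain ⟨z, -, ⟨k1, k2⟩, h1, h2⟩ := exists_sign_chart_eq he.mem_source he.map_center 0 (-1)
            (hform.and (S.isOpen.eventually_mem hq))
          rw [sign_eq_zero_iff] at h1
          rw [← k1.2.2.2.2.1 h1 (sign_eq_neg_one_iff.mp h2)]
          exact hcol _ k2 (k1.2.2.1.mpr (Or.inl h1))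
        obtain ⟨y, hy⟩ := exists_powAct_eq a m r
        refine ⟨y, hform.mono fun z hz hzT => hgu ?_⟩
        obtain ⟨-, -, h3, -, -, -, h7, h8, h9, h10⟩ := hz
        have hzc := hzT.2
        rw [h3, not_or] at hzc
        rw [hq', hα, ← hy] at *
        rcases lt_or_gt_of_ne hzc.1 with k | k <;> rcases lt_or_gt_of_ne hzc.2 with k' | k'
        · rw [(h7 k k').1, (h7 k k').2]
        · rw [(h9 k k').1, (h9 k k').2, powAct_add_one]
        · rw [(h8 k k').1, (h8 k k').2, powAct_add_one]
        · rw [(h10 k k').1, (h10 k k').2, powAct_add_two]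
      · obtain ⟨y, hy⟩ := exists_powAct_eq a (D.rightIndex q) (C.rightColor q)
        refine ⟨y, (C.strandForm hc hx).mono fun z hz hzT => hgu ?_⟩
        rcases hz.2.2 hzT.2 with ⟨k, k'⟩ | ⟨k, k'⟩
        · rw [k, k', hy]
        · rw [k, k', hcol q hq hc, powAct_add_one, hy]
    · obtain ⟨y, hy⟩ := exists_powAct_eq a (D.index q) (C.reg q)
      refine ⟨y, ?_⟩
      filter_upwards [C.eventually_reg_eq hc, D.index_locally_constant q hc] with z z1 z2 _
      exact hgu (by rw [z1, z2, hy])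
  by_cases hne : ∃ z ∈ V, z ∉ D.curve
  · obtain ⟨p₀, hp₀, hc₀⟩ := hne
    refine ⟨g p₀, hcolB, fun z hz hc => ?_⟩
    obtain ⟨w, hwV, w1, w2, w3⟩ := ((mem_closure_iff_frequently.mp
      (S.subset_closure hz)).and_eventually ((C.eventually_reg_eq hc).and
      ((D.index_locally_constant z hc).and (eventually_notMem_curve hc)))).exists
    have key := S.isPreconnected.eq_of_eventually_eq (T := {z | z ∈ V ∧ z ∉ D.curve}) (g := g)
      (fun z hz => hz.1) (fun z hz => mem_closure_iff_frequently.mpr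
        (((D.frequently_notMem_curve z).and_eventually (S.isOpen.eventually_mem hz)).mono
          fun w hw => ⟨hw.2, hw.1⟩)) hloc ⟨hp₀, hc₀⟩ ⟨hwV, w3⟩
    rw [key, ← w1, ← w2, hg]
  · refine ⟨a, hcolB, fun z hz hc => ?_⟩
    obtain ⟨w, hwV, hw⟩ := ((mem_closure_iff_frequently.mp (S.subset_closure hz)).and_eventually
      (eventually_notMem_curve hc)).exists
    exact absurd ⟨w, hwV, hw⟩ hne

theorem MonochromeForm.rightColor_eq (N : MonochromeForm C B a r) (S : CurveDisc D V B)
    (hp : p ∈ B) (hc : p ∈ D.curve) (hx : p ∉ D.crossings) :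
    C.rightColor p = powAct a (D.rightIndex p) r := by
  obtain ⟨w, ⟨hwV, hwc⟩, (w1 : ∀ᶠ z in 𝓝 w, _), w2⟩ := ((mem_closure_iff_frequently.mp
    (S.mem_closure p hp hc)).and_eventually
    (((C.strandForm hc hx).eventually_nhds).and
    (eventually_notMem_crossings hx))).exists
  obtain ⟨b1, b2, -⟩ := StrandBody.of_eventually w1 hwc
  rw [← b1, ← b2]
  have h := D.isRightIndex hwc w2
  have key : ∀ᶠ z in 𝓝 w, z ∉ D.curve →
      (D.index z = D.rightIndex w ∧ C.reg z = powAct a (D.rightIndex w) r) ∨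
      (D.index z = D.rightIndex w + 1 ∧ C.reg z = powAct a (D.rightIndex w + 1) r) := by
    filter_upwards [h.1, S.isOpen.eventually_mem hwV] with z z1 z2 hzc
    rw [N.reg z (S.subset z2) hzc]
    rcases z1 hzc with k | k
    · left; rw [k]; exact ⟨rfl, rfl⟩
    · right; rw [k]; exact ⟨rfl, rfl⟩
  exact (C.right_eq hwc w2 key).2.1

/-- The constants of the monochrome form are determined on the frontier of the disc. -/
theorem MonochromeForm.eq_of_agree (M : LocalMove D D' V B)
    (hC : C.AgreesOutside B C') (N : MonochromeForm C B a r) (N' : MonochromeForm C' B a' r')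
    (hend : ∃ z ∈ B, z ∉ V ∧ z ∈ D.curve) (hcor : ∃ z ∈ B, z ∉ V ∧ z ∉ D.curve) :
    a = a' ∧ r = r' := by
  obtain ⟨z, hz, hzV, hzc⟩ := hend
  have hx := M.notMem_crossings z hz hzV
  obtain rfl : a = a' := by
    rw [← N.col z hz hzc, ← N'.col z hz ((M.curve_iff z hz hzV).mp hzc)]
    cases M.agreeAt hC hzV with
    | region h => exact absurd hzc h
    | strand _ _ _ _ _ _ hc => exact hc
    | crossing h => exact absurd h hx.1
  obtain ⟨w, hw, hwV, hwc⟩ := hcor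
  refine ⟨rfl, ?_⟩
  have h1 := N.reg w hw hwc
  have h2 := N'.reg w hw fun h => hwc ((M.curve_iff w hw hwV).mpr h)
  cases M.agreeAt hC hwV with
  | region _ _ hi hr =>
    rw [h1, h2, hi] at hr
    exact powAct_injective a _ hr
  | strand h => exact absurd h hwc
  | crossing h => exact absurd (D.crossings_subset h) hwc

theorem LinkDiagram.trivialColoring_agreesOutside (D D' : LinkDiagram) (B : Set Square) :
    D.trivialColoring.AgreesOutside B D'.trivialColoring :=
  fun _ _ => ⟨fun _ _ => rfl, fun _ _ => rfl⟩

theorem LocalMove.index_eq (M : LocalMove D D' V B) (hpV : p ∉ V) (hc : p ∉ D.curve) :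
    D.index p = D'.index p := by
  cases M.agreeAt (D.trivialColoring_agreesOutside D' B) hpV with
  | region _ _ hi => exact hi
  | strand h => exact absurd h hc
  | crossing h => exact absurd (D.crossings_subset h) hc

theorem LocalMove.rightIndex_eq (M : LocalMove D D' V B) (hpV : p ∉ V) (hc : p ∈ D.curve)
    (hx : p ∉ D.crossings) : D.rightIndex p = D'.rightIndex p := by
  cases M.agreeAt (D.trivialColoring_agreesOutside D' B) hpV with
  | region h => exact absurd hc h
  | strand _ _ _ _ hi => exact hi
  | crossing h => exact absurd h hx

/-- A coloring which is monochrome in the disc gives rise to a coloring of any diagram which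
agrees outside the disc. -/
theorem MonochromeForm.exists_coloring (M : LocalMove D D' V B) (S : CurveDisc D V B)
    (N : MonochromeForm C B a r) : ∃ C' : ShadowColoring X D', C.AgreesOutside B C' := by
  refine M.exists_coloring C (reg := fun z => powAct a (D'.index z) r) (col := fun _ => a)
    (fun p hp hc => ?_) (fun p hp hpV hc => ?_) (fun p hp hc hx => ?_) fun p hp hx => ?_
  · filter_upwards [D'.index_locally_constant p hc] with z hz _
    rw [hz]
  · have hc' : p ∉ D.curve := fun h => hc ((M.curve_iff p hp hpV).mp h)
    rw [← M.index_eq hpV hc', N.reg p hp hc']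
  · refine ⟨D'.rightIndex p, powAct a (D'.rightIndex p) r, ?_, fun hpV => ?_⟩
    · filter_upwards [D'.trivialColoring.strandForm hc hx] with z hz _
      refine ⟨hz.1, fun _ => rfl, fun hzc => ?_⟩
      rcases hz.2.2 hzc with ⟨k, -⟩ | ⟨k, -⟩
      · left; simp only [k]; exact ⟨trivial, trivial⟩
      · right; simp only [k, powAct_add_one]; exact ⟨trivial, trivial⟩
    · have hc' := (M.curve_iff p hp hpV).mpr hc
      have hx' := (M.notMem_crossings p hp hpV).1
      rw [← M.rightIndex_eq hpV hc' hx', N.rightColor_eq S hp hc' hx', N.col p hp hc']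
      exact ⟨rfl, rfl, rfl⟩
  · obtain ⟨e, he⟩ := D'.crossing_chart p hx
    obtain ⟨m, r₁, a₁, hform⟩ := D'.trivialColoring.exists_crossForm hx he
    refine ⟨e, m, powAct a m r, a, he, hform.mono fun z hz => ?_⟩
    obtain ⟨h1, h2, h3, -, -, -, h7, h8, h9, h10⟩ := hz
    refine ⟨h1, h2, h3, fun _ => rfl, fun _ _ => rfl, fun _ _ => Quandle.fix.symm, fun k k' => ?_,
      fun k k' => ?_, fun k k' => ?_, fun k k' => ?_⟩
    · simp only [(h7 k k').1]; exact ⟨trivial, trivial⟩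
    · simp only [(h8 k k').1, powAct_add_one]; exact ⟨trivial, trivial⟩
    · simp only [(h9 k k').1, powAct_add_one]; exact ⟨trivial, trivial⟩
    · simp only [(h10 k k').1, powAct_add_two]; exact ⟨trivial, trivial⟩

/-- If all colorings of `D'` are monochrome in the disc, then a coloring is determined by the
coloring outside the disc. -/
theorem LocalMove.coloring_unique_of_monochrome (M : LocalMove D D' V B)
    (hN : ∀ C' : ShadowColoring X D', ∃ a r, MonochromeForm C' B a r)
    (hN' : ∀ C : ShadowColoring X D, ∃ a r, MonochromeForm C B a r)
    (hend : ∃ z ∈ B, z ∉ V ∧ z ∈ D.curve) (hcor : ∃ z ∈ B, z ∉ V ∧ z ∉ D.curve)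
    {C₁ C₂ : ShadowColoring X D'} (h1 : C.AgreesOutside B C₁) (h2 : C.AgreesOutside B C₂) :
    C₁ = C₂ := by
  obtain ⟨a, r, N⟩ := hN' C
  obtain ⟨a₁, r₁, N₁⟩ := hN C₁
  obtain ⟨a₂, r₂, N₂⟩ := hN C₂
  obtain ⟨rfl, rfl⟩ := N.eq_of_agree M h1 N₁ hend hcor
  obtain ⟨rfl, rfl⟩ := N.eq_of_agree M h2 N₂ hend hcor
  refine ShadowColoring.ext_reg_col (fun p hp => ?_) fun p hp => ?_
  · by_cases hpB : p ∈ B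
    · rw [N₁.reg p hpB hp, N₂.reg p hpB hp]
    · have hc : p ∉ D.curve := fun hh => hp ((M.agree p hpB).1.mp hh)
      rw [← h1.reg_eq hpB hc hp, ← h2.reg_eq hpB hc hp]
  · by_cases hpB : p ∈ B
    · rw [N₁.col p hpB hp, N₂.col p hpB hp]
    · have hc := (M.agree p hpB).1.mpr hp
      rw [← h1.col_eq hpB hc hp, ← h2.col_eq hpB hc hp]

end Monochrome

/-! ### The balls of the degenerate squares -/

/-- A map of the cone over the square to `Z` which extends the square `(r, a, a)`, and which is
compatible with the folding of the square which identifies its sides `t = ε` and `u = ε`. -/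
structure FoldBall
    (j : C(ExtendedRackSpace X, Z)) (r a : X) (W : C((I × I) × I, Z)) : Prop where
  base : ∀ t u, W ((t, u), 0) = j (rackSquare r a a t u)
  fold : ∀ ε t h, W ((cubeEnd ε, t), h) = W ((t, cubeEnd ε), h)
  apex : ∀ p q, W (p, 1) = W (q, 1)

theorem isDegenerate_square {X : Type u} (k : SpaceKind) (r a : X) :
    IsDegenerate k (![r, a, a] : Fin (2 + 1) → X) := ⟨1, rfl, fun _ => le_rfl⟩

section Ball

theorem rackSquare_mem_closedCell (r a : X) (t u : I) :
    rackSquare r a a t u ∈ closedCell (n := 2) ![r, a, a] := ⟨![t, u], rfl⟩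

/-- The side `u = 1` has the label `(r * a, a * a)`, and the side `t = 1` has
the label `(r * a, a)`. -/
theorem rackSquare_fold (r a : X) (ε : Bool) (t : I) :
    rackSquare r a a (cubeEnd ε) t = rackSquare r a a t (cubeEnd ε) := by
  rw [rackSquare_left, rackSquare_right]
  cases ε <;> simp [Quandle.fix]

theorem continuous_rackSquare (r a b : X) : Continuous fun p : I × I => rackSquare r a b p.1 p.2 :=
  (PreCubicSet.continuous_point _ _).comp (continuous_pi fun i => by
    fin_cases i
    · exact continuous_fst
    · exact continuous_snd)

/-- In each of the quandle spaces, the square `(r, a, a)`, folded to a sphere, is contractible. -/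
theorem exists_foldBall (k : SpaceKind) (m : SpaceModel) (r a : X) :
    ∃ W, FoldBall (toQuandleSpace X k m) r a W := by
  cases m with
  | mappingCones =>
    let x : DegenerateCell X k := ⟨2, ![r, a, a], isDegenerate_square k r a⟩
    let P : I × I → closedCell x.2.1 := fun p => ⟨_, rackSquare_mem_closedCell r a p.1 p.2⟩
    have hP : Continuous P := (continuous_rackSquare r a a).subtype_mk _
    let w : (I × I) × I → ConePieces X k := fun p => Sum.inr ⟨x, P p.1, p.2⟩
    have hx : Continuous fun p : closedCell x.2.1 × I =>
        (⟨x, p⟩ : Σ x : DegenerateCell X k, closedCell x.2.1 × I) :=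
      @continuous_sigmaMk _ (fun x : DegenerateCell X k => closedCell x.2.1 × I) _ x
    have hw : Continuous w :=
      continuous_inr.comp (hx.comp ((hP.comp continuous_fst).prodMk continuous_snd))
    refine ⟨⟨fun p => (Quot.mk _ (w p) : ConeQuandleSpace X k), continuous_quot_mk.comp hw⟩,
      fun t u => Quot.sound (.base x (P (t, u))), fun ε t h => ?_,
      fun p q => Quot.sound (.apex x (P p) (P q))⟩
    have : P (cubeEnd ε, t) = P (t, cubeEnd ε) := Subtype.ext (rackSquare_fold r a ε t)
    exact congrArg (fun p => (Quot.mk _ (Sum.inr ⟨x, p, h⟩) : ConeQuandleSpace X k)) this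
  | extraCells =>
    let w : (I × I) × I → CellPieces X k := fun p => ballPiece r a p.1.1 p.1.2 p.2
    have hx : Continuous fun p : I × I × I => (⟨(r, a), p⟩ : Σ _ : X × X, I × I × I) :=
      @continuous_sigmaMk _ (fun _ : X × X => I × I × I) _ (r, a)
    have hw : Continuous w := continuous_inr.comp (continuous_inl.comp (hx.comp (by fun_prop)))
    exact ⟨⟨fun p => (Quot.mk _ (w p) : CellQuandleSpace X k), continuous_quot_mk.comp hw⟩,
      fun t u => Quot.sound (.ball_base r a t u), fun ε t h => Quot.sound (.ball_fold r a ε t h),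
      fun p q => Quot.sound (.ball_apex r a _ _ _ _)⟩

end Ball

/-- The middle third of the unit interval, stretched to the unit interval. -/
noncomputable def middleThird : C(I, I) :=
  ⟨fun s => projIcc 0 1 zero_le_one (3 * (s : ℝ) - 1), continuous_projIcc.comp (by fun_prop)⟩

/-- The height of the path `bridge`. -/
noncomputable def bridgeHeight (l s : I) : I :=
  projIcc 0 1 zero_le_one ((l : ℝ) * min 1 (min (3 * (s : ℝ)) (3 - 3 * (s : ℝ))))

theorem middleThird_of_le {s : I} (h : 3 * (s : ℝ) ≤ 1) : middleThird s = 0 :=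
  projIcc_of_le_left zero_le_one (by linarith)

theorem middleThird_of_ge {s : I} (h : 2 ≤ 3 * (s : ℝ)) : middleThird s = 1 :=
  projIcc_of_right_le zero_le_one (by linarith)

theorem middleThird_zero : middleThird 0 = 0 := middleThird_of_le (by simp)

theorem middleThird_one : middleThird 1 = 1 := middleThird_of_ge (by simp; norm_num)

theorem bridgeHeight_zero_left (s : I) : bridgeHeight 0 s = 0 := projIcc_of_le_left _ (by simp)

theorem bridgeHeight_zero (l : I) : bridgeHeight l 0 = 0 := projIcc_of_le_left _ (by simp)

theorem bridgeHeight_one (l : I) : bridgeHeight l 1 = 0 := projIcc_of_le_left _ (by simp)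

theorem bridgeHeight_middle {s : I} (h : 1 ≤ 3 * (s : ℝ)) (h' : 3 * (s : ℝ) ≤ 2) :
    bridgeHeight 1 s = 1 :=
  projIcc_of_right_le _ (by
    rw [Icc.coe_one, one_mul, le_min_iff, le_min_iff]
    exact ⟨le_rfl, h, by linarith⟩)

section Bridge

/-- The path in the cone over the square from the point `p` of the base to the point `q` of the
base, which passes at the height `l`: it goes up from `p`, then straight to a point above `q`, and
then down to `q`. -/
noncomputable def bridge (W : C((I × I) × I, Z)) : C(((I × I) × (I × I)) × I, C(I, Z)) :=
  ContinuousMap.curry ⟨fun y : (((I × I) × (I × I)) × I) × I =>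
    W ((Icc.convexComb y.1.1.1.1 y.1.1.2.1 (middleThird y.2),
      Icc.convexComb y.1.1.1.2 y.1.1.2.2 (middleThird y.2)), bridgeHeight y.1.2 y.2), by
    refine W.continuous.comp (Continuous.prodMk (Continuous.prodMk ?_ ?_) ?_)
    · exact Icc.continuous_convexComb_prod.comp (f := fun y : (((I × I) × (I × I)) × I) × I =>
        (y.1.1.1.1, y.1.1.2.1, middleThird y.2)) (by fun_prop)
    · exact Icc.continuous_convexComb_prod.comp (f := fun y : (((I × I) × (I × I)) × I) × I =>
        (y.1.1.1.2, y.1.1.2.2, middleThird y.2)) (by fun_prop)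
    · exact continuous_projIcc.comp (by fun_prop)⟩

theorem bridge_apply (W : C((I × I) × I, Z)) (p q : I × I) (l s : I) :
    bridge W ((p, q), l) s = W ((Icc.convexComb p.1 q.1 (middleThird s),
      Icc.convexComb p.2 q.2 (middleThird s)), bridgeHeight l s) := rfl

variable {W : C((I × I) × I, Z)} {p q p' q' : I × I} {l : I}

theorem bridge_zero : bridge W ((p, q), l) 0 = W (p, 0) := by
  rw [bridge_apply, middleThird_zero, Icc.convexComb_zero, Icc.convexComb_zero, bridgeHeight_zero]

theorem bridge_one : bridge W ((p, q), l) 1 = W (q, 0) := by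
  rw [bridge_apply, middleThird_one, Icc.convexComb_one, Icc.convexComb_one, bridgeHeight_one]

/-- The points `p` and `q` of the square are identified by the folding. -/
def FoldEq (W : C((I × I) × I, Z)) (p q : I × I) : Prop := ∀ h, W (p, h) = W (q, h)

/-- Since the path at height `1` passes through the apex, it depends only on the images of its end
points in the folded square. -/
theorem bridge_congr (hW : ∀ p q, W (p, 1) = W (q, 1)) (hp : FoldEq W p p') (hq : FoldEq W q q') :
    bridge W ((p, q), 1) = bridge W ((p', q'), 1) := by
  ext s
  simp only [bridge_apply]
  rcases le_total (3 * (s : ℝ)) 1 with h | h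
  · simp only [middleThird_of_le h, Icc.convexComb_zero]
    exact hp _
  · rcases le_total (3 * (s : ℝ)) 2 with h' | h'
    · rw [bridgeHeight_middle h h']
      exact hW _ _
    · simp only [middleThird_of_ge h', Icc.convexComb_one]
      exact hq _

end Bridge

/-- The lifts of the vertices of level `k`, `k + 1`, `k + 2` to the square `(r_k, a, a)`. -/
def cornerLift (k n : ℤ) : I × I := if n = k then (0, 0) else if n = k + 1 then (1, 0) else (1, 1)

/-- The lifts of the edges of level `k` and `k + 1` to the square `(r_k, a, a)`. -/
def edgeLift (k n : ℤ) (t : I) : I × I := if n = k then (t, 0) else (1, t)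

theorem continuous_edgeLift (k n : ℤ) : Continuous (edgeLift k n) := by
  unfold edgeLift
  split_ifs <;> fun_prop

theorem edgeLift_cubeEnd {k n : ℤ} (hn : n = k ∨ n = k + 1) (s : Bool) :
    edgeLift k n (cubeEnd s) = cornerLift k (n + if s then 1 else 0) := by
  rcases hn with rfl | rfl <;> cases s <;> simp [edgeLift, cornerLift, cubeEnd, add_assoc]

section Lifts

variable {r a : X} {k : ℤ} {W : C((I × I) × I, Z)}

theorem FoldBall.edge (H : FoldBall j (powAct a k r) a W) {n : ℤ} (hn : n = k ∨ n = k + 1) (t : I) :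
    W (edgeLift k n t, 0) = j (rackEdge (powAct a n r) a t) := by
  rcases hn with rfl | rfl
  · rw [edgeLift, if_pos rfl, H.base]
    exact congrArg j (rackSquare_right _ a a false t)
  · rw [edgeLift, if_neg (by omega), H.base, powAct_add_one]
    exact congrArg j (rackSquare_left _ a a true t)

theorem FoldBall.corner (H : FoldBall j (powAct a k r) a W) {n : ℤ} (hn : k ≤ n ∧ n ≤ k + 2) :
    W (cornerLift k n, 0) = j (rackVertex (powAct a n r)) := by
  obtain h | h : n ≤ k + 1 ∨ n = k + 2 := by omega
  · have h' : n = k ∨ n = k + 1 := by omega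
    have := edgeLift_cubeEnd h' false
    rw [if_neg (by simp), add_zero] at this
    rw [← this, H.edge h', rackEdge_end]; rfl
  · have := edgeLift_cubeEnd (k := k) (n := k + 1) (Or.inr rfl) true
    rw [if_pos rfl] at this
    obtain rfl : n = k + 1 + 1 := by omega
    rw [← this, H.edge (Or.inr rfl), rackEdge_end, actIf_true, powAct_add_one a (k + 1)]

theorem FoldBall.bridge_edge (H : FoldBall j (powAct a k r) a W) {n : ℤ} (hn : n = k ∨ n = k + 1)
    (t t' s : I) : bridge W ((edgeLift k n t, edgeLift k n t'), 0) s =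
      j (rackEdge (powAct a n r) a (Icc.convexComb t t' (middleThird s))) := by
  rw [← H.edge hn, bridge_apply, bridgeHeight_zero_left, edgeLift, edgeLift, edgeLift]
  split_ifs <;> simp only [Icc.convexComb_eq]

theorem FoldBall.bridge_corner (H : FoldBall j (powAct a k r) a W) {n : ℤ}
    (hn : k ≤ n ∧ n ≤ k + 2) (s : I) : bridge W ((cornerLift k n, cornerLift k n), 0) s =
      j (rackVertex (powAct a n r)) := by
  rw [← H.corner hn, bridge_apply, bridgeHeight_zero_left, Icc.convexComb_eq, Icc.convexComb_eq]

theorem FoldBall.foldEq_left (H : FoldBall j r a W) (s : Bool) (t : I) :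
    FoldEq W (cubeEnd s, t) (edgeLift k (k + if s then 1 else 0) t) := by
  intro h
  cases s
  · simpa [edgeLift, cubeEnd] using H.fold false t h
  · simp [edgeLift, cubeEnd]

theorem FoldBall.foldEq_right (H : FoldBall j r a W) (s : Bool) (t : I) :
    FoldEq W (t, cubeEnd s) (edgeLift k (k + if s then 1 else 0) t) := by
  intro h
  cases s
  · simp [edgeLift, cubeEnd]
  · simpa [edgeLift, cubeEnd] using (H.fold true t h).symm

theorem FoldBall.foldEq_corner (H : FoldBall j r a W) (s s' : Bool) :
    FoldEq W (cubeEnd s, cubeEnd s')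
      (cornerLift k (k + (if s then 1 else 0) + if s' then 1 else 0)) := by
  have := H.foldEq_left (k := k) s (cubeEnd s')
  rwa [edgeLift_cubeEnd (by cases s <;> simp)] at this

end Lifts

/-! ### Lifts to the folded square -/

section LiftAt

/-- Near `z`, the family `P` is the lift of the vertex of level `n`, which is the value of `f`. -/
def CornerLift (f : Square → ExtendedRackSpace X) (r a : X) (k : ℤ) (P : ℝ → Square → I × I) (n : ℤ)
    (z : Square) : Prop :=
  ∀ᶠ p in nhdsPos z, P p.1 p.2 = cornerLift k n ∧
    sharpenRack p.1 (f p.2) = rackVertex (powAct a n r)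

/-- Near `z`, the family `P` is the lift of the sharpening of `f` from the edge of level `n`;
the map `f` is on the side `κ` of the midpoint. -/
def EdgeLift (f : Square → ExtendedRackSpace X) (r a : X) (k : ℤ) (P : ℝ → Square → I × I) (n : ℤ)
    (κ : Square → SignType) (z : Square) : Prop :=
  ∃ c : ℝ → Square → I, ∀ᶠ p in nhdsPos z, P p.1 p.2 = edgeLift k n (c p.1 p.2) ∧
    sharpenRack p.1 (f p.2) = rackEdge (powAct a n r) a (c p.1 p.2) ∧
    sign ((c p.1 p.2 : ℝ) - 1 / 2) = κ p.2

/-- Near `z`, the family `P` is the lift of the sharpening of `f` which is determined by the diagram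
`D`. -/
structure LiftAt (D : LinkDiagram) (f : Square → ExtendedRackSpace X) (r a : X) (k : ℤ)
    (P : ℝ → Square → I × I) (z : Square) : Prop where
  region : z ∉ D.curve → CornerLift f r a k P (D.index z) z
  strand : z ∈ D.curve → z ∉ D.crossings → EdgeLift f r a k P (D.rightIndex z) (D.strandSign z) z

/-- In the disc `B` with interior `V`, the coloring is monochrome, and the indices are
in `[k, k + 2]`. -/
structure LevelDisc (C : ShadowColoring X D) (V B : Set Square) (a r : X)
    (k : ℤ) : Prop extends CurveDisc D V B, MonochromeForm C B a r where
  index_mem : ∀ z ∈ V, z ∉ D.curve → k ≤ D.index z ∧ D.index z ≤ k + 2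

variable {f : Square → ExtendedRackSpace X} {r a : X} {k n : ℤ} {P P' : ℝ → Square → I × I}
    {κ : Square → SignType}

theorem LiftAt.eventually_eq (h : LiftAt D f r a k P z) (h' : LiftAt D f r a k P' z)
    (hx : z ∉ D.crossings) : ∀ᶠ p in nhdsPos z, P p.1 p.2 = P' p.1 p.2 := by
  by_cases hc : z ∈ D.curve
  · obtain ⟨c, h⟩ := h.strand hc hx
    obtain ⟨c', h'⟩ := h'.strand hc hx
    filter_upwards [h, h'] with p hp hp'
    rw [hp.1, hp'.1, eq_of_rackEdge_eq (hp.2.1.symm.trans hp'.2.1) (hp.2.2.trans hp'.2.2.symm)]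
  · filter_upwards [h.region hc, h'.region hc] with p hp hp'
    rw [hp.1, hp'.1]

theorem LevelDisc.rightIndex_eq_or (S : LevelDisc C V B a r k) (hq : q ∈ B) (hc : q ∈ D.curve)
    (hx : q ∉ D.crossings) : D.rightIndex q = k ∨ D.rightIndex q = k + 1 := by
  obtain ⟨w, ⟨hwV, hwc⟩, (w1 : ∀ᶠ z in 𝓝 w, _), w2⟩ := ((mem_closure_iff_frequently.mp
    (S.mem_closure q hq hc)).and_eventually
    (((C.strandForm hc hx).eventually_nhds).and
    (eventually_notMem_crossings hx))).exists
  rw [← (StrandBody.of_eventually w1 hwc).1]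
  obtain ⟨-, h1, h2⟩ := D.isRightIndex hwc w2
  obtain ⟨u, ⟨u1, u2⟩, u3⟩ := (h1.and_eventually (S.isOpen.eventually_mem hwV)).exists
  obtain ⟨u', ⟨u1', u2'⟩, u3'⟩ := (h2.and_eventually (S.isOpen.eventually_mem hwV)).exists
  have := (S.index_mem u u3 u1).1
  have := (S.index_mem u' u3' u1').2
  omega

/-- At the points near a strand, the lift is in the edge of the strand. -/
theorem eventually_edgeLift (hq : q ∈ D.curve) (hx : q ∉ D.crossings)
    (hn : D.rightIndex q = k ∨ D.rightIndex q = k + 1) :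
    ∀ᶠ z in 𝓝 q, ∀ P, LiftAt D f r a k P z →
      EdgeLift f r a k P (D.rightIndex q) (D.strandSign q) z := by
  filter_upwards [(D.isRightIndex hq hx).1, eventually_notMem_crossings hx,
    (D.trivialColoring.strandForm hq hx).eventually_nhds] with z z1 z2 z3 P hP
  by_cases hc : z ∈ D.curve
  · have hi := (StrandBody.of_eventually z3 hc).1
    have := hP.strand hc z2
    rwa [hi, strandSign_congr hi] at this
  · obtain ⟨s, hs⟩ : ∃ s : Bool, D.index z = D.rightIndex q + if s then 1 else 0 := by
      rcases z1 hc with h | h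
      · exact ⟨false, by simpa⟩
      · exact ⟨true, by simpa⟩
    refine ⟨fun _ _ => cubeEnd s, ?_⟩
    filter_upwards [hP.region hc, (D.index_locally_constant z hc).prod_inr _,
      (eventually_notMem_curve hc).prod_inr _] with p p1 p2 p3
    refine ⟨by rw [p1.1, edgeLift_cubeEnd hn, hs], ?_, ?_⟩
    · rw [p1.2, rackEdge_end, hs, powAct_add_ite]
    · rw [strandSign, if_neg p3, p2, hs]
      cases s
      · rw [if_pos (by simp), sign_eq_neg_one_iff]; simp [cubeEnd]
      · rw [if_neg (by simp), sign_eq_one_iff]; simp [cubeEnd]; norm_num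

/-- The properties, at the points `z` near `q`, of a lift of the sharpening of `f`. -/
structure LiftFrame (j : C(ExtendedRackSpace X, Z)) (W : C((I × I) × I, Z)) (D : LinkDiagram)
    (f : Square → ExtendedRackSpace X) (r a : X) (k : ℤ) (P : ℝ → Square → I × I) (q : Square)
    (η : ℝ) (z : Square) : Prop where
  continuousAt : ∀ ε, 0 < ε → ε ≤ η → ContinuousAt (P ε) z
  map_eq : ∀ ε, 0 < ε → ε ≤ η → W (P ε z, 0) = j (sharpenRack ε (f z))
  notMem_crossings : z ≠ q → z ∉ D.crossings
  lift : q ∉ D.crossings → LiftAt D f r a k P z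
  fold : z ≠ q → ∃ P', LiftAt D f r a k P' z ∧ ∀ᶠ p in nhdsPos z, FoldEq W (P p.1 p.2) (P' p.1 p.2)

variable {W : C((I × I) × I, Z)}
  {ψ : RackLoop r₀}

theorem LevelDisc.exists_liftFrame_region (S : LevelDisc C V B a r k) (hf : IsShadowMap C ψ)
    (H : FoldBall j (powAct a k r) a W) (hq : q ∈ V) (hc : q ∉ D.curve) :
    ∃ P : ℝ → Square → I × I, ∃ η > 0, ∀ᶠ z in 𝓝 q, LiftFrame j W D ψ r a k P q η z := by
  obtain ⟨η, hη, h1⟩ := hf.eventually_sharpen_region hc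
  rw [S.reg q (S.subset hq) hc] at h1
  refine ⟨fun _ _ => cornerLift k (D.index q), η, hη, ?_⟩
  filter_upwards [h1.eventually_nhds, D.index_locally_constant q hc,
    eventually_notMem_curve hc] with z z1 z2 z3
  have hL : LiftAt D ψ r a k (fun _ _ => cornerLift k (D.index q)) z := by
    refine ⟨fun _ => ?_, fun h => absurd h z3⟩
    filter_upwards [eventually_prod_of_le hη z1] with p hp
    rw [z2]
    exact ⟨rfl, hp.2⟩
  refine ⟨fun _ _ _ => continuousAt_const, fun ε e1 e2 => ?_,
    fun _ h => z3 (D.crossings_subset h), fun _ => hL,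
    fun _ => ⟨_, hL, .of_forall fun _ _ => rfl⟩⟩
  rw [z1.self_of_nhds ε e1 e2, H.corner (S.index_mem q hq hc)]

theorem LevelDisc.exists_liftFrame_strand (S : LevelDisc C V B a r k) (hf : IsShadowMap C ψ)
    (H : FoldBall j (powAct a k r) a W) (hq : q ∈ V) (hc : q ∈ D.curve) (hx : q ∉ D.crossings) :
    ∃ P : ℝ → Square → I × I, ∃ η > 0, ∀ᶠ z in 𝓝 q, LiftFrame j W D ψ r a k P q η z := by
  obtain ⟨c, η, hη, h1⟩ := hf.exists_strandCoord hc hx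
  have hqB := S.subset hq
  have hn := S.rightIndex_eq_or hqB hc hx
  rw [S.toMonochromeForm.rightColor_eq S.toCurveDisc hqB hc hx, S.col q hqB hc] at h1
  refine ⟨fun ε z => edgeLift k (D.rightIndex q) (sharp ε (c z)), η, hη, ?_⟩
  filter_upwards [h1.eventually_nhds, eventually_notMem_crossings hx,
    (D.isRightIndex hc hx).1, (C.strandForm hc hx).eventually_nhds]
    with z z1 z2 z3 z4
  have y1 := z1.self_of_nhds
  have hL : LiftAt D ψ r a k (fun ε z => edgeLift k (D.rightIndex q) (sharp ε (c z))) z := by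
    have e1 := eventually_prod_of_le hη (z1.mono fun _ h => h.2.2)
    refine ⟨fun hzc => ?_, fun hzc _ => ?_⟩
    · have hne : c z ≠ 0 := by
        rw [← sign_ne_zero, y1.2.1, strandSign, if_neg hzc]
        split_ifs <;> decide
      have hs : D.index z = D.rightIndex q + if decide (0 < c z) then 1 else 0 := by
        simp only [decide_eq_true_eq, ← sign_eq_one_iff, y1.2.1, strandSign, if_neg hzc]
        rcases z3 hzc with h | h <;> simp [h]
      filter_upwards [eventually_sharp_eq y1.1 hne, e1] with p p1 p2
      rw [p2.2, p1, edgeLift_cubeEnd hn, rackEdge_end, hs, powAct_add_ite]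
      exact ⟨rfl, rfl⟩
    · have hi := (StrandBody.of_eventually z4 hzc).1
      refine ⟨fun ε z => sharp ε (c z), ?_⟩
      filter_upwards [e1, z1.prod_inr _] with p p1 p2
      rw [hi, strandSign_congr hi, sign_sharp p1.1]
      exact ⟨rfl, p1.2, p2.2.1⟩
  refine ⟨fun ε _ _ => (continuous_edgeLift k _).continuousAt.comp
    ((continuous_sharp ε).continuousAt.comp y1.1), fun ε e1 e2 => ?_, fun _ => z2, fun _ => hL,
    fun _ => ⟨_, hL, .of_forall fun _ _ => rfl⟩⟩
  rw [y1.2.2 ε e1 e2, H.edge hn]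

theorem LevelDisc.crossForm_eq (S : LevelDisc C V B a r k) (hq : q ∈ V) {m : ℤ} {r₁ α : X}
    (he : D.IsCrossingChart q e) (hform : CrossForm D C.reg C.col q e m r₁ α) :
    m = k ∧ r₁ = powAct a k r ∧ α = a := by
  have key := fun s t => exists_sign_chart_eq he.mem_source he.map_center s t
    (hform.and (S.isOpen.eventually_mem hq))
  obtain ⟨w, -, ⟨w3, wV⟩, w1, w2⟩ := key (-1) (-1)
  rw [sign_eq_neg_one_iff] at w1 w2
  have c1 : w ∉ D.curve := by
    rw [w3.2.2.1, not_or]; exact ⟨w1.ne, w2.ne⟩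
  obtain ⟨i1, i2⟩ := w3.2.2.2.2.2.2.1 w1 w2
  have hm : m = k := by
    obtain ⟨w', -, ⟨w3', wV'⟩, w1', w2'⟩ := key 1 1
    rw [sign_eq_one_iff] at w1' w2'
    have c2 : w' ∉ D.curve := by
      rw [w3'.2.2.1, not_or]; exact ⟨w1'.ne', w2'.ne'⟩
    have b1 := (S.index_mem w wV c1).1
    have b2 := (S.index_mem w' wV' c2).2
    rw [i1] at b1
    rw [(w3'.2.2.2.2.2.2.2.2.2 w1' w2').1] at b2
    omega
  refine ⟨hm, ?_, ?_⟩
  · rw [← i2, S.reg w (S.subset wV) c1, i1, hm]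
  · obtain ⟨w, -, ⟨w3, wV⟩, w1, w2⟩ := key 0 (-1)
    rw [sign_eq_zero_iff] at w1
    rw [← w3.2.2.2.2.1 w1 (sign_eq_neg_one_iff.mp w2),
      S.col w (S.subset wV) (w3.2.2.1.mpr (Or.inl w1))]

/-- At a crossing the lift is given by the two coordinates of the square. At a nearby point of a
strand it differs from the lift given there by the index, but only by the folding. -/
theorem LevelDisc.exists_liftFrame_crossing (S : LevelDisc C V B a r k) (hf : IsShadowMap C ψ)
    (H : FoldBall j (powAct a k r) a W) (hq : q ∈ V) (hx : q ∈ D.crossings) :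
    ∃ P : ℝ → Square → I × I, ∃ η > 0, ∀ᶠ z in 𝓝 q, LiftFrame j W D ψ r a k P q η z := by
  obtain ⟨e, m, r₁, α, he, hform, c, d, η, hη, h1⟩ := hf.exists_crossCoord hx
  obtain ⟨rfl, rfl, rfl⟩ := S.crossForm_eq hq he hform
  have hqa : C.col q = α := S.col q (S.subset hq) (D.crossings_subset hx)
  refine ⟨fun ε z => (sharp ε (c z), sharp ε (d z)), η, hη, ?_⟩
  filter_upwards [h1.eventually_nhds, D.eventually_mem_crossings_eq q,
    hform.eventually_nhds, S.isOpen.eventually_mem hq] with z z1 z2 z3 z4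
  have y1 := z1.self_of_nhds
  have y3 := z3.self_of_nhds
  have e1 := eventually_prod_of_le hη (z1.mono fun _ h => h.2.2.2.2)
  refine ⟨fun ε _ _ => ((continuous_sharp ε).continuousAt.comp y1.1).prodMk
    ((continuous_sharp ε).continuousAt.comp y1.2.1), fun ε e1 e2 => ?_, fun hne h => hne (z2 h),
    fun h => absurd hx h, fun hne => ?_⟩
  · rw [y1.2.2.2.2 ε e1 e2, H.base, hqa]
  have hzx : z ∉ D.crossings := fun h => hne (z2 h)
  by_cases hzc : z ∈ D.curve
  · obtain ⟨n0, -, -, hr, hs⟩ | ⟨n0, -, -, hr, hs⟩ := CrossForm.strand_cases C he hx z3 hzc hzx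
    · have n2 : d z ≠ 0 := ne_zero_of_sign y1.2.2.2.1 n0
      rw [← decide_pos_eq_of_sign y1.2.2.2.1] at hs
      refine ⟨fun ε w => edgeLift m (D.rightIndex z) (sharp ε (c w)), ?_, ?_⟩
      · refine ⟨fun h => absurd hzc h, fun _ _ => ⟨fun ε w => sharp ε (c w), ?_⟩⟩
        filter_upwards [e1, eventually_sharp_eq y1.2.1 n2, z1.prod_inr _,
          hr.prod_inr _] with p p1 p2 p3 p4
        refine ⟨rfl, ?_, ?_⟩
        · rw [p1.2, p2, rackSquare_right, hqa, hs, powAct_add_ite]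
          cases decide (0 < d z) <;> simp [Quandle.fix]
        · rw [sign_sharp p1.1, p3.2.2.1, p4]
      · filter_upwards [eventually_sharp_eq y1.2.1 n2] with p p2
        rw [p2, hs]
        exact H.foldEq_right _ _
    · have n2 : c z ≠ 0 := ne_zero_of_sign y1.2.2.1 n0
      rw [← decide_pos_eq_of_sign y1.2.2.1] at hs
      refine ⟨fun ε w => edgeLift m (D.rightIndex z) (sharp ε (d w)), ?_, ?_⟩
      · refine ⟨fun h => absurd hzc h, fun _ _ => ⟨fun ε w => sharp ε (d w), ?_⟩⟩
        filter_upwards [e1, eventually_sharp_eq y1.1 n2, z1.prod_inr _,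
          hr.prod_inr _] with p p1 p2 p3 p4
        refine ⟨rfl, ?_, ?_⟩
        · rw [p1.2, p2, rackSquare_left, hqa, hs, powAct_add_ite]
        · rw [sign_sharp p1.1, p3.2.2.2.1, p4]
      · filter_upwards [eventually_sharp_eq y1.1 n2] with p p2
        rw [p2, hs]
        exact H.foldEq_left _ _
  · have hzc' := y3.ne_zero hzc
    have n1 : c z ≠ 0 := ne_zero_of_sign y1.2.2.1 hzc'.1
    have n2 : d z ≠ 0 := ne_zero_of_sign y1.2.2.2.1 hzc'.2
    have hs := (y3.eq_of_notMem hzc).1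
    rw [← decide_pos_eq_of_sign y1.2.2.1, ← decide_pos_eq_of_sign y1.2.2.2.1] at hs
    refine ⟨fun _ _ => cornerLift m (D.index z), ⟨fun _ => ?_, fun h => absurd h hzc⟩, ?_⟩
    · filter_upwards [e1, eventually_sharp_eq y1.1 n1, eventually_sharp_eq y1.2.1 n2]
        with p p1 p2 p3
      rw [p1.2, p2, p3, hqa, rackSquare_left, rackEdge_end, hs, powAct_add_ite, powAct_add_ite]
      exact ⟨rfl, rfl⟩
    · filter_upwards [eventually_sharp_eq y1.1 n1, eventually_sharp_eq y1.2.1 n2] with p p2 p3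
      rw [p2, p3, hs]
      exact H.foldEq_corner _ _

end LiftAt

/-! ### The homotopy across a degenerate square -/

section Monochrome

variable {W : C((I × I) × I, Z)}
  {f g : RackLoop r₀} {r a : X} {k n : ℤ}

theorem LevelDisc.exists_liftFrame (S : LevelDisc C V B a r k) (hf : IsShadowMap C f)
    (H : FoldBall j (powAct a k r) a W) (hq : q ∈ V) :
    ∃ P : ℝ → Square → I × I, ∃ η > 0, ∀ᶠ z in 𝓝 q, LiftFrame j W D f r a k P q η z := by
  by_cases hc : q ∈ D.curve
  · by_cases hx : q ∈ D.crossings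
    · exact S.exists_liftFrame_crossing hf H hq hx
    · exact S.exists_liftFrame_strand hf H hq hc hx
  · exact S.exists_liftFrame_region hf H hq hc

/-- In a disc in which both colorings are monochrome and the indices take at most three
consecutive values, both maps lift to the cone over a folded square. The homotopy between them
passes through the apex of the cone near the crossings (`lam = 1`), and is straight near
the frontier of the disc (`lam = 0`). -/
theorem LevelDisc.homotopic (M : LocalMove D D' V B) (S : LevelDisc C V B a r k)
    (S' : LevelDisc C' V B a r k) (H : FoldBall j (powAct a k r) a W) {lam : Square → I}
    (hlam : ∀ z ∈ V, ContinuousAt lam z)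
    (hlam1 : ∀ z ∈ V, z ∈ D.crossings ∨ z ∈ D'.crossings → ∀ᶠ w in 𝓝 z, lam w = 1)
    (hlam0 : ∀ z ∈ B, z ∉ V → ∀ᶠ w in 𝓝 z, w ∈ V → lam w = 0)
    (hC : C.AgreesOutside B C') (hf : IsShadowMap C f) (hg : IsShadowMap C' g) :
    GenLoop.Homotopic (pushLoop j f) (pushLoop j g) := by
  have h1 : ∀ q, ∃ P P' : ℝ → Square → I × I, ∃ η > 0, q ∈ V → ∀ᶠ z in 𝓝 q,
      LiftFrame j W D f r a k P q η z ∧ LiftFrame j W D' g r a k P' q η z := by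
    intro q
    by_cases hq : q ∈ V
    · obtain ⟨P, η, hη, h⟩ := S.exists_liftFrame hf H hq
      obtain ⟨P', η', hη', h'⟩ := S'.exists_liftFrame hg H hq
      refine ⟨P, P', min η η', lt_min hη hη', fun _ => ?_⟩
      filter_upwards [h, h'] with z z1 z2
      exact ⟨⟨fun ε e1 e2 => z1.continuousAt ε e1 (e2.trans (min_le_left _ _)),
        fun ε e1 e2 => z1.map_eq ε e1 (e2.trans (min_le_left _ _)), z1.3, z1.4, z1.5⟩,
        ⟨fun ε e1 e2 => z2.continuousAt ε e1 (e2.trans (min_le_right _ _)),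
        fun ε e1 e2 => z2.map_eq ε e1 (e2.trans (min_le_right _ _)), z2.3, z2.4, z2.5⟩⟩
    · exact ⟨fun _ _ => (0, 0), fun _ _ => (0, 0), 1, one_pos, fun h => absurd h hq⟩
  choose P P' η hη hP using h1
  have hself : ∀ q ∈ V, q ∉ D.crossings → LiftAt D f r a k (P q) q := fun q hq hx =>
    (hP q hq).self_of_nhds.1.lift hx
  have hself' : ∀ q ∈ V, q ∉ D'.crossings → LiftAt D' g r a k (P' q) q := fun q hq hx =>
    (hP q hq).self_of_nhds.2.lift hx
  refine homotopic_of_agree (θ := middleThird) (S := Vᶜ) middleThird_zero middleThird_one hf hg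
    (fun q hq => M.agreeAt hC hq)
    (fun q ε z => bridge W ((P q ε z, P' q ε z), lam z)) η (fun q _ => hη q) (fun q hq => ?_)
    (fun q hq => ?_) (fun q hq hx => ?_) (fun q hq hc hx => ?_) (fun q hq hc => ?_)
  · rw [Set.notMem_compl_iff] at hq
    filter_upwards [hP q hq, M.isOpen.eventually_mem hq] with z z1 z2
    refine ⟨Set.notMem_compl_iff.mpr z2, fun h => disjoint_left.mp M.disjoint (M.subset z2) h,
      fun ε e1 e2 => ?_, fun ε e1 e2 => ?_, fun ε e1 e2 => ?_⟩
    · exact (bridge W).continuous.continuousAt.comp (((z1.1.continuousAt ε e1 e2).prodMk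
        (z1.2.continuousAt ε e1 e2)).prodMk (hlam z z2))
    · rw [bridge_zero, z1.1.map_eq ε e1 e2]
    · rw [bridge_one, z1.2.map_eq ε e1 e2]
  · rw [Set.notMem_compl_iff] at hq
    by_cases hx : q ∈ D.crossings ∨ q ∈ D'.crossings
    · filter_upwards [hP q hq, (hlam1 q hq hx).eventually_nhds] with z z1 z2 z3
      rw [Set.notMem_compl_iff] at z3
      by_cases hne : z = q
      · rw [hne]; exact .of_forall fun _ => rfl
      obtain ⟨Q, hQ, hQ'⟩ := z1.1.fold hne
      obtain ⟨R, hR, hR'⟩ := z1.2.fold hne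
      have x1 := z1.1.notMem_crossings hne
      have x2 := z1.2.notMem_crossings hne
      filter_upwards [hQ', hR', hQ.eventually_eq (hself z z3 x1) x1,
        hR.eventually_eq (hself' z z3 x2) x2, z2.prod_inr _] with p p1 p2 p3 p4 p5
      rw [p5]
      rw [p3] at p1
      rw [p4] at p2
      exact bridge_congr H.apex p1 p2
    · rw [not_or] at hx
      filter_upwards [hP q hq, eventually_notMem_crossings hx.1,
        eventually_notMem_crossings hx.2] with z z1 x1 x2 z3
      rw [Set.notMem_compl_iff] at z3
      filter_upwards [(z1.1.lift hx.1).eventually_eq (hself z z3 x1) x1,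
        (z1.2.lift hx.2).eventually_eq (hself' z z3 x2) x2] with p p1 p2
      rw [p1, p2]
  · by_cases hqB : q ∈ B
    · exact absurd hx (M.notMem_crossings q hqB hq).1
    · filter_upwards [M.isClosed.isOpen_compl.eventually_mem hqB] with z z1 z2
      exact z1 (M.subset z2)
  · by_cases hqB : q ∈ B
    · have hc' := (M.curve_iff q hqB hq).mp hc
      have hx' := (M.notMem_crossings q hqB hq).2
      have hn := S.rightIndex_eq_or hqB hc hx
      have hi := M.rightIndex_eq hq hc hx
      rw [S.toMonochromeForm.rightColor_eq S.toCurveDisc hqB hc hx, S.col q hqB hc]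
      filter_upwards [eventually_edgeLift (f := f) (r := r) (a := a) hc hx hn,
        eventually_edgeLift (f := g) (r := r) (a := a) hc' hx' (hi ▸ hn),
        (hlam0 q hqB hq).eventually_nhds,
        eventually_notMem_crossings hx,
        eventually_notMem_crossings hx'] with z z1 z2 z3 x1 x2 z4
      rw [Set.notMem_compl_iff] at z4
      obtain ⟨c, hc⟩ := z1 _ (hself z z4 x1)
      obtain ⟨c', hc'⟩ := z2 _ (hself' z z4 x2)
      rw [← hi] at hc'
      refine ⟨c, c', ?_⟩
      filter_upwards [hc, hc', z3.prod_inr _,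
        (M.isOpen.eventually_mem z4).prod_inr _] with p p1 p2 p3 p4
      refine ⟨⟨p1.2.1, p1.2.2⟩, ⟨p2.2.1, p2.2.2⟩, fun s => ?_⟩
      rw [p1.1, p2.1, p3 p4, H.bridge_edge hn]
    · filter_upwards [M.isClosed.isOpen_compl.eventually_mem hqB] with z z1 z2
      exact absurd (M.subset (Set.notMem_compl_iff.mp z2)) z1
  · by_cases hqB : q ∈ B
    · have hc' : q ∉ D'.curve := fun h => hc ((M.curve_iff q hqB hq).mpr h)
      have hi := M.index_eq hq hc
      rw [S.reg q hqB hc]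
      filter_upwards [D.index_locally_constant q hc, D'.index_locally_constant q hc',
        eventually_notMem_curve hc, eventually_notMem_curve hc',
        (hlam0 q hqB hq).eventually_nhds] with z z1 z2 z3 z4 z5 z6
      rw [Set.notMem_compl_iff] at z6
      have n1 := S.index_mem z z6 z3
      have l1 := (hself z z6 fun h => z3 (D.crossings_subset h)).region z3
      have l2 := (hself' z z6 fun h => z4 (D'.crossings_subset h)).region z4
      rw [z2, ← hi] at l2
      rw [z1] at l1 n1
      filter_upwards [l1, l2, z5.prod_inr _,
        (M.isOpen.eventually_mem z6).prod_inr _] with p p1 p2 p3 p4 s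
      rw [p1.1, p2.1, p3 p4, H.bridge_corner n1]
    · filter_upwards [M.isClosed.isOpen_compl.eventually_mem hqB] with z z1 z2
      exact absurd (M.subset (Set.notMem_compl_iff.mp z2)) z1

end Monochrome

/-! ### The kink -/

/-- The curve of the picture `P` is parametrized by the interval `[-b, b]`. -/
structure CurveParam (P : LocalPicture) (γ : ℝ → ℝ × ℝ) (b : ℝ) : Prop where
  continuous : Continuous γ
  mem : ∀ s ∈ Ioo (-b) b, γ s ∈ P.curve ∧ γ s ∈ openPictureBox
  surj : ∀ w ∈ P.curve, w ∈ pictureBox →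
    ∃ s ∈ Icc (-b) b, γ s = w ∧ (w ∈ openPictureBox → s ∈ Ioo (-b) b)

section Param

variable {P : LocalPicture} {γ : ℝ → ℝ × ℝ} {b s : ℝ}
  {v w : ℝ × ℝ}

theorem LinkDiagram.LooksLike.symm_mem_curve (hD : D.LooksLike e P) (hbox : pictureBox ⊆ e.target)
    (hw : w ∈ pictureBox) : e.symm w ∈ D.curve ↔ w ∈ P.curve := by
  have := hD _ (e.map_target (hbox hw)) (by rwa [e.right_inv (hbox hw)])
  rw [this.1, e.right_inv (hbox hw)]

theorem LinkDiagram.LooksLike.symm_mem_crossings (hD : D.LooksLike e P)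
    (hbox : pictureBox ⊆ e.target) (hw : w ∈ pictureBox) :
    e.symm w ∈ D.crossings ↔ w ∈ P.crossings := by
  have := hD _ (e.map_target (hbox hw)) (by rwa [e.right_inv (hbox hw)])
  rw [this.2.1, e.right_inv (hbox hw)]

theorem CurveParam.curveDisc (hγ : CurveParam P γ b) (hb : 0 < b) (hbox : pictureBox ⊆ e.target)
    (hD : D.LooksLike e P)
    (hcr : ∀ w ∈ pictureBox, w ∉ openPictureBox → w ∉ P.crossings) :
    CurveDisc D (e.symm '' openPictureBox) (boxOf e) := by
  refine ⟨isOpen_openDisc hbox, image_mono openPictureBox_subset, disc_subset_closure hbox,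
    isPreconnected_openDisc hbox, ?_, ?_⟩
  · rintro _ ⟨w, hw, rfl⟩ hc
    rw [hD.symm_mem_curve hbox hw] at hc
    obtain ⟨s, hs, rfl, -⟩ := hγ.surj w hc hw
    have h1 : s ∈ closure (Ioo (-b) b) := by rwa [closure_Ioo (by linarith)]
    have h2 : ContinuousAt (fun s => e.symm (γ s)) s :=
      (e.continuousAt_symm (hbox hw)).comp hγ.continuous.continuousAt
    refine closure_mono ?_ (h2.continuousWithinAt.mem_closure_image h1)
    rintro _ ⟨t, ht, rfl⟩
    obtain ⟨h3, h4⟩ := hγ.mem t ht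
    exact ⟨mem_image_of_mem _ h4, (hD.symm_mem_curve hbox (openPictureBox_subset h4)).mpr h3⟩
  · rintro _ ⟨w, hw, rfl⟩ hx
    rw [hD.symm_mem_crossings hbox hw] at hx
    by_contra h
    exact hcr w hw (fun hh => h (mem_image_of_mem _ hh)) hx

theorem CurveParam.tendsto (hγ : CurveParam P γ b) (hbox : pictureBox ⊆ e.target)
    (hs : γ s ∈ openPictureBox) : Tendsto (fun t => e.symm (γ t)) (𝓝 s) (𝓝 (e.symm (γ s))) :=
  ((e.continuousAt_symm (hbox (openPictureBox_subset hs))).comp hγ.continuous.continuousAt).tendsto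

theorem CurveParam.eventually_mem_curve (hγ : CurveParam P γ b) (hbox : pictureBox ⊆ e.target)
    (hD : D.LooksLike e P) (hs : s ∈ Ioo (-b) b) : ∀ᶠ t in 𝓝 s, e.symm (γ t) ∈ D.curve := by
  filter_upwards [isOpen_Ioo.eventually_mem hs] with t ht
  exact (hD.symm_mem_curve hbox (openPictureBox_subset (hγ.mem t ht).2)).mpr (hγ.mem t ht).1

theorem CurveParam.eventually_col_eq (hγ : CurveParam P γ b) (hbox : pictureBox ⊆ e.target)
    (hD : D.LooksLike e P) (hs : s ∈ Ioo (-b) b) (hx : γ s ∉ P.crossings) :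
    ∀ᶠ t in 𝓝 s, C.col (e.symm (γ t)) = C.col (e.symm (γ s)) := by
  have h1 := (hγ.mem s hs).2
  have hx' : e.symm (γ s) ∉ D.crossings := fun h =>
    hx ((hD.symm_mem_crossings hbox (openPictureBox_subset h1)).mp h)
  filter_upwards [(hγ.tendsto hbox h1).eventually (C.eventually_col_eq
    (hγ.eventually_mem_curve hbox hD hs).self_of_nhds hx'),
    hγ.eventually_mem_curve hbox hD hs] with t h1 h2 using h1 h2

theorem CurveParam.exists_monochromeForm (hγ : CurveParam P γ b) (hbox : pictureBox ⊆ e.target)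
    (hD : D.LooksLike e P) (S : CurveDisc D (e.symm '' openPictureBox) (boxOf e))
    (h : ∀ s ∈ Ioo (-b) b, ∀ᶠ t in 𝓝 s, C.col (e.symm (γ t)) = C.col (e.symm (γ s))) :
    ∃ a r, MonochromeForm C (boxOf e) a r := by
  refine ⟨C.col (e.symm (γ 0)), S.exists_monochromeForm ?_⟩
  rintro _ ⟨w, hw, rfl⟩ hc
  rw [hD.symm_mem_curve hbox (openPictureBox_subset hw)] at hc
  obtain ⟨s, -, rfl, hs⟩ := hγ.surj w hc (openPictureBox_subset hw)
  have hs := hs hw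
  exact isPreconnected_Ioo.eq_of_locally_eq (S := Ioo (-b) b)
    (g := fun s => C.col (e.symm (γ s))) (fun q hq => (h q hq).mono fun _ h _ => h) hs
    ⟨by linarith [hs.1, hs.2], by linarith [hs.1, hs.2]⟩

/-- The index is constant along a curve off the diagram. -/
theorem LinkDiagram.LooksLike.index_eq (hD : D.LooksLike e P) (hbox : pictureBox ⊆ e.target)
    {J : Set ℝ} (hJ : IsPreconnected J) {ρ : ℝ → ℝ × ℝ} (hρ : Continuous ρ)
    (h : ∀ t ∈ J, ρ t ∈ pictureBox ∧ ρ t ∉ P.curve) {t t' : ℝ} (ht : t ∈ J) (ht' : t' ∈ J) :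
    D.index (e.symm (ρ t)) = D.index (e.symm (ρ t')) := by
  refine hJ.eq_of_locally_eq (g := fun t => D.index (e.symm (ρ t))) (fun q hq => ?_) ht ht'
  have h1 := (e.continuousAt_symm (hbox (h q hq).1)).comp hρ.continuousAt
  have h2 : e.symm (ρ q) ∉ D.curve := fun hc =>
    (h q hq).2 ((hD.symm_mem_curve hbox (h q hq).1).mp hc)
  exact (h1.tendsto.eventually (D.index_locally_constant _ h2)).mono fun _ h _ => h

end Param

theorem mem_pictureI_curve {w : ℝ × ℝ} : w ∈ pictureI.curve ↔ 4 * w.2 ^ 2 = w.1 + 1 / 2 := by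
  simp [pictureI, LocalPicture.ofStrands]

theorem notMem_pictureI_crossings {w : ℝ × ℝ} : w ∉ pictureI.crossings := by
  rintro ⟨i, j, h, -⟩
  omega

theorem mem_pictureI'_curve {w : ℝ × ℝ} :
    w ∈ pictureI'.curve ↔ 4 * w.2 ^ 2 = w.1 ^ 2 * (w.1 + 1 / 2) := Iff.rfl

theorem mem_openPictureBox_of_lt {w : ℝ × ℝ} (h : w.1 < 1) (h1 : -(1 / 2) ≤ w.1)
    (h2 : 4 * w.2 ^ 2 ≤ 3 / 2) : w ∈ openPictureBox := by
  rw [mem_openPictureBox_iff, abs_lt, ← sq_lt_one_iff_abs_lt_one]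
  exact ⟨⟨by linarith, h⟩, by linarith⟩

theorem sq_mul_le {x : ℝ} (h : -(1 / 2) ≤ x) (h1 : x ≤ 1) : x ^ 2 * (x + 1 / 2) ≤ 3 / 2 := by
  have : x ^ 2 ≤ 1 := by nlinarith
  nlinarith

theorem neg_half_le_of_mem {w : ℝ × ℝ} (h : w ∈ pictureI'.curve) : -(1 / 2) ≤ w.1 := by
  rw [mem_pictureI'_curve] at h
  by_contra hn
  have : 0 < w.1 ^ 2 * (-(w.1 + 1 / 2)) := mul_pos (by nlinarith) (by linarith)
  nlinarith [sq_nonneg w.2]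

theorem picturePair_I : PicturePair pictureI pictureI' := by
  have key : ∀ w ∈ pictureBox, w ∉ openPictureBox → w ∈ pictureI.curve → w.1 = 1 := by
    intro w hw hw' hc
    rw [mem_pictureI_curve] at hc
    rw [mem_pictureBox_iff, abs_le] at hw
    by_contra hne
    exact hw' (mem_openPictureBox_of_lt (lt_of_le_of_ne hw.1.2 hne) (by nlinarith [sq_nonneg w.2])
      (by linarith [hw.1.2]))
  have key' : ∀ w ∈ pictureBox, w ∉ openPictureBox → w ∈ pictureI'.curve → w.1 = 1 := by
    intro w hw hw' hc
    have h1 := neg_half_le_of_mem hc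
    rw [mem_pictureI'_curve] at hc
    rw [mem_pictureBox_iff, abs_le] at hw
    by_contra hne
    exact hw' (mem_openPictureBox_of_lt (lt_of_le_of_ne hw.1.2 hne) h1
      (by rw [hc]; exact sq_mul_le h1 hw.1.2))
  refine ⟨fun w hw hw' => ⟨fun h => ?_, fun h => ?_⟩, fun w hw hw' =>
    ⟨notMem_pictureI_crossings, fun h => ?_⟩, fun w hw hw' h => ?_, fun w hw hw' h => ?_⟩
  · have h1 := key w hw hw' h
    rw [mem_pictureI_curve, h1] at h
    rw [mem_pictureI'_curve, h, h1]; norm_num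
  · have h1 := key' w hw hw' h
    rw [mem_pictureI'_curve, h1] at h
    rw [mem_pictureI_curve, h, h1]; norm_num
  · obtain rfl : w = 0 := h
    exact hw' (by rw [mem_openPictureBox_iff]; simp)
  · rw [key w hw hw' h, abs_one]
  · have h1 := key w hw hw' h
    rw [mem_pictureI_curve, h1] at h
    have h0 : 0 < w.2 * w.2 := by nlinarith
    refine ⟨{v | 0 < v.2 * w.2}, ?_, ?_⟩
    · exact (isOpen_lt (by fun_prop) (by fun_prop)).mem_nhds h0
    · rintro v ⟨hv : 0 < v.2 * w.2, hvc, -⟩ v' ⟨hv' : 0 < v'.2 * w.2, hvc', -⟩ hvv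
      rw [mem_pictureI_curve] at hvc hvc'
      refine Prod.ext hvv ?_
      have h2 : (v.2 - v'.2) * (v.2 + v'.2) = 0 := by
        have : v.1 = v'.1 := hvv
        linarith
      rcases mul_eq_zero.mp h2 with h3 | h3
      · linarith
      · have : v.2 * w.2 + v'.2 * w.2 = 0 := by rw [← add_mul, h3, zero_mul]
        linarith

/-- The end points are at the parameters `±b` with `b² = 3/2`, where the first coordinate is `1`. -/
theorem curveParam_I {b : ℝ} (hb : 0 < b) (hb2 : b ^ 2 = 3 / 2) :
    CurveParam pictureI (fun s => (s ^ 2 - 1 / 2, s / 2)) b := by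
  refine ⟨by fun_prop, fun s hs => ⟨?_, ?_⟩, fun w hw hwb => ⟨2 * w.2, ?_, ?_, fun h => ?_⟩⟩
  · rw [mem_pictureI_curve]; ring
  · have := sq_lt_sq' hs.1 hs.2
    exact mem_openPictureBox_of_lt (by linarith) (by nlinarith) (by nlinarith)
  · rw [mem_pictureI_curve] at hw
    have := (abs_le.mp (mem_pictureBox_iff.mp hwb).1).2
    exact abs_le.mp (abs_le_of_sq_le_sq (by nlinarith) hb.le)
  · rw [mem_pictureI_curve] at hw
    ext
    · simp only; linarith
    · simp
  · rw [mem_pictureI_curve] at hw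
    have := (abs_lt.mp (mem_openPictureBox_iff.mp h).1).2
    exact abs_lt.mp (abs_lt_of_sq_lt_sq (by nlinarith) hb.le)

/-- The rational parametrization of the nodal cubic `4y² = x²(x + 1/2)`. The node
is at `s² = 1/2`. -/
theorem curveParam_I' {b : ℝ} (hb : 0 < b) (hb2 : b ^ 2 = 3 / 2) :
    CurveParam pictureI' (fun s => (s ^ 2 - 1 / 2, s * (s ^ 2 - 1 / 2) / 2)) b := by
  have hs : ∀ w ∈ pictureI'.curve,
      ∃ s : ℝ, s ^ 2 = w.1 + 1 / 2 ∧ (s ^ 2 - 1 / 2, s * (s ^ 2 - 1 / 2) / 2) = w := by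
    intro w hw
    rw [mem_pictureI'_curve] at hw
    by_cases h0 : w.1 = 0
    · refine ⟨√(1 / 2), ?_, ?_⟩
      · rw [Real.sq_sqrt (by norm_num), h0, zero_add]
      · rw [Real.sq_sqrt (by norm_num)]
        rw [h0] at hw
        ext
        · simp [h0]
        · have : w.2 = 0 := by nlinarith
          simp [this]
    · have h1 : (2 * w.2 / w.1) ^ 2 = w.1 + 1 / 2 := by
        field_simp
        linarith
      -- the slope through the node parametrizes the nodal cubic
      refine ⟨2 * w.2 / w.1, h1, ?_⟩
      rw [h1]
      ext
      · simp
      · simp only [add_sub_cancel_right]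
        field_simp
  refine ⟨by fun_prop, fun s hs => ⟨?_, ?_⟩, fun w hw hwb => ?_⟩
  · rw [mem_pictureI'_curve]; ring
  · have h1 := sq_lt_sq' hs.1 hs.2
    have h2 : -(1 / 2) ≤ s ^ 2 - 1 / 2 := by nlinarith
    refine mem_openPictureBox_of_lt (by linarith) h2 ?_
    have := sq_mul_le h2 (by linarith)
    simp only
    nlinarith
  · obtain ⟨s, h1, h2⟩ := hs w hw
    refine ⟨s, ?_, h2, fun h => ?_⟩
    · have := (abs_le.mp (mem_pictureBox_iff.mp hwb).1).2
      exact abs_le.mp (abs_le_of_sq_le_sq (by linarith) hb.le)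
    · have := (abs_lt.mp (mem_openPictureBox_iff.mp h).1).2
      exact abs_lt.mp (abs_lt_of_sq_lt_sq (by linarith) hb.le)

section Kink

theorem exists_sq_eq_three_half : ∃ b : ℝ, 0 < b ∧ b ^ 2 = 3 / 2 :=
  ⟨√(3 / 2), by positivity, Real.sq_sqrt (by norm_num)⟩

theorem zero_mem_openPictureBox : (0 : ℝ × ℝ) ∈ openPictureBox := by
  rw [mem_openPictureBox_iff]; simp

theorem curveDisc_I (hbox : pictureBox ⊆ e.target) (hD : D.LooksLike e pictureI) :
    CurveDisc D (e.symm '' openPictureBox) (boxOf e) := by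
  obtain ⟨b, hb, hb2⟩ := exists_sq_eq_three_half
  exact (curveParam_I hb hb2).curveDisc hb hbox hD fun _ _ _ => notMem_pictureI_crossings

theorem curveDisc_I' (hbox : pictureBox ⊆ e.target) (hD : D.LooksLike e pictureI') :
    CurveDisc D (e.symm '' openPictureBox) (boxOf e) := by
  obtain ⟨b, hb, hb2⟩ := exists_sq_eq_three_half
  exact (curveParam_I' hb hb2).curveDisc hb hbox hD fun w hw hw' =>
    (picturePair_I.notMem_crossings w hw hw').2

theorem exists_monochromeForm_I (hbox : pictureBox ⊆ e.target) (hD : D.LooksLike e pictureI) :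
    ∃ a r, MonochromeForm C (boxOf e) a r := by
  obtain ⟨b, hb, hb2⟩ := exists_sq_eq_three_half
  have hγ := curveParam_I hb hb2
  exact hγ.exists_monochromeForm hbox hD (curveDisc_I hbox hD) fun s hs =>
    hγ.eventually_col_eq hbox hD hs notMem_pictureI_crossings

/-- In a kink, the color is constant along the strand from the over-crossing to the
under-crossing, so that the two under-arcs have colors `x` and `y` with `x = b` or `y = b`, where
`y = x * b`. Since `b * b = b`, they have the color `b` of the over-arc. -/
theorem exists_monochromeForm_I' (hbox : pictureBox ⊆ e.target) (hD : D.LooksLike e pictureI') :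
    ∃ a r, MonochromeForm C (boxOf e) a r := by
  obtain ⟨b, hb, hb2⟩ := exists_sq_eq_three_half
  obtain ⟨c, hc, hc2⟩ : ∃ c : ℝ, 0 < c ∧ c ^ 2 = 1 / 2 :=
    ⟨√(1 / 2), by positivity, Real.sq_sqrt (by norm_num)⟩
  have hcb : c < b := by nlinarith
  have hγ := curveParam_I' hb hb2
  set γ : ℝ → ℝ × ℝ := fun s => (s ^ 2 - 1 / 2, s * (s ^ 2 - 1 / 2) / 2) with hγdef
  have h0 : ∀ s, s ^ 2 = c ^ 2 → γ s = 0 := by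
    intro s hs
    rw [hγdef]
    simp only
    rw [hs, hc2]; ext <;> simp
  have h0' : ∀ s, γ s ∈ pictureI'.crossings → s = c ∨ s = -c := by
    intro s (hs : γ s = 0)
    have : s ^ 2 - 1 / 2 = 0 := congrArg Prod.fst hs
    exact sq_eq_sq_iff_eq_or_eq_neg.mp (by linarith)
  have hp0 := openPictureBox_subset zero_mem_openPictureBox
  set p := e.symm 0 with hp
  have hpx : p ∈ D.crossings := (hD.symm_mem_crossings hbox hp0).mpr rfl
  have hps : p ∈ e.source := e.map_target (hbox hp0)
  have hep : e p = 0 := e.right_inv (hbox hp0)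
  have hover : ∀ᶠ w in 𝓝 p, w ∈ D.overStrand p ↔ e w ∈ pictureI'.overStrand (e p) :=
    (hD p hps (by rwa [hep])).2.2 hpx
  have hmem : ∀ {s}, s ∈ Ioo (-b) b → e (e.symm (γ s)) = γ s := fun {s} hs =>
    e.right_inv (hbox (openPictureBox_subset (hγ.mem s hs).2))
  have htend : ∀ s, s ^ 2 = c ^ 2 → Tendsto (fun t => e.symm (γ t)) (𝓝 s) (𝓝 p) := by
    intro s hs
    have := hγ.tendsto hbox (s := s) (by rw [h0 s hs]; exact zero_mem_openPictureBox)
    rwa [h0 s hs] at this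
  have hcI : c ∈ Ioo (-b) b := ⟨by linarith, hcb⟩
  have hcI' : -c ∈ Ioo (-b) b := ⟨by linarith, by linarith⟩
  -- the strand is an over-strand at the parameter `c`, and an under-strand at `-c`
  have h1 : ∀ s ∈ Ioo (-c) b, C.col (e.symm (γ s)) = C.col p := by
    intro s hs
    have h2 : C.col (e.symm (γ c)) = C.col p := by rw [h0 c rfl]
    rw [← h2]
    refine isPreconnected_Ioo.eq_of_locally_eq (S := Ioo (-c) b)
      (g := fun s => C.col (e.symm (γ s))) (fun q hq => ?_) hs ⟨by linarith, hcb⟩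
    have hq' : q ∈ Ioo (-b) b := ⟨by linarith [hq.1], hq.2⟩
    by_cases hqc : q = c
    · subst hqc
      filter_upwards [(htend q rfl).eventually (C.eventually_over_col_eq hpx),
        (htend q rfl).eventually hover, hγ.eventually_mem_curve hbox hD hq',
        isOpen_Ioo.eventually_mem hq', eventually_gt_nhds hc] with t t1 t2 t3 t4 t5 _
      simp only [h2]
      refine t1 t3 (t2.mpr ?_)
      rw [hmem t4]
      refine ⟨(hγ.mem t t4).1, ?_⟩
      have : (t ^ 2 - 1 / 2) * (t * (t ^ 2 - 1 / 2) / 2) = (t ^ 2 - 1 / 2) ^ 2 * t / 2 := by ring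
      simp only [hγdef, this]
      positivity
    · refine (hγ.eventually_col_eq hbox hD hq' fun hx => ?_).mono fun _ h _ => h
      rcases h0' q hx with h | h
      · exact hqc h
      · linarith [hq.1]
  obtain ⟨e₁, he₁⟩ := D.crossing_chart p hpx
  obtain ⟨m, r, α, hform⟩ := C.exists_crossForm hpx he₁
  have hα : α = C.col p := by
    have h2 : Tendsto (fun t => e.symm (γ t)) (𝓝[>] (-c)) (𝓝 p) :=
      (htend (-c) (by ring)).mono_left nhdsWithin_le_nhds
    have h3 : Ioo (-c) 0 ∈ 𝓝[>] (-c) := Ioo_mem_nhdsGT (by linarith)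
    obtain ⟨t, t1, t2, t3⟩ := ((h2.eventually hform).and ((h2.eventually hover).and
      h3)).exists
    have t4 : t ∈ Ioo (-b) b := ⟨by linarith [t3.1], by linarith [t3.2]⟩
    have t5 : t ^ 2 - 1 / 2 ≠ 0 := by
      have : t ^ 2 < c ^ 2 := sq_lt_sq' t3.1 (by linarith [t3.2])
      linarith
    have hcol := h1 t ⟨t3.1, t4.2⟩
    have hn : (e₁ (e.symm (γ t))).2 ≠ 0 := by
      intro hh
      rw [← he₁.mem_over_iff _ t1.1, t2, hmem t4] at hh
      have hh := hh.2
      have : (t ^ 2 - 1 / 2) * (t * (t ^ 2 - 1 / 2) / 2) = (t ^ 2 - 1 / 2) ^ 2 * (t / 2) := by ring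
      simp only [hγdef, this] at hh
      have : (t ^ 2 - 1 / 2) ^ 2 * (t / 2) < 0 :=
        mul_neg_of_pos_of_neg (by positivity) (by linarith [t3.2])
      linarith
    have h4 := (t1.2.2.1.mp (hγ.eventually_mem_curve hbox hD t4).self_of_nhds).resolve_right hn
    rcases hn.lt_or_gt with h5 | h5
    · rw [← t1.2.2.2.2.1 h4 h5, hcol]
    · exact eq_of_act_eq (by rw [← t1.2.2.2.2.2.1 h4 h5, hcol])
  refine hγ.exists_monochromeForm hbox hD (curveDisc_I' hbox hD) fun s hs => ?_
  by_cases hx : γ s ∈ pictureI'.crossings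
  · have hsc : s ^ 2 = c ^ 2 := sq_eq_sq_iff_eq_or_eq_neg.mpr (h0' s hx)
    have hsp : e.symm (γ s) = p := by rw [h0 s hsc]
    filter_upwards [(htend s hsc).eventually hform, hγ.eventually_mem_curve hbox hD hs] with t t1 t2
    rw [hsp]
    obtain ⟨-, -, t3, t4, t5, t6, -⟩ := t1
    rcases eq_or_ne (e₁ (e.symm (γ t))).2 0 with h | h
    · exact t4 h
    · have h' := (t3.mp t2).resolve_right h
      rcases h.lt_or_gt with h | h
      · rw [t5 h' h, hα]
      · rw [t6 h' h, hα, Quandle.fix]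
  · exact hγ.eventually_col_eq hbox hD hs hx

theorem sq_le_one_of_mem {t : ℝ} (ht : t ∈ Icc (0 : ℝ) 1) : t ^ 2 ≤ 1 := by
  nlinarith [ht.1, ht.2]

/-- Below the graph of `F`, the index is constant along vertical lines to the axis. -/
theorem index_eq_axis (hbox : pictureBox ⊆ e.target) {P : LocalPicture} (hD : D.LooksLike e P)
    {F : ℝ → ℝ} (hF : ∀ w, w ∈ P.curve ↔ 4 * w.2 ^ 2 = F w.1) {x y : ℝ}
    (hw : (x, y) ∈ pictureBox) (h : 4 * y ^ 2 < F x) :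
    D.index (e.symm (x, y)) = D.index (e.symm (x, 0)) := by
  rw [mem_pictureBox_iff, abs_le, abs_le] at hw
  obtain ⟨hx, y1, y2⟩ := hw
  simp only at hx y1 y2
  have := hD.index_eq hbox (isPreconnected_Icc (a := 0) (b := 1)) (ρ := fun t => (x, t * y))
    (by fun_prop) (fun t ht => ⟨?_, ?_⟩) (right_mem_Icc.mpr zero_le_one)
    (left_mem_Icc.mpr zero_le_one)
  · simpa using this
  · rw [mem_pictureBox_iff, abs_le, abs_le]
    exact ⟨hx, by nlinarith [ht.1, ht.2], by nlinarith [ht.1, ht.2]⟩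
  · rw [hF]
    simp only [mul_pow]
    nlinarith [sq_le_one_of_mem ht, sq_nonneg y]

/-- Above the graph of `F`, the index is constant along vertical lines to the frontier. -/
theorem exists_index_eq_frontier (hbox : pictureBox ⊆ e.target) {P : LocalPicture}
    (hD : D.LooksLike e P) {F : ℝ → ℝ} (hF : ∀ w, w ∈ P.curve ↔ 4 * w.2 ^ 2 = F w.1) {x y : ℝ}
    (hw : (x, y) ∈ pictureBox) (h : F x < 4 * y ^ 2) : ∃ ε : ℝ, (ε = 1 ∨ ε = -1) ∧
      D.index (e.symm (x, y)) = D.index (e.symm (x, ε)) := by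
  rw [mem_pictureBox_iff, abs_le, abs_le] at hw
  obtain ⟨hx, y1, y2⟩ := hw
  simp only at hx y1 y2
  obtain ⟨ε, hε, hy⟩ : ∃ ε : ℝ, (ε = 1 ∨ ε = -1) ∧ 0 ≤ ε * y := by
    rcases le_total 0 y with h | h
    · exact ⟨1, Or.inl rfl, by linarith⟩
    · exact ⟨-1, Or.inr rfl, by linarith⟩
  refine ⟨ε, hε, ?_⟩
  have := hD.index_eq hbox (isPreconnected_Icc (a := 0) (b := 1))
    (ρ := fun t => (x, y + t * (ε - y))) (by fun_prop) (fun t ht => ⟨?_, ?_⟩)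
    (left_mem_Icc.mpr zero_le_one) (right_mem_Icc.mpr zero_le_one)
  · simpa using this
  · rw [mem_pictureBox_iff, abs_le, abs_le]
    refine ⟨hx, ?_⟩
    rcases hε with rfl | rfl <;> constructor <;> simp only <;> nlinarith [ht.1, ht.2]
  · rw [hF]
    simp only
    have : y ^ 2 ≤ (y + t * (ε - y)) ^ 2 := by
      refine sq_le_sq.mpr ?_
      rcases hε with rfl | rfl
      · rw [one_mul] at hy
        have h1 : 0 ≤ t * (1 - y) := mul_nonneg ht.1 (by linarith)
        rw [abs_of_nonneg hy, abs_of_nonneg (by linarith)]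
        linarith
      · have h1 : 0 ≤ t * (1 + y) := mul_nonneg ht.1 (by linarith)
        have h2 : t * (-1 - y) = -(t * (1 + y)) := by ring
        rw [h2, abs_of_nonpos (by linarith), abs_of_nonpos (by linarith)]
        linarith
    linarith

/-- The four quadrants at the crossing of the kink meet all the regions in the disc. -/
theorem exists_index_mem_I' (hbox : pictureBox ⊆ e.target) (hD : D.LooksLike e pictureI') :
    ∃ k, ∀ w ∈ pictureBox, w ∉ pictureI'.curve →
      k ≤ D.index (e.symm w) ∧ D.index (e.symm w) ≤ k + 2 := by
  have hp0 := openPictureBox_subset zero_mem_openPictureBox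
  have hpx : e.symm 0 ∈ D.crossings := (hD.symm_mem_crossings hbox hp0).mpr rfl
  obtain ⟨e₁, he₁⟩ := D.crossing_chart _ hpx
  obtain ⟨m, r, α, hform⟩ := D.trivialColoring.exists_crossForm hpx he₁
  -- a region which reaches the crossing along `ρ` has an index in `[m, m + 2]`
  have hreach : ∀ ρ : ℝ → ℝ × ℝ, Continuous ρ → ρ 0 = 0 →
      (∀ t ∈ Ioc (0 : ℝ) 1, ρ t ∈ pictureBox ∧ ρ t ∉ pictureI'.curve) →
      m ≤ D.index (e.symm (ρ 1)) ∧ D.index (e.symm (ρ 1)) ≤ m + 2 := by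
    intro ρ hρ h0 h
    have h1 : Tendsto (fun t => e.symm (ρ t)) (𝓝[>] 0) (𝓝 (e.symm 0)) := by
      have := (e.continuousAt_symm (hbox hp0)).tendsto
      rw [← h0] at this
      rw [← h0]
      exact (this.comp hρ.continuousAt.tendsto).mono_left nhdsWithin_le_nhds
    obtain ⟨t, t1, t2⟩ := ((h1.eventually hform).and (Ioc_mem_nhdsGT one_pos)).exists
    have t3 : e.symm (ρ t) ∉ D.curve := fun hh =>
      (h t t2).2 ((hD.symm_mem_curve hbox (h t t2).1).mp hh)
    rw [hD.index_eq hbox isPreconnected_Ioc hρ h (right_mem_Ioc.mpr one_pos) t2,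
      (t1.eq_of_notMem t3).1]
    constructor <;> split_ifs <;> omega
  refine ⟨m, fun w hw hwc => ?_⟩
  obtain ⟨x, y⟩ := w
  obtain ⟨x1, x2⟩ := abs_le.mp (mem_pictureBox_iff.mp hw).1
  simp only at x1 x2
  rw [mem_pictureI'_curve] at hwc
  simp only at hwc
  have hF : ∀ w, w ∈ pictureI'.curve ↔ 4 * w.2 ^ 2 = (fun x => x ^ 2 * (x + 1 / 2)) w.1 :=
    fun _ => Iff.rfl
  rcases lt_or_gt_of_ne hwc with h | h
  · -- inside the loop or on the right of the crossing: move to the axis, then to the crossing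
    have hx : 0 < x ^ 2 * (x + 1 / 2) := by nlinarith [sq_nonneg y]
    have hx0 : 0 < x ^ 2 := by
      rcases eq_or_ne x 0 with h0 | h0
      · simp [h0] at hx
      · positivity
    have hx1 : 0 < x + 1 / 2 := (pos_iff_pos_of_mul_pos hx).mp hx0
    rw [index_eq_axis (F := fun x => x ^ 2 * (x + 1 / 2)) hbox hD hF hw h]
    have e2 := hreach (fun t => (t * x, 0)) (by fun_prop) (by simp) fun t ht => ⟨?_, ?_⟩
    · simpa using e2
    · rw [mem_pictureBox_iff, abs_le, abs_le]
      simp only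
      exact ⟨⟨by nlinarith [ht.1, ht.2], by nlinarith [ht.1, ht.2]⟩, by norm_num, by norm_num⟩
    · rw [mem_pictureI'_curve]
      have h1 : 0 < t * x + 1 / 2 := by nlinarith [ht.1, ht.2]
      have h2 : 0 < (t * x) ^ 2 := by rw [mul_pow]; exact mul_pos (pow_pos ht.1 2) hx0
      have := mul_pos h2 h1
      simp only
      nlinarith
  · -- outside: move to the top or bottom of the box, then along it, then to the crossing
    obtain ⟨ε, hε, h1⟩ := exists_index_eq_frontier (F := fun x => x ^ 2 * (x + 1 / 2))
      hbox hD hF hw h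
    have hε1 : ε ^ 2 = 1 := by rcases hε with rfl | rfl <;> norm_num
    have hε2 : |ε| = 1 := by rcases hε with rfl | rfl <;> norm_num
    have hx : |x| ≤ 1 := abs_le.mpr ⟨x1, x2⟩
    have e1 := hD.index_eq hbox (isPreconnected_Icc (a := 0) (b := 1)) (ρ := fun t => (t * x, ε))
      (by fun_prop) (fun t ht => ⟨?_, ?_⟩) (right_mem_Icc.mpr zero_le_one)
      (left_mem_Icc.mpr zero_le_one)
    · have e2 := hreach (fun t => (0, t * ε)) (by fun_prop) (by simp) fun t ht => ⟨?_, ?_⟩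
      · simp only [one_mul, zero_mul] at e1 e2
        rwa [h1, e1]
      · rw [mem_pictureBox_iff, abs_mul, hε2, mul_one, abs_of_pos ht.1]
        exact ⟨by simp, ht.2⟩
      · rw [mem_pictureI'_curve, mul_pow, hε1]
        have := pow_pos ht.1 2
        simp only
        nlinarith
    · rw [mem_pictureBox_iff, abs_mul, hε2, abs_of_nonneg ht.1]
      exact ⟨mul_le_one₀ ht.2 (abs_nonneg x) hx, le_rfl⟩
    · rw [mem_pictureI'_curve, hε1]
      intro hh
      have h4 := neg_half_le_of_mem (w := (t * x, ε)) (by rw [mem_pictureI'_curve, hε1]; exact hh)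
      have h5 : t * x ≤ 1 := by nlinarith [ht.1, ht.2]
      have := sq_mul_le h4 h5
      simp only at this hh
      linarith

/-- Without the crossing, each region in the disc reaches the frontier, where the indices are those
of the kink. -/
theorem index_mem_I {k : ℤ} (hbox : pictureBox ⊆ e.target) (hD : D.LooksLike e pictureI)
    (M : LocalMove D D' (e.symm '' openPictureBox) (boxOf e))
    (hk : ∀ w ∈ pictureBox, w ∉ pictureI'.curve →
      k ≤ D'.index (e.symm w) ∧ D'.index (e.symm w) ≤ k + 2) :
    ∀ w ∈ pictureBox, w ∉ pictureI.curve → k ≤ D.index (e.symm w) ∧ D.index (e.symm w) ≤ k + 2 := by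
  have hfr : ∀ w ∈ pictureBox, w ∉ openPictureBox → w ∉ pictureI.curve →
      k ≤ D.index (e.symm w) ∧ D.index (e.symm w) ≤ k + 2 := by
    intro w hw hw' hc
    rw [M.index_eq]
    · exact hk w hw fun h => hc ((picturePair_I.curve_iff w hw hw').mpr h)
    · rw [mem_openBoxOf_iff hbox, e.right_inv (hbox hw)]
      exact fun h => hw' h.2
    · rwa [hD.symm_mem_curve hbox hw]
  rintro ⟨x, y⟩ hw hc
  have hF : ∀ w, w ∈ pictureI.curve ↔ 4 * w.2 ^ 2 = (fun x => x + 1 / 2) w.1 :=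
    fun _ => mem_pictureI_curve
  have hx := abs_le.mp (mem_pictureBox_iff.mp hw).1
  simp only at hx
  rw [mem_pictureI_curve] at hc
  rcases lt_or_gt_of_ne hc with h | h
  · rw [index_eq_axis (F := fun x => x + 1 / 2) hbox hD hF hw h]
    simp only at h
    have h0 : -(1 / 2) < x := by nlinarith [sq_nonneg y]
    have := hD.index_eq hbox (isPreconnected_Icc (a := x) (b := 1)) (ρ := fun t => (t, 0))
      (by fun_prop) (fun t ht => ⟨?_, ?_⟩) (left_mem_Icc.mpr hx.2) (right_mem_Icc.mpr hx.2)
    · rw [this]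
      refine hfr _ ?_ ?_ ?_
      · rw [mem_pictureBox_iff]; simp
      · rw [mem_openPictureBox_iff]; simp
      · rw [mem_pictureI_curve]; norm_num
    · rw [mem_pictureBox_iff, abs_le]
      exact ⟨⟨by linarith [ht.1], ht.2⟩, by simp⟩
    · rw [mem_pictureI_curve]
      simp only
      have := ht.1
      intro hh
      linarith
  · obtain ⟨ε, hε, h1⟩ := exists_index_eq_frontier (F := fun x => x + 1 / 2) hbox hD hF hw h
    have hε1 : ε ^ 2 = 1 := by rcases hε with rfl | rfl <;> norm_num
    have hε2 : |ε| = 1 := by rcases hε with rfl | rfl <;> norm_num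
    rw [h1]
    refine hfr _ ?_ ?_ ?_
    · rw [mem_pictureBox_iff, hε2]; exact ⟨abs_le.mpr hx, le_rfl⟩
    · rw [mem_openPictureBox_iff, hε2]; simp
    · rw [mem_pictureI_curve, hε1]
      intro hh
      simp only at hh
      linarith [hx.2]

/-- The effect of the first Reidemeister move on colorings and on the class of `ψ`. -/
theorem reidemeisterI {k : SpaceKind} {m : SpaceModel} (hbox : pictureBox ⊆ e.target)
    (hD : D.LooksLike e pictureI) (hD' : D'.LooksLike e pictureI')
    (M : LocalMove D D' (e.symm '' openPictureBox) (boxOf e)) :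
    (∀ C : ShadowColoring X D, ∃! C' : ShadowColoring X D', C.AgreesOutside (boxOf e) C') ∧
    (∀ C' : ShadowColoring X D', ∃! C : ShadowColoring X D, C.AgreesOutside (boxOf e) C') ∧
    ∀ (C : ShadowColoring X D) (C' : ShadowColoring X D'), C.AgreesOutside (boxOf e) C' →
      ∀ {r₀ : X} {f g : RackLoop r₀}, IsShadowMap C f → IsShadowMap C' g →
        GenLoop.Homotopic (pushLoop (toQuandleSpace X k m) f)
          (pushLoop (toQuandleSpace X k m) g) := by
  have S := curveDisc_I hbox hD
  have S' := curveDisc_I' hbox hD'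
  have hN : ∀ C : ShadowColoring X D, ∃ a r, MonochromeForm C (boxOf e) a r :=
    fun C => exists_monochromeForm_I hbox hD
  have hN' : ∀ C : ShadowColoring X D', ∃ a r, MonochromeForm C (boxOf e) a r :=
    fun C => exists_monochromeForm_I' hbox hD'
  have hV : ∀ w ∈ pictureBox, w ∉ openPictureBox → e.symm w ∉ e.symm '' openPictureBox := by
    intro w hw hw' h
    rw [mem_openBoxOf_iff hbox, e.right_inv (hbox hw)] at h
    exact hw' h.2
  have hend : ∃ z ∈ boxOf e, z ∉ e.symm '' openPictureBox ∧ z ∈ D.curve := by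
    obtain ⟨b, hb, hb2⟩ := exists_sq_eq_three_half
    have hw : ((1, b / 2) : ℝ × ℝ) ∈ pictureBox := by
      rw [mem_pictureBox_iff, abs_of_pos (by linarith : 0 < b / 2)]
      exact ⟨by simp, by nlinarith⟩
    refine ⟨_, mem_image_of_mem _ hw, hV _ hw ?_, (hD.symm_mem_curve hbox hw).mpr ?_⟩
    · rw [mem_openPictureBox_iff]; simp
    · rw [mem_pictureI_curve]; simp only; linarith
  have hcor : ∃ z ∈ boxOf e, z ∉ e.symm '' openPictureBox ∧ z ∉ D.curve := by
    have hw : ((1, 0) : ℝ × ℝ) ∈ pictureBox := by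
      rw [mem_pictureBox_iff]; simp
    refine ⟨_, mem_image_of_mem _ hw, hV _ hw ?_, fun h => ?_⟩
    · rw [mem_openPictureBox_iff]; simp
    · have := (hD.symm_mem_curve hbox hw).mp h
      rw [mem_pictureI_curve] at this
      norm_num at this
  have hend' : ∃ z ∈ boxOf e, z ∉ e.symm '' openPictureBox ∧ z ∈ D'.curve := by
    obtain ⟨z, h1, h2, h3⟩ := hend
    exact ⟨z, h1, h2, (M.curve_iff z h1 h2).mp h3⟩
  have hcor' : ∃ z ∈ boxOf e, z ∉ e.symm '' openPictureBox ∧ z ∉ D'.curve := by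
    obtain ⟨z, h1, h2, h3⟩ := hcor
    exact ⟨z, h1, h2, fun h => h3 ((M.curve_iff z h1 h2).mpr h)⟩
  refine ⟨fun C => ?_, fun C' => ?_, fun C C' hC r₀ f g hf hg => ?_⟩
  · obtain ⟨a, r, N⟩ := hN C
    obtain ⟨C', hC'⟩ := N.exists_coloring M S
    exact ⟨C', hC', fun C₁ h => M.coloring_unique_of_monochrome hN' hN hend hcor h hC'⟩
  · obtain ⟨a, r, N⟩ := hN' C'
    obtain ⟨C, hC⟩ := N.exists_coloring M.symm S'
    exact ⟨C, hC.symm, fun C₁ h =>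
      M.symm.coloring_unique_of_monochrome hN hN' hend' hcor' h.symm hC⟩
  · obtain ⟨n, hn⟩ := exists_index_mem_I' hbox hD'
    have hn' := index_mem_I hbox hD M hn
    obtain ⟨a, r, N⟩ := hN C
    obtain ⟨a', r', N'⟩ := hN' C'
    obtain ⟨rfl, rfl⟩ := N.eq_of_agree M hC N' hend hcor
    have L : LevelDisc C (e.symm '' openPictureBox) (boxOf e) a r n := by
      refine ⟨S, N, ?_⟩
      rintro _ ⟨w, hw, rfl⟩ hc
      have hw := openPictureBox_subset hw
      exact hn' w hw fun h => hc ((hD.symm_mem_curve hbox hw).mpr h)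
    have L' : LevelDisc C' (e.symm '' openPictureBox) (boxOf e) a r n := by
      refine ⟨S', N', ?_⟩
      rintro _ ⟨w, hw, rfl⟩ hc
      have hw := openPictureBox_subset hw
      exact hn w hw fun h => hc ((hD'.symm_mem_curve hbox hw).mpr h)
    obtain ⟨W, H⟩ := exists_foldBall k m (powAct a n r) a
    have hnorm : ∀ z ∈ e.source, ContinuousAt (fun z => ‖e z‖) z := fun z hz =>
      (e.continuousAt hz).norm
    have hboxnorm : ∀ w : ℝ × ℝ, ‖w‖ < 1 → w ∈ openPictureBox := by
      intro w hw
      rw [mem_openPictureBox_iff, ← Real.norm_eq_abs, ← Real.norm_eq_abs]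
      exact ⟨(norm_fst_le w).trans_lt hw, (norm_snd_le w).trans_lt hw⟩
    -- `1` within distance `1/3` of the crossing at the origin, and `0` beyond distance `2/3`
    refine L.homotopic M L' H (lam := fun z => projIcc 0 1 zero_le_one (2 - 3 * ‖e z‖))
      (fun z hz => ?_) (fun z hz hx => ?_) (fun z hz hzV => ?_) hC hf hg
    · rw [mem_openBoxOf_iff hbox] at hz
      exact continuous_projIcc.continuousAt.comp
        (continuousAt_const.sub (continuousAt_const.mul (hnorm z hz.1)))
    · rw [mem_openBoxOf_iff hbox] at hz
      have hz' := openPictureBox_subset hz.2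
      have h0 : e z = 0 := by
        rcases hx with hx | hx
        · exact absurd ((hD z hz.1 hz').2.1.mp hx) notMem_pictureI_crossings
        · exact (hD' z hz.1 hz').2.1.mp hx
      have h1 : ‖e z‖ < 1 / 3 := by rw [h0, norm_zero]; norm_num
      filter_upwards [(hnorm z hz.1).eventually_lt continuousAt_const h1] with w hw
      exact projIcc_of_right_le _ (by linarith)
    · rw [mem_symm_image_iff hbox] at hz
      have h1 : 2 / 3 < ‖e z‖ := by
        by_contra h
        refine hzV ((mem_openBoxOf_iff hbox).mpr
          ⟨hz.1, hboxnorm _ (by linarith)⟩)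
      filter_upwards [continuousAt_const.eventually_lt (hnorm z hz.1) h1] with w hw _
      exact projIcc_of_le_left _ (by linarith)

end Kink

/-! ### Homeomorphisms of the square -/

theorem eventually_homeomorph {φ : Square ≃ₜ Square} {Q : Square → Prop}
    (h : ∀ᶠ z in 𝓝 p, Q (φ z)) : ∀ᶠ z in 𝓝 (φ p), Q z := by
  rw [← φ.map_nhds_eq]; exact h

/-- The homeomorphism `φ` maps the diagram `D` to `D'`. -/
def CarriesDiagram (φ : Square ≃ₜ Square) (D D' : LinkDiagram) : Prop :=
  ∀ p, (p ∈ D.curve ↔ φ p ∈ D'.curve) ∧ (p ∈ D.crossings ↔ φ p ∈ D'.crossings) ∧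
    (p ∈ D.crossings → ∀ᶠ w in 𝓝 p, w ∈ D.overStrand p ↔ φ w ∈ D'.overStrand (φ p)) ∧
    (p ∉ D.curve → D.index p = D'.index (φ p))

/-- The homeomorphism `φ` maps the shadow coloring `C` to `C'`. -/
def CarriesColoring (φ : Square ≃ₜ Square)
    (C : ShadowColoring X D) (C' : ShadowColoring X D') : Prop :=
  (∀ p ∉ D.curve, C'.reg (φ p) = C.reg p) ∧ ∀ p ∈ D.curve, C'.col (φ p) = C.col p

section Carries

variable {φ : Square ≃ₜ Square}

theorem CarriesDiagram.symm (h : CarriesDiagram φ D D') : CarriesDiagram φ.symm D' D := by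
  intro p
  obtain ⟨p, rfl⟩ := φ.surjective p
  obtain ⟨h1, h2, h3, h4⟩ := h p
  rw [φ.symm_apply_apply]
  refine ⟨h1.symm, h2.symm, fun hx => eventually_homeomorph ?_, fun hc => (h4 ?_).symm⟩
  · filter_upwards [h3 (h2.mpr hx)] with w hw
    rw [φ.symm_apply_apply]; exact hw.symm
  · rwa [h1]

theorem CarriesDiagram.isRegularChart (h : CarriesDiagram φ D D') (he : D.IsRegularChart p e) :
    D'.IsRegularChart (φ p) (φ.symm.transOpenPartialHomeomorph e) := by
  have hc : ∀ q, φ.symm q ∈ D.curve ↔ q ∈ D'.curve := fun q => (h.symm q).1.symm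
  obtain ⟨n, hn⟩ := he.index_eq
  have hi : ∀ q, φ.symm q ∈ e.source → (e (φ.symm q)).1 ≠ 0 →
      D'.index q = D.index (φ.symm q) := fun q hq hne =>
    (h.symm q).2.2.2 fun hh => hne ((he.mem_curve_iff _ hq).mp ((hc q).mpr hh))
  refine ⟨?_, ?_, fun q hq => ?_, n, fun q hq => ⟨fun hlt => ?_, fun hlt => ?_⟩⟩
  · exact (congrArg (· ∈ e.source) (φ.symm_apply_apply p)).mpr he.mem_source
  · exact (congrArg e (φ.symm_apply_apply p)).trans he.map_center
  · exact (hc q).symm.trans (he.mem_curve_iff _ hq)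
  · rw [hi q hq (ne_of_lt hlt)]; exact (hn _ hq).1 hlt
  · rw [hi q hq (ne_of_gt hlt)]; exact (hn _ hq).2 hlt

theorem CarriesDiagram.exists_crossingChart (h : CarriesDiagram φ D D')
    (he : D.IsCrossingChart p e) (hp : p ∈ D.crossings) : ∃ e', D'.IsCrossingChart (φ p) e' ∧
      ∀ᶠ z in 𝓝 p, φ z ∈ e'.source ∧ e' (φ z) = e z := by
  have hc : ∀ q, φ.symm q ∈ D.curve ↔ q ∈ D'.curve := fun q => (h.symm q).1.symm
  obtain ⟨N, hN, hNo, hpN⟩ := eventually_nhds_iff.mp ((h p).2.2.1 hp)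
  obtain ⟨n, hn⟩ := he.index_eq
  have hs : ∀ {q}, q ∈ (φ.symm.transOpenPartialHomeomorph (e.restrOpen N hNo)).source ↔
      φ.symm q ∈ e.source ∧ φ.symm q ∈ N := Iff.rfl
  refine ⟨φ.symm.transOpenPartialHomeomorph (e.restrOpen N hNo), ⟨?_, ?_, fun q hq => ?_,
    fun q hq => ?_, n, fun q hq h1 h2 => ?_⟩, ?_⟩
  · rw [hs, φ.symm_apply_apply]; exact ⟨he.mem_source, hpN⟩
  · exact (congrArg e (φ.symm_apply_apply p)).trans he.map_center
  · exact (hc q).symm.trans (he.mem_curve_iff _ (hs.mp hq).1)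
  · rw [hs] at hq
    have := hN _ hq.2
    rw [φ.apply_symm_apply] at this
    exact this.symm.trans (he.mem_over_iff _ hq.1)
  · rw [hs] at hq
    rw [(h.symm q).2.2.2 fun hh => ?_]
    · exact hn _ hq.1 h1 h2
    · exact ((he.mem_curve_iff _ hq.1).mp ((hc q).mpr hh)).elim h1 h2
  · filter_upwards [e.open_source.eventually_mem he.mem_source, hNo.eventually_mem hpN]
      with z z1 z2
    rw [hs, φ.symm_apply_apply]
    exact ⟨⟨z1, z2⟩, congrArg e (φ.symm_apply_apply z)⟩

theorem CarriesColoring.symm (h : CarriesDiagram φ D D') (hC : CarriesColoring φ C C') :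
    CarriesColoring φ.symm C' C := by
  constructor <;> intro p hp <;> obtain ⟨p, rfl⟩ := φ.surjective p <;> rw [φ.symm_apply_apply]
  · exact (hC.1 p fun hh => hp ((h p).1.mp hh)).symm
  · exact (hC.2 p ((h p).1.mpr hp)).symm

theorem CarriesDiagram.existsUnique_coloring (h : CarriesDiagram φ D D')
    (C : ShadowColoring X D) : ∃! C' : ShadowColoring X D', CarriesColoring φ C C' := by
  have key : ∃ C' : ShadowColoring X D', (∀ p ∉ D'.curve, C'.reg p = (C.reg ∘ φ.symm) p) ∧
      ∀ p ∈ D'.curve, C'.col p = (C.col ∘ φ.symm) p := by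
    refine exists_shadowColoring (fun p hp => ?_) (fun p hp hx => ?_) (fun p hx => ?_) <;>
      obtain ⟨p, rfl⟩ := φ.surjective p
    · refine eventually_homeomorph ((C.eventually_reg_eq fun hh => hp ((h p).1.mp hh)).mono
        fun z hz => ?_)
      simpa using hz
    · refine ⟨D.rightIndex p, C.rightColor p, eventually_homeomorph ((C.strandForm ((h p).1.mpr hp)
        fun hh => hx ((h p).2.1.mp hh)).mono fun z hz => ?_)⟩
      obtain ⟨z1, z2, z3⟩ := hz
      refine ⟨fun hh => z1 ((h z).2.1.mpr hh), fun hh => ?_, fun hh => ?_⟩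
      · simpa using z2 ((h z).1.mpr hh)
      · have hzc : z ∉ D.curve := fun hh' => hh ((h z).1.mp hh')
        rw [← (h z).2.2.2 hzc]
        simpa using z3 hzc
    · have hx' := (h p).2.1.mpr hx
      obtain ⟨e, he⟩ := D.crossing_chart p hx'
      obtain ⟨m, r, a, hform⟩ := C.exists_crossForm hx' he
      obtain ⟨e', he', hee⟩ := h.exists_crossingChart he hx'
      refine ⟨e', m, r, a, he', eventually_homeomorph ?_⟩
      filter_upwards [hform, hee] with z hz hze
      obtain ⟨z1, z2, z3, z4, z5, z6, z7, z8, z9, z10⟩ := hz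
      have hi : ∀ {x y : ℝ}, (e z).1 = x → (e z).2 = y → x ≠ 0 → y ≠ 0 →
          D'.index (φ z) = D.index z := fun h1 h2 h3 h4 => by
        refine ((h z).2.2.2 fun hh => ?_).symm
        rw [z3, h1, h2] at hh
        exact hh.elim h3 h4
      unfold CrossBody
      simp only [Function.comp_apply, φ.symm_apply_apply, hze.2, ← (h z).1]
      refine ⟨hze.1, fun hh => congrArg φ (z2 ((h z).2.1.mpr hh)), z3, z4, z5, z6, fun k k' => ?_,
        fun k k' => ?_, fun k k' => ?_, fun k k' => ?_⟩
      · rw [hi rfl rfl k.ne k'.ne]; exact z7 k k'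
      · rw [hi rfl rfl k.ne' k'.ne]; exact z8 k k'
      · rw [hi rfl rfl k.ne k'.ne']; exact z9 k k'
      · rw [hi rfl rfl k.ne' k'.ne']; exact z10 k k'
  obtain ⟨C', h1, h2⟩ := key
  refine ⟨C', ⟨fun p hp => ?_, fun p hp => ?_⟩, fun C₁ h' => ?_⟩
  · rw [h1 _ fun hh => hp ((h p).1.mpr hh), Function.comp_apply, φ.symm_apply_apply]
  · rw [h2 _ ((h p).1.mp hp), Function.comp_apply, φ.symm_apply_apply]
  · refine ShadowColoring.ext_reg_col (fun p hp => ?_) fun p hp => ?_ <;>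
      obtain ⟨p, rfl⟩ := φ.surjective p
    · rw [h1 _ hp, h'.1 p fun hh => hp ((h p).1.mp hh), Function.comp_apply, φ.symm_apply_apply]
    · rw [h2 _ hp, h'.2 p ((h p).1.mpr hp), Function.comp_apply, φ.symm_apply_apply]

variable {f : RackLoop r₀}

/-- The composition of a map on the square with a homeomorphism which fixes the boundary. -/
def compHomeomorph {Y : Type*} [TopologicalSpace Y] {y : Y} (f : Ω^ (Fin 2) Y y)
    (φ : Square ≃ₜ Square) (hφ : ∀ p ∈ Cube.boundary (Fin 2), φ p = p) : Ω^ (Fin 2) Y y :=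
  ⟨f.1.comp φ, fun p hp => by
    rw [ContinuousMap.comp_apply]
    exact (congrArg f.1 (hφ p hp)).trans (f.2 p hp)⟩

theorem IsShadowMap.comp_homeomorph (hf : IsShadowMap C f) (h : CarriesDiagram φ D D')
    (hC : CarriesColoring φ C C') (hφ : ∀ p ∈ Cube.boundary (Fin 2), φ.symm p = p) :
    IsShadowMap C' (compHomeomorph f φ.symm hφ) := by
  have hfz : ∀ z, compHomeomorph f φ.symm hφ (φ z) = f z := fun z =>
    congrArg f.1 (φ.symm_apply_apply z)
  have hreg : ∀ p h1 h2, C'.region ⟨φ p, h1⟩ = C.region ⟨p, h2⟩ := fun p h1 h2 => by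
    rw [C'.region_eq, C.region_eq]; exact hC.1 p h2
  have harc : ∀ p h1 h2, C'.arc ⟨φ p, h1⟩ = C.arc ⟨p, h2⟩ := fun p h1 h2 => by
    rw [C'.arc_eq, C.arc_eq]; exact hC.2 p h2
  refine ⟨?_, ?_, ?_⟩ <;> rintro ⟨p, hp⟩ <;> obtain ⟨p, rfl⟩ := φ.surjective p
  · have hp' : p ∉ D.curve := fun hh => hp ((h p).1.mp hh)
    rw [hreg p hp hp', hfz]
    exact hf.at_region ⟨p, hp'⟩
  · intro hx
    have hp' := (h p).1.mpr hp
    obtain ⟨e, he, r, τ, U, hU, hUs, hτ, hr, hh⟩ :=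
      hf.at_strand ⟨p, hp'⟩ fun hh => hx ((h p).2.1.mp hh)
    refine ⟨_, h.isRegularChart he, r, τ ∘ φ.symm, φ.symm ⁻¹' U, ?_, fun q hq => hUs hq,
      hτ.comp φ.symm.continuous.continuousOn fun q hq => hq, ?_, ?_⟩
    · exact φ.symm.continuous.continuousAt.preimage_mem_nhds (by rwa [φ.symm_apply_apply])
    · rintro ⟨q, hq⟩ hqU hlt
      obtain ⟨q, rfl⟩ := φ.surjective q
      have hq' : q ∉ D.curve := fun hh => hq ((h q).1.mp hh)
      have hlt : (e (φ.symm (φ q))).1 < 0 := hlt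
      have hqU : φ.symm (φ q) ∈ U := hqU
      rw [φ.symm_apply_apply] at hlt hqU
      rw [hreg q hq hq']
      exact hr ⟨q, hq'⟩ hqU hlt
    · intro q hq
      rw [harc p hp hp']
      exact hh _ hq
  · intro hx
    have hp' := (h p).1.mpr hp
    have hx' := (h p).2.1.mpr hx
    obtain ⟨e, he, r, a, τ, υ, U, hU, hUs, hτ, hυ, hr, ha, hh⟩ := hf.at_crossing ⟨p, hp'⟩ hx'
    obtain ⟨e', he', hee⟩ := h.exists_crossingChart he hx'
    have hq' : ∀ q, φ.symm q ∈ {z | φ z ∈ e'.source ∧ e' (φ z) = e z} →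
        q ∈ e'.source ∧ e' q = e (φ.symm q) := fun q hq => by
      have : φ (φ.symm q) ∈ e'.source ∧ e' (φ (φ.symm q)) = e (φ.symm q) := hq
      rwa [φ.apply_symm_apply] at this
    refine ⟨e', he', r, a, τ ∘ φ.symm, υ ∘ φ.symm, φ.symm ⁻¹' (U ∩ {z | _}), ?_,
      fun q hq => (hq' q hq.2).1, hτ.comp φ.symm.continuous.continuousOn fun q hq => hq.1,
      hυ.comp φ.symm.continuous.continuousOn fun q hq => hq.1, ?_, ?_, ?_⟩
    · refine φ.symm.continuous.continuousAt.preimage_mem_nhds ?_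
      rw [φ.symm_apply_apply]
      exact inter_mem hU hee
    · rintro ⟨q, hq⟩ ⟨hqU, hqe⟩ h1 h2
      have hq1 : φ.symm q ∉ D.curve := fun hh => hq ((h.symm q).1.mpr hh)
      rw [(hq' q hqe).2] at h1 h2
      rw [← hr ⟨_, hq1⟩ hqU h1 h2, ← hreg _ (by rwa [φ.apply_symm_apply]) hq1]
      congr 2
      exact (φ.apply_symm_apply q).symm
    · rintro ⟨q, hq⟩ ⟨hqU, hqe⟩ h1 h2
      have hq1 : φ.symm q ∈ D.curve := (h.symm q).1.mp hq
      rw [(hq' q hqe).2] at h1 h2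
      rw [← ha ⟨_, hq1⟩ hqU h1 h2, ← harc _ (by rwa [φ.apply_symm_apply]) hq1]
      congr 2
      exact (φ.apply_symm_apply q).symm
    · rintro q ⟨hqU, hqe⟩
      rw [harc p hp hp', (hq' q hqe).2]
      exact hh _ hqU

/-- A homeomorphism of the square which fixes the boundary is homotopic to the identity relative to
the boundary, by the straight homotopy. -/
theorem homotopic_compHomeomorph
    (j : C(ExtendedRackSpace X, Z)) (hφ : ∀ p ∈ Cube.boundary (Fin 2), φ p = p) :
    GenLoop.Homotopic (pushLoop j f) (pushLoop j (compHomeomorph f φ hφ)) := by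
  have hcont : Continuous fun p : Square × I =>
      j (f.1 fun i => Icc.convexComb (p.1 i) (φ p.1 i) p.2) := by
    refine j.continuous.comp (f.1.continuous.comp (continuous_pi fun i => ?_))
    exact Icc.continuous_convexComb_prod.comp
      (f := fun p : Square × I => (p.1 i, φ p.1 i, p.2)) (by fun_prop)
  refine homotopicRel_of_curry (ContinuousMap.curry ⟨_, hcont⟩) (fun z => ?_) (fun z => ?_)
    fun z hz s => ?_
  · refine congrArg (fun w => j (f.1 w)) (funext fun i => Icc.convexComb_zero _ _)
  · refine congrArg (fun w => j (f.1 w)) (funext fun i => Icc.convexComb_one _ _)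
  · refine congrArg (fun w => j (f.1 w)) (funext fun i => ?_)
    exact (congrArg (fun w : Square => Icc.convexComb (z i) (w i) s) (hφ z hz)).trans
      (Icc.convexComb_eq _ _)

end Carries

/-! ### Link invariants -/

section Invariance

variable {D D' D'' : LinkDiagram} {k : SpaceKind} {m : SpaceModel}

theorem shadowClasses_eq
    {f : RackLoop r₀} (hf : IsShadowMap C f) :
    shadowClasses k m C r₀ = {Quotient.mk _ (pushLoop (toQuandleSpace X k m) f)} := by
  refine Set.eq_singleton_iff_unique_mem.mpr ⟨⟨f, hf, rfl⟩, ?_⟩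
  rintro _ ⟨g, hg, rfl⟩
  exact Quotient.sound (hg.homotopic _ hf)

theorem shadowClasses_eq_of_homotopic
    (ho : C'.outer = C.outer)
    (h : ∀ {r₀ : X} {f g : RackLoop r₀}, IsShadowMap C f →
      IsShadowMap C' g → GenLoop.Homotopic (pushLoop (toQuandleSpace X k m) f)
        (pushLoop (toQuandleSpace X k m) g)) :
    shadowClasses k m C' C.outer = shadowClasses k m C C.outer := by
  obtain ⟨f, hf⟩ := exists_isShadowMap C
  obtain ⟨g, hg⟩ : ∃ g : RackLoop C.outer, IsShadowMap C' g := ho ▸ exists_isShadowMap C'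
  rw [shadowClasses_eq hf, shadowClasses_eq hg]
  exact congrArg _ (Quotient.sound (h hf hg)).symm

variable (X k m) in
/-- There is a bijection between the shadow colorings of the diagrams `D` and `D'` which preserves
the color of the outer region and the class of `ψ`. -/
def SameInvariant (D D' : LinkDiagram) : Prop :=
  ∃ Φ : ShadowColoring X D ≃ ShadowColoring X D', ∀ C : ShadowColoring X D,
    (Φ C).outer = C.outer ∧ shadowClasses k m (Φ C) C.outer = shadowClasses k m C C.outer

theorem SameInvariant.refl : SameInvariant X k m D D := ⟨.refl _, fun _ => ⟨rfl, rfl⟩⟩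

theorem SameInvariant.symm (h : SameInvariant X k m D D') : SameInvariant X k m D' D := by
  obtain ⟨Φ, hΦ⟩ := h
  refine ⟨Φ.symm, fun C' => ?_⟩
  obtain ⟨C, rfl⟩ := Φ.surjective C'
  rw [Φ.symm_apply_apply, (hΦ C).1]
  exact ⟨rfl, (hΦ C).2.symm⟩

theorem SameInvariant.trans (h : SameInvariant X k m D D') (h' : SameInvariant X k m D' D'') :
    SameInvariant X k m D D'' := by
  obtain ⟨Φ, hΦ⟩ := h
  obtain ⟨Φ', hΦ'⟩ := h'
  refine ⟨Φ.trans Φ', fun C => ?_⟩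
  obtain ⟨h1, h2⟩ := hΦ C
  obtain ⟨h3, h4⟩ := hΦ' (Φ C)
  rw [h1] at h3 h4
  exact ⟨h3, h4.trans h2⟩

theorem SameInvariant.of_existsUnique {R : ShadowColoring X D → ShadowColoring X D' → Prop}
    (h1 : ∀ C, ∃! C', R C C') (h2 : ∀ C', ∃! C, R C C')
    (h : ∀ C C', R C C' →
      C'.outer = C.outer ∧ shadowClasses k m C' C.outer = shadowClasses k m C C.outer) :
    SameInvariant X k m D D' := by
  choose Φ hΦ hΦu using h1
  refine ⟨.ofBijective Φ ⟨fun C C₁ hC => ?_, fun C' => ?_⟩, fun C => h C _ (hΦ C)⟩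
  · exact (h2 (Φ C)).unique (hΦ C) (by rw [hC]; exact hΦ C₁)
  · obtain ⟨C, hC, -⟩ := h2 C'
    exact ⟨C, (hΦu C C' hC).symm⟩

theorem SameInvariant.of_planarIsotopic (h : LinkDiagram.PlanarIsotopic D D') :
    SameInvariant X k m D D' := by
  obtain ⟨φ, hφ, h : CarriesDiagram φ D D'⟩ := h
  have hφ' : ∀ p ∈ Cube.boundary (Fin 2), φ.symm p = p := fun p hp =>
    φ.symm_apply_eq.mpr (hφ p hp).symm
  refine .of_existsUnique (R := CarriesColoring φ) h.existsUnique_coloring (fun C' => ?_)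
    fun C C' hC => ?_
  · obtain ⟨C, hC, hu⟩ := h.symm.existsUnique_coloring C'
    exact ⟨C, hC.symm h.symm, fun C₁ h₁ => hu C₁ (h₁.symm h)⟩
  · have ho : C'.outer = C.outer := by
      rw [C.outer_eq_reg, C'.outer_eq_reg, ← hC.1 0 D.zero_notMem_curve, hφ 0 ⟨0, Or.inl rfl⟩]
    refine ⟨ho, shadowClasses_eq_of_homotopic ho fun hf hg => ?_⟩
    exact (homotopic_compHomeomorph _ hφ').trans
      ((hf.comp_homeomorph h hC hφ').homotopic _ hg)

/-- The effect of a Reidemeister move on colorings and on the class of `ψ`. -/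
theorem LinkDiagram.ReidemeisterMove.invariance {B : Set Square}
    (h : LinkDiagram.ReidemeisterMove B D D') :
    (∀ C : ShadowColoring X D, ∃! C' : ShadowColoring X D', C.AgreesOutside B C') ∧
    (∀ C' : ShadowColoring X D', ∃! C : ShadowColoring X D, C.AgreesOutside B C') ∧
    ∀ (C : ShadowColoring X D) (C' : ShadowColoring X D'), C.AgreesOutside B C' →
      C'.outer = C.outer ∧ shadowClasses k m C' C.outer = shadowClasses k m C C.outer := by
  obtain ⟨e, P, P', hbox, hbd, rfl, hP, hD, hD', hag⟩ := h
  obtain ⟨rfl, rfl⟩ | ⟨φ, φ', G, G', hends⟩ := hP.eq_or_exists_graphPictures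
  · have M := picturePair_I.localMove hbox hbd hD hD' hag
    obtain ⟨h1, h2, h3⟩ := reidemeisterI (X := X) (k := k) (m := m) hbox hD hD' M
    exact ⟨h1, h2, fun C C' hC => ⟨M.outer_eq hC,
      shadowClasses_eq_of_homotopic (M.outer_eq hC) (h3 C C' hC)⟩⟩
  · obtain ⟨V, h, h', M⟩ := G.exists_strandMove G' hends hbox hbd hD hD' hag
    refine ⟨fun C => ?_, fun C' => ?_, fun C C' hC => ⟨M.move.outer_eq hC,
      shadowClasses_eq_of_homotopic (M.move.outer_eq hC) fun hf hg => M.homotopic _ hC hf hg⟩⟩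
    · obtain ⟨C', hC'⟩ := M.exists_coloring C
      exact ⟨C', hC', fun C₁ hC₁ => M.coloring_unique hC₁ hC'⟩
    · obtain ⟨C, hC⟩ := M.symm.exists_coloring C'
      exact ⟨C, hC.symm, fun C₁ hC₁ => M.symm.coloring_unique hC₁.symm hC⟩

theorem SameInvariant.of_equivalent (h : LinkDiagram.Equivalent D D') :
    SameInvariant X k m D D' := by
  induction h with
  | rel D D' h =>
    rcases h with h | ⟨B, h⟩
    · exact .of_planarIsotopic h
    · obtain ⟨h1, h2, h3⟩ := h.invariance (X := X) (k := k) (m := m)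
      exact .of_existsUnique h1 h2 h3
  | refl D => exact .refl
  | symm D D' _ ih => exact ih.symm
  | trans D D' D'' _ _ ih ih' => exact ih.trans ih'

theorem SameInvariant.shadowStateSum_eq (h : SameInvariant X k m D D') {G : Type v}
    (T : (r : X) → QuandlePi2 X k m r → G) : shadowStateSum T D = shadowStateSum T D' := by
  obtain ⟨Φ, hΦ⟩ := h
  refine finsum_eq_of_bijective Φ Φ.bijective fun C => ?_
  obtain ⟨h1, h2⟩ := hΦ C
  have key : ∀ r, r = C.outer → T r (Classical.epsilon fun κ => κ ∈ shadowClasses k m (Φ C) r) =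
      T C.outer (shadowClass k m C) := by
    rintro _ rfl
    rw [h2]; rfl
  exact congrArg (fun x => Finsupp.single x 1) (key _ h1).symm

end Invariance

end

theorem mainTheorem2 {X : Type u} [Quandle X] (k : SpaceKind) (m : SpaceModel) :
    -- the homotopy class of the map defined by a shadow coloring exists and is unique
    (∀ (D : LinkDiagram) (C : ShadowColoring X D),
      ∃ κ : QuandlePi2 X k m C.outer, shadowClasses k m C C.outer = {κ}) ∧
    -- it is invariant under Reidemeister moves
    (∀ (B : Set Square) (D D' : LinkDiagram), LinkDiagram.ReidemeisterMove B D D' →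
      (∀ C : ShadowColoring X D, ∃! C' : ShadowColoring X D', C.AgreesOutside B C') ∧
      (∀ C' : ShadowColoring X D', ∃! C : ShadowColoring X D, C.AgreesOutside B C') ∧
      ∀ (C : ShadowColoring X D) (C' : ShadowColoring X D'), C.AgreesOutside B C' →
        C'.outer = C.outer ∧ shadowClasses k m C' C.outer = shadowClasses k m C C.outer) ∧
    -- hence the shadow homotopy invariant is a link invariant
    (∀ D D' : LinkDiagram, LinkDiagram.Equivalent D D' →
      (∃ Φ : ShadowColoring X D ≃ ShadowColoring X D', ∀ C : ShadowColoring X D,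
        (Φ C).outer = C.outer ∧
          shadowClasses k m (Φ C) C.outer = shadowClasses k m C C.outer) ∧
      ∀ {G : Type v} (T : (r : X) → QuandlePi2 X k m r → G),
        shadowStateSum T D = shadowStateSum T D') := by
  refine ⟨fun D C => ?_, fun B D D' h => h.invariance, fun D D' h => ?_⟩
  · obtain ⟨f, hf⟩ := exists_isShadowMap C
    exact ⟨_, shadowClasses_eq hf⟩
  · have h : SameInvariant X k m D D' := .of_equivalent h
    exact ⟨h, fun T => h.shadowStateSum_eq T⟩
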